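/- Fix $\theta_0,\theta_1\in\mathbb{C}$. Let $\mathcal V=O e_1\oplus O(-[\infty])e_2$ on $\mathbb{P}^1$ (rank two, degree $-1$). For a $\mathbb{C}$-algebra $R$, a *family over $R$* is a pair $(\nabla,t)$ where $t\in R^*$ and $\nabla:\mathcal V_R\to\Omega([0]+[1]+2[\infty])\otimes\mathcal V_R$ is a relative connection on $\mathbb{P}^1_R$ such that the residues of $\nabla$ at $z=0$ and $z=1$ (the actions of $z\nabla_{d/dz}$ modulo $z$ and of $(z-1)\nabla_{d/dz}$ modulo $z-1$) have characteristic polynomials $X^2-\frac{\theta_0^2}{4}$ and $X^2-\frac{\theta_1^2}{4}$, and such that, Zariski locally on $\mathrm{Spec}\,R$, the connection on the lattice of $\mathcal V$ at $\infty$ is equivalent over $R[[z^{-1}]]$ to $z\frac{d}{dz}+\begin{pmatrix}-\frac34&tz\\ t&-\frac14\end{pmatrix}$. Two families are isomorphic if they have the same $t$ and an automorphism of $\mathcal V_R$ carries one connection to the other. A family is *of the prescribed local form* if moreover, Zariski locally on $\mathrm{Spec}\,R$, its residues at $0,1$ are conjugate to matrices $\begin{pmatrix}\theta_i/2&*\\0&-\theta_i/2\end{pmatrix}$,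 $i=0,1$. Let $\mathcal M_1\subset\mathbb{A}^3\times\mathbb{C}^*$, with coordinates $a_0,b_0,c_1,t$, be given by $$a_0^2+b_0c_0-\tfrac{\theta_0^2}{4}=0,\qquad c_0:=-\tfrac{\theta_0^2}{4}+\tfrac{\theta_1^2}{4}-c_1-t^2-b_0c_1-b_0t^2,$$ and let $\mathcal M_2\subset\mathbb{A}^3\times\mathbb{C}^*$, with coordinates $a_2,b_1,c_1,t$, be given by $$a_2^2+b_1(-a_2-b_1c_2+t^2)=0,\qquad c_2:=-c_1-t^2-b_1\tfrac{\theta_0^2}{4}-b_1c_1+a_2-\tfrac{\theta_0^2}{4}+\tfrac{\theta_1^2}{4}.$$ Let $\mathcal M=\mathcal M(\theta_0,\theta_1)$ be obtained by gluing the open parts $b_0\neq0$ of $\mathcal M_1$ and $b_1\ne0$ of $\mathcal M_2$ by $$(a_0,b_0,c_1,t)\mapsto(a_2,b_1,c_1,t)=\Big(\tfrac{a_0}{b_0^2},\ \tfrac1{b_0},\ b_0c_1+\tfrac{a_0-a_0^2}{b_0},\ t\Big).$$ Then the following hold. 1. $\mathcal M$ is an integral separated scheme of finite type over $\mathbb{C}$,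 covered by the open subschemes $\mathcal M_1,\mathcal M_2$, whose intersection is the given overlap. 2. If $\theta_0\ne0$ and $\theta_1\neq0$, then $\mathcal M$ is smooth of dimension $3$ over $\mathbb{C}$, and smooth of relative dimension $2$ over $\mathbb{C}^*$ via $t$. 3. The singular locus of $\mathcal M_1$ is: empty if $\theta_0,\theta_1\ne0$; $\{a_0=0,\ b_0=0,\ c_1=-t^2+\frac{\theta_1^2}{4}\}$ if $\theta_0=0\neq\theta_1$; $\{a_0=0,\ b_0=-1,\ c_1=-t^2+\frac{\theta_0^2}{4}\}$ if $\theta_0\neq0=\theta_1$; $\{a_0=0,\ b_0(b_0+1)=0,\ c_1=-t^2\}$ if $\theta_0=\theta_1=0$. The singular locus of $\mathcal M_2$ is empty if $\theta_1\neq0$ and $\{a_2=0,\ b_1=-1,\ c_1=t^2-\frac{\theta_0^2}{4}\}$ if $\theta_1=0$. The singular locus of $\mathcal M$ is the union of those of $\mathcal M_1$ and $\mathcal M_2$. Each of these is at the same time the locus where the space is not smooth of dimension 3 over $\mathbb{C}$ and the locus where it is not smooth of relative dimension 2 over $\mathbb{C}^*$ via $t$. 4. There is a natural assignment of a classifying morphism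 $\mathrm{Spec}\,R\to\mathcal M$ over $\mathbb{C}$ to every family over a $\mathbb{C}$-algebra $R$, such that two families over $R$ have the same classifying morphism if and only if they are isomorphic, and every $\mathbb{C}$-morphism $\mathrm{Spec}\,R\to\mathcal M$ is, Zariski locally on $\mathrm{Spec}\,R$, the classifying morphism of a family. The inclusions of $\mathcal M_1$ and $\mathcal M_2$ are the classifying morphisms of the connections $\frac{d}{dz}+\frac{1}{z(z-1)}A_i$ with $$A_1=\begin{pmatrix}a_0&c_0+c_1z+t^2z^2\\ z+b_0&-a_0\end{pmatrix},\qquad A_2=\begin{pmatrix}a_2z^2&\frac{\theta_0^2}{4}+c_1z+c_2z^2+(t^2-b_1c_2-a_2)z^3\\ 1+b_1z&-a_2z^2\end{pmatrix}.$$ With this assignment, $\mathcal M$ is a fine moduli space for the families of the prescribed local form (every morphism $\mathrm{Spec}\,R\to\mathcal M$ is locally the classifying morphism of such a family) if and only if $\theta_0\neq0$ and $\theta_1\neq0$. 5. Taking the generic fibre gives a bijection from $\mathcal M(\mathbb{C})$ onto the set of isomorphism classes of tuples $(M,t,\Lambda_0,\Lambda_1)$, where $t\in\mathbb{C}^*$,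 $M$ is a two-dimensional differential module over $\mathbb{C}(z)$ with $\Lambda^2M$ trivial, regular at all points $a\neq0,1,\infty$, having over $\mathbb{C}((z^{-1/4}))$ a basis on which $z\partial$ has the matrix $\mathrm{diag}(tz^{1/2},-tz^{1/2})$, and $\Lambda_0,\Lambda_1$ are lattices at $0,1$, invariant under $z\partial$, resp. $(z-1)\partial$, with residues of characteristic polynomial $X^2-\frac{\theta_0^2}{4}$, resp. $X^2-\frac{\theta_1^2}{4}$. If neither $\theta_0$ nor $\theta_1$ is a non-zero integer, then taking the generic fibre gives a bijection from $\mathcal M(\mathbb{C})$ onto the set ${\bf S}(\theta_0,\theta_1)$ of isomorphism classes of tuples $(M,t)$ with $M,t$ as above such that $M$ is represented over $\mathbb{C}((z))$ by $\frac{d}{dz}+\frac1z\begin{pmatrix}\theta_0/2&*\\0&-\theta_0/2\end{pmatrix}$ and over $\mathbb{C}((z-1))$ by $\frac{d}{dz}+\frac1{z-1}\begin{pmatrix}\theta_1/2&*\\0&-\theta_1/2\end{pmatrix}$, with constants $*\in\mathbb{C}$. -/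

import Mathlib

open CategoryTheory CategoryTheory.Limits AlgebraicGeometry Polynomial
open scoped LaurentPolynomial PowerSeries

namespace DegPV

noncomputable section

/-! ### Laurent series -/

/-- The derivative of a formal Laurent series with respect to its variable. -/
def lderiv {R : Type} [CommRing R] (f : LaurentSeries R) : LaurentSeries R :=
  LaurentSeries.hasseDeriv R 1 f

/-! ### Connections on the bundle `V = O e₁ ⊕ O(-[∞]) e₂` over `ℙ¹_R` -/

/-- The module `H⁰(ℙ¹_R, V(n[∞]))`, inside the module `R[z]²` of sections of `V` over
`Spec R[z]`: pairs `(f, g)`, standing for `f e₁ + g e₂`, with `deg f ≤ n` and `deg g ≤ n - 1`. -/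
def bundleSections (R : Type) [CommRing R] (n : ℕ) : Submodule R (Fin 2 → R[X]) :=
  (degreeLT R (n + 1)).comap (LinearMap.proj 0) ⊓ (degreeLT R n).comap (LinearMap.proj 1)

/-- A relative connection `∇ : V → Ω([0] + [1] + 2[∞]) ⊗ V` on `ℙ¹_R`, given by the operator
`D = z(z-1) ∇_{d/dz}` on the sections over `Spec R[z]`. The pole order at `∞` is at most `2`
exactly when `D` maps `V(n[∞])` into `V((n+2)[∞])` for all `n`. -/
structure BundleConnection (R : Type) [CommRing R] where
  op : (Fin 2 → R[X]) →ₗ[R] (Fin 2 → R[X])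
  leibniz : ∀ (f : R[X]) (v : Fin 2 → R[X]),
    op (f • v) = (X * (X - 1) * derivative f) • v + f • op v
  pole : ∀ (n : ℕ) (v : Fin 2 → R[X]),
    v ∈ bundleSections R n → op v ∈ bundleSections R (n + 2)

namespace BundleConnection

variable {R : Type} [CommRing R] (D : BundleConnection R)

/-- The matrix of `D = z(z-1) ∇_{d/dz}`: its `j`-th column is `D e_j`. -/
def matrix : Matrix (Fin 2) (Fin 2) R[X] :=
  Matrix.of fun i j => D.op (Pi.single j 1) i

/-- The residue at `z = 0`, i.e. `z ∇_{d/dz} = (z-1)⁻¹ D` modulo `z`. -/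
def residueZero : Matrix (Fin 2) (Fin 2) R := -(D.matrix.map (eval 0))

/-- The residue at `z = 1`, i.e. `(z-1) ∇_{d/dz} = z⁻¹ D` modulo `z-1`. -/
def residueOne : Matrix (Fin 2) (Fin 2) R := D.matrix.map (eval 1)

end BundleConnection

/-- The coordinate `z = w⁻¹` as a Laurent series in the local parameter `w` at `∞`. -/
def zInf (R : Type) [CommRing R] : LaurentSeries R := HahnSeries.single (-1) 1

/-- The derivation `z d/dz = -w d/dw` on `R((w))`. -/
def eulerInf {R : Type} [CommRing R] (f : LaurentSeries R) : LaurentSeries R :=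
  -(HahnSeries.single 1 1 * lderiv f)

/-- The matrix `(-3/4, t z; t, -1/4)`. -/
def infModel {R : Type} [CommRing R] [Algebra ℂ R] (t : R) :
    Matrix (Fin 2) (Fin 2) (LaurentSeries R) :=
  !![HahnSeries.C (algebraMap ℂ R (-3 / 4)), HahnSeries.C t * zInf R;
    HahnSeries.C t, HahnSeries.C (algebraMap ℂ R (-1 / 4))]

/-- Let `A` be the matrix of `D = z(z-1) ∇_{d/dz}` on `e₁, e₂`. The predicate says that `∇` on the
lattice of `V` at `∞` (basis `e₁, z⁻¹ e₂` over `R[[w]]`) is equivalent to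
`z d/dz + (-3/4, t z; t, -1/4)`: some basis `h = diag(1, w) g` of this lattice,
`g ∈ GL₂(R[[w]])`, satisfies `z ∇_{d/dz} h = h (-3/4, t z; t, -1/4)`. Both sides are multiplied
by `z - 1`. -/
def HasInfModel {R : Type} [CommRing R] [Algebra ℂ R]
    (A : Matrix (Fin 2) (Fin 2) R[X]) (t : R) : Prop :=
  ∃ g : (Matrix (Fin 2) (Fin 2) R⟦X⟧)ˣ, ∃ h : Matrix (Fin 2) (Fin 2) (LaurentSeries R),
    h = Matrix.diagonal ![1, HahnSeries.single 1 1] *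
      (g : Matrix (Fin 2) (Fin 2) R⟦X⟧).map (HahnSeries.ofPowerSeries ℤ R) ∧
    A.map (aeval (zInf R)) * h + (zInf R - 1) • h.map eulerInf =
      (zInf R - 1) • (h * infModel t)

/-- A family, parametrized by `Spec R`, of connections on the bundle `V` with the prescribed
local data: the residues at `0` and `1` have characteristic polynomials `X² - θ₀²/4` and
`X² - θ₁²/4`, and, locally on `Spec R`, the connection is equivalent to
`z d/dz + (-3/4, t z; t, -1/4)` at `∞`, where the invertible function `t` is part of the data. -/
structure Family (θ₀ θ₁ : ℂ) (R : Type) [CommRing R] [Algebra ℂ R] where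
  conn : BundleConnection R
  t : Rˣ
  at_zero : conn.residueZero.charpoly = X ^ 2 - C (algebraMap ℂ R (θ₀ ^ 2 / 4))
  at_one : conn.residueOne.charpoly = X ^ 2 - C (algebraMap ℂ R (θ₁ ^ 2 / 4))
  at_infty : ∃ s : Set R, Ideal.span s = ⊤ ∧ ∀ r ∈ s,
    HasInfModel
      (conn.matrix.map (Polynomial.map (algebraMap R (Localization.Away r))))
      (algebraMap R (Localization.Away r) t)

/-- Locally on `Spec R`, the matrix `B` is conjugate to a matrix `(ω, *; 0, -ω)`. -/
def IsLocallyTriangular {R : Type} [CommRing R] [Algebra ℂ R]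
    (B : Matrix (Fin 2) (Fin 2) R) (ω : ℂ) : Prop :=
  ∃ s : Set R, Ideal.span s = ⊤ ∧ ∀ r ∈ s,
    ∃ (g : (Matrix (Fin 2) (Fin 2) (Localization.Away r))ˣ) (c : Localization.Away r),
      B.map (algebraMap R (Localization.Away r)) * g.val =
        g.val * !![algebraMap ℂ _ ω, c; 0, -algebraMap ℂ _ ω]

namespace Family

variable {θ₀ θ₁ : ℂ} {R : Type} [CommRing R] [Algebra ℂ R]

/-- Isomorphism of families: the same `t`, and an automorphism of the bundle `V` over `ℙ¹_R`
that carries one connection to the other. -/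
def Iso (x y : Family θ₀ θ₁ R) : Prop :=
  x.t = y.t ∧ ∃ g : (Fin 2 → R[X]) ≃ₗ[R[X]] (Fin 2 → R[X]),
    (∀ (n : ℕ) (v : Fin 2 → R[X]), g v ∈ bundleSections R n ↔ v ∈ bundleSections R n) ∧
    ∀ v, g (x.conn.op v) = y.conn.op (g v)

/-- `y` is the pull-back of the family `x` along `φ : R → R'`. -/
def IsPullback {R' : Type} [CommRing R'] [Algebra ℂ R'] (φ : R →ₐ[ℂ] R')
    (x : Family θ₀ θ₁ R) (y : Family θ₀ θ₁ R') : Prop :=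
  (y.t : R') = φ x.t ∧
    ∀ v : Fin 2 → R[X], y.conn.op (fun i => (v i).map (φ : R →+* R')) =
      fun i => (x.conn.op v i).map (φ : R →+* R')

/-- The residues at `0` and `1` are, locally on the base, of the form `(θ_i/2, *; 0, -θ_i/2)`
on a suitable basis. -/
def IsTriangular (x : Family θ₀ θ₁ R) : Prop :=
  IsLocallyTriangular x.conn.residueZero (θ₀ / 2) ∧
    IsLocallyTriangular x.conn.residueOne (θ₁ / 2)

end Family

/-! ### The two affine parts -/

/-- The polynomial ring in three variables over the ring `ℂ[t, t⁻¹]`. -/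
abbrev CoordRing : Type := MvPolynomial (Fin 3) ℂ[T;T⁻¹]

/-- The image of `t` in an algebra over `ℂ[t, t⁻¹]`. -/
def tt (A : Type) [CommRing A] [Algebra ℂ[T;T⁻¹] A] : A :=
  algebraMap ℂ[T;T⁻¹] A (LaurentPolynomial.T 1)

/-- A complex constant in an algebra over `ℂ[t, t⁻¹]`. -/
def kk (A : Type) [CommRing A] [Algebra ℂ[T;T⁻¹] A] (c : ℂ) : A :=
  algebraMap ℂ[T;T⁻¹] A (LaurentPolynomial.C c)

/-- The function `c₀` of the first affine part. -/
def formC0 (θ₀ θ₁ : ℂ) {A : Type} [CommRing A] [Algebra ℂ[T;T⁻¹] A] (b₀ c₁ : A) : A :=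
  -kk A (θ₀ ^ 2 / 4) + kk A (θ₁ ^ 2 / 4) - c₁ - tt A ^ 2 - b₀ * c₁ - b₀ * tt A ^ 2

/-- The left-hand side of the equation of the first affine part. -/
def form1 (θ₀ θ₁ : ℂ) {A : Type} [CommRing A] [Algebra ℂ[T;T⁻¹] A] (a₀ b₀ c₁ : A) : A :=
  a₀ ^ 2 + b₀ * formC0 θ₀ θ₁ b₀ c₁ - kk A (θ₀ ^ 2 / 4)

/-- The function `c₂` of the second affine part. -/
def formC2 (θ₀ θ₁ : ℂ) {A : Type} [CommRing A] [Algebra ℂ[T;T⁻¹] A] (a₂ b₁ c₁ : A) : A :=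
  -c₁ - tt A ^ 2 - b₁ * kk A (θ₀ ^ 2 / 4) - b₁ * c₁ + a₂ - kk A (θ₀ ^ 2 / 4) + kk A (θ₁ ^ 2 / 4)

/-- The left-hand side of the equation of the second affine part. -/
def form2 (θ₀ θ₁ : ℂ) {A : Type} [CommRing A] [Algebra ℂ[T;T⁻¹] A] (a₂ b₁ c₁ : A) : A :=
  a₂ ^ 2 + b₁ * (-a₂ - b₁ * formC2 θ₀ θ₁ a₂ b₁ c₁ + tt A ^ 2)

/-- The ideal generated by the equation of the first affine part. -/
def ideal1 (θ₀ θ₁ : ℂ) : Ideal CoordRing :=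
  Ideal.span {form1 θ₀ θ₁ (MvPolynomial.X 0) (MvPolynomial.X 1) (MvPolynomial.X 2)}

/-- The coordinate ring `ℂ[a₀, b₀, c₁, t, t⁻¹]/(equation)` of the first affine part. -/
def Chart1 (θ₀ θ₁ : ℂ) : Type := CoordRing ⧸ ideal1 θ₀ θ₁

instance (θ₀ θ₁ : ℂ) : CommRing (Chart1 θ₀ θ₁) :=
  inferInstanceAs (CommRing (CoordRing ⧸ ideal1 θ₀ θ₁))

instance (θ₀ θ₁ : ℂ) : Algebra ℂ[T;T⁻¹] (Chart1 θ₀ θ₁) :=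
  inferInstanceAs (Algebra ℂ[T;T⁻¹] (CoordRing ⧸ ideal1 θ₀ θ₁))

instance (θ₀ θ₁ : ℂ) : Algebra ℂ (Chart1 θ₀ θ₁) :=
  inferInstanceAs (Algebra ℂ (CoordRing ⧸ ideal1 θ₀ θ₁))

instance (θ₀ θ₁ : ℂ) : IsScalarTower ℂ ℂ[T;T⁻¹] (Chart1 θ₀ θ₁) :=
  inferInstanceAs (IsScalarTower ℂ ℂ[T;T⁻¹] (CoordRing ⧸ ideal1 θ₀ θ₁))

/-- The quotient map onto the coordinate ring of the first affine part. -/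
def quot1 (θ₀ θ₁ : ℂ) : CoordRing →ₐ[ℂ[T;T⁻¹]] Chart1 θ₀ θ₁ :=
  Ideal.Quotient.mkₐ ℂ[T;T⁻¹] (ideal1 θ₀ θ₁)

/-- The ideal generated by the equation of the second affine part. -/
def ideal2 (θ₀ θ₁ : ℂ) : Ideal CoordRing :=
  Ideal.span {form2 θ₀ θ₁ (MvPolynomial.X 0) (MvPolynomial.X 1) (MvPolynomial.X 2)}

/-- The coordinate ring `ℂ[a₂, b₁, c₁, t, t⁻¹]/(equation)` of the second affine part. -/
def Chart2 (θ₀ θ₁ : ℂ) : Type := CoordRing ⧸ ideal2 θ₀ θ₁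

instance (θ₀ θ₁ : ℂ) : CommRing (Chart2 θ₀ θ₁) :=
  inferInstanceAs (CommRing (CoordRing ⧸ ideal2 θ₀ θ₁))

instance (θ₀ θ₁ : ℂ) : Algebra ℂ[T;T⁻¹] (Chart2 θ₀ θ₁) :=
  inferInstanceAs (Algebra ℂ[T;T⁻¹] (CoordRing ⧸ ideal2 θ₀ θ₁))

instance (θ₀ θ₁ : ℂ) : Algebra ℂ (Chart2 θ₀ θ₁) :=
  inferInstanceAs (Algebra ℂ (CoordRing ⧸ ideal2 θ₀ θ₁))

instance (θ₀ θ₁ : ℂ) : IsScalarTower ℂ ℂ[T;T⁻¹] (Chart2 θ₀ θ₁) :=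
  inferInstanceAs (IsScalarTower ℂ ℂ[T;T⁻¹] (CoordRing ⧸ ideal2 θ₀ θ₁))

/-- The quotient map onto the coordinate ring of the second affine part. -/
def quot2 (θ₀ θ₁ : ℂ) : CoordRing →ₐ[ℂ[T;T⁻¹]] Chart2 θ₀ θ₁ :=
  Ideal.Quotient.mkₐ ℂ[T;T⁻¹] (ideal2 θ₀ θ₁)

/-- The coordinate functions `a₀, b₀, c₁` of the first affine part. -/
def x1 (θ₀ θ₁ : ℂ) (i : Fin 3) : Chart1 θ₀ θ₁ := quot1 θ₀ θ₁ (MvPolynomial.X i)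

/-- The coordinate functions `a₂, b₁, c₁` of the second affine part. -/
def x2 (θ₀ θ₁ : ℂ) (i : Fin 3) : Chart2 θ₀ θ₁ := quot2 θ₀ θ₁ (MvPolynomial.X i)

section forms

variable (θ₀ θ₁ : ℂ) {A B : Type} [CommRing A] [Algebra ℂ[T;T⁻¹] A] [CommRing B]
  [Algebra ℂ[T;T⁻¹] B] (f : A →ₐ[ℂ[T;T⁻¹]] B)

theorem map_tt : f (tt A) = tt B := f.commutes _

theorem map_kk (c : ℂ) : f (kk A c) = kk B c := f.commutes _

theorem map_form1 (a b c : A) : f (form1 θ₀ θ₁ a b c) = form1 θ₀ θ₁ (f a) (f b) (f c) := by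
  simp [form1, formC0, map_tt, map_kk]

theorem map_form2 (a b c : A) : f (form2 θ₀ θ₁ a b c) = form2 θ₀ θ₁ (f a) (f b) (f c) := by
  simp [form2, formC2, map_tt, map_kk]

theorem form1_x1 : form1 θ₀ θ₁ (x1 θ₀ θ₁ 0) (x1 θ₀ θ₁ 1) (x1 θ₀ θ₁ 2) = 0 := by
  have h := map_form1 θ₀ θ₁ (quot1 θ₀ θ₁) (MvPolynomial.X 0) (MvPolynomial.X 1)
    (MvPolynomial.X 2)
  refine h.symm.trans ?_
  exact Ideal.Quotient.eq_zero_iff_mem.2 (Ideal.subset_span rfl)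

theorem form2_x2 : form2 θ₀ θ₁ (x2 θ₀ θ₁ 0) (x2 θ₀ θ₁ 1) (x2 θ₀ θ₁ 2) = 0 := by
  have h := map_form2 θ₀ θ₁ (quot2 θ₀ θ₁) (MvPolynomial.X 0) (MvPolynomial.X 1)
    (MvPolynomial.X 2)
  refine h.symm.trans ?_
  exact Ideal.Quotient.eq_zero_iff_mem.2 (Ideal.subset_span rfl)

theorem form2_of_form1 {a b c i : A} (hi : b * i = 1) (h : form1 θ₀ θ₁ a b c = 0) :
    form2 θ₀ θ₁ (a * i ^ 2) i (b * c + (a - a ^ 2) * i) = 0 := by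
  simp only [form1, form2, formC0, formC2] at *
  grind

theorem form1_of_form2 {a b c i : A} (hi : b * i = 1) (h : form2 θ₀ θ₁ a b c = 0) :
    form1 θ₀ θ₁ (a * i ^ 2) i (b * c - (a * i ^ 2 - (a * i ^ 2) ^ 2) * b ^ 2) = 0 := by
  simp only [form1, form2, formC0, formC2] at *
  grind

/-- The homomorphism out of the first coordinate ring given by a solution of its equation. -/
def lift1 (a b c : A) (h : form1 θ₀ θ₁ a b c = 0) :
    Chart1 θ₀ θ₁ →ₐ[ℂ[T;T⁻¹]] A :=
  Ideal.Quotient.liftₐ _ (MvPolynomial.aeval ![a, b, c]) (fun p hp => by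
    rw [← RingHom.mem_ker]
    refine (Ideal.span_le (I := RingHom.ker (MvPolynomial.aeval ![a, b, c]))).2 ?_ hp
    rintro _ rfl
    simpa [RingHom.mem_ker, map_form1] using h)

theorem lift1_0 (a b c : A) (h : form1 θ₀ θ₁ a b c = 0) :
    lift1 θ₀ θ₁ a b c h (x1 θ₀ θ₁ 0) = a :=
  (Ideal.Quotient.liftₐ_apply _ _ _ _).trans <|
    (Ideal.Quotient.lift_mk _ _ _).trans (MvPolynomial.aeval_X ![a, b, c] 0)

theorem lift1_1 (a b c : A) (h : form1 θ₀ θ₁ a b c = 0) :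
    lift1 θ₀ θ₁ a b c h (x1 θ₀ θ₁ 1) = b :=
  (Ideal.Quotient.liftₐ_apply _ _ _ _).trans <|
    (Ideal.Quotient.lift_mk _ _ _).trans (MvPolynomial.aeval_X ![a, b, c] 1)

theorem lift1_2 (a b c : A) (h : form1 θ₀ θ₁ a b c = 0) :
    lift1 θ₀ θ₁ a b c h (x1 θ₀ θ₁ 2) = c :=
  (Ideal.Quotient.liftₐ_apply _ _ _ _).trans <|
    (Ideal.Quotient.lift_mk _ _ _).trans (MvPolynomial.aeval_X ![a, b, c] 2)

theorem ext1 {f g : Chart1 θ₀ θ₁ →ₐ[ℂ[T;T⁻¹]] A}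
    (h : ∀ i, f (x1 θ₀ θ₁ i) = g (x1 θ₀ θ₁ i)) : f = g :=
  Ideal.Quotient.algHom_ext _ (MvPolynomial.algHom_ext h)

/-- The homomorphism out of the second coordinate ring given by a solution of its equation. -/
def lift2 (a b c : A) (h : form2 θ₀ θ₁ a b c = 0) :
    Chart2 θ₀ θ₁ →ₐ[ℂ[T;T⁻¹]] A :=
  Ideal.Quotient.liftₐ _ (MvPolynomial.aeval ![a, b, c]) (fun p hp => by
    rw [← RingHom.mem_ker]
    refine (Ideal.span_le (I := RingHom.ker (MvPolynomial.aeval ![a, b, c]))).2 ?_ hp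
    rintro _ rfl
    simpa [RingHom.mem_ker, map_form2] using h)

theorem lift2_0 (a b c : A) (h : form2 θ₀ θ₁ a b c = 0) :
    lift2 θ₀ θ₁ a b c h (x2 θ₀ θ₁ 0) = a :=
  (Ideal.Quotient.liftₐ_apply _ _ _ _).trans <|
    (Ideal.Quotient.lift_mk _ _ _).trans (MvPolynomial.aeval_X ![a, b, c] 0)

theorem lift2_1 (a b c : A) (h : form2 θ₀ θ₁ a b c = 0) :
    lift2 θ₀ θ₁ a b c h (x2 θ₀ θ₁ 1) = b :=
  (Ideal.Quotient.liftₐ_apply _ _ _ _).trans <|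
    (Ideal.Quotient.lift_mk _ _ _).trans (MvPolynomial.aeval_X ![a, b, c] 1)

theorem lift2_2 (a b c : A) (h : form2 θ₀ θ₁ a b c = 0) :
    lift2 θ₀ θ₁ a b c h (x2 θ₀ θ₁ 2) = c :=
  (Ideal.Quotient.liftₐ_apply _ _ _ _).trans <|
    (Ideal.Quotient.lift_mk _ _ _).trans (MvPolynomial.aeval_X ![a, b, c] 2)

theorem ext2 {f g : Chart2 θ₀ θ₁ →ₐ[ℂ[T;T⁻¹]] A}
    (h : ∀ i, f (x2 θ₀ θ₁ i) = g (x2 θ₀ θ₁ i)) : f = g :=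
  Ideal.Quotient.algHom_ext _ (MvPolynomial.algHom_ext h)

end forms

/-! ### The gluing -/

section gluing

variable (θ₀ θ₁ : ℂ)

/-- The open part `b₀ ≠ 0` of the first affine part. -/
def Overlap : Type := Localization.Away (x1 θ₀ θ₁ 1)

instance : CommRing (Overlap θ₀ θ₁) :=
  inferInstanceAs (CommRing (Localization.Away (x1 θ₀ θ₁ 1)))

instance : Algebra (Chart1 θ₀ θ₁) (Overlap θ₀ θ₁) :=
  inferInstanceAs (Algebra (Chart1 θ₀ θ₁) (Localization.Away (x1 θ₀ θ₁ 1)))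

instance : Algebra ℂ[T;T⁻¹] (Overlap θ₀ θ₁) :=
  inferInstanceAs (Algebra ℂ[T;T⁻¹] (Localization.Away (x1 θ₀ θ₁ 1)))

instance : IsScalarTower ℂ[T;T⁻¹] (Chart1 θ₀ θ₁) (Overlap θ₀ θ₁) :=
  inferInstanceAs (IsScalarTower ℂ[T;T⁻¹] (Chart1 θ₀ θ₁) (Localization.Away (x1 θ₀ θ₁ 1)))

instance : IsLocalization.Away (x1 θ₀ θ₁ 1) (Overlap θ₀ θ₁) :=
  inferInstanceAs (IsLocalization.Away (x1 θ₀ θ₁ 1) (Localization.Away (x1 θ₀ θ₁ 1)))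

/-- The open part `b₁ ≠ 0` of the second affine part. -/
def Overlap' : Type := Localization.Away (x2 θ₀ θ₁ 1)

instance : CommRing (Overlap' θ₀ θ₁) :=
  inferInstanceAs (CommRing (Localization.Away (x2 θ₀ θ₁ 1)))

instance : Algebra (Chart2 θ₀ θ₁) (Overlap' θ₀ θ₁) :=
  inferInstanceAs (Algebra (Chart2 θ₀ θ₁) (Localization.Away (x2 θ₀ θ₁ 1)))

instance : Algebra ℂ[T;T⁻¹] (Overlap' θ₀ θ₁) :=
  inferInstanceAs (Algebra ℂ[T;T⁻¹] (Localization.Away (x2 θ₀ θ₁ 1)))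

instance : IsScalarTower ℂ[T;T⁻¹] (Chart2 θ₀ θ₁) (Overlap' θ₀ θ₁) :=
  inferInstanceAs (IsScalarTower ℂ[T;T⁻¹] (Chart2 θ₀ θ₁) (Localization.Away (x2 θ₀ θ₁ 1)))

instance : IsLocalization.Away (x2 θ₀ θ₁ 1) (Overlap' θ₀ θ₁) :=
  inferInstanceAs (IsLocalization.Away (x2 θ₀ θ₁ 1) (Localization.Away (x2 θ₀ θ₁ 1)))

/-- The functions `a₀, b₀, c₁` on the overlap. -/
def y1 (i : Fin 3) : Overlap θ₀ θ₁ := algebraMap (Chart1 θ₀ θ₁) (Overlap θ₀ θ₁) (x1 θ₀ θ₁ i)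

/-- The functions `a₂, b₁, c₁` on the open part `b₁ ≠ 0` of the second affine part. -/
def y2 (i : Fin 3) : Overlap' θ₀ θ₁ := algebraMap (Chart2 θ₀ θ₁) (Overlap' θ₀ θ₁) (x2 θ₀ θ₁ i)

/-- The function `1 / b₀`. -/
def inv1 : Overlap θ₀ θ₁ := IsLocalization.Away.invSelf (x1 θ₀ θ₁ 1)

/-- The function `1 / b₁`. -/
def inv2 : Overlap' θ₀ θ₁ := IsLocalization.Away.invSelf (x2 θ₀ θ₁ 1)

theorem y1_mul_inv1 : y1 θ₀ θ₁ 1 * inv1 θ₀ θ₁ = 1 := IsLocalization.Away.mul_invSelf _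

theorem y2_mul_inv2 : y2 θ₀ θ₁ 1 * inv2 θ₀ θ₁ = 1 := IsLocalization.Away.mul_invSelf _

theorem form1_y1 : form1 θ₀ θ₁ (y1 θ₀ θ₁ 0) (y1 θ₀ θ₁ 1) (y1 θ₀ θ₁ 2) = 0 := by
  have h := map_form1 θ₀ θ₁ (IsScalarTower.toAlgHom ℂ[T;T⁻¹] (Chart1 θ₀ θ₁) (Overlap θ₀ θ₁))
    (x1 θ₀ θ₁ 0) (x1 θ₀ θ₁ 1) (x1 θ₀ θ₁ 2)
  rw [form1_x1, map_zero] at h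
  exact h.symm

theorem form2_y2 : form2 θ₀ θ₁ (y2 θ₀ θ₁ 0) (y2 θ₀ θ₁ 1) (y2 θ₀ θ₁ 2) = 0 := by
  have h := map_form2 θ₀ θ₁ (IsScalarTower.toAlgHom ℂ[T;T⁻¹] (Chart2 θ₀ θ₁) (Overlap' θ₀ θ₁))
    (x2 θ₀ θ₁ 0) (x2 θ₀ θ₁ 1) (x2 θ₀ θ₁ 2)
  rw [form2_x2, map_zero] at h
  exact h.symm

/-- The transition map: on the overlap, the coordinates `a₂, b₁, c₁` of the second affine part are
`a₀ / b₀², 1 / b₀, b₀ c₁ + (a₀ - a₀²) / b₀`. -/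
def transition : Chart2 θ₀ θ₁ →ₐ[ℂ[T;T⁻¹]] Overlap θ₀ θ₁ :=
  lift2 θ₀ θ₁ (y1 θ₀ θ₁ 0 * inv1 θ₀ θ₁ ^ 2) (inv1 θ₀ θ₁)
    (y1 θ₀ θ₁ 1 * y1 θ₀ θ₁ 2 + (y1 θ₀ θ₁ 0 - y1 θ₀ θ₁ 0 ^ 2) * inv1 θ₀ θ₁)
    (form2_of_form1 θ₀ θ₁ (y1_mul_inv1 θ₀ θ₁) (form1_y1 θ₀ θ₁))

/-- The transition map in the other direction. -/
def transition' : Chart1 θ₀ θ₁ →ₐ[ℂ[T;T⁻¹]] Overlap' θ₀ θ₁ :=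
  lift1 θ₀ θ₁ (y2 θ₀ θ₁ 0 * inv2 θ₀ θ₁ ^ 2) (inv2 θ₀ θ₁)
    (y2 θ₀ θ₁ 1 * y2 θ₀ θ₁ 2 - (y2 θ₀ θ₁ 0 * inv2 θ₀ θ₁ ^ 2 -
      (y2 θ₀ θ₁ 0 * inv2 θ₀ θ₁ ^ 2) ^ 2) * y2 θ₀ θ₁ 1 ^ 2)
    (form1_of_form2 θ₀ θ₁ (y2_mul_inv2 θ₀ θ₁) (form2_y2 θ₀ θ₁))

/-- The extension of the transition map to the open part `b₁ ≠ 0`. -/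
def transitionAway : Overlap' θ₀ θ₁ →ₐ[ℂ[T;T⁻¹]] Overlap θ₀ θ₁ :=
  IsLocalization.liftAlgHom (M := Submonoid.powers (x2 θ₀ θ₁ 1)) (f := transition θ₀ θ₁) (by
    rintro ⟨_, n, rfl⟩
    simp only [map_pow]
    refine IsUnit.pow _ ?_
    rw [transition, lift2_1]
    exact IsUnit.of_mul_eq_one_right _ (y1_mul_inv1 θ₀ θ₁))

/-- The extension of the other transition map to the open part `b₀ ≠ 0`. -/
def transitionAway' : Overlap θ₀ θ₁ →ₐ[ℂ[T;T⁻¹]] Overlap' θ₀ θ₁ :=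
  IsLocalization.liftAlgHom (M := Submonoid.powers (x1 θ₀ θ₁ 1)) (f := transition' θ₀ θ₁) (by
    rintro ⟨_, n, rfl⟩
    simp only [map_pow]
    refine IsUnit.pow _ ?_
    rw [transition', lift1_1]
    exact IsUnit.of_mul_eq_one_right _ (y2_mul_inv2 θ₀ θ₁))

theorem transitionAway_algebraMap (a : Chart2 θ₀ θ₁) :
    transitionAway θ₀ θ₁ (algebraMap (Chart2 θ₀ θ₁) (Overlap' θ₀ θ₁) a) = transition θ₀ θ₁ a :=
  IsLocalization.lift_eq _ _

theorem transitionAway_y2 (i : Fin 3) :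
    transitionAway θ₀ θ₁ (y2 θ₀ θ₁ i) = transition θ₀ θ₁ (x2 θ₀ θ₁ i) :=
  IsLocalization.lift_eq _ _

theorem transitionAway'_y1 (i : Fin 3) :
    transitionAway' θ₀ θ₁ (y1 θ₀ θ₁ i) = transition' θ₀ θ₁ (x1 θ₀ θ₁ i) :=
  IsLocalization.lift_eq _ _

theorem transitionAway_inv2 : transitionAway θ₀ θ₁ (inv2 θ₀ θ₁) = y1 θ₀ θ₁ 1 := by
  have h := congrArg (transitionAway θ₀ θ₁) (y2_mul_inv2 θ₀ θ₁)
  have h' := y1_mul_inv1 θ₀ θ₁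
  rw [map_mul, transitionAway_y2, transition, lift2_1, map_one] at h
  linear_combination y1 θ₀ θ₁ 1 * h - transitionAway θ₀ θ₁ (inv2 θ₀ θ₁) * h'

theorem transitionAway'_inv1 : transitionAway' θ₀ θ₁ (inv1 θ₀ θ₁) = y2 θ₀ θ₁ 1 := by
  have h := congrArg (transitionAway' θ₀ θ₁) (y1_mul_inv1 θ₀ θ₁)
  have h' := y2_mul_inv2 θ₀ θ₁
  rw [map_mul, transitionAway'_y1, transition', lift1_1, map_one] at h
  linear_combination y2 θ₀ θ₁ 1 * h - transitionAway' θ₀ θ₁ (inv1 θ₀ θ₁) * h'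

theorem transition_left :
    (transitionAway' θ₀ θ₁).comp (transitionAway θ₀ θ₁) = AlgHom.id _ _ := by
  refine IsLocalization.algHom_ext (Submonoid.powers (x2 θ₀ θ₁ 1)) ?_
  refine ext2 θ₀ θ₁ fun i => ?_
  change transitionAway' θ₀ θ₁ (transitionAway θ₀ θ₁ (y2 θ₀ θ₁ i)) = y2 θ₀ θ₁ i
  have h := y2_mul_inv2 θ₀ θ₁
  rw [transitionAway_y2]
  fin_cases i <;>
    simp only [transition, lift2_0, lift2_1, lift2_2, map_mul, map_add, map_sub, map_pow, transitionAway'_y1,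
      transitionAway'_inv1, transition', lift1_0, lift1_1, lift1_2, Fin.zero_eta, Fin.mk_one,
      Fin.reduceFinMk] <;> grind

theorem transition_right :
    (transitionAway θ₀ θ₁).comp (transitionAway' θ₀ θ₁) = AlgHom.id _ _ := by
  refine IsLocalization.algHom_ext (Submonoid.powers (x1 θ₀ θ₁ 1)) ?_
  refine ext1 θ₀ θ₁ fun i => ?_
  change transitionAway θ₀ θ₁ (transitionAway' θ₀ θ₁ (y1 θ₀ θ₁ i)) = y1 θ₀ θ₁ i
  have h := y1_mul_inv1 θ₀ θ₁
  rw [transitionAway'_y1]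
  fin_cases i <;>
    simp only [transition', lift1_0, lift1_1, lift1_2, map_mul, map_sub, map_pow, transitionAway_y2,
      transitionAway_inv2, transition, lift2_0, lift2_1, lift2_2, Fin.zero_eta, Fin.mk_one,
      Fin.reduceFinMk] <;> grind

/-- The punctured line `ℂ^*` with coordinate `t`. -/
abbrev TLine : Scheme.{0} := Spec (CommRingCat.of ℂ[T;T⁻¹])

/-- The structure morphism of `ℂ^*`. -/
def TLine.toC : TLine ⟶ Spec (CommRingCat.of ℂ) :=
  Spec.map (CommRingCat.ofHom (algebraMap ℂ ℂ[T;T⁻¹]))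

/-- The first affine part. -/
abbrev M₁ : Scheme.{0} := Spec (CommRingCat.of (Chart1 θ₀ θ₁))

/-- The second affine part. -/
abbrev M₂ : Scheme.{0} := Spec (CommRingCat.of (Chart2 θ₀ θ₁))

/-- The open part `b₀ ≠ 0` of the first affine part, as a scheme. -/
abbrev M₁₂ : Scheme.{0} := Spec (CommRingCat.of (Overlap θ₀ θ₁))

/-- The function `t` on the first affine part. -/
def M₁.toT : M₁ θ₀ θ₁ ⟶ TLine :=
  Spec.map (CommRingCat.ofHom (algebraMap ℂ[T;T⁻¹] (Chart1 θ₀ θ₁)))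

/-- The function `t` on the second affine part. -/
def M₂.toT : M₂ θ₀ θ₁ ⟶ TLine :=
  Spec.map (CommRingCat.ofHom (algebraMap ℂ[T;T⁻¹] (Chart2 θ₀ θ₁)))

/-- The inclusion of the overlap into the first affine part. -/
def incl₁ : M₁₂ θ₀ θ₁ ⟶ M₁ θ₀ θ₁ :=
  Spec.map (CommRingCat.ofHom (algebraMap (Chart1 θ₀ θ₁) (Overlap θ₀ θ₁)))

/-- The inclusion of the overlap into the second affine part. -/
def incl₂ : M₁₂ θ₀ θ₁ ⟶ M₂ θ₀ θ₁ :=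
  Spec.map (CommRingCat.ofHom (transition θ₀ θ₁ : Chart2 θ₀ θ₁ →+* Overlap θ₀ θ₁))

instance : IsOpenImmersion (incl₁ θ₀ θ₁) :=
  inferInstanceAs (IsOpenImmersion (Spec.map (CommRingCat.ofHom
    (algebraMap (Chart1 θ₀ θ₁) (Localization.Away (x1 θ₀ θ₁ 1))))))

/-- The transition map as an isomorphism of the two descriptions of the overlap. -/
def overlapEquiv : Overlap' θ₀ θ₁ ≃+* Overlap θ₀ θ₁ :=
  (AlgEquiv.ofAlgHom (transitionAway θ₀ θ₁) (transitionAway' θ₀ θ₁)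
    (transition_right θ₀ θ₁) (transition_left θ₀ θ₁)).toRingEquiv

theorem incl₂_eq : incl₂ θ₀ θ₁ = Spec.map (overlapEquiv θ₀ θ₁).toCommRingCatIso.hom ≫
    Spec.map (CommRingCat.ofHom (algebraMap (Chart2 θ₀ θ₁) (Overlap' θ₀ θ₁))) := by
  rw [← Spec.map_comp]
  exact congrArg Spec.map (CommRingCat.hom_ext
    (RingHom.ext fun a => (transitionAway_algebraMap θ₀ θ₁ a).symm))

instance : IsOpenImmersion (Spec.map (CommRingCat.ofHom
    (algebraMap (Chart2 θ₀ θ₁) (Overlap' θ₀ θ₁)))) :=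
  inferInstanceAs (IsOpenImmersion (Spec.map (CommRingCat.ofHom
    (algebraMap (Chart2 θ₀ θ₁) (Localization.Away (x2 θ₀ θ₁ 1))))))

instance : IsOpenImmersion (incl₂ θ₀ θ₁) := by
  rw [incl₂_eq]
  exact IsOpenImmersion.comp _ _

/-- The space `M(θ₀, θ₁)`: the two affine parts glued along the overlap. -/
def M : Scheme.{0} := pushout (incl₁ θ₀ θ₁) (incl₂ θ₀ θ₁)

/-- The first affine part as a part of `M(θ₀, θ₁)`. -/
def ι₁ : M₁ θ₀ θ₁ ⟶ M θ₀ θ₁ := pushout.inl _ _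

/-- The second affine part as a part of `M(θ₀, θ₁)`. -/
def ι₂ : M₂ θ₀ θ₁ ⟶ M θ₀ θ₁ := pushout.inr _ _

/-- The function `t` on `M(θ₀, θ₁)`. -/
def M.toT : M θ₀ θ₁ ⟶ TLine :=
  pushout.desc (M₁.toT θ₀ θ₁) (M₂.toT θ₀ θ₁) (by
    refine (Spec.map_comp _ _).symm.trans (Eq.trans ?_ (Spec.map_comp _ _))
    rw [← CommRingCat.ofHom_comp, ← CommRingCat.ofHom_comp, ← IsScalarTower.algebraMap_eq,
      AlgHom.comp_algebraMap])

/-- The structure morphism of `M(θ₀, θ₁)` over `ℂ`. -/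
def M.toC : M θ₀ θ₁ ⟶ Spec (CommRingCat.of ℂ) := M.toT θ₀ θ₁ ≫ TLine.toC

end gluing

/-! ### Singular loci -/

/-- The singular locus of `X` relative to `S`: the points where the morphism `f : X ⟶ S` is not
smooth of relative dimension `n`. -/
def singularLocus {X S : Scheme.{0}} (f : X ⟶ S) (n : ℕ) : Set X :=
  {x | ¬ ∃ U : X.Opens, x ∈ U ∧ SmoothOfRelativeDimension n (U.ι ≫ f)}

/-- The set `Z` is the singular locus of the threefold `X`, both over `ℂ` and as a family of
surfaces over `ℂ^*` (with parameter `t`). -/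
def HasSingularLocus {X : Scheme.{0}} (f : X ⟶ TLine) (Z : Set X) : Prop :=
  singularLocus (f ≫ TLine.toC) 3 = Z ∧ singularLocus f 2 = Z

/-! ### Moduli -/

section moduli

variable (θ₀ θ₁ : ℂ)

/-- The matrix of `z(z-1) ∇_{d/dz}` for the family of connections over the first affine part. -/
def univMatrix1 : Matrix (Fin 2) (Fin 2) (Chart1 θ₀ θ₁)[X] :=
  !![C (x1 θ₀ θ₁ 0),
      C (formC0 θ₀ θ₁ (x1 θ₀ θ₁ 1) (x1 θ₀ θ₁ 2)) + C (x1 θ₀ θ₁ 2) * X + C (tt _ ^ 2) * X ^ 2;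
    X + C (x1 θ₀ θ₁ 1), -C (x1 θ₀ θ₁ 0)]

/-- The matrix of `z(z-1) ∇_{d/dz}` for the family of connections over the second affine part. -/
def univMatrix2 : Matrix (Fin 2) (Fin 2) (Chart2 θ₀ θ₁)[X] :=
  !![C (x2 θ₀ θ₁ 0) * X ^ 2,
      C (kk _ (θ₀ ^ 2 / 4)) + C (x2 θ₀ θ₁ 2) * X +
        C (formC2 θ₀ θ₁ (x2 θ₀ θ₁ 0) (x2 θ₀ θ₁ 1) (x2 θ₀ θ₁ 2)) * X ^ 2 +
        C (tt _ ^ 2 - x2 θ₀ θ₁ 1 * formC2 θ₀ θ₁ (x2 θ₀ θ₁ 0) (x2 θ₀ θ₁ 1) (x2 θ₀ θ₁ 2) -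
          x2 θ₀ θ₁ 0) * X ^ 3;
    1 + C (x2 θ₀ θ₁ 1) * X, -(C (x2 θ₀ θ₁ 0) * X ^ 2)]

/-- The structure morphism of `Spec R` over `ℂ`. -/
def specToC (R : Type) [CommRing R] [Algebra ℂ R] :
    Spec (CommRingCat.of R) ⟶ Spec (CommRingCat.of ℂ) :=
  Spec.map (CommRingCat.ofHom (algebraMap ℂ R))

/-- Assignments of a morphism `Spec R ⟶ M(θ₀, θ₁)` to every family of connections over `R`. -/
abbrev Assignment : Type 1 :=
  ∀ (R : Type) [CommRing R] [Algebra ℂ R],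
    Family θ₀ θ₁ R → (Spec (CommRingCat.of R) ⟶ M θ₀ θ₁)

variable {θ₀ θ₁}

/-- The assignment is a morphism of functors on `ℂ`-algebras: it takes values in the morphisms over
`ℂ` and is compatible with pull-backs of families. -/
def Assignment.IsNatural (η : Assignment θ₀ θ₁) : Prop :=
  (∀ (R : Type) [CommRing R] [Algebra ℂ R] (x : Family θ₀ θ₁ R),
    η R x ≫ M.toC θ₀ θ₁ = specToC R) ∧
  ∀ (R R' : Type) [CommRing R] [Algebra ℂ R] [CommRing R'] [Algebra ℂ R'] (φ : R →ₐ[ℂ] R')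
    (x : Family θ₀ θ₁ R) (y : Family θ₀ θ₁ R'), Family.IsPullback φ x y →
      η R' y = Spec.map (CommRingCat.ofHom (φ : R →+* R')) ≫ η R x

/-- The assignment identifies the functor of points of `M(θ₀, θ₁)` with the Zariski sheaf associated
with `R ↦ {families over R with property P} / isomorphism`: two families have the same classifying
morphism exactly when they are isomorphic, and every morphism `Spec R ⟶ M(θ₀, θ₁)` is, locally on
`Spec R`, the classifying morphism of a family with property `P`. -/
def Assignment.Represents (η : Assignment θ₀ θ₁)
    (P : ∀ (R : Type) [CommRing R] [Algebra ℂ R], Family θ₀ θ₁ R → Prop) : Prop :=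
  (∀ (R : Type) [CommRing R] [Algebra ℂ R] (x y : Family θ₀ θ₁ R), P R x → P R y →
    (η R x = η R y ↔ x.Iso y)) ∧
  ∀ (R : Type) [CommRing R] [Algebra ℂ R] (f : Spec (CommRingCat.of R) ⟶ M θ₀ θ₁),
    f ≫ M.toC θ₀ θ₁ = specToC R →
      ∃ s : Set R, Ideal.span s = ⊤ ∧ ∀ r ∈ s, ∃ x : Family θ₀ θ₁ (Localization.Away r),
        P _ x ∧ η _ x =
          Spec.map (CommRingCat.ofHom (algebraMap R (Localization.Away r))) ≫ f

end moduli

/-! ### Differential modules over `ℂ(z)` -/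

/-- The derivation `d/dz` on `ℂ(z)`. -/
def rderiv (r : RatFunc ℂ) : RatFunc ℂ :=
  algebraMap ℂ[X] (RatFunc ℂ) (derivative r.num * r.denom - r.num * derivative r.denom) /
    algebraMap ℂ[X] (RatFunc ℂ) r.denom ^ 2

theorem rderiv_of_eq (r : RatFunc ℂ) (p q : ℂ[X]) (hq : q ≠ 0)
    (hr : r = algebraMap ℂ[X] (RatFunc ℂ) p / algebraMap ℂ[X] (RatFunc ℂ) q) :
    rderiv r = algebraMap ℂ[X] (RatFunc ℂ) (derivative p * q - p * derivative q) /
      algebraMap ℂ[X] (RatFunc ℂ) q ^ 2 := by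
  have hinj := RatFunc.algebraMap_injective ℂ
  have hq' : algebraMap ℂ[X] (RatFunc ℂ) q ≠ 0 :=
    (map_ne_zero_iff _ hinj).2 hq
  have hd' : algebraMap ℂ[X] (RatFunc ℂ) r.denom ≠ 0 :=
    (map_ne_zero_iff _ hinj).2 r.denom_ne_zero
  have h1 : r.num * q = p * r.denom := by
    apply hinj
    have h := r.num_div_denom.trans hr
    rw [div_eq_div_iff hd' hq'] at h
    rw [map_mul, map_mul, h]
  have h2 := congrArg derivative h1
  simp only [derivative_mul] at h2
  rw [rderiv, div_eq_div_iff (pow_ne_zero 2 hd') (pow_ne_zero 2 hq'), ← map_pow, ← map_pow,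
    ← map_mul, ← map_mul]
  have h3 : (derivative r.num * r.denom - r.num * derivative r.denom) * q ^ 2 =
      (derivative p * q - p * derivative q) * r.denom ^ 2 := by
    linear_combination (q * r.denom) * h2 -
      (q * derivative r.denom + r.denom * derivative q) * h1
  rw [h3]

theorem rderiv_div (p q : ℂ[X]) (hq : q ≠ 0) :
    rderiv (algebraMap ℂ[X] (RatFunc ℂ) p / algebraMap ℂ[X] (RatFunc ℂ) q) =
      algebraMap ℂ[X] (RatFunc ℂ) (derivative p * q - p * derivative q) /
        algebraMap ℂ[X] (RatFunc ℂ) q ^ 2 :=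
  rderiv_of_eq _ p q hq rfl

theorem exists_div (r : RatFunc ℂ) : ∃ p q : ℂ[X], q ≠ 0 ∧
    r = algebraMap ℂ[X] (RatFunc ℂ) p / algebraMap ℂ[X] (RatFunc ℂ) q :=
  ⟨r.num, r.denom, r.denom_ne_zero, r.num_div_denom.symm⟩

theorem rderiv_add (r s : RatFunc ℂ) : rderiv (r + s) = rderiv r + rderiv s := by
  obtain ⟨p, q, hq, rfl⟩ := exists_div r
  obtain ⟨p', q', hq', rfl⟩ := exists_div s
  have h1 : algebraMap ℂ[X] (RatFunc ℂ) q ≠ 0 := by simpa using hq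
  have h2 : algebraMap ℂ[X] (RatFunc ℂ) q' ≠ 0 := by simpa using hq'
  rw [div_add_div _ _ h1 h2, ← map_mul, ← map_mul, ← map_mul, ← map_add,
    rderiv_div _ _ (mul_ne_zero hq hq'), rderiv_div _ _ hq, rderiv_div _ _ hq']
  simp only [derivative_mul, map_add, map_sub, map_mul]
  field_simp
  ring

theorem rderiv_mul (r s : RatFunc ℂ) : rderiv (r * s) = rderiv r * s + r * rderiv s := by
  obtain ⟨p, q, hq, rfl⟩ := exists_div r
  obtain ⟨p', q', hq', rfl⟩ := exists_div s
  have h1 : algebraMap ℂ[X] (RatFunc ℂ) q ≠ 0 := by simpa using hq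
  have h2 : algebraMap ℂ[X] (RatFunc ℂ) q' ≠ 0 := by simpa using hq'
  rw [div_mul_div_comm, ← map_mul, ← map_mul,
    rderiv_div _ _ (mul_ne_zero hq hq'), rderiv_div _ _ hq, rderiv_div _ _ hq']
  simp only [derivative_mul, map_add, map_sub, map_mul]
  field_simp
  ring

/-- A differential module over `ℂ(z)`: a vector space with an additive operator `∂` satisfying the
Leibniz rule with respect to `d/dz`. -/
structure DiffModule where
  carrier : Type
  [grp : AddCommGroup carrier]
  [mod : Module (RatFunc ℂ) carrier]
  op : carrier →+ carrier
  leibniz : ∀ (f : RatFunc ℂ) (m : carrier), op (f • m) = rderiv f • m + f • op m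

attribute [instance] DiffModule.grp DiffModule.mod

/-- The expansion of a rational function at `z = x`, where `x` is a (non-constant) Laurent
series. -/
def expand (x : LaurentSeries ℂ) (r : RatFunc ℂ) : LaurentSeries ℂ :=
  RatFunc.eval (HahnSeries.C : ℂ →+* LaurentSeries ℂ) x r

/-- `a + s`, where `s` is the variable of the ring of Laurent series: the coordinate `z` in terms
of the local parameter at the point `a`. -/
def zAt (a : ℂ) : LaurentSeries ℂ := HahnSeries.C a + HahnSeries.single 1 1

/-- `δ + A` and `δ + B` are equivalent over the field of Laurent series. -/
def GaugeEquiv (δ : LaurentSeries ℂ → LaurentSeries ℂ)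
    (A B : Matrix (Fin 2) (Fin 2) (LaurentSeries ℂ)) : Prop :=
  ∃ g : (Matrix (Fin 2) (Fin 2) (LaurentSeries ℂ))ˣ,
    A * g.val + g.val.map δ = g.val * B

/-- The coordinate `z = u⁻⁴` in terms of the local parameter `u = z^{-1/4}` of the ramified cover
of degree `4` at `∞`. -/
def zRam : LaurentSeries ℂ := HahnSeries.single (-4) 1

/-- The derivation `z d/dz = -(1/4) u d/du` on `ℂ((u))`, `u = z^{-1/4}`. -/
def eulerRam (f : LaurentSeries ℂ) : LaurentSeries ℂ :=
  HahnSeries.C (-1 / 4) * (HahnSeries.single 1 1 * lderiv f)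

/-- The local ring of `ℂ[z]` at the point `a`, inside `ℂ(z)`. -/
def localRing (a : ℂ) : Subring (RatFunc ℂ) where
  carrier := {r | ∃ p q : ℂ[X], q.eval a ≠ 0 ∧
    r = algebraMap ℂ[X] (RatFunc ℂ) p / algebraMap ℂ[X] (RatFunc ℂ) q}
  zero_mem' := ⟨0, 1, by simp, by simp⟩
  one_mem' := ⟨1, 1, by simp, by simp⟩
  add_mem' := by
    rintro _ _ ⟨p, q, hq, rfl⟩ ⟨p', q', hq', rfl⟩
    refine ⟨p * q' + q * p', q * q', by simp [hq, hq'], ?_⟩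
    have h1 : algebraMap ℂ[X] (RatFunc ℂ) q ≠ 0 := by
      simpa using (fun h => hq (by simp [h]) : q ≠ 0)
    have h2 : algebraMap ℂ[X] (RatFunc ℂ) q' ≠ 0 := by
      simpa using (fun h => hq' (by simp [h]) : q' ≠ 0)
    rw [div_add_div _ _ h1 h2]
    simp
  mul_mem' := by
    rintro _ _ ⟨p, q, hq, rfl⟩ ⟨p', q', hq', rfl⟩
    exact ⟨p * p', q * q', by simp [hq, hq'], by rw [div_mul_div_comm]; simp⟩
  neg_mem' := by
    rintro _ ⟨p, q, hq, rfl⟩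
    exact ⟨-p, q, hq, by rw [map_neg]; ring⟩

namespace DiffModule

/-- The matrix of `∂` with respect to a basis. -/
def matrix (N : DiffModule) (b : Module.Basis (Fin 2) (RatFunc ℂ) N.carrier) :
    Matrix (Fin 2) (Fin 2) (RatFunc ℂ) :=
  Matrix.of fun i j => b.repr (N.op (b j)) i

/-- The exterior product `Λ² N` is the trivial differential module: there is a non-zero horizontal
alternating form `N × N → ℂ(z)`. (For `N` of dimension `2`.) -/
def HasTrivialDet (N : DiffModule) : Prop :=
  ∃ ω : N.carrier →ₗ[RatFunc ℂ] N.carrier →ₗ[RatFunc ℂ] RatFunc ℂ,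
    ω ≠ 0 ∧ (∀ m, ω m m = 0) ∧
      ∀ m n, rderiv (ω m n) = ω (N.op m) n + ω m (N.op n)

/-- At every point `a ≠ 0, 1` the module is regular, i.e. over `ℂ((z-a))` there is a basis of
horizontal elements, and over `ℂ((z^{-1/4}))` there is a basis on which `z ∂` has the matrix
`(t z^{1/2}, 0; 0, -t z^{1/2})`. Here `b` is any basis of the module. -/
def IsPrescribedAwayFrom01 (N : DiffModule) (b : Module.Basis (Fin 2) (RatFunc ℂ) N.carrier)
    (t : ℂ) : Prop :=
  (∀ a : ℂ, a ≠ 0 → a ≠ 1 → GaugeEquiv lderiv ((N.matrix b).map (expand (zAt a))) 0) ∧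
    GaugeEquiv eulerRam (zRam • (N.matrix b).map (expand zRam))
      !![HahnSeries.single (-2) t, 0; 0, -HahnSeries.single (-2) t]

/-- Over `ℂ((z-a))` the module is represented by `d/dz + (z-a)⁻¹ (ω, *; 0, -ω)` for some complex
number `*`. -/
def IsTriangularAt (N : DiffModule) (b : Module.Basis (Fin 2) (RatFunc ℂ) N.carrier)
    (a ω : ℂ) : Prop :=
  ∃ c : ℂ, GaugeEquiv lderiv ((N.matrix b).map (expand (zAt a)))
    !![HahnSeries.single (-1) ω, HahnSeries.single (-1) c; 0, -HahnSeries.single (-1) ω]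

/-- `Λ` is a lattice at the point `a`, invariant under `(z-a) ∂`, on which the residue has
characteristic polynomial `X² - θ²/4`: some basis `b` of the module generates `Λ` over the local
ring, `(z-a) ∂` has on `b` a matrix `B` with entries in the local ring, and `B(a)` has this
characteristic polynomial. -/
def IsLatticeAt (N : DiffModule) (a θ : ℂ) (Λ : Submodule (localRing a) N.carrier) : Prop :=
  ∃ b : Module.Basis (Fin 2) (RatFunc ℂ) N.carrier,
    Λ = Submodule.span (localRing a) (Set.range b) ∧
    ∃ B : Matrix (Fin 2) (Fin 2) (RatFunc ℂ),
      B = (RatFunc.X - RatFunc.C a) • N.matrix b ∧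
      (∀ i j, B i j ∈ localRing a) ∧
      (B.map (RatFunc.eval (RingHom.id ℂ) a)).charpoly = X ^ 2 - C (θ ^ 2 / 4)

/-- Isomorphisms of differential modules. -/
structure Equiv (N N' : DiffModule) where
  toEquiv : N.carrier ≃ₗ[RatFunc ℂ] N'.carrier
  comm : ∀ m, toEquiv (N.op m) = N'.op (toEquiv m)

/-- The identity. -/
def Equiv.refl (N : DiffModule) : N.Equiv N := ⟨LinearEquiv.refl _ _, fun _ => rfl⟩

/-- The inverse isomorphism. -/
def Equiv.symm {N N' : DiffModule} (e : N.Equiv N') : N'.Equiv N :=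
  ⟨e.toEquiv.symm, fun m => by
    rw [LinearEquiv.symm_apply_eq, e.comm, LinearEquiv.apply_symm_apply]⟩

/-- The composition of isomorphisms. -/
def Equiv.trans {N N' N'' : DiffModule} (e : N.Equiv N') (e' : N'.Equiv N'') : N.Equiv N'' :=
  ⟨e.toEquiv.trans e'.toEquiv, fun m => by
    simp only [LinearEquiv.trans_apply, e.comm, e'.comm]⟩

end DiffModule

section S

variable (θ₀ θ₁ : ℂ)

/-- A tuple `(N, t)`, where `N` is a two-dimensional differential module over `ℂ(z)` with trivial
determinant and the local data prescribed by `θ₀`, `θ₁` and `t` at `0`, `1`, `∞`. -/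
structure STuple where
  N : DiffModule
  t : ℂˣ
  det : N.HasTrivialDet
  loc : ∃ b : Module.Basis (Fin 2) (RatFunc ℂ) N.carrier,
    N.IsPrescribedAwayFrom01 b t ∧ N.IsTriangularAt b 0 (θ₀ / 2) ∧ N.IsTriangularAt b 1 (θ₁ / 2)

/-- Isomorphism of tuples. -/
instance STuple.setoid : Setoid (STuple θ₀ θ₁) where
  r x y := x.t = y.t ∧ Nonempty (x.N.Equiv y.N)
  iseqv :=
    ⟨fun x => ⟨rfl, ⟨.refl x.N⟩⟩, fun ⟨h, ⟨e⟩⟩ => ⟨h.symm, ⟨e.symm⟩⟩,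
      fun ⟨h, ⟨e⟩⟩ ⟨h', ⟨e'⟩⟩ => ⟨h.trans h', ⟨e.trans e'⟩⟩⟩

/-- The set `S(θ₀, θ₁)` of isomorphism classes. -/
def S : Type 1 := _root_.Quotient (STuple.setoid θ₀ θ₁)

/-- A tuple `(N, t, Λ₀, Λ₁)`: as before, but with the invariant lattices `Λ₀`, `Λ₁` at `0` and `1`
as part of the data. -/
structure LatticeTuple where
  N : DiffModule
  t : ℂˣ
  Λ₀ : Submodule (localRing 0) N.carrier
  Λ₁ : Submodule (localRing 1) N.carrier
  det : N.HasTrivialDet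
  loc : ∃ b : Module.Basis (Fin 2) (RatFunc ℂ) N.carrier, N.IsPrescribedAwayFrom01 b t
  lattice₀ : N.IsLatticeAt 0 θ₀ Λ₀
  lattice₁ : N.IsLatticeAt 1 θ₁ Λ₁

/-- Isomorphism of tuples: an isomorphism of differential modules that respects the lattices. -/
instance LatticeTuple.setoid : Setoid (LatticeTuple θ₀ θ₁) where
  r x y := x.t = y.t ∧ ∃ e : x.N.Equiv y.N,
    (∀ m, e.toEquiv m ∈ y.Λ₀ ↔ m ∈ x.Λ₀) ∧ ∀ m, e.toEquiv m ∈ y.Λ₁ ↔ m ∈ x.Λ₁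
  iseqv := by
    refine ⟨fun x => ⟨rfl, .refl x.N, fun _ => Iff.rfl, fun _ => Iff.rfl⟩, ?_, ?_⟩
    · rintro x y ⟨h, e, h0, h1⟩
      refine ⟨h.symm, e.symm, fun m => ?_, fun m => ?_⟩
      · rw [← h0]
        simp [DiffModule.Equiv.symm]
      · rw [← h1]
        simp [DiffModule.Equiv.symm]
    · rintro x y z ⟨h, e, h0, h1⟩ ⟨h', e', h0', h1'⟩
      exact ⟨h.trans h', e.trans e', fun m => (h0' _).trans (h0 m), fun m => (h1' _).trans (h1 m)⟩

/-- The set of isomorphism classes of tuples with lattices. -/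
def SLattice : Type 1 := _root_.Quotient (LatticeTuple.setoid θ₀ θ₁)

end S

/-- The generic fibre of a connection on the bundle `V` over `ℙ¹_ℂ`: the vector space
`ℂ(z) e₁ ⊕ ℂ(z) e₂` with `∂ = ∇_{d/dz}`. -/
def genericFibre (D : BundleConnection ℂ) : DiffModule where
  carrier := Fin 2 → RatFunc ℂ
  op := AddMonoidHom.mk' (fun v => (fun i => rderiv (v i)) +
      (RatFunc.X * (RatFunc.X - 1) : RatFunc ℂ)⁻¹ •
        (D.matrix.map (algebraMap ℂ[X] (RatFunc ℂ))).mulVec v) (fun v w => by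
    ext i
    simp only [Pi.add_apply, rderiv_add, Matrix.mulVec_add, smul_add]
    ring)
  leibniz f v := by
    ext i
    simp only [AddMonoidHom.mk'_apply, Pi.add_apply, Pi.smul_apply, smul_eq_mul, rderiv_mul,
      Matrix.mulVec_smul]
    ring

/-- The lattice at the point `a` defined by the bundle `V`. -/
def bundleLattice (D : BundleConnection ℂ) (a : ℂ) :
    Submodule (localRing a) (genericFibre D).carrier :=
  Submodule.span (localRing a) (Set.range (Pi.basisFun (RatFunc ℂ) (Fin 2)))

/-- The set `M(θ₀, θ₁)(ℂ)` of complex points. -/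
def ComplexPoints (θ₀ θ₁ : ℂ) : Type :=
  {f : Spec (CommRingCat.of ℂ) ⟶ M θ₀ θ₁ // f ≫ M.toC θ₀ θ₁ = specToC ℂ}

end

end DegPV

namespace DegPV

/-! ### The scheme obtained by gluing -/

section glued

variable (θ₀ θ₁ : ℂ)

instance : IsOpenImmersion (ι₁ θ₀ θ₁) :=
  inferInstanceAs (IsOpenImmersion
    (colimit.ι (span (incl₁ θ₀ θ₁) (incl₂ θ₀ θ₁)) WalkingSpan.left))

instance : IsOpenImmersion (ι₂ θ₀ θ₁) :=
  inferInstanceAs (IsOpenImmersion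
    (colimit.ι (span (incl₁ θ₀ θ₁) (incl₂ θ₀ θ₁)) WalkingSpan.right))

theorem incl_condition : incl₁ θ₀ θ₁ ≫ ι₁ θ₀ θ₁ = incl₂ θ₀ θ₁ ≫ ι₂ θ₀ θ₁ :=
  pushout.condition

theorem ι₁_toT : ι₁ θ₀ θ₁ ≫ M.toT θ₀ θ₁ = M₁.toT θ₀ θ₁ := pushout.inl_desc _ _ _

theorem ι₂_toT : ι₂ θ₀ θ₁ ≫ M.toT θ₀ θ₁ = M₂.toT θ₀ θ₁ := pushout.inr_desc _ _ _

theorem mem_range_or (x : M θ₀ θ₁) : x ∈ Set.range (ι₁ θ₀ θ₁) ∨ x ∈ Set.range (ι₂ θ₀ θ₁) := by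
  obtain ⟨i, y, h⟩ := Scheme.IsLocallyDirected.ι_jointly_surjective
    (span (incl₁ θ₀ θ₁) (incl₂ θ₀ θ₁)) x
  rcases i with _ | _ | _
  · left
    refine ⟨incl₁ θ₀ θ₁ y, ?_⟩
    have hw : incl₁ θ₀ θ₁ ≫ ι₁ θ₀ θ₁ =
        colimit.ι (span (incl₁ θ₀ θ₁) (incl₂ θ₀ θ₁)) WalkingSpan.zero :=
      colimit.w (span (incl₁ θ₀ θ₁) (incl₂ θ₀ θ₁)) WalkingSpan.Hom.fst
    exact ((Scheme.Hom.comp_apply (incl₁ θ₀ θ₁) (ι₁ θ₀ θ₁) y).symm.trans congr($hw y)).trans h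
  · exact .inl ⟨y, h⟩
  · exact .inr ⟨y, h⟩

theorem exists_overlap_of_eq (x : M₁ θ₀ θ₁) (y : M₂ θ₀ θ₁) (h : ι₁ θ₀ θ₁ x = ι₂ θ₀ θ₁ y) :
    ∃ w : M₁₂ θ₀ θ₁, incl₁ θ₀ θ₁ w = x ∧ incl₂ θ₀ θ₁ w = y := by
  obtain ⟨k, f, g, w, h1, h2⟩ := (Scheme.IsLocallyDirected.ι_eq_ι_iff
    (span (incl₁ θ₀ θ₁) (incl₂ θ₀ θ₁)) (i := WalkingSpan.left) (j := WalkingSpan.right)).1 h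
  rcases k with _ | _ | _
  · obtain rfl : f = WalkingSpan.Hom.fst := Subsingleton.elim _ _
    obtain rfl : g = WalkingSpan.Hom.snd := Subsingleton.elim _ _
    exact ⟨w, h1, h2⟩
  · exact nomatch g
  · exact nomatch f

theorem isPullback_overlap :
    IsPullback (incl₁ θ₀ θ₁) (incl₂ θ₀ θ₁) (ι₁ θ₀ θ₁) (ι₂ θ₀ θ₁) := by
  refine IsOpenImmersion.isPullback _ _ _ _ (incl_condition θ₀ θ₁).symm ?_
  ext y
  constructor
  · rintro ⟨x, hx⟩
    obtain ⟨w, -, h2⟩ := exists_overlap_of_eq θ₀ θ₁ x y hx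
    exact ⟨w, h2⟩
  · rintro ⟨w, rfl⟩
    exact ⟨incl₁ θ₀ θ₁ w, by
      rw [← Scheme.Hom.comp_apply, incl_condition, Scheme.Hom.comp_apply]⟩

theorem of_charts (P : MorphismProperty Scheme.{0}) [IsZariskiLocalAtSource P] {Y : Scheme.{0}}
    (f : M θ₀ θ₁ ⟶ Y) (h1 : P (ι₁ θ₀ θ₁ ≫ f)) (h2 : P (ι₂ θ₀ θ₁ ≫ f)) : P f := by
  refine IsZariskiLocalAtSource.of_openCover
    (Scheme.IsLocallyDirected.openCover (span (incl₁ θ₀ θ₁) (incl₂ θ₀ θ₁))) fun i => ?_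
  rcases i with _ | _ | _
  · have := IsZariskiLocalAtSource.comp h1 (incl₁ θ₀ θ₁)
    have hw : incl₁ θ₀ θ₁ ≫ ι₁ θ₀ θ₁ =
        colimit.ι (span (incl₁ θ₀ θ₁) (incl₂ θ₀ θ₁)) WalkingSpan.zero :=
      colimit.w (span (incl₁ θ₀ θ₁) (incl₂ θ₀ θ₁)) WalkingSpan.Hom.fst
    rw [← Category.assoc, hw] at this
    exact this
  · exact h1
  · exact h2

/-- Morphisms from an affine scheme into the two charts agree in the glued scheme exactly when they
come from a morphism into the overlap. -/
theorem spec_comp_ι_eq_iff {B : Type} [CommRing B] (φ : Chart1 θ₀ θ₁ →+* B)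
    (ψ : Chart2 θ₀ θ₁ →+* B) :
    Spec.map (CommRingCat.ofHom φ) ≫ ι₁ θ₀ θ₁ = Spec.map (CommRingCat.ofHom ψ) ≫ ι₂ θ₀ θ₁ ↔
      ∃ κ : Overlap θ₀ θ₁ →+* B, κ.comp (algebraMap _ _) = φ ∧
        κ.comp (transition θ₀ θ₁ : Chart2 θ₀ θ₁ →+* Overlap θ₀ θ₁) = ψ := by
  constructor
  · intro h
    obtain ⟨l, h1, h2⟩ := (isPullback_overlap θ₀ θ₁).exists_lift _ _ h
    obtain ⟨κ, rfl⟩ := Spec.map_surjective l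
    refine ⟨κ.hom, ?_, ?_⟩
    · rw [incl₁, ← Spec.map_comp] at h1
      exact congr($(Spec.map_injective h1).hom)
    · rw [incl₂, ← Spec.map_comp] at h2
      exact congr($(Spec.map_injective h2).hom)
  · rintro ⟨κ, rfl, rfl⟩
    rw [CommRingCat.ofHom_comp, CommRingCat.ofHom_comp, Spec.map_comp, Spec.map_comp,
      Category.assoc, Category.assoc]
    exact congrArg _ (incl_condition θ₀ θ₁)

theorem spec_comp_ι₁_injective {B : Type} [CommRing B] {φ ψ : Chart1 θ₀ θ₁ →+* B}
    (h : Spec.map (CommRingCat.ofHom φ) ≫ ι₁ θ₀ θ₁ =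
      Spec.map (CommRingCat.ofHom ψ) ≫ ι₁ θ₀ θ₁) : φ = ψ :=
  congr($(Spec.map_injective ((cancel_mono _).1 h)).hom)

theorem spec_comp_ι₂_injective {B : Type} [CommRing B] {φ ψ : Chart2 θ₀ θ₁ →+* B}
    (h : Spec.map (CommRingCat.ofHom φ) ≫ ι₂ θ₀ θ₁ =
      Spec.map (CommRingCat.ofHom ψ) ≫ ι₂ θ₀ θ₁) : φ = ψ :=
  congr($(Spec.map_injective ((cancel_mono _).1 h)).hom)

theorem exists_spec_of_range_ι₁ {B : Type} [CommRing B] (f : Spec (CommRingCat.of B) ⟶ M θ₀ θ₁)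
    (h : Set.range f ⊆ Set.range (ι₁ θ₀ θ₁)) :
    ∃ φ : Chart1 θ₀ θ₁ →+* B, f = Spec.map (CommRingCat.ofHom φ) ≫ ι₁ θ₀ θ₁ := by
  obtain ⟨κ, hκ⟩ := Spec.map_surjective (IsOpenImmersion.lift (ι₁ θ₀ θ₁) f h)
  exact ⟨κ.hom, by rw [CommRingCat.ofHom_hom, hκ, IsOpenImmersion.lift_fac]⟩

theorem exists_spec_of_range_ι₂ {B : Type} [CommRing B] (f : Spec (CommRingCat.of B) ⟶ M θ₀ θ₁)
    (h : Set.range f ⊆ Set.range (ι₂ θ₀ θ₁)) :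
    ∃ φ : Chart2 θ₀ θ₁ →+* B, f = Spec.map (CommRingCat.ofHom φ) ≫ ι₂ θ₀ θ₁ := by
  obtain ⟨κ, hκ⟩ := Spec.map_surjective (IsOpenImmersion.lift (ι₂ θ₀ θ₁) f h)
  exact ⟨κ.hom, by rw [CommRingCat.ofHom_hom, hκ, IsOpenImmersion.lift_fac]⟩

theorem range_subset_of_closedPoint_mem {B : Type} [CommRing B] [IsLocalRing B] {X : Scheme.{0}}
    (f : Spec (CommRingCat.of B) ⟶ X) (U : X.Opens) (h : f (IsLocalRing.closedPoint B) ∈ U) :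
    Set.range f ⊆ U := by
  rintro _ ⟨x, rfl⟩
  have hs : x ⤳ IsLocalRing.closedPoint B := IsLocalRing.specializes_closedPoint x
  exact (hs.map f.continuous).mem_open U.2 h

/-- A morphism from a local scheme factors through one of the charts. -/
theorem exists_spec_of_isLocalRing {B : Type} [CommRing B] [IsLocalRing B]
    (f : Spec (CommRingCat.of B) ⟶ M θ₀ θ₁) :
    (∃ φ : Chart1 θ₀ θ₁ →+* B, f = Spec.map (CommRingCat.ofHom φ) ≫ ι₁ θ₀ θ₁) ∨
      ∃ φ : Chart2 θ₀ θ₁ →+* B, f = Spec.map (CommRingCat.ofHom φ) ≫ ι₂ θ₀ θ₁ := by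
  rcases mem_range_or θ₀ θ₁ (f (IsLocalRing.closedPoint B)) with h | h
  · exact .inl (exists_spec_of_range_ι₁ _ _ _
      (range_subset_of_closedPoint_mem f (ι₁ θ₀ θ₁).opensRange h))
  · exact .inr (exists_spec_of_range_ι₂ _ _ _
      (range_subset_of_closedPoint_mem f (ι₂ θ₀ θ₁).opensRange h))

/-- On the locus where `b₀` is invertible one can pass to the second chart. -/
theorem exists_spec_ι₂_of_isUnit {B : Type} [CommRing B] (φ : Chart1 θ₀ θ₁ →+* B)
    (h : IsUnit (φ (x1 θ₀ θ₁ 1))) : ∃ ψ : Chart2 θ₀ θ₁ →+* B,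
      Spec.map (CommRingCat.ofHom φ) ≫ ι₁ θ₀ θ₁ = Spec.map (CommRingCat.ofHom ψ) ≫ ι₂ θ₀ θ₁ :=
  ⟨_, (spec_comp_ι_eq_iff θ₀ θ₁ φ _).2
    ⟨IsLocalization.Away.lift (S := Overlap θ₀ θ₁) (x1 θ₀ θ₁ 1) h,
      IsLocalization.Away.lift_comp _ _, rfl⟩⟩

theorem transition_x2_one : transition θ₀ θ₁ (x2 θ₀ θ₁ 1) = inv1 θ₀ θ₁ := lift2_1 _ _ _ _ _ _

theorem mul_eq_one_of_spec_comp_eq {B : Type} [CommRing B] {φ : Chart1 θ₀ θ₁ →+* B}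
    {ψ : Chart2 θ₀ θ₁ →+* B}
    (h : Spec.map (CommRingCat.ofHom φ) ≫ ι₁ θ₀ θ₁ =
      Spec.map (CommRingCat.ofHom ψ) ≫ ι₂ θ₀ θ₁) :
    φ (x1 θ₀ θ₁ 1) * ψ (x2 θ₀ θ₁ 1) = 1 := by
  obtain ⟨κ, rfl, rfl⟩ := (spec_comp_ι_eq_iff θ₀ θ₁ φ ψ).1 h
  rw [RingHom.comp_apply, RingHom.comp_apply, ← map_mul]
  refine Eq.trans ?_ (map_one κ)
  congr 1
  exact (congrArg _ (transition_x2_one θ₀ θ₁)).trans (y1_mul_inv1 θ₀ θ₁)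

end glued

/-! ### Finiteness and separatedness -/

section separated

variable (θ₀ θ₁ : ℂ)

instance : Algebra.FiniteType ℂ ℂ[T;T⁻¹] :=
  inferInstanceAs (Algebra.FiniteType ℂ (AddMonoidAlgebra ℂ ℤ))

instance : Algebra.FiniteType ℂ[T;T⁻¹] (Chart1 θ₀ θ₁) :=
  inferInstanceAs (Algebra.FiniteType ℂ[T;T⁻¹] (CoordRing ⧸ ideal1 θ₀ θ₁))

instance : Algebra.FiniteType ℂ[T;T⁻¹] (Chart2 θ₀ θ₁) :=
  inferInstanceAs (Algebra.FiniteType ℂ[T;T⁻¹] (CoordRing ⧸ ideal2 θ₀ θ₁))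

instance : LocallyOfFiniteType (M.toT θ₀ θ₁) := by
  refine @of_charts θ₀ θ₁ @LocallyOfFiniteType HasRingHomProperty.instIsZariskiLocalAtSource _
    (M.toT θ₀ θ₁) ?_ ?_
  · rw [ι₁_toT, M₁.toT, HasRingHomProperty.Spec_iff (P := @LocallyOfFiniteType)]
    exact RingHom.finiteType_algebraMap.2 inferInstance
  · rw [ι₂_toT, M₂.toT, HasRingHomProperty.Spec_iff (P := @LocallyOfFiniteType)]
    exact RingHom.finiteType_algebraMap.2 inferInstance

instance : LocallyOfFiniteType TLine.toC := by
  rw [TLine.toC, HasRingHomProperty.Spec_iff (P := @LocallyOfFiniteType)]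
  exact RingHom.finiteType_algebraMap.2 inferInstance

instance locallyOfFiniteType_toC : LocallyOfFiniteType (M.toC θ₀ θ₁) := by
  unfold M.toC; infer_instance

theorem range_union : Set.range (ι₁ θ₀ θ₁) ∪ Set.range (ι₂ θ₀ θ₁) = Set.univ :=
  Set.eq_univ_of_forall fun x => mem_range_or θ₀ θ₁ x

instance : CompactSpace (M θ₀ θ₁) := by
  rw [← isCompact_univ_iff, ← range_union]
  exact (isCompact_range (ι₁ θ₀ θ₁).continuous).union (isCompact_range (ι₂ θ₀ θ₁).continuous)

instance quasiCompact_toC : QuasiCompact (M.toC θ₀ θ₁) :=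
  (quasiCompact_iff_compactSpace _).2 inferInstance

instance isSeparated_toC : IsSeparated (M.toC θ₀ θ₁) := by
  have : IsLocallyNoetherian (M θ₀ θ₁) :=
    LocallyOfFiniteType.isLocallyNoetherian (M.toC θ₀ θ₁)
  refine IsSeparated.of_valuativeCriterion _ fun S => ⟨?_⟩
  rintro ⟨l, h1, h2⟩ ⟨l', h1', h2'⟩
  suffices l = l' by subst this; rfl
  have hinj := IsFractionRing.injective S.R S.K
  have key := h1.trans h1'.symm
  clear h1 h1' h2 h2'
  have same1 : ∀ φ ψ : Chart1 θ₀ θ₁ →+* S.R,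
      Spec.map (CommRingCat.ofHom (algebraMap S.R S.K)) ≫ Spec.map (CommRingCat.ofHom φ) ≫
        ι₁ θ₀ θ₁ = Spec.map (CommRingCat.ofHom (algebraMap S.R S.K)) ≫
        Spec.map (CommRingCat.ofHom ψ) ≫ ι₁ θ₀ θ₁ → φ = ψ := by
    intro φ ψ h
    rw [← Category.assoc, ← Category.assoc, ← Spec.map_comp, ← Spec.map_comp,
      ← CommRingCat.ofHom_comp, ← CommRingCat.ofHom_comp] at h
    exact (RingHom.cancel_left hinj).1 (spec_comp_ι₁_injective _ _ h)
  have same2 : ∀ φ ψ : Chart2 θ₀ θ₁ →+* S.R,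
      Spec.map (CommRingCat.ofHom (algebraMap S.R S.K)) ≫ Spec.map (CommRingCat.ofHom φ) ≫
        ι₂ θ₀ θ₁ = Spec.map (CommRingCat.ofHom (algebraMap S.R S.K)) ≫
        Spec.map (CommRingCat.ofHom ψ) ≫ ι₂ θ₀ θ₁ → φ = ψ := by
    intro φ ψ h
    rw [← Category.assoc, ← Category.assoc, ← Spec.map_comp, ← Spec.map_comp,
      ← CommRingCat.ofHom_comp, ← CommRingCat.ofHom_comp] at h
    exact (RingHom.cancel_left hinj).1 (spec_comp_ι₂_injective _ _ h)
  have mixed : ∀ (φ : Chart1 θ₀ θ₁ →+* S.R) (ψ : Chart2 θ₀ θ₁ →+* S.R),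
      Spec.map (CommRingCat.ofHom (algebraMap S.R S.K)) ≫ Spec.map (CommRingCat.ofHom φ) ≫
        ι₁ θ₀ θ₁ = Spec.map (CommRingCat.ofHom (algebraMap S.R S.K)) ≫
        Spec.map (CommRingCat.ofHom ψ) ≫ ι₂ θ₀ θ₁ →
      Spec.map (CommRingCat.ofHom φ) ≫ ι₁ θ₀ θ₁ =
        Spec.map (CommRingCat.ofHom ψ) ≫ ι₂ θ₀ θ₁ := by
    intro φ ψ h
    have h' := h
    rw [← Category.assoc, ← Category.assoc, ← Spec.map_comp, ← Spec.map_comp,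
      ← CommRingCat.ofHom_comp, ← CommRingCat.ofHom_comp] at h'
    have hu := mul_eq_one_of_spec_comp_eq _ _ h'
    rw [RingHom.comp_apply, RingHom.comp_apply, ← map_mul] at hu
    obtain ⟨ψ', hψ'⟩ := exists_spec_ι₂_of_isUnit θ₀ θ₁ φ
      (IsUnit.of_mul_eq_one _ (hinj (hu.trans (map_one _).symm)))
    rw [hψ'] at h ⊢
    rw [same2 _ _ h]
  rcases exists_spec_of_isLocalRing θ₀ θ₁ l with ⟨φ, rfl⟩ | ⟨φ, rfl⟩ <;>
    rcases exists_spec_of_isLocalRing θ₀ θ₁ l' with ⟨ψ, rfl⟩ | ⟨ψ, rfl⟩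
  · rw [same1 _ _ key]
  · exact mixed _ _ key
  · exact (mixed _ _ key.symm).symm
  · rw [same2 _ _ key]

end separated

end DegPV

namespace DegPV

/-! ### Integrality -/

section integral

instance : UniqueFactorizationMonoid ℂ[T;T⁻¹] :=
  UniqueFactorizationMonoid.of_isLocalization (M := ℂ[X]) (Submonoid.powers (X : ℂ[X])) _

variable (θ₀ θ₁ : ℂ)

theorem notMem_vars_of_mem_supported {p : CoordRing} {s : Set (Fin 3)} {i : Fin 3}
    (h : p ∈ MvPolynomial.supported ℂ[T;T⁻¹] s) (hi : i ∉ s) : i ∉ p.vars :=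
  fun h' => hi (MvPolynomial.mem_supported.1 h h')

theorem irreducible_X_one : Irreducible (MvPolynomial.X 1 : CoordRing) := by
  have h := MvPolynomial.irreducible_mul_X_add (1 : CoordRing) 0 1 one_ne_zero
    (by simp) (by simp) isRelPrime_one_left
  rwa [one_mul, add_zero] at h

theorem irreducible_X_one_add : Irreducible (MvPolynomial.X 1 + 1 : CoordRing) := by
  have h := MvPolynomial.irreducible_mul_X_add (1 : CoordRing) 1 1 one_ne_zero
    (by simp) (by simp) isRelPrime_one_left
  rwa [one_mul] at h

theorem isRelPrime_of_aeval_ne_zero {p g : CoordRing} (hp : Irreducible p)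
    (v : Fin 3 → ℂ[T;T⁻¹][X]) (h0 : MvPolynomial.aeval v p = 0)
    (h1 : MvPolynomial.aeval v g ≠ 0) : IsRelPrime p g := by
  refine (hp.isRelPrime_iff_not_dvd).2 ?_
  rintro ⟨q, rfl⟩
  exact h1 (by rw [map_mul, h0, zero_mul])

theorem irreducible_form1 : Irreducible
    (form1 θ₀ θ₁ (MvPolynomial.X 0) (MvPolynomial.X 1) (MvPolynomial.X 2) : CoordRing) := by
  have h := MvPolynomial.irreducible_mul_X_add
    (-(MvPolynomial.X 1 * (MvPolynomial.X 1 + 1)) : CoordRing)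
    (form1 θ₀ θ₁ (MvPolynomial.X 0) (MvPolynomial.X 1) 0) 2
    (neg_ne_zero.2 (mul_ne_zero irreducible_X_one.ne_zero irreducible_X_one_add.ne_zero))
    (notMem_vars_of_mem_supported (s := {2}ᶜ) ?_ (by simp))
    (notMem_vars_of_mem_supported (s := {2}ᶜ) ?_ (by simp)) ?_
  · convert h using 1
    simp only [form1, formC0]
    ring
  · have h1 : (MvPolynomial.X 1 : CoordRing) ∈ MvPolynomial.supported ℂ[T;T⁻¹] {2}ᶜ :=
      MvPolynomial.X_mem_supported.2 (by simp)
    exact neg_mem (mul_mem h1 (add_mem h1 (one_mem _)))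
  · have h0 : (MvPolynomial.X 0 : CoordRing) ∈ MvPolynomial.supported ℂ[T;T⁻¹] {2}ᶜ :=
      MvPolynomial.X_mem_supported.2 (by simp)
    have h1 : (MvPolynomial.X 1 : CoordRing) ∈ MvPolynomial.supported ℂ[T;T⁻¹] {2}ᶜ :=
      MvPolynomial.X_mem_supported.2 (by simp)
    have h := map_form1 θ₀ θ₁ (A := MvPolynomial.supported ℂ[T;T⁻¹] ({2}ᶜ : Set (Fin 3)))
      (MvPolynomial.supported ℂ[T;T⁻¹] ({2}ᶜ : Set (Fin 3))).val ⟨_, h0⟩ ⟨_, h1⟩ 0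
    simp only [map_zero, Subalgebra.coe_val] at h
    rw [← h]
    exact Subtype.prop _
  · rw [IsRelPrime.neg_left_iff]
    refine IsRelPrime.mul_left ?_ ?_
    · refine isRelPrime_of_aeval_ne_zero irreducible_X_one ![X, 0, 0] (by simp) fun h => ?_
      have := congrArg (fun p => coeff p 2) ((map_form1 θ₀ θ₁ _ _ _ _).symm.trans h)
      simp [form1, formC0, kk, tt] at this
    · refine isRelPrime_of_aeval_ne_zero irreducible_X_one_add ![X, -1, 0] (by simp) fun h => ?_
      have h' : form1 θ₀ θ₁ (X : ℂ[T;T⁻¹][X]) (-1) 0 = 0 := by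
        simpa [map_form1] using h
      have he : form1 θ₀ θ₁ (X : ℂ[T;T⁻¹][X]) (-1) 0 = X ^ 2 +
          C (-kk _ (θ₁ ^ 2 / 4)) := by
        simp only [form1, formC0, kk, ← Polynomial.C_eq_algebraMap, C_neg, Algebra.algebraMap_self,
          RingHom.id_apply]
        ring
      simpa using congrArg (fun p => coeff p 2) (he.symm.trans h')

theorem irreducible_form2 : Irreducible
    (form2 θ₀ θ₁ (MvPolynomial.X 0) (MvPolynomial.X 1) (MvPolynomial.X 2) : CoordRing) := by
  have h := MvPolynomial.irreducible_mul_X_add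
    (MvPolynomial.X 1 * (MvPolynomial.X 1 * (MvPolynomial.X 1 + 1)) : CoordRing)
    (form2 θ₀ θ₁ (MvPolynomial.X 0) (MvPolynomial.X 1) 0) 2
    (mul_ne_zero irreducible_X_one.ne_zero
      (mul_ne_zero irreducible_X_one.ne_zero irreducible_X_one_add.ne_zero))
    (notMem_vars_of_mem_supported (s := {2}ᶜ) ?_ (by simp))
    (notMem_vars_of_mem_supported (s := {2}ᶜ) ?_ (by simp)) ?_
  · convert h using 1
    simp only [form2, formC2]
    ring
  · have h1 : (MvPolynomial.X 1 : CoordRing) ∈ MvPolynomial.supported ℂ[T;T⁻¹] {2}ᶜ :=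
      MvPolynomial.X_mem_supported.2 (by simp)
    exact mul_mem h1 (mul_mem h1 (add_mem h1 (one_mem _)))
  · have h0 : (MvPolynomial.X 0 : CoordRing) ∈ MvPolynomial.supported ℂ[T;T⁻¹] {2}ᶜ :=
      MvPolynomial.X_mem_supported.2 (by simp)
    have h1 : (MvPolynomial.X 1 : CoordRing) ∈ MvPolynomial.supported ℂ[T;T⁻¹] {2}ᶜ :=
      MvPolynomial.X_mem_supported.2 (by simp)
    have h := map_form2 θ₀ θ₁ (A := MvPolynomial.supported ℂ[T;T⁻¹] ({2}ᶜ : Set (Fin 3)))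
      (MvPolynomial.supported ℂ[T;T⁻¹] ({2}ᶜ : Set (Fin 3))).val ⟨_, h0⟩ ⟨_, h1⟩ 0
    simp only [map_zero, Subalgebra.coe_val] at h
    rw [← h]
    exact Subtype.prop _
  · have hX : IsRelPrime (MvPolynomial.X 1 : CoordRing)
        (form2 θ₀ θ₁ (MvPolynomial.X 0) (MvPolynomial.X 1) 0) := by
      refine isRelPrime_of_aeval_ne_zero irreducible_X_one ![X, 0, 0] (by simp) fun h => ?_
      have := congrArg (fun p => coeff p 2) ((map_form2 θ₀ θ₁ _ _ _ _).symm.trans h)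
      simp [form2, formC2, kk, tt] at this
    refine IsRelPrime.mul_left hX (IsRelPrime.mul_left hX ?_)
    refine isRelPrime_of_aeval_ne_zero irreducible_X_one_add ![X, -1, 0] (by simp) fun h => ?_
    have h' : form2 θ₀ θ₁ (X : ℂ[T;T⁻¹][X]) (-1) 0 = 0 := by
      simpa [map_form2] using h
    have he : form2 θ₀ θ₁ (X : ℂ[T;T⁻¹][X]) (-1) 0 = X ^ 2 +
        C (-kk _ (θ₁ ^ 2 / 4)) := by
      simp only [form2, formC2, kk, tt, ← Polynomial.C_eq_algebraMap, C_neg,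
        Algebra.algebraMap_self, RingHom.id_apply]
      ring
    simpa using congrArg (fun p => coeff p 2) (he.symm.trans h')

instance : IsDomain (Chart1 θ₀ θ₁) := by
  have : (ideal1 θ₀ θ₁).IsPrime :=
    (Ideal.span_singleton_prime (irreducible_form1 θ₀ θ₁).ne_zero).2
      (irreducible_form1 θ₀ θ₁).prime
  exact inferInstanceAs (IsDomain (CoordRing ⧸ ideal1 θ₀ θ₁))

instance : IsDomain (Chart2 θ₀ θ₁) := by
  have : (ideal2 θ₀ θ₁).IsPrime :=
    (Ideal.span_singleton_prime (irreducible_form2 θ₀ θ₁).ne_zero).2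
      (irreducible_form2 θ₀ θ₁).prime
  exact inferInstanceAs (IsDomain (CoordRing ⧸ ideal2 θ₀ θ₁))

theorem x1_one_ne_zero : x1 θ₀ θ₁ 1 ≠ 0 := by
  have h2 : kk ℂ[T;T⁻¹] (1 / 2) * 2 = 1 := by
    have : (2 : ℂ[T;T⁻¹]) = kk ℂ[T;T⁻¹] 2 := (map_ofNat LaurentPolynomial.C 2).symm
    rw [this]
    simp [kk, ← map_mul]
  have h : form1 θ₀ θ₁ (0 : ℂ[T;T⁻¹]) 1
      (kk _ (1 / 2) * (-kk _ (θ₀ ^ 2 / 4) + kk _ (θ₁ ^ 2 / 4) - kk _ (θ₀ ^ 2 / 4)) -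
        tt _ ^ 2) = 0 := by
    simp only [form1, formC0]
    linear_combination (kk ℂ[T;T⁻¹] (θ₀ ^ 2 / 4) + kk _ (θ₀ ^ 2 / 4) - kk _ (θ₁ ^ 2 / 4)) * h2
  intro h0
  have := lift1_1 θ₀ θ₁ _ _ _ h
  rw [h0, map_zero] at this
  exact zero_ne_one this

instance : Nontrivial (Overlap θ₀ θ₁) :=
  (IsLocalization.injective (M := Submonoid.powers (x1 θ₀ θ₁ 1)) (Overlap θ₀ θ₁)
    (powers_le_nonZeroDivisors_of_noZeroDivisors (x1_one_ne_zero θ₀ θ₁))).nontrivial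

theorem _root_.IsIrreducible.subset_closure_of_isOpen_inter {X : Type*} [TopologicalSpace X]
    {s t : Set X} (hs : IsPreirreducible s) (ht : IsOpen t) (h : (s ∩ t).Nonempty) :
    s ⊆ closure t := by
  intro x hx
  rw [mem_closure_iff]
  intro o ho hxo
  obtain ⟨y, -, h1, h2⟩ := hs o t ho ht ⟨x, hx, hxo⟩ h
  exact ⟨y, h1, h2⟩

instance : IrreducibleSpace (M θ₀ θ₁) := by
  have h1 : IsIrreducible (Set.range (ι₁ θ₀ θ₁)) := by
    rw [← Set.image_univ]
    exact (IrreducibleSpace.isIrreducible_univ _).image _ (ι₁ θ₀ θ₁).continuous.continuousOn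
  have h2 : IsIrreducible (Set.range (ι₂ θ₀ θ₁)) := by
    rw [← Set.image_univ]
    exact (IrreducibleSpace.isIrreducible_univ _).image _ (ι₂ θ₀ θ₁).continuous.continuousOn
  have h3 : (Set.range (ι₂ θ₀ θ₁) ∩ Set.range (ι₁ θ₀ θ₁)).Nonempty := by
    obtain ⟨w⟩ : Nonempty (M₁₂ θ₀ θ₁) := inferInstanceAs (Nonempty (PrimeSpectrum _))
    exact ⟨_, ⟨incl₂ θ₀ θ₁ w, rfl⟩, ⟨incl₁ θ₀ θ₁ w, by
      rw [← Scheme.Hom.comp_apply, incl_condition, Scheme.Hom.comp_apply]⟩⟩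
  have h4 := h1.closure
  rw [Set.eq_univ_of_univ_subset ((range_union θ₀ θ₁).ge.trans
    (Set.union_subset subset_closure (IsIrreducible.subset_closure_of_isOpen_inter
      h2.isPreirreducible (ι₁ θ₀ θ₁).opensRange.2 h3)))] at h4
  exact (irreducibleSpace_def _).2 h4

instance isIntegral_M : AlgebraicGeometry.IsIntegral (M θ₀ θ₁) := by
  have : AlgebraicGeometry.IsReduced (M θ₀ θ₁) := by
    have hs : ∀ x : M θ₀ θ₁, _root_.IsReduced ((M θ₀ θ₁).presheaf.stalk x) := by
      intro x
      rcases mem_range_or θ₀ θ₁ x with ⟨y, rfl⟩ | ⟨y, rfl⟩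
      · exact isReduced_of_injective _
          (asIso ((ι₁ θ₀ θ₁).stalkMap y)).commRingCatIsoToRingEquiv.injective
      · exact isReduced_of_injective _
          (asIso ((ι₂ θ₀ θ₁).stalkMap y)).commRingCatIsoToRingEquiv.injective
    exact isReduced_of_isReduced_stalk _
  exact isIntegral_of_irreducibleSpace_of_isReduced _

end integral

end DegPV

namespace DegPV

/-! ### Points of the charts in a `ℂ`-algebra -/

section points

variable {R : Type} [CommRing R] [Algebra ℂ R]

/-- The homomorphism `ℂ[t, t⁻¹] → R` given by a unit of `R`. -/
noncomputable def laurentHom (t : Rˣ) : ℂ[T;T⁻¹] →+* R := LaurentPolynomial.eval₂ (algebraMap ℂ R) t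

/-- The equation of the first chart. -/
def Eq1 (θ₀ θ₁ : ℂ) (t a b c : R) : Prop :=
  a ^ 2 + b * (-algebraMap ℂ R (θ₀ ^ 2 / 4) + algebraMap ℂ R (θ₁ ^ 2 / 4) - c - t ^ 2 - b * c -
    b * t ^ 2) - algebraMap ℂ R (θ₀ ^ 2 / 4) = 0

/-- The equation of the second chart. -/
def Eq2 (θ₀ θ₁ : ℂ) (t a b c : R) : Prop :=
  a ^ 2 + b * (-a - b * (-c - t ^ 2 - b * algebraMap ℂ R (θ₀ ^ 2 / 4) - b * c + a -
    algebraMap ℂ R (θ₀ ^ 2 / 4) + algebraMap ℂ R (θ₁ ^ 2 / 4)) + t ^ 2) = 0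

variable {θ₀ θ₁ : ℂ}

theorem laurentHom_T (t : Rˣ) : laurentHom t (LaurentPolynomial.T 1) = (t : R) := by
  simp [laurentHom, LaurentPolynomial.eval₂_T]

theorem laurentHom_C (t : Rˣ) (c : ℂ) :
    laurentHom t (LaurentPolynomial.C c) = algebraMap ℂ R c := by
  simp [laurentHom]

theorem laurent_ringHom_ext {S : Type*} [CommRing S] {f g : ℂ[T;T⁻¹] →+* S}
    (hC : ∀ c, f (LaurentPolynomial.C c) = g (LaurentPolynomial.C c))
    (hT : f (LaurentPolynomial.T 1) = g (LaurentPolynomial.T 1)) : f = g := by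
  refine IsLocalization.ringHom_ext (Submonoid.powers (X : ℂ[X])) ?_
  refine Polynomial.ringHom_ext (fun c => ?_) ?_
  · simpa using hC c
  · simpa using hT

/-- The point of the first chart with given coordinates. -/
noncomputable def point1 (t : Rˣ) (a b c : R) (h : Eq1 θ₀ θ₁ (t : R) a b c) : Chart1 θ₀ θ₁ →+* R :=
  letI := (laurentHom t).toAlgebra
  (lift1 θ₀ θ₁ a b c (by
    have h1 : tt R = (t : R) := laurentHom_T t
    have h2 : ∀ x, kk R x = algebraMap ℂ R x := laurentHom_C t
    rw [form1, formC0, h1, h2, h2]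
    exact h)).toRingHom

/-- The point of the second chart with given coordinates. -/
noncomputable def point2 (t : Rˣ) (a b c : R) (h : Eq2 θ₀ θ₁ (t : R) a b c) : Chart2 θ₀ θ₁ →+* R :=
  letI := (laurentHom t).toAlgebra
  (lift2 θ₀ θ₁ a b c (by
    have h1 : tt R = (t : R) := laurentHom_T t
    have h2 : ∀ x, kk R x = algebraMap ℂ R x := laurentHom_C t
    rw [form2, formC2, h1, h2, h2]
    exact h)).toRingHom

section

variable (t : Rˣ) (a b c : R)

theorem point1_zero (h : Eq1 θ₀ θ₁ (t : R) a b c) : point1 t a b c h (x1 θ₀ θ₁ 0) = a :=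
  letI := (laurentHom t).toAlgebra
  lift1_0 θ₀ θ₁ a b c _

theorem point1_one (h : Eq1 θ₀ θ₁ (t : R) a b c) : point1 t a b c h (x1 θ₀ θ₁ 1) = b :=
  letI := (laurentHom t).toAlgebra
  lift1_1 θ₀ θ₁ a b c _

theorem point1_two (h : Eq1 θ₀ θ₁ (t : R) a b c) : point1 t a b c h (x1 θ₀ θ₁ 2) = c :=
  letI := (laurentHom t).toAlgebra
  lift1_2 θ₀ θ₁ a b c _

theorem point1_tt (h : Eq1 θ₀ θ₁ (t : R) a b c) : point1 t a b c h (tt _) = t :=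
  letI := (laurentHom t).toAlgebra
  (map_tt (lift1 θ₀ θ₁ a b c _)).trans (laurentHom_T t)

theorem point1_kk (h : Eq1 θ₀ θ₁ (t : R) a b c) (x : ℂ) :
    point1 t a b c h (kk _ x) = algebraMap ℂ R x :=
  letI := (laurentHom t).toAlgebra
  (map_kk (lift1 θ₀ θ₁ a b c _) x).trans (laurentHom_C t x)

theorem point2_zero (h : Eq2 θ₀ θ₁ (t : R) a b c) : point2 t a b c h (x2 θ₀ θ₁ 0) = a :=
  letI := (laurentHom t).toAlgebra
  lift2_0 θ₀ θ₁ a b c _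

theorem point2_one (h : Eq2 θ₀ θ₁ (t : R) a b c) : point2 t a b c h (x2 θ₀ θ₁ 1) = b :=
  letI := (laurentHom t).toAlgebra
  lift2_1 θ₀ θ₁ a b c _

theorem point2_two (h : Eq2 θ₀ θ₁ (t : R) a b c) : point2 t a b c h (x2 θ₀ θ₁ 2) = c :=
  letI := (laurentHom t).toAlgebra
  lift2_2 θ₀ θ₁ a b c _

theorem point2_tt (h : Eq2 θ₀ θ₁ (t : R) a b c) : point2 t a b c h (tt _) = t :=
  letI := (laurentHom t).toAlgebra
  (map_tt (lift2 θ₀ θ₁ a b c _)).trans (laurentHom_T t)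

theorem point2_kk (h : Eq2 θ₀ θ₁ (t : R) a b c) (x : ℂ) :
    point2 t a b c h (kk _ x) = algebraMap ℂ R x :=
  letI := (laurentHom t).toAlgebra
  (map_kk (lift2 θ₀ θ₁ a b c _) x).trans (laurentHom_C t x)

end

theorem kk_eq_algebraMap₁ (x : ℂ) : kk (Chart1 θ₀ θ₁) x = algebraMap ℂ _ x :=
  (IsScalarTower.algebraMap_apply ℂ ℂ[T;T⁻¹] (Chart1 θ₀ θ₁) x).symm

theorem kk_eq_algebraMap₂ (x : ℂ) : kk (Chart2 θ₀ θ₁) x = algebraMap ℂ _ x :=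
  (IsScalarTower.algebraMap_apply ℂ ℂ[T;T⁻¹] (Chart2 θ₀ θ₁) x).symm

theorem chart1_ringHom_ext {S : Type*} [CommRing S] {f g : Chart1 θ₀ θ₁ →+* S}
    (hk : ∀ x, f (kk _ x) = g (kk _ x)) (ht : f (tt _) = g (tt _))
    (hx : ∀ i, f (x1 θ₀ θ₁ i) = g (x1 θ₀ θ₁ i)) : f = g := by
  refine Ideal.Quotient.ringHom_ext ?_
  refine MvPolynomial.ringHom_ext' ?_ hx
  exact laurent_ringHom_ext hk ht

theorem chart2_ringHom_ext {S : Type*} [CommRing S] {f g : Chart2 θ₀ θ₁ →+* S}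
    (hk : ∀ x, f (kk _ x) = g (kk _ x)) (ht : f (tt _) = g (tt _))
    (hx : ∀ i, f (x2 θ₀ θ₁ i) = g (x2 θ₀ θ₁ i)) : f = g := by
  refine Ideal.Quotient.ringHom_ext ?_
  refine MvPolynomial.ringHom_ext' ?_ hx
  exact laurent_ringHom_ext hk ht

theorem isUnit_tt (A : Type) [CommRing A] [Algebra ℂ[T;T⁻¹] A] : IsUnit (tt A) :=
  (LaurentPolynomial.isUnit_T 1).map _

theorem eq1_of_ringHom (f : Chart1 θ₀ θ₁ →+* R) (hk : ∀ x, f (kk _ x) = algebraMap ℂ R x) :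
    Eq1 θ₀ θ₁ (f (tt _)) (f (x1 θ₀ θ₁ 0)) (f (x1 θ₀ θ₁ 1)) (f (x1 θ₀ θ₁ 2)) := by
  have h := congrArg f (form1_x1 θ₀ θ₁)
  simp only [form1, formC0, map_add, map_sub, map_mul, map_pow, map_neg, map_zero, hk] at h
  exact h

theorem eq2_of_ringHom (f : Chart2 θ₀ θ₁ →+* R) (hk : ∀ x, f (kk _ x) = algebraMap ℂ R x) :
    Eq2 θ₀ θ₁ (f (tt _)) (f (x2 θ₀ θ₁ 0)) (f (x2 θ₀ θ₁ 1)) (f (x2 θ₀ θ₁ 2)) := by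
  have h := congrArg f (form2_x2 θ₀ θ₁)
  simp only [form2, formC2, map_add, map_sub, map_mul, map_pow, map_neg, map_zero, hk] at h
  exact h

end points

end DegPV

namespace DegPV

open scoped TensorProduct

/-! ### A Jacobian criterion for hypersurfaces -/

section jacobian

theorem isStandardSmooth_hypersurface {S σ : Type} [CommRing S] [Finite σ] (i : σ)
    (F : MvPolynomial σ S) (B : Type) [CommRing B] [Algebra S B]
    [Algebra (MvPolynomial σ S ⧸ Ideal.span (Set.range fun _ : Unit => F)) B]
    [IsScalarTower S (MvPolynomial σ S ⧸ Ideal.span (Set.range fun _ : Unit => F)) B]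
    [IsLocalization.Away (Ideal.Quotient.mk (Ideal.span (Set.range fun _ : Unit => F))
      (MvPolynomial.pderiv i F)) B] :
    Algebra.IsStandardSmoothOfRelativeDimension (Nat.card σ - 1) S B := by
  let P := Algebra.PreSubmersivePresentation.naive (v := fun _ : Unit => F) (fun _ : Unit => i)
    (fun _ _ _ => rfl)
  let Q := Algebra.PreSubmersivePresentation.localizationAway B
    (Ideal.Quotient.mk (Ideal.span (Set.range fun _ : Unit => F)) (MvPolynomial.pderiv i F))
  have hP : P.jacobian = Ideal.Quotient.mk _ (MvPolynomial.pderiv i F) := by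
    rw [Algebra.PreSubmersivePresentation.jacobian_eq_jacobiMatrix_det, Matrix.det_unique]
    exact congrArg (Ideal.Quotient.mk _)
      (Algebra.PreSubmersivePresentation.jacobiMatrix_naive (v := fun _ : Unit => F) _ _ _ _ _ _)
  have hQ : IsUnit (Q.comp P).jacobian := by
    rw [Algebra.PreSubmersivePresentation.comp_jacobian_eq_jacobian_smul_jacobian,
      Algebra.PreSubmersivePresentation.localizationAway_jacobian, hP, Algebra.smul_def]
    have := IsLocalization.Away.algebraMap_isUnit (S := B)
      (Ideal.Quotient.mk (Ideal.span (Set.range fun _ : Unit => F)) (MvPolynomial.pderiv i F))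
    exact this.mul this
  refine Algebra.SubmersivePresentation.isStandardSmoothOfRelativeDimension
    ⟨Q.comp P, hQ⟩ ?_
  simp only [Algebra.Presentation.dimension, Nat.card_sum, Nat.card_unique]
  omega

theorem card_le_of_derivation {R₀ A B K : Type} [CommRing R₀] [CommRing A] [Algebra R₀ A]
    [CommRing B] [Algebra R₀ B] [Algebra A B] [IsScalarTower R₀ A B] [Algebra.FormallyEtale A B]
    [Field K] [Algebra R₀ K] [Algebra A K] [IsScalarTower R₀ A K] [Algebra B K]
    [IsScalarTower A B K]
    {n m : ℕ} [Algebra.IsStandardSmoothOfRelativeDimension n R₀ B]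
    (D : Derivation R₀ A (Fin m → K)) (a : Fin m → A) (hD : ∀ j, D (a j) = Pi.single j 1) :
    m ≤ n := by
  have : Nontrivial B := (algebraMap B K).domain_nontrivial
  have hst : Algebra.IsStandardSmooth R₀ B :=
    Algebra.IsStandardSmoothOfRelativeDimension.isStandardSmooth n
  have hr := Algebra.IsStandardSmoothOfRelativeDimension.rank_kaehlerDifferential
    (R := R₀) (S := B) n
  have hfin : Module.Finite B Ω[B⁄R₀] := Module.finite_of_rank_eq_nat hr
  let e : K ⊗[A] Ω[A⁄R₀] ≃ₗ[K] K ⊗[B] Ω[B⁄R₀] :=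
    (TensorProduct.AlgebraTensorModule.cancelBaseChange A B K K Ω[A⁄R₀]).symm ≪≫ₗ
      TensorProduct.AlgebraTensorModule.congr (LinearEquiv.refl K K)
        (KaehlerDifferential.tensorKaehlerEquivOfFormallyEtale R₀ A B)
  have hf : Module.finrank K (K ⊗[A] Ω[A⁄R₀]) = n := by
    rw [e.finrank_eq, Module.finrank_baseChange, Module.finrank_eq_of_rank_eq hr]
  have : Module.Finite K (K ⊗[A] Ω[A⁄R₀]) := Module.Finite.equiv e.symm
  let φ : K ⊗[A] Ω[A⁄R₀] →ₗ[K] (Fin m → K) :=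
    LinearMap.liftBaseChange K D.liftKaehlerDifferential
  have hφ : Function.Surjective φ := by
    rw [← LinearMap.range_eq_top, eq_top_iff, ← (Pi.basisFun K (Fin m)).span_eq,
      Submodule.span_le]
    rintro _ ⟨j, rfl⟩
    refine ⟨1 ⊗ₜ KaehlerDifferential.D R₀ A (a j), ?_⟩
    simp [φ, hD]
  have := LinearMap.finrank_le_finrank_of_surjective hφ
  rwa [hf, Module.finrank_fin_fun] at this

instance : Algebra.IsStandardSmoothOfRelativeDimension 1 ℂ ℂ[T;T⁻¹] := by
  let P := Algebra.PreSubmersivePresentation.naive (R := ℂ) (σ := Unit)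
    (v := fun i : Empty => i.elim) (fun i => i.elim) (fun i => i.elim)
  have h1 := Algebra.SubmersivePresentation.isStandardSmoothOfRelativeDimension
    (n := 1) ⟨P, by
      rw [Algebra.PreSubmersivePresentation.jacobian_eq_jacobiMatrix_det]
      simp⟩ (by simp [Algebra.Presentation.dimension])
  have h2 : Algebra.IsStandardSmoothOfRelativeDimension 1 ℂ ℂ[X] := by
    refine Algebra.IsStandardSmoothOfRelativeDimension.of_algEquiv 1
      (((Ideal.quotientEquivAlgOfEq ℂ
        (I := Ideal.span (Set.range fun i : Empty => (i.elim : MvPolynomial Unit ℂ))) (J := ⊥)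
        (by rw [Set.range_eq_empty, Ideal.span_empty])).trans
        (AlgEquiv.quotientBot ℂ (MvPolynomial Unit ℂ))).trans
        (MvPolynomial.uniqueAlgEquiv ℂ Unit))
  have h3 : Algebra.IsStandardSmoothOfRelativeDimension 0 ℂ[X] ℂ[T;T⁻¹] :=
    Algebra.IsStandardSmoothOfRelativeDimension.localization_away (X : ℂ[X])
  have : IsScalarTower ℂ ℂ[X] ℂ[T;T⁻¹] := IsScalarTower.of_algebraMap_eq fun c => by
    simp
  exact Algebra.IsStandardSmoothOfRelativeDimension.trans 1 0 ℂ ℂ[X] ℂ[T;T⁻¹]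

end jacobian

/-! ### Singular loci and open immersions -/

section singular

theorem isZariskiLocalAtSource_smooth (n : ℕ) :
    IsZariskiLocalAtSource (@SmoothOfRelativeDimension.{0} n) :=
  @HasRingHomProperty.instIsZariskiLocalAtSource _ _ inferInstance

theorem smooth_comp_of_isOpenImmersion {W X S : Scheme.{0}} (j : W ⟶ X) [IsOpenImmersion j]
    (f : X ⟶ S) (n : ℕ) (h : SmoothOfRelativeDimension n f) :
    SmoothOfRelativeDimension n (j ≫ f) :=
  @IsZariskiLocalAtSource.comp _ (isZariskiLocalAtSource_smooth n) _ _ _ _ h j _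

theorem apply_mem_singularLocus_iff {W X S : Scheme.{0}} (j : W ⟶ X) [IsOpenImmersion j]
    (f : X ⟶ S) (n : ℕ) (w : W) :
    j w ∈ singularLocus f n ↔ w ∈ singularLocus (j ≫ f) n := by
  refine not_congr ⟨?_, ?_⟩
  · rintro ⟨U, hU, h⟩
    refine ⟨j ⁻¹ᵁ U, hU, ?_⟩
    rw [← Category.assoc, ← morphismRestrict_ι, Category.assoc]
    exact smooth_comp_of_isOpenImmersion _ _ n h
  · rintro ⟨U, hU, h⟩
    refine ⟨(U.ι ≫ j).opensRange, ⟨⟨w, hU⟩, rfl⟩, ?_⟩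
    have := smooth_comp_of_isOpenImmersion (U.ι ≫ j).isoOpensRange.inv _ n h
    rwa [← Category.assoc U.ι, ← Category.assoc, Scheme.Hom.isoOpensRange_inv_comp] at this

theorem singularLocus_eq_empty_iff {X S : Scheme.{0}} (f : X ⟶ S) (n : ℕ) :
    singularLocus f n = ∅ ↔ SmoothOfRelativeDimension n f := by
  constructor
  · intro h
    have hx : ∀ x, x ∉ singularLocus f n := fun x => h ▸ Set.notMem_empty x
    choose U hU hs using fun x => not_not.1 (hx x)
    have := isZariskiLocalAtSource_smooth n
    exact IsZariskiLocalAtSource.of_iSup_eq_top U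
      (TopologicalSpace.Opens.ext (Set.eq_univ_of_forall fun x => by simpa using ⟨x, hU x⟩)) hs
  · intro h
    refine Set.eq_empty_of_forall_notMem fun x hx => hx ⟨⊤, trivial, ?_⟩
    exact smooth_comp_of_isOpenImmersion _ f n h

variable {R₀ A : Type} [CommRing R₀] [CommRing A] [Algebra R₀ A]

theorem notMem_singularLocus_of_isStandardSmooth {n : ℕ} (p : PrimeSpectrum A) (g : A)
    (hg : g ∉ p.asIdeal)
    (h : Algebra.IsStandardSmoothOfRelativeDimension n R₀ (Localization.Away g)) :
    p ∉ singularLocus (Spec.map (CommRingCat.ofHom (algebraMap R₀ A))) n := by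
  let j := Spec.map (CommRingCat.ofHom (algebraMap A (Localization.Away g)))
  obtain ⟨w, hw⟩ : p ∈ Set.range (PrimeSpectrum.comap (algebraMap A (Localization.Away g))) := by
    rw [PrimeSpectrum.localization_away_comap_range _ g]
    exact hg
  subst hw
  refine fun hn => (apply_mem_singularLocus_iff j _ n w).1 hn ⟨⊤, trivial, smooth_comp_of_isOpenImmersion _ _ n ?_⟩
  rw [← Spec.map_comp, ← CommRingCat.ofHom_comp, ← IsScalarTower.algebraMap_eq,
    HasRingHomProperty.Spec_iff (P := @SmoothOfRelativeDimension n)]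
  refine RingHom.locally_of RingHom.isStandardSmoothOfRelativeDimension_respectsIso _ ?_
  exact (RingHom.isStandardSmoothOfRelativeDimension_algebraMap n).2 h

theorem card_le_of_locally {B : Type} [CommRing B] [Algebra R₀ B] [Algebra A B]
    [IsScalarTower R₀ A B] [Algebra.FormallyEtale A B] {n m : ℕ}
    (h : RingHom.Locally (RingHom.IsStandardSmoothOfRelativeDimension n) (algebraMap R₀ B))
    {K : Type} [Field K] [Algebra R₀ K] [Algebra A K] [IsScalarTower R₀ A K] [Algebra B K]
    [IsScalarTower A B K]
    (D : Derivation R₀ A (Fin m → K)) (a : Fin m → A) (hD : ∀ j, D (a j) = Pi.single j 1) :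
    m ≤ n := by
  obtain ⟨s, hs1, hs2⟩ := h
  obtain ⟨r, hr, hr0⟩ : ∃ r ∈ s, algebraMap B K r ≠ 0 := by
    by_contra! hc
    have : Ideal.span s ≤ RingHom.ker (algebraMap B K) := Ideal.span_le.2 hc
    rw [hs1, top_le_iff] at this
    exact RingHom.ker_ne_top _ this
  let : Algebra (Localization.Away r) K :=
    (IsLocalization.Away.lift r (isUnit_iff_ne_zero.2 hr0)).toAlgebra
  have : IsScalarTower B (Localization.Away r) K :=
    IsScalarTower.of_algebraMap_eq fun x =>
      (IsLocalization.Away.lift_eq r (isUnit_iff_ne_zero.2 hr0) x).symm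
  have : IsScalarTower A (Localization.Away r) K :=
    IsScalarTower.to₁₃₄ A B (Localization.Away r) K
  have : Algebra.FormallyEtale B (Localization.Away r) :=
    Algebra.FormallyEtale.of_isLocalization (Submonoid.powers r)
  have : Algebra.FormallyEtale A (Localization.Away r) :=
    Algebra.FormallyEtale.comp A B (Localization.Away r)
  have hst : Algebra.IsStandardSmoothOfRelativeDimension n R₀ (Localization.Away r) := by
    have := hs2 r hr
    rwa [← IsScalarTower.algebraMap_eq,
      RingHom.isStandardSmoothOfRelativeDimension_algebraMap] at this
  exact card_le_of_derivation (B := Localization.Away r) D a hD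

theorem card_le_of_notMem_singularLocus {n m : ℕ} (p : PrimeSpectrum A)
    (h : p ∉ singularLocus (Spec.map (CommRingCat.ofHom (algebraMap R₀ A))) n)
    {K : Type} [Field K] [Algebra R₀ K] [Algebra A K] [IsScalarTower R₀ A K]
    (hK : RingHom.ker (algebraMap A K) = p.asIdeal)
    (D : Derivation R₀ A (Fin m → K)) (a : Fin m → A) (hD : ∀ j, D (a j) = Pi.single j 1) :
    m ≤ n := by
  obtain ⟨U, hpU, hU⟩ := not_not.1 h
  obtain ⟨_, ⟨_, ⟨g, rfl⟩, rfl⟩, hpg, hgU⟩ :=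
    PrimeSpectrum.isBasis_basic_opens.exists_subset_of_mem_open hpU U.2
  have hg : IsUnit (algebraMap A K g) := by
    rw [isUnit_iff_ne_zero]
    intro h0
    exact hpg (hK ▸ h0)
  let j := Spec.map (CommRingCat.ofHom (algebraMap A (Localization.Away g)))
  have hj : Set.range j ⊆ Set.range U.ι := by
    rw [Scheme.Opens.range_ι]
    refine Set.Subset.trans ?_ hgU
    exact (PrimeSpectrum.localization_away_comap_range (Localization.Away g) g).le
  have hs : SmoothOfRelativeDimension n
      (j ≫ Spec.map (CommRingCat.ofHom (algebraMap R₀ A))) := by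
    rw [← IsOpenImmersion.lift_fac U.ι j hj, Category.assoc]
    have : IsOpenImmersion (IsOpenImmersion.lift U.ι j hj) := by
      have : IsOpenImmersion (IsOpenImmersion.lift U.ι j hj ≫ U.ι) := by
        rw [IsOpenImmersion.lift_fac]; infer_instance
      exact IsOpenImmersion.of_comp _ U.ι
    exact smooth_comp_of_isOpenImmersion _ _ n hU
  rw [← Spec.map_comp, ← CommRingCat.ofHom_comp, ← IsScalarTower.algebraMap_eq,
    HasRingHomProperty.Spec_iff (P := @SmoothOfRelativeDimension n)] at hs
  let : Algebra (Localization.Away g) K := (IsLocalization.Away.lift g hg).toAlgebra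
  have : IsScalarTower A (Localization.Away g) K :=
    IsScalarTower.of_algebraMap_eq fun x => (IsLocalization.Away.lift_eq g hg x).symm
  have : Algebra.FormallyEtale A (Localization.Away g) :=
    Algebra.FormallyEtale.of_isLocalization (Submonoid.powers g)
  exact card_le_of_locally hs D a hD

end singular

end DegPV

namespace DegPV

noncomputable section chartSingular

theorem isStandardSmooth_of_eq_span {S σ : Type} [CommRing S] [Finite σ] (i : σ)
    (F : MvPolynomial σ S) (I : Ideal (MvPolynomial σ S)) (hI : I = Ideal.span {F})
    (B : Type) [CommRing B] [Algebra S B] [Algebra (MvPolynomial σ S ⧸ I) B]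
    [IsScalarTower S (MvPolynomial σ S ⧸ I) B]
    [IsLocalization.Away (Ideal.Quotient.mk I (MvPolynomial.pderiv i F)) B] :
    Algebra.IsStandardSmoothOfRelativeDimension (Nat.card σ - 1) S B := by
  obtain rfl : I = Ideal.span (Set.range fun _ : Unit => F) := by rw [hI, Set.range_const]
  exact isStandardSmooth_hypersurface i F B

variable {θ₀ θ₁ : ℂ}

theorem notMem_singularLocus_chart1 (p : PrimeSpectrum (Chart1 θ₀ θ₁)) (i : Fin 3)
    (h : quot1 θ₀ θ₁ (MvPolynomial.pderiv i (form1 θ₀ θ₁ (MvPolynomial.X 0) (MvPolynomial.X 1)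
      (MvPolynomial.X 2))) ∉ p.asIdeal) : p ∉ singularLocus (M₁.toT θ₀ θ₁) 2 := by
  refine notMem_singularLocus_of_isStandardSmooth p _ h ?_
  have := @isStandardSmooth_of_eq_span ℂ[T;T⁻¹] (Fin 3) _ _ i _ (ideal1 θ₀ θ₁) rfl
    (Localization.Away (quot1 θ₀ θ₁ (MvPolynomial.pderiv i (form1 θ₀ θ₁ (MvPolynomial.X 0)
      (MvPolynomial.X 1) (MvPolynomial.X 2))))) _ _
      (inferInstanceAs (Algebra (Chart1 θ₀ θ₁) (Localization.Away (quot1 θ₀ θ₁ (MvPolynomial.pderiv i (form1 θ₀ θ₁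
        (MvPolynomial.X 0) (MvPolynomial.X 1) (MvPolynomial.X 2)))))))
      (inferInstanceAs (IsScalarTower ℂ[T;T⁻¹] (Chart1 θ₀ θ₁) _))
      (inferInstanceAs (IsLocalization.Away (quot1 θ₀ θ₁ (MvPolynomial.pderiv i (form1 θ₀ θ₁
        (MvPolynomial.X 0) (MvPolynomial.X 1) (MvPolynomial.X 2)))) _))
  simpa using this

theorem notMem_singularLocus_chart2 (p : PrimeSpectrum (Chart2 θ₀ θ₁)) (i : Fin 3)
    (h : quot2 θ₀ θ₁ (MvPolynomial.pderiv i (form2 θ₀ θ₁ (MvPolynomial.X 0) (MvPolynomial.X 1)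
      (MvPolynomial.X 2))) ∉ p.asIdeal) : p ∉ singularLocus (M₂.toT θ₀ θ₁) 2 := by
  refine notMem_singularLocus_of_isStandardSmooth p _ h ?_
  have := @isStandardSmooth_of_eq_span ℂ[T;T⁻¹] (Fin 3) _ _ i _ (ideal2 θ₀ θ₁) rfl
    (Localization.Away (quot2 θ₀ θ₁ (MvPolynomial.pderiv i (form2 θ₀ θ₁ (MvPolynomial.X 0)
      (MvPolynomial.X 1) (MvPolynomial.X 2))))) _ _
      (inferInstanceAs (Algebra (Chart2 θ₀ θ₁) (Localization.Away (quot2 θ₀ θ₁ (MvPolynomial.pderiv i (form2 θ₀ θ₁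
        (MvPolynomial.X 0) (MvPolynomial.X 1) (MvPolynomial.X 2)))))))
      (inferInstanceAs (IsScalarTower ℂ[T;T⁻¹] (Chart2 θ₀ θ₁) _))
      (inferInstanceAs (IsLocalization.Away (quot2 θ₀ θ₁ (MvPolynomial.pderiv i (form2 θ₀ θ₁
        (MvPolynomial.X 0) (MvPolynomial.X 1) (MvPolynomial.X 2)))) _))
  simpa using this

theorem pderiv_tt (i : Fin 3) : MvPolynomial.pderiv i (tt CoordRing) = 0 :=
  Derivation.map_algebraMap _ _

theorem pderiv_kk (i : Fin 3) (c : ℂ) : MvPolynomial.pderiv i (kk CoordRing c) = 0 :=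
  Derivation.map_algebraMap _ _

theorem quot1_pderiv_zero : quot1 θ₀ θ₁ (MvPolynomial.pderiv 0 (form1 θ₀ θ₁ (MvPolynomial.X 0)
    (MvPolynomial.X 1) (MvPolynomial.X 2))) = 2 * x1 θ₀ θ₁ 0 := by
  simp [form1, formC0, pderiv_tt, pderiv_kk, Derivation.leibniz_pow, x1, MvPolynomial.pderiv_X, map_ofNat]

theorem quot1_pderiv_one : quot1 θ₀ θ₁ (MvPolynomial.pderiv 1 (form1 θ₀ θ₁ (MvPolynomial.X 0)
    (MvPolynomial.X 1) (MvPolynomial.X 2))) =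
    formC0 θ₀ θ₁ (x1 θ₀ θ₁ 1) (x1 θ₀ θ₁ 2) - x1 θ₀ θ₁ 1 * (x1 θ₀ θ₁ 2 + tt _ ^ 2) := by
  simp [form1, formC0, pderiv_tt, pderiv_kk, Derivation.leibniz_pow, x1, MvPolynomial.pderiv_X,
    map_tt, map_kk]
  ring

theorem quot1_pderiv_two : quot1 θ₀ θ₁ (MvPolynomial.pderiv 2 (form1 θ₀ θ₁ (MvPolynomial.X 0)
    (MvPolynomial.X 1) (MvPolynomial.X 2))) = -(x1 θ₀ θ₁ 1 * (x1 θ₀ θ₁ 1 + 1)) := by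
  simp [form1, formC0, pderiv_tt, pderiv_kk, Derivation.leibniz_pow, x1, MvPolynomial.pderiv_X]
  ring

theorem quot2_pderiv_zero : quot2 θ₀ θ₁ (MvPolynomial.pderiv 0 (form2 θ₀ θ₁ (MvPolynomial.X 0)
    (MvPolynomial.X 1) (MvPolynomial.X 2))) =
    2 * x2 θ₀ θ₁ 0 - x2 θ₀ θ₁ 1 * (1 + x2 θ₀ θ₁ 1) := by
  simp [form2, formC2, pderiv_tt, pderiv_kk, Derivation.leibniz_pow, x2, MvPolynomial.pderiv_X, map_ofNat]
  ring

theorem quot2_pderiv_one : quot2 θ₀ θ₁ (MvPolynomial.pderiv 1 (form2 θ₀ θ₁ (MvPolynomial.X 0)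
    (MvPolynomial.X 1) (MvPolynomial.X 2))) =
    -x2 θ₀ θ₁ 0 - 2 * x2 θ₀ θ₁ 1 * formC2 θ₀ θ₁ (x2 θ₀ θ₁ 0) (x2 θ₀ θ₁ 1) (x2 θ₀ θ₁ 2) +
      tt _ ^ 2 + x2 θ₀ θ₁ 1 ^ 2 * (kk _ (θ₀ ^ 2 / 4) + x2 θ₀ θ₁ 2) := by
  simp [form2, formC2, pderiv_tt, pderiv_kk, Derivation.leibniz_pow, x2, MvPolynomial.pderiv_X,
    map_tt, map_kk]
  ring

theorem quot2_pderiv_two : quot2 θ₀ θ₁ (MvPolynomial.pderiv 2 (form2 θ₀ θ₁ (MvPolynomial.X 0)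
    (MvPolynomial.X 1) (MvPolynomial.X 2))) =
    x2 θ₀ θ₁ 1 ^ 2 * (x2 θ₀ θ₁ 1 + 1) := by
  simp [form2, formC2, pderiv_tt, pderiv_kk, Derivation.leibniz_pow, x2, MvPolynomial.pderiv_X]
  ring

/-- The derivation given by a lift of `A → K` to a square zero extension of `K`. -/
noncomputable def derivationOfLift {A K : Type} [CommRing A] [Algebra ℂ A] [Field K] [Algebra ℂ K] [Algebra A K]
    [IsScalarTower ℂ A K] {m : ℕ} (φ : A →+* TrivSqZeroExt K (Fin m → K))
    (h1 : ∀ a, (φ a).fst = algebraMap A K a)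
    (h2 : ∀ c : ℂ, φ (algebraMap ℂ A c) = TrivSqZeroExt.inl (algebraMap ℂ K c)) :
    Derivation ℂ A (Fin m → K) :=
  Derivation.mk'
    { toFun := fun a => (φ a).snd
      map_add' := fun a b => by rw [map_add, TrivSqZeroExt.snd_add]
      map_smul' := fun c a => by
        rw [Algebra.smul_def, map_mul, h2, TrivSqZeroExt.snd_mul]
        simp }
    (fun a b => by
      change (φ (a * b)).snd = a • (φ b).snd + b • (φ a).snd
      rw [map_mul, TrivSqZeroExt.snd_mul, h1, h1, op_smul_eq_smul, algebraMap_smul,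
        algebraMap_smul])

theorem toT_toC₁ : M₁.toT θ₀ θ₁ ≫ TLine.toC =
    Spec.map (CommRingCat.ofHom (algebraMap ℂ (Chart1 θ₀ θ₁))) := by
  rw [M₁.toT, TLine.toC, ← Spec.map_comp, ← CommRingCat.ofHom_comp, ← IsScalarTower.algebraMap_eq]

theorem toT_toC₂ : M₂.toT θ₀ θ₁ ≫ TLine.toC =
    Spec.map (CommRingCat.ofHom (algebraMap ℂ (Chart2 θ₀ θ₁))) := by
  rw [M₂.toT, TLine.toC, ← Spec.map_comp, ← CommRingCat.ofHom_comp, ← IsScalarTower.algebraMap_eq]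

theorem mem_singularLocus_chart1 (p : PrimeSpectrum (Chart1 θ₀ θ₁))
    (h0 : x1 θ₀ θ₁ 0 ∈ p.asIdeal)
    (h1 : formC0 θ₀ θ₁ (x1 θ₀ θ₁ 1) (x1 θ₀ θ₁ 2) - x1 θ₀ θ₁ 1 * (x1 θ₀ θ₁ 2 + tt _ ^ 2) ∈ p.asIdeal)
    (h2 : x1 θ₀ θ₁ 1 * (x1 θ₀ θ₁ 1 + 1) ∈ p.asIdeal) :
    p ∈ singularLocus (M₁.toT θ₀ θ₁ ≫ TLine.toC) 3 := by
  by_contra hp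
  rw [toT_toC₁] at hp
  let K := p.asIdeal.ResidueField
  let κ : Chart1 θ₀ θ₁ →+* K := algebraMap _ K
  have hκ : RingHom.ker κ = p.asIdeal := Ideal.ker_algebraMap_residueField _
  have hk : ∀ x, κ (kk _ x) = algebraMap ℂ K x := fun x => by
    rw [kk_eq_algebraMap₁]
    exact (IsScalarTower.algebraMap_apply ℂ (Chart1 θ₀ θ₁) K x).symm
  have e0 : κ (x1 θ₀ θ₁ 0) = 0 := by rwa [← hκ] at h0
  have e1 := hκ.ge h1
  have e2 := hκ.ge h2
  rw [RingHom.mem_ker] at e1 e2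
  simp only [formC0, map_add, map_sub, map_mul, map_pow, map_neg, map_one, hk] at e1 e2
  have e := eq1_of_ringHom κ hk
  have ht : IsUnit (TrivSqZeroExt.inl (κ (tt _)) + TrivSqZeroExt.inr (Pi.single 3 1) :
      TrivSqZeroExt K (Fin 4 → K)) := by
    rw [TrivSqZeroExt.isUnit_iff_isUnit_fst]
    simpa using (isUnit_tt (Chart1 θ₀ θ₁)).map κ
  let P := point1 (θ₀ := θ₀) (θ₁ := θ₁) ht.unit
    (TrivSqZeroExt.inl (κ (x1 θ₀ θ₁ 0)) + TrivSqZeroExt.inr (Pi.single 0 1))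
    (TrivSqZeroExt.inl (κ (x1 θ₀ θ₁ 1)) + TrivSqZeroExt.inr (Pi.single 1 1))
    (TrivSqZeroExt.inl (κ (x1 θ₀ θ₁ 2)) + TrivSqZeroExt.inr (Pi.single 2 1)) (by
      rw [Eq1] at e ⊢
      rw [IsUnit.unit_spec]
      simp only [TrivSqZeroExt.algebraMap_eq_inl']
      generalize algebraMap ℂ K (θ₀ ^ 2 / 4) = k0 at e e1
      generalize algebraMap ℂ K (θ₁ ^ 2 / 4) = k1 at e e1
      ext i
      · simpa using e
      · simp [pow_two]
        linear_combination 2 * Pi.single (M := fun _ => K) 0 1 i * e0 + Pi.single (M := fun _ => K) 1 1 i * e1 -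
          Pi.single (M := fun _ => K) 2 1 i * e2 - 2 * κ (tt _) * Pi.single (M := fun _ => K) 3 1 i * e2)
  have hP1 : ∀ a, (P a).fst = algebraMap (Chart1 θ₀ θ₁) K a := by
    intro a
    have : (TrivSqZeroExt.fstHom K K (Fin 4 → K)).toRingHom.comp P = κ := by
      refine chart1_ringHom_ext (fun x => ?_) ?_ fun i => ?_
      · simp [P, point1_kk, hk, TrivSqZeroExt.algebraMap_eq_inl']
      · simp [P, point1_tt]
      · fin_cases i
        · simp [P, point1_zero]
        · simp [P, point1_one]
        · simp [P, point1_two]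
    exact congr($this a)
  have hP2 : ∀ c : ℂ, P (algebraMap ℂ _ c) = TrivSqZeroExt.inl (algebraMap ℂ K c) := by
    intro c
    rw [← kk_eq_algebraMap₁, point1_kk, TrivSqZeroExt.algebraMap_eq_inl']
  have := card_le_of_notMem_singularLocus p hp hκ (derivationOfLift P hP1 hP2)
    ![x1 θ₀ θ₁ 0, x1 θ₀ θ₁ 1, x1 θ₀ θ₁ 2, tt _] (fun j => by
      fin_cases j
      · change (P (x1 θ₀ θ₁ 0)).snd = _
        simp [P, point1_zero]
      · change (P (x1 θ₀ θ₁ 1)).snd = _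
        simp [P, point1_one]
      · change (P (x1 θ₀ θ₁ 2)).snd = _
        simp [P, point1_two]
      · change (P (tt _)).snd = _
        simp [P, point1_tt])
  omega

theorem mem_singularLocus_chart2 (p : PrimeSpectrum (Chart2 θ₀ θ₁))
    (h0 : 2 * x2 θ₀ θ₁ 0 - x2 θ₀ θ₁ 1 * (1 + x2 θ₀ θ₁ 1) ∈ p.asIdeal)
    (h1 : -x2 θ₀ θ₁ 0 - 2 * x2 θ₀ θ₁ 1 * formC2 θ₀ θ₁ (x2 θ₀ θ₁ 0) (x2 θ₀ θ₁ 1) (x2 θ₀ θ₁ 2) +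
      tt _ ^ 2 + x2 θ₀ θ₁ 1 ^ 2 * (kk _ (θ₀ ^ 2 / 4) + x2 θ₀ θ₁ 2) ∈ p.asIdeal)
    (h2 : x2 θ₀ θ₁ 1 ^ 2 * (x2 θ₀ θ₁ 1 + 1) ∈ p.asIdeal) :
    p ∈ singularLocus (M₂.toT θ₀ θ₁ ≫ TLine.toC) 3 := by
  by_contra hp
  rw [toT_toC₂] at hp
  let K := p.asIdeal.ResidueField
  let κ : Chart2 θ₀ θ₁ →+* K := algebraMap _ K
  have hκ : RingHom.ker κ = p.asIdeal := Ideal.ker_algebraMap_residueField _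
  have hk : ∀ x, κ (kk _ x) = algebraMap ℂ K x := fun x => by
    rw [kk_eq_algebraMap₂]
    exact (IsScalarTower.algebraMap_apply ℂ (Chart2 θ₀ θ₁) K x).symm
  have e0 := hκ.ge h0
  have e1 := hκ.ge h1
  have e2 := hκ.ge h2
  rw [RingHom.mem_ker] at e0 e1 e2
  simp only [formC2, map_add, map_sub, map_mul, map_pow, map_neg, map_one, map_ofNat, hk] at e0 e1 e2
  have e3 : κ (x2 θ₀ θ₁ 1) * (κ (x2 θ₀ θ₁ 1) + 1) = 0 := by
    rcases mul_eq_zero.1 e2 with h | h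
    · rw [pow_eq_zero_iff two_ne_zero] at h
      rw [h, zero_mul]
    · rw [h, mul_zero]
  have e := eq2_of_ringHom κ hk
  have ht : IsUnit (TrivSqZeroExt.inl (κ (tt _)) + TrivSqZeroExt.inr (Pi.single 3 1) :
      TrivSqZeroExt K (Fin 4 → K)) := by
    rw [TrivSqZeroExt.isUnit_iff_isUnit_fst]
    simpa using (isUnit_tt (Chart2 θ₀ θ₁)).map κ
  let P := point2 (θ₀ := θ₀) (θ₁ := θ₁) ht.unit
    (TrivSqZeroExt.inl (κ (x2 θ₀ θ₁ 0)) + TrivSqZeroExt.inr (Pi.single 0 1))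
    (TrivSqZeroExt.inl (κ (x2 θ₀ θ₁ 1)) + TrivSqZeroExt.inr (Pi.single 1 1))
    (TrivSqZeroExt.inl (κ (x2 θ₀ θ₁ 2)) + TrivSqZeroExt.inr (Pi.single 2 1)) (by
      rw [Eq2] at e ⊢
      rw [IsUnit.unit_spec]
      simp only [TrivSqZeroExt.algebraMap_eq_inl']
      generalize algebraMap ℂ K (θ₀ ^ 2 / 4) = k0 at e e1
      generalize algebraMap ℂ K (θ₁ ^ 2 / 4) = k1 at e e1
      ext i
      · simpa using e
      · simp [pow_two]
        linear_combination Pi.single (M := fun _ => K) 0 1 i * e0 +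
          Pi.single (M := fun _ => K) 1 1 i * e1 + Pi.single (M := fun _ => K) 2 1 i * e2 +
          2 * κ (tt _) * Pi.single (M := fun _ => K) 3 1 i * e3)
  have hP1 : ∀ a, (P a).fst = algebraMap (Chart2 θ₀ θ₁) K a := by
    intro a
    have : (TrivSqZeroExt.fstHom K K (Fin 4 → K)).toRingHom.comp P = κ := by
      refine chart2_ringHom_ext (fun x => ?_) ?_ fun i => ?_
      · simp [P, point2_kk, hk, TrivSqZeroExt.algebraMap_eq_inl']
      · simp [P, point2_tt]
      · fin_cases i
        · simp [P, point2_zero]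
        · simp [P, point2_one]
        · simp [P, point2_two]
    exact congr($this a)
  have hP2 : ∀ c : ℂ, P (algebraMap ℂ _ c) = TrivSqZeroExt.inl (algebraMap ℂ K c) := by
    intro c
    rw [← kk_eq_algebraMap₂, point2_kk, TrivSqZeroExt.algebraMap_eq_inl']
  have := card_le_of_notMem_singularLocus p hp hκ (derivationOfLift P hP1 hP2)
    ![x2 θ₀ θ₁ 0, x2 θ₀ θ₁ 1, x2 θ₀ θ₁ 2, tt _] (fun j => by
      fin_cases j
      · change (P (x2 θ₀ θ₁ 0)).snd = _
        simp [P, point2_zero]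
      · change (P (x2 θ₀ θ₁ 1)).snd = _
        simp [P, point2_one]
      · change (P (x2 θ₀ θ₁ 2)).snd = _
        simp [P, point2_two]
      · change (P (tt _)).snd = _
        simp [P, point2_tt])
  omega

instance : SmoothOfRelativeDimension 1 TLine.toC := by
  rw [TLine.toC, HasRingHomProperty.Spec_iff (P := @SmoothOfRelativeDimension 1)]
  refine RingHom.locally_of RingHom.isStandardSmoothOfRelativeDimension_respectsIso _ ?_
  change @Algebra.IsStandardSmoothOfRelativeDimension 1 _ _ _ _ (algebraMap ℂ ℂ[T;T⁻¹]).toAlgebra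
  rw [toAlgebra_algebraMap]
  infer_instance

theorem singularLocus_comp_subset {X : Scheme.{0}} (f : X ⟶ TLine) :
    singularLocus (f ≫ TLine.toC) 3 ⊆ singularLocus f 2 := by
  rintro x hx ⟨U, hU, h⟩
  refine hx ⟨U, hU, ?_⟩
  rw [← Category.assoc]
  exact smoothOfRelativeDimension_comp (n := 2) (m := 1) _ _

variable (θ₀ θ₁) in
theorem hasSingularLocus_chart1 : HasSingularLocus (M₁.toT θ₀ θ₁)
    {p : PrimeSpectrum (Chart1 θ₀ θ₁) | x1 θ₀ θ₁ 0 ∈ p.asIdeal ∧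
      formC0 θ₀ θ₁ (x1 θ₀ θ₁ 1) (x1 θ₀ θ₁ 2) - x1 θ₀ θ₁ 1 * (x1 θ₀ θ₁ 2 + tt _ ^ 2) ∈ p.asIdeal ∧
      x1 θ₀ θ₁ 1 * (x1 θ₀ θ₁ 1 + 1) ∈ p.asIdeal} := by
  have h1 : singularLocus (M₁.toT θ₀ θ₁) 2 ⊆ {p : PrimeSpectrum (Chart1 θ₀ θ₁) |
      x1 θ₀ θ₁ 0 ∈ p.asIdeal ∧
      formC0 θ₀ θ₁ (x1 θ₀ θ₁ 1) (x1 θ₀ θ₁ 2) - x1 θ₀ θ₁ 1 * (x1 θ₀ θ₁ 2 + tt _ ^ 2) ∈ p.asIdeal ∧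
      x1 θ₀ θ₁ 1 * (x1 θ₀ θ₁ 1 + 1) ∈ p.asIdeal} := by
    intro p hp
    have h i := not_imp_comm.1 (notMem_singularLocus_chart1 p i) (not_not.2 hp)
    refine ⟨?_, ?_, ?_⟩
    · have := h 0
      rw [quot1_pderiv_zero] at this
      refine (p.2.mem_or_mem this).resolve_left fun h2 => p.2.ne_top ?_
      refine Ideal.eq_top_of_isUnit_mem _ h2 ?_
      have h3 := (IsUnit.mk0 (2 : ℂ) two_ne_zero).map (algebraMap ℂ (Chart1 θ₀ θ₁))
      rwa [map_ofNat] at h3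
    · have := h 1
      rwa [quot1_pderiv_one] at this
    · have := h 2
      rwa [quot1_pderiv_two, neg_mem_iff] at this
  have h2 := singularLocus_comp_subset (M₁.toT θ₀ θ₁)
  have h3 : {p : PrimeSpectrum (Chart1 θ₀ θ₁) |
      x1 θ₀ θ₁ 0 ∈ p.asIdeal ∧
      formC0 θ₀ θ₁ (x1 θ₀ θ₁ 1) (x1 θ₀ θ₁ 2) - x1 θ₀ θ₁ 1 * (x1 θ₀ θ₁ 2 + tt _ ^ 2) ∈ p.asIdeal ∧
      x1 θ₀ θ₁ 1 * (x1 θ₀ θ₁ 1 + 1) ∈ p.asIdeal} ⊆ singularLocus (M₁.toT θ₀ θ₁ ≫ TLine.toC) 3 :=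
    fun p ⟨h, h', h''⟩ => mem_singularLocus_chart1 p h h' h''
  exact ⟨(h2.trans h1).antisymm h3, h1.antisymm (h3.trans h2)⟩

variable (θ₀ θ₁) in
theorem hasSingularLocus_chart2 : HasSingularLocus (M₂.toT θ₀ θ₁)
    {p : PrimeSpectrum (Chart2 θ₀ θ₁) |
      2 * x2 θ₀ θ₁ 0 - x2 θ₀ θ₁ 1 * (1 + x2 θ₀ θ₁ 1) ∈ p.asIdeal ∧
      -x2 θ₀ θ₁ 0 - 2 * x2 θ₀ θ₁ 1 * formC2 θ₀ θ₁ (x2 θ₀ θ₁ 0) (x2 θ₀ θ₁ 1) (x2 θ₀ θ₁ 2) +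
        tt _ ^ 2 + x2 θ₀ θ₁ 1 ^ 2 * (kk _ (θ₀ ^ 2 / 4) + x2 θ₀ θ₁ 2) ∈ p.asIdeal ∧
      x2 θ₀ θ₁ 1 ^ 2 * (x2 θ₀ θ₁ 1 + 1) ∈ p.asIdeal} := by
  have h1 : singularLocus (M₂.toT θ₀ θ₁) 2 ⊆ {p : PrimeSpectrum (Chart2 θ₀ θ₁) |
      2 * x2 θ₀ θ₁ 0 - x2 θ₀ θ₁ 1 * (1 + x2 θ₀ θ₁ 1) ∈ p.asIdeal ∧
      -x2 θ₀ θ₁ 0 - 2 * x2 θ₀ θ₁ 1 * formC2 θ₀ θ₁ (x2 θ₀ θ₁ 0) (x2 θ₀ θ₁ 1) (x2 θ₀ θ₁ 2) +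
        tt _ ^ 2 + x2 θ₀ θ₁ 1 ^ 2 * (kk _ (θ₀ ^ 2 / 4) + x2 θ₀ θ₁ 2) ∈ p.asIdeal ∧
      x2 θ₀ θ₁ 1 ^ 2 * (x2 θ₀ θ₁ 1 + 1) ∈ p.asIdeal} := by
    intro p hp
    have h i := not_imp_comm.1 (notMem_singularLocus_chart2 p i) (not_not.2 hp)
    have h0 := h 0
    have h1 := h 1
    have h2 := h 2
    rw [quot2_pderiv_zero] at h0
    rw [quot2_pderiv_one] at h1
    rw [quot2_pderiv_two] at h2
    exact ⟨h0, h1, h2⟩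
  have h2 := singularLocus_comp_subset (M₂.toT θ₀ θ₁)
  have h3 : {p : PrimeSpectrum (Chart2 θ₀ θ₁) |
      2 * x2 θ₀ θ₁ 0 - x2 θ₀ θ₁ 1 * (1 + x2 θ₀ θ₁ 1) ∈ p.asIdeal ∧
      -x2 θ₀ θ₁ 0 - 2 * x2 θ₀ θ₁ 1 * formC2 θ₀ θ₁ (x2 θ₀ θ₁ 0) (x2 θ₀ θ₁ 1) (x2 θ₀ θ₁ 2) +
        tt _ ^ 2 + x2 θ₀ θ₁ 1 ^ 2 * (kk _ (θ₀ ^ 2 / 4) + x2 θ₀ θ₁ 2) ∈ p.asIdeal ∧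
      x2 θ₀ θ₁ 1 ^ 2 * (x2 θ₀ θ₁ 1 + 1) ∈ p.asIdeal} ⊆
        singularLocus (M₂.toT θ₀ θ₁ ≫ TLine.toC) 3 :=
    fun p ⟨h, h', h''⟩ => mem_singularLocus_chart2 p h h' h''
  exact ⟨(h2.trans h1).antisymm h3, h1.antisymm (h3.trans h2)⟩

theorem exists_point_of_prime1 (p : PrimeSpectrum (Chart1 θ₀ θ₁)) :
    ∃ (K : Type) (_ : Field K) (κ : Chart1 θ₀ θ₁ →+* K) (j : ℂ →+* K),
      (∀ x, x ∈ p.asIdeal ↔ κ x = 0) ∧ (∀ c, κ (kk _ c) = j c) ∧ κ (tt _) ≠ 0 ∧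
      κ (x1 θ₀ θ₁ 0) ^ 2 + κ (x1 θ₀ θ₁ 1) * (-j (θ₀ ^ 2 / 4) + j (θ₁ ^ 2 / 4) - κ (x1 θ₀ θ₁ 2) -
        κ (tt _) ^ 2 - κ (x1 θ₀ θ₁ 1) * κ (x1 θ₀ θ₁ 2) - κ (x1 θ₀ θ₁ 1) * κ (tt _) ^ 2) -
        j (θ₀ ^ 2 / 4) = 0 := by
  have hk : ∀ x, algebraMap _ p.asIdeal.ResidueField (kk (Chart1 θ₀ θ₁) x) = algebraMap ℂ _ x :=
    fun x => by
    rw [kk_eq_algebraMap₁]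
    exact (IsScalarTower.algebraMap_apply ℂ (Chart1 θ₀ θ₁) _ x).symm
  exact ⟨_, inferInstance, algebraMap _ p.asIdeal.ResidueField, algebraMap ℂ _,
    fun x => by rw [← RingHom.mem_ker, Ideal.ker_algebraMap_residueField], hk,
    ((isUnit_tt (Chart1 θ₀ θ₁)).map _).ne_zero, eq1_of_ringHom _ hk⟩

theorem exists_point_of_prime2 (p : PrimeSpectrum (Chart2 θ₀ θ₁)) :
    ∃ (K : Type) (_ : Field K) (κ : Chart2 θ₀ θ₁ →+* K) (j : ℂ →+* K),
      (∀ x, x ∈ p.asIdeal ↔ κ x = 0) ∧ (∀ c, κ (kk _ c) = j c) ∧ κ (tt _) ≠ 0 ∧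
      κ (x2 θ₀ θ₁ 0) ^ 2 + κ (x2 θ₀ θ₁ 1) * (-κ (x2 θ₀ θ₁ 0) - κ (x2 θ₀ θ₁ 1) * (-κ (x2 θ₀ θ₁ 2) -
        κ (tt _) ^ 2 - κ (x2 θ₀ θ₁ 1) * j (θ₀ ^ 2 / 4) - κ (x2 θ₀ θ₁ 1) * κ (x2 θ₀ θ₁ 2) +
        κ (x2 θ₀ θ₁ 0) - j (θ₀ ^ 2 / 4) + j (θ₁ ^ 2 / 4)) + κ (tt _) ^ 2) = 0 := by
  have hk : ∀ x, algebraMap _ p.asIdeal.ResidueField (kk (Chart2 θ₀ θ₁) x) = algebraMap ℂ _ x :=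
    fun x => by
    rw [kk_eq_algebraMap₂]
    exact (IsScalarTower.algebraMap_apply ℂ (Chart2 θ₀ θ₁) _ x).symm
  exact ⟨_, inferInstance, algebraMap _ p.asIdeal.ResidueField, algebraMap ℂ _,
    fun x => by rw [← RingHom.mem_ker, Ideal.ker_algebraMap_residueField], hk,
    ((isUnit_tt (Chart2 θ₀ θ₁)).map _).ne_zero, eq2_of_ringHom _ hk⟩

theorem map_div_four_ne_zero {K : Type} [Field K] (j : ℂ →+* K) {θ : ℂ} (h : θ ≠ 0) :
    j (θ ^ 2 / 4) ≠ 0 := by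
  simpa using h

theorem HasSingularLocus.of_eq {X : Scheme.{0}} {f : X ⟶ TLine} {Z Z' : Set X}
    (h : HasSingularLocus f Z) (hZ : Z' = Z) : HasSingularLocus f Z' :=
  hZ ▸ h

theorem singular1_nonzero_nonzero (h₀ : θ₀ ≠ 0) (h₁ : θ₁ ≠ 0) :
    HasSingularLocus (M₁.toT θ₀ θ₁) ∅ := by
  refine (hasSingularLocus_chart1 θ₀ θ₁).of_eq (Set.eq_empty_iff_forall_notMem.2 ?_).symm
  rintro p ⟨ha, hc, hb⟩
  obtain ⟨K, _, κ, j, hκ, hk, ht, e⟩ := exists_point_of_prime1 p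
  simp only [hκ, formC0, map_add, map_sub, map_mul, map_pow, map_neg, map_one, hk] at ha hb hc
  have h0 := map_div_four_ne_zero j h₀
  have h1 := map_div_four_ne_zero j h₁
  grind

theorem singular1_zero_nonzero (h₀ : θ₀ = 0) (h₁ : θ₁ ≠ 0) :
    HasSingularLocus (M₁.toT θ₀ θ₁) (PrimeSpectrum.zeroLocus {x1 θ₀ θ₁ 0, x1 θ₀ θ₁ 1,
      x1 θ₀ θ₁ 2 - (-tt _ ^ 2 + kk _ (θ₁ ^ 2 / 4))}) := by
  refine (hasSingularLocus_chart1 θ₀ θ₁).of_eq (Set.ext fun (p : PrimeSpectrum (Chart1 θ₀ θ₁)) => ?_)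
  change _ ↔ (_ ∧ _ ∧ _)
  obtain ⟨K, _, κ, j, hκ, hk, ht, e⟩ := exists_point_of_prime1 p
  simp only [PrimeSpectrum.mem_zeroLocus, Set.insert_subset_iff, Set.singleton_subset_iff,
    SetLike.mem_coe, hκ, formC0, map_add, map_sub, map_mul, map_pow, map_neg, map_one, hk]
  have h0 : j (θ₀ ^ 2 / 4) = 0 := by simp [h₀]
  have h1 := map_div_four_ne_zero j h₁
  clear hκ hk
  generalize j (θ₀ ^ 2 / 4) = k0, j (θ₁ ^ 2 / 4) = k1 at *
  generalize κ (x1 θ₀ θ₁ 0) = a, κ (x1 θ₀ θ₁ 1) = b, κ (x1 θ₀ θ₁ 2) = c, κ (tt _) = t at *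
  constructor
  · rintro ⟨h2, h3, h4⟩
    refine ⟨h2, ?_, ?_⟩ <;> grind
  · rintro ⟨h2, h3, h4⟩
    have h5 : b = 0 ∨ b = -1 := by
      rcases mul_eq_zero.1 h4 with h | h
      · exact .inl h
      · exact .inr (eq_neg_of_add_eq_zero_left h)
    refine ⟨h2, ?_, ?_⟩ <;> rcases h5 with rfl | rfl <;> grind

theorem singular1_nonzero_zero (h₀ : θ₀ ≠ 0) (h₁ : θ₁ = 0) :
    HasSingularLocus (M₁.toT θ₀ θ₁) (PrimeSpectrum.zeroLocus {x1 θ₀ θ₁ 0, x1 θ₀ θ₁ 1 - (-1),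
      x1 θ₀ θ₁ 2 - (-tt _ ^ 2 + kk _ (θ₀ ^ 2 / 4))}) := by
  refine (hasSingularLocus_chart1 θ₀ θ₁).of_eq (Set.ext fun (p : PrimeSpectrum (Chart1 θ₀ θ₁)) => ?_)
  change _ ↔ (_ ∧ _ ∧ _)
  obtain ⟨K, _, κ, j, hκ, hk, ht, e⟩ := exists_point_of_prime1 p
  simp only [PrimeSpectrum.mem_zeroLocus, Set.insert_subset_iff, Set.singleton_subset_iff,
    SetLike.mem_coe, hκ, formC0, map_add, map_sub, map_mul, map_pow, map_neg, map_one, hk]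
  have h0 := map_div_four_ne_zero j h₀
  have h1 : j (θ₁ ^ 2 / 4) = 0 := by simp [h₁]
  clear hκ hk
  generalize j (θ₀ ^ 2 / 4) = k0, j (θ₁ ^ 2 / 4) = k1 at *
  generalize κ (x1 θ₀ θ₁ 0) = a, κ (x1 θ₀ θ₁ 1) = b, κ (x1 θ₀ θ₁ 2) = c, κ (tt _) = t at *
  constructor
  · rintro ⟨h2, h3, h4⟩
    refine ⟨h2, ?_, ?_⟩ <;> grind
  · rintro ⟨h2, h3, h4⟩
    have h5 : b = 0 ∨ b = -1 := by
      rcases mul_eq_zero.1 h4 with h | h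
      · exact .inl h
      · exact .inr (eq_neg_of_add_eq_zero_left h)
    refine ⟨h2, ?_, ?_⟩ <;> rcases h5 with rfl | rfl <;> grind

theorem singular1_zero_zero (h₀ : θ₀ = 0) (h₁ : θ₁ = 0) :
    HasSingularLocus (M₁.toT θ₀ θ₁) (PrimeSpectrum.zeroLocus {x1 θ₀ θ₁ 0,
      x1 θ₀ θ₁ 1 * (x1 θ₀ θ₁ 1 + 1), x1 θ₀ θ₁ 2 - (-tt _ ^ 2)}) := by
  refine (hasSingularLocus_chart1 θ₀ θ₁).of_eq (Set.ext fun (p : PrimeSpectrum (Chart1 θ₀ θ₁)) => ?_)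
  change _ ↔ (_ ∧ _ ∧ _)
  obtain ⟨K, _, κ, j, hκ, hk, ht, e⟩ := exists_point_of_prime1 p
  simp only [PrimeSpectrum.mem_zeroLocus, Set.insert_subset_iff, Set.singleton_subset_iff,
    SetLike.mem_coe, hκ, formC0, map_add, map_sub, map_mul, map_pow, map_neg, map_one, hk]
  have h0 : j (θ₀ ^ 2 / 4) = 0 := by simp [h₀]
  have h1 : j (θ₁ ^ 2 / 4) = 0 := by simp [h₁]
  clear hκ hk
  generalize j (θ₀ ^ 2 / 4) = k0, j (θ₁ ^ 2 / 4) = k1 at *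
  generalize κ (x1 θ₀ θ₁ 0) = a, κ (x1 θ₀ θ₁ 1) = b, κ (x1 θ₀ θ₁ 2) = c, κ (tt _) = t at *
  constructor
  · rintro ⟨h2, h3, h4⟩
    refine ⟨h2, ?_, ?_⟩ <;> grind
  · rintro ⟨h2, h3, h4⟩
    have h5 : b = 0 ∨ b = -1 := by
      rcases mul_eq_zero.1 h4 with h | h
      · exact .inl h
      · exact .inr (eq_neg_of_add_eq_zero_left h)
    refine ⟨h2, ?_, ?_⟩ <;> rcases h5 with rfl | rfl <;> grind

theorem singular2_zero (h₁ : θ₁ = 0) :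
    HasSingularLocus (M₂.toT θ₀ θ₁) (PrimeSpectrum.zeroLocus {x2 θ₀ θ₁ 0, x2 θ₀ θ₁ 1 - (-1),
      x2 θ₀ θ₁ 2 - (tt _ ^ 2 - kk _ (θ₀ ^ 2 / 4))}) := by
  refine (hasSingularLocus_chart2 θ₀ θ₁).of_eq (Set.ext fun (p : PrimeSpectrum (Chart2 θ₀ θ₁)) => ?_)
  change _ ↔ (_ ∧ _ ∧ _)
  obtain ⟨K, _, κ, j, hκ, hk, ht, e⟩ := exists_point_of_prime2 p
  simp only [PrimeSpectrum.mem_zeroLocus, Set.insert_subset_iff, Set.singleton_subset_iff,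
    SetLike.mem_coe, hκ, formC2, map_add, map_sub, map_mul, map_pow, map_neg, map_one,
    map_ofNat, hk]
  have h1 : j (θ₁ ^ 2 / 4) = 0 := by simp [h₁]
  clear hκ hk
  generalize j (θ₀ ^ 2 / 4) = k0, j (θ₁ ^ 2 / 4) = k1 at *
  generalize κ (x2 θ₀ θ₁ 0) = a, κ (x2 θ₀ θ₁ 1) = b, κ (x2 θ₀ θ₁ 2) = c, κ (tt _) = t at *
  constructor
  · rintro ⟨h2, h3, h4⟩
    refine ⟨?_, ?_, ?_⟩ <;> grind
  · rintro ⟨h2, h3, h4⟩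
    have h5 : b = 0 ∨ b = -1 := by
      rcases mul_eq_zero.1 h4 with h | h
      · exact .inl (by simpa using h)
      · exact .inr (eq_neg_of_add_eq_zero_left h)
    have h6 : a = 0 := by
      have : (2 : K) ≠ 0 := by
        have h := (map_ne_zero j).2 (two_ne_zero (α := ℂ))
        rwa [map_ofNat] at h
      rcases h5 with rfl | rfl <;> grind
    have h7 : b = -1 := by
      refine h5.resolve_left fun h => ht ?_
      subst h h6
      simpa using h3
    refine ⟨?_, ?_, ?_⟩ <;> grind

theorem singular2_nonzero (h₁ : θ₁ ≠ 0) : HasSingularLocus (M₂.toT θ₀ θ₁) ∅ := by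
  refine (hasSingularLocus_chart2 θ₀ θ₁).of_eq (Set.eq_empty_iff_forall_notMem.2 ?_).symm
  rintro p ⟨h2, h3, h4⟩
  obtain ⟨K, _, κ, j, hκ, hk, ht, e⟩ := exists_point_of_prime2 p
  simp only [hκ, formC2, map_add, map_sub, map_mul, map_pow, map_neg, map_one, map_ofNat, hk]
    at h2 h3 h4
  have h1 := map_div_four_ne_zero j h₁
  clear hκ hk
  generalize j (θ₀ ^ 2 / 4) = k0, j (θ₁ ^ 2 / 4) = k1 at *
  generalize κ (x2 θ₀ θ₁ 0) = a, κ (x2 θ₀ θ₁ 1) = b, κ (x2 θ₀ θ₁ 2) = c, κ (tt _) = t at *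
  have h5 : b = 0 ∨ b = -1 := by
    rcases mul_eq_zero.1 h4 with h | h
    · exact .inl (by simpa using h)
    · exact .inr (eq_neg_of_add_eq_zero_left h)
  have h6 : a = 0 := by
    have : (2 : K) ≠ 0 := by
      have h := (map_ne_zero j).2 (two_ne_zero (α := ℂ))
      rwa [map_ofNat] at h
    rcases h5 with rfl | rfl <;> grind
  have h7 : b = -1 := by
    refine h5.resolve_left fun h => ht ?_
    subst h h6
    simpa using h3
  grind

variable (θ₀ θ₁) in
theorem hasSingularLocus_M : HasSingularLocus (M.toT θ₀ θ₁)
    ((ι₁ θ₀ θ₁) '' singularLocus (M₁.toT θ₀ θ₁) 2 ∪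
      (ι₂ θ₀ θ₁) '' singularLocus (M₂.toT θ₀ θ₁) 2) := by
  have key : ∀ (S : Scheme.{0}) (f : TLine ⟶ S) (n : ℕ),
      singularLocus (M.toT θ₀ θ₁ ≫ f) n =
        (ι₁ θ₀ θ₁) '' singularLocus (M₁.toT θ₀ θ₁ ≫ f) n ∪
          (ι₂ θ₀ θ₁) '' singularLocus (M₂.toT θ₀ θ₁ ≫ f) n := by
    intro S f n
    have h1 w := apply_mem_singularLocus_iff (ι₁ θ₀ θ₁) (M.toT θ₀ θ₁ ≫ f) n w
    have h2 w := apply_mem_singularLocus_iff (ι₂ θ₀ θ₁) (M.toT θ₀ θ₁ ≫ f) n w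
    rw [← Category.assoc, ι₁_toT] at h1
    rw [← Category.assoc, ι₂_toT] at h2
    ext x
    constructor
    · intro hx
      rcases mem_range_or θ₀ θ₁ x with ⟨w, rfl⟩ | ⟨w, rfl⟩
      · exact .inl ⟨w, (h1 w).1 hx, rfl⟩
      · exact .inr ⟨w, (h2 w).1 hx, rfl⟩
    · rintro (⟨w, hw, rfl⟩ | ⟨w, hw, rfl⟩)
      · exact (h1 w).2 hw
      · exact (h2 w).2 hw
  have hT := key _ (𝟙 _) 2
  simp only [Category.comp_id] at hT
  refine ⟨?_, hT⟩
  rw [key, (hasSingularLocus_chart1 θ₀ θ₁).1, (hasSingularLocus_chart2 θ₀ θ₁).1,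
    (hasSingularLocus_chart1 θ₀ θ₁).2, (hasSingularLocus_chart2 θ₀ θ₁).2]

theorem smooth_M (h₀ : θ₀ ≠ 0) (h₁ : θ₁ ≠ 0) :
    SmoothOfRelativeDimension 3 (M.toC θ₀ θ₁) ∧ SmoothOfRelativeDimension 2 (M.toT θ₀ θ₁) := by
  have h := hasSingularLocus_M θ₀ θ₁
  rw [(singular1_nonzero_nonzero h₀ h₁).2, (singular2_nonzero h₁).2, Set.image_empty,
    Set.image_empty, Set.union_empty] at h
  exact ⟨(singularLocus_eq_empty_iff _ _).1 h.1, (singularLocus_eq_empty_iff _ _).1 h.2⟩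

end chartSingular

end DegPV

namespace DegPV

noncomputable section powerSeries

variable {R : Type} [CommRing R]

theorem powerSeries_eq_of_forall_dvd {f g : R⟦X⟧} (h : ∀ n, PowerSeries.X ^ n ∣ f - g) : f = g := by
  ext n
  have := PowerSeries.X_pow_dvd_iff.1 (h (n + 1)) n n.lt_succ_self
  rwa [map_sub, sub_eq_zero] at this

/-- A map of tuples of power series that is contracting for the `X`-adic topology has a fixed
point. -/
theorem exists_fixedPoint_of_contracting {ι : Type} (Ψ : (ι → R⟦X⟧) → ι → R⟦X⟧)
    (h : ∀ (n : ℕ) (u v : ι → R⟦X⟧), (∀ i, PowerSeries.X ^ n ∣ u i - v i) →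
      ∀ i, PowerSeries.X ^ (n + 1) ∣ Ψ u i - Ψ v i) : ∃ u, Ψ u = u := by
  have h1 : ∀ n i, PowerSeries.X ^ n ∣ Ψ (Ψ^[n] 0) i - Ψ^[n] 0 i := by
    intro n
    induction n with
    | zero => simp
    | succ n ih =>
      rw [Function.iterate_succ_apply']
      exact h n _ _ ih
  have h2 : ∀ n k i, PowerSeries.X ^ n ∣ Ψ^[n + k] 0 i - Ψ^[n] 0 i := by
    intro n k i
    induction k with
    | zero => simp
    | succ k ih =>
      have := (dvd_trans (pow_dvd_pow _ (Nat.le_add_right n k)) (h1 (n + k) i)).add ih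
      rw [sub_add_sub_cancel, ← Function.iterate_succ_apply' Ψ] at this
      exact this
  let u : ι → R⟦X⟧ := fun i => PowerSeries.mk fun n => PowerSeries.coeff n (Ψ^[n + 1] 0 i)
  have hu : ∀ n i, PowerSeries.X ^ n ∣ u i - Ψ^[n] 0 i := by
    intro n i
    rw [PowerSeries.X_pow_dvd_iff]
    intro m hm
    have := PowerSeries.X_pow_dvd_iff.1 (h2 (m + 1) (n - (m + 1)) i) m m.lt_succ_self
    rw [Nat.add_sub_of_le hm] at this
    rw [map_sub, PowerSeries.coeff_mk, ← neg_eq_zero, neg_sub, ← map_sub, this]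
  refine ⟨u, funext fun i => powerSeries_eq_of_forall_dvd fun n => ?_⟩
  have h3 := (dvd_trans (pow_dvd_pow _ n.le_succ) (h n _ _ (hu n) i)).add
    ((h1 n i).add ((dvd_sub_comm).1 (hu n i)))
  convert h3 using 1
  ring

theorem X_pow_dvd_X_mul_derivative {n : ℕ} {f : R⟦X⟧} (h : PowerSeries.X ^ n ∣ f) :
    PowerSeries.X ^ n ∣ PowerSeries.X * d⁄dX R f := by
  rw [PowerSeries.X_pow_dvd_iff] at h ⊢
  intro m hm
  cases m with
  | zero => simp
  | succ m => simp [PowerSeries.coeff_succ_X_mul, PowerSeries.coeff_derivative, h _ hm]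

/-- The even part `∑ f_{2n} X^n` of a power series. -/
def evenPart (f : R⟦X⟧) : R⟦X⟧ := PowerSeries.mk fun n => PowerSeries.coeff (2 * n) f

/-- The odd part `∑ f_{2n+1} X^n` of a power series. -/
def oddPart (f : R⟦X⟧) : R⟦X⟧ := PowerSeries.mk fun n => PowerSeries.coeff (2 * n + 1) f

/-- The substitution of `X²` for `X`. -/
abbrev sq : R⟦X⟧ →ₐ[R] R⟦X⟧ := PowerSeries.expand 2 two_ne_zero

theorem coeff_two_mul_sq (f : R⟦X⟧) (n : ℕ) :
    PowerSeries.coeff (2 * n) (sq f) = PowerSeries.coeff n f := by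
  exact PowerSeries.coeff_expand_mul ..

theorem coeff_two_mul_add_one_sq (f : R⟦X⟧) (n : ℕ) :
    PowerSeries.coeff (2 * n + 1) (sq f) = 0 := by
  refine PowerSeries.coeff_expand_of_not_dvd _ _ _ ?_
  omega

theorem sq_evenPart_add (f : R⟦X⟧) : sq (evenPart f) + PowerSeries.X * sq (oddPart f) = f := by
  ext n
  obtain ⟨k, rfl | rfl⟩ := n.even_or_odd'
  · cases k with
    | zero => simp [evenPart]
    | succ k =>
      rw [map_add, coeff_two_mul_sq, show 2 * (k + 1) = (2 * k + 1) + 1 by ring,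
        PowerSeries.coeff_succ_X_mul, coeff_two_mul_add_one_sq, evenPart, PowerSeries.coeff_mk]
      simp [mul_add]
  · rw [map_add, coeff_two_mul_add_one_sq, PowerSeries.coeff_succ_X_mul, coeff_two_mul_sq,
      oddPart, PowerSeries.coeff_mk, zero_add]

theorem sq_add_X_mul_sq_eq_iff {f g f' g' : R⟦X⟧} :
    sq f + PowerSeries.X * sq g = sq f' + PowerSeries.X * sq g' ↔ f = f' ∧ g = g' := by
  refine ⟨fun h => ⟨?_, ?_⟩, fun h => by rw [h.1, h.2]⟩
  · ext n
    have := congrArg (PowerSeries.coeff (2 * n)) h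
    cases n with
    | zero => simpa using this
    | succ n =>
      rw [map_add, map_add, coeff_two_mul_sq, coeff_two_mul_sq,
        show 2 * (n + 1) = (2 * n + 1) + 1 by ring,
        PowerSeries.coeff_succ_X_mul, PowerSeries.coeff_succ_X_mul, coeff_two_mul_add_one_sq,
        coeff_two_mul_add_one_sq, add_zero, add_zero] at this
      exact this
  · ext n
    have := congrArg (PowerSeries.coeff (2 * n + 1)) h
    rw [map_add, map_add, coeff_two_mul_add_one_sq, coeff_two_mul_add_one_sq, zero_add, zero_add,
        PowerSeries.coeff_succ_X_mul, PowerSeries.coeff_succ_X_mul, coeff_two_mul_sq,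
        coeff_two_mul_sq] at this
    exact this

theorem X_mul_derivative_sq (f : R⟦X⟧) :
    PowerSeries.X * d⁄dX R (sq f) = sq (2 * (PowerSeries.X * d⁄dX R f)) := by
  ext n
  have key : ∀ (g : R⟦X⟧) (m : ℕ), PowerSeries.coeff m (PowerSeries.X * d⁄dX R g) =
      m * PowerSeries.coeff m g := by
    intro g m
    cases m with
    | zero => simp
    | succ m =>
      rw [PowerSeries.coeff_succ_X_mul, PowerSeries.coeff_derivative]
      push_cast
      ring
  obtain ⟨k, rfl | rfl⟩ := n.even_or_odd'
  · rw [key, coeff_two_mul_sq, coeff_two_mul_sq, two_mul (PowerSeries.X * _), map_add, key]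
    push_cast
    ring
  · rw [key, coeff_two_mul_add_one_sq, coeff_two_mul_add_one_sq, mul_zero]

variable [Algebra ℂ R]

/-- The power series `f` without constant term that satisfies `X f' = g - g(0)`. -/
def logIntegral (g : R⟦X⟧) : R⟦X⟧ :=
  PowerSeries.mk fun n => algebraMap ℂ R (n : ℂ)⁻¹ * PowerSeries.coeff n g

theorem X_mul_derivative_logIntegral (g : R⟦X⟧) (hg : PowerSeries.constantCoeff g = 0) :
    PowerSeries.X * d⁄dX R (logIntegral g) = g := by
  ext n
  cases n with
  | zero => simp [hg]
  | succ n =>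
    rw [PowerSeries.coeff_succ_X_mul, PowerSeries.coeff_derivative, logIntegral,
      PowerSeries.coeff_mk, mul_right_comm]
    have : algebraMap ℂ R ((n + 1 : ℕ) : ℂ)⁻¹ * ((n : R) + 1) = 1 := by
      have h : algebraMap ℂ R (((n + 1 : ℕ) : ℂ)⁻¹ * ((n + 1 : ℕ) : ℂ)) = 1 := by
        rw [inv_mul_cancel₀ (Nat.cast_ne_zero.2 n.succ_ne_zero), map_one]
      simpa using h
    rw [this, one_mul]

theorem constantCoeff_logIntegral (g : R⟦X⟧) :
    PowerSeries.constantCoeff (logIntegral g) = 0 := by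
  rw [← PowerSeries.coeff_zero_eq_constantCoeff_apply, logIntegral, PowerSeries.coeff_mk]
  simp

theorem logIntegral_sub (f g : R⟦X⟧) :
    logIntegral (f - g) = logIntegral f - logIntegral g := by
  ext n
  simp [logIntegral, mul_sub]

theorem X_pow_dvd_logIntegral {n : ℕ} {f : R⟦X⟧} (h : PowerSeries.X ^ n ∣ f) :
    PowerSeries.X ^ n ∣ logIntegral f := by
  rw [PowerSeries.X_pow_dvd_iff] at h ⊢
  intro m hm
  rw [logIntegral, PowerSeries.coeff_mk, h m hm, mul_zero]

end powerSeries

end DegPV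

namespace DegPV

noncomputable section infinity

variable {R : Type} [CommRing R] [Algebra ℂ R]

/-- The matrix `w (-3/4, t/w; t, -1/4)` over `R[[w]]`. -/
def infSeries (t : R) : Matrix (Fin 2) (Fin 2) R⟦X⟧ :=
  !![PowerSeries.C (algebraMap ℂ R (-3 / 4)) * PowerSeries.X, PowerSeries.C t;
    PowerSeries.C t * PowerSeries.X, PowerSeries.C (algebraMap ℂ R (-1 / 4)) * PowerSeries.X]

theorem exists_formal_solution (t : Rˣ) (b11 b12 b21 b22 K : R⟦X⟧) :
    ∃ x q : R⟦X⟧, PowerSeries.constantCoeff x = 1 ∧ PowerSeries.constantCoeff q = 0 ∧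
      PowerSeries.C (t : R) * q = PowerSeries.X *
        (-PowerSeries.C (algebraMap ℂ R (3 / 4)) * x - b11 * x - PowerSeries.X * (b12 * (x + q)) +
          PowerSeries.C (algebraMap ℂ R (1 / 2)) * (PowerSeries.X * d⁄dX R x)) ∧
      PowerSeries.X * d⁄dX R x = PowerSeries.X * (K * x + b12 * (x + q) + b21 * x) +
        (b22 + PowerSeries.C (algebraMap ℂ R (1 / 4))) * q -
        PowerSeries.C (algebraMap ℂ R (1 / 2)) * (PowerSeries.X * d⁄dX R q) := by
  let E : R⟦X⟧ → R⟦X⟧ → R⟦X⟧ := fun x q => PowerSeries.X * (PowerSeries.C ((t⁻¹ : Rˣ) : R) *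
    (-PowerSeries.C (algebraMap ℂ R (3 / 4)) * x - b11 * x - PowerSeries.X * (b12 * (x + q)) +
          PowerSeries.C (algebraMap ℂ R (1 / 2)) * (PowerSeries.X * d⁄dX R x)))
  let F : R⟦X⟧ → R⟦X⟧ → R⟦X⟧ → R⟦X⟧ := fun x q r =>
    PowerSeries.X * (K * x + b12 * (x + q) + b21 * x) +
        (b22 + PowerSeries.C (algebraMap ℂ R (1 / 4))) * r -
        PowerSeries.C (algebraMap ℂ R (1 / 2)) * (PowerSeries.X * d⁄dX R r)
  have hE : ∀ x q x' q', E x q - E x' q' = E (x - x') (q - q') := by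
    intro x q x' q'
    simp only [E, map_sub]
    ring
  have hF : ∀ x q r x' q' r', F x q r - F x' q' r' = F (x - x') (q - q') (r - r') := by
    intro x q r x' q' r'
    simp only [F, map_sub]
    ring
  have hE' : ∀ n x q, PowerSeries.X ^ n ∣ x → PowerSeries.X ^ n ∣ q →
      PowerSeries.X ^ (n + 1) ∣ E x q := by
    intro n x q hx hq
    rw [pow_succ']
    refine mul_dvd_mul_left _ (Dvd.dvd.mul_left ?_ _)
    exact (((hx.mul_left _).sub (hx.mul_left _)).sub
      (((hx.add hq).mul_left _).mul_left _)).add ((X_pow_dvd_X_mul_derivative hx).mul_left _)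
  have hF' : ∀ n x q r, PowerSeries.X ^ n ∣ x → PowerSeries.X ^ n ∣ q →
      PowerSeries.X ^ (n + 1) ∣ r → PowerSeries.X ^ (n + 1) ∣ F x q r := by
    intro n x q r hx hq hr
    refine ((?_ : _ ∣ _).add (hr.mul_left _)).sub ((X_pow_dvd_X_mul_derivative hr).mul_left _)
    rw [pow_succ']
    exact mul_dvd_mul_left _ (((hx.mul_left _).add ((hx.add hq).mul_left _)).add (hx.mul_left _))
  obtain ⟨u, hu⟩ := exists_fixedPoint_of_contracting (R := R) (ι := Fin 2)
    (fun u => ![1 + logIntegral (F (u 0) (u 1) (E (u 0) (u 1))), E (u 0) (u 1)]) (by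
      intro n u v h i
      have h1 : PowerSeries.X ^ (n + 1) ∣ E (u 0) (u 1) - E (v 0) (v 1) := by
        rw [hE]
        exact hE' _ _ _ (h 0) (h 1)
      fin_cases i
      · change _ ∣ (1 + logIntegral _) - (1 + logIntegral _)
        rw [add_sub_add_left_eq_sub, ← logIntegral_sub, hF]
        exact X_pow_dvd_logIntegral (hF' _ _ _ _ (h 0) (h 1) h1)
      · exact h1)
  have h0 : 1 + logIntegral (F (u 0) (u 1) (E (u 0) (u 1))) = u 0 := congrFun hu 0
  have h1 : E (u 0) (u 1) = u 1 := congrFun hu 1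
  rw [h1] at h0
  have hq : PowerSeries.constantCoeff (u 1) = 0 := by
    rw [← h1]
    simp [E]
  refine ⟨u 0, u 1, ?_, hq, ?_, ?_⟩
  · rw [← h0, map_add, constantCoeff_logIntegral, map_one, add_zero]
  · conv_lhs => rw [← h1]
    have ht : PowerSeries.C (t : R) * PowerSeries.C ((t⁻¹ : Rˣ) : R) = (1 : R⟦X⟧) := by
      rw [← map_mul, Units.mul_inv, map_one]
    simp only [E]
    linear_combination (PowerSeries.X * (-PowerSeries.C (algebraMap ℂ R (3 / 4)) * u 0 -
      b11 * u 0 - PowerSeries.X * (b12 * (u 0 + u 1)) +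
          PowerSeries.C (algebraMap ℂ R (1 / 2)) * (PowerSeries.X * d⁄dX R (u 0)))) * ht
  · conv_lhs => rw [← h0]
    rw [map_add, ← map_one (PowerSeries.C (R := R)), PowerSeries.derivative_C, zero_add,
      X_mul_derivative_logIntegral]
    simp [F, hq]

theorem even_odd_row {p r x y z : R⟦X⟧} (t : R)
    (h : sq p * x + sq r * y - PowerSeries.C (algebraMap ℂ R (1 / 2)) *
      (PowerSeries.X ^ 2 * (PowerSeries.X * d⁄dX R z)) =
      (PowerSeries.C t * PowerSeries.X - PowerSeries.C (algebraMap ℂ R (3 / 4)) *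
        PowerSeries.X ^ 2) * z) :
    p * evenPart x + r * evenPart y - PowerSeries.X ^ 2 * d⁄dX R (evenPart z) =
        PowerSeries.C t * PowerSeries.X * oddPart z +
          PowerSeries.C (algebraMap ℂ R (-3 / 4)) * PowerSeries.X * evenPart z ∧
      p * oddPart x + r * oddPart y - PowerSeries.X ^ 2 * d⁄dX R (oddPart z) =
        PowerSeries.C t * evenPart z +
          PowerSeries.C (algebraMap ℂ R (-1 / 4)) * PowerSeries.X * oddPart z := by
  have e1 : PowerSeries.C (algebraMap ℂ R (1 / 2)) * 2 = (1 : R⟦X⟧) := by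
    rw [← map_ofNat (PowerSeries.C (R := R)) 2, ← map_ofNat (algebraMap ℂ R) 2, ← map_mul,
      ← map_mul]
    norm_num
  have e2 : PowerSeries.C (algebraMap ℂ R (-3 / 4)) =
      -PowerSeries.C (algebraMap ℂ R (3 / 4)) := by
    rw [← map_neg, ← map_neg]
    norm_num
  have e3 : PowerSeries.C (algebraMap ℂ R (-1 / 4)) = PowerSeries.C (algebraMap ℂ R (1 / 2))
      - PowerSeries.C (algebraMap ℂ R (3 / 4)) := by
    rw [← map_sub, ← map_sub]
    norm_num
  have hd : PowerSeries.X * d⁄dX R z = sq (2 * (PowerSeries.X * d⁄dX R (evenPart z))) +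
      PowerSeries.X * sq (oddPart z + 2 * (PowerSeries.X * d⁄dX R (oddPart z))) := by
    conv_lhs => rw [← sq_evenPart_add z]
    rw [map_add, mul_add, X_mul_derivative_sq, Derivation.leibniz, PowerSeries.derivative_X,
      smul_eq_mul, smul_eq_mul, mul_one, map_add, ← X_mul_derivative_sq,
      ← X_mul_derivative_sq]
    ring
  rw [hd] at h
  conv at h => lhs; rw [← sq_evenPart_add x, ← sq_evenPart_add y]
  conv at h => rhs; rw [← sq_evenPart_add z]
  have hC : ∀ c : R, PowerSeries.C c = sq (PowerSeries.C c) := fun c =>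
    (PowerSeries.expand_C 2 two_ne_zero c).symm
  have hX : (PowerSeries.X : R⟦X⟧) ^ 2 = sq PowerSeries.X := (PowerSeries.expand_X ..).symm
  obtain ⟨h1, h2⟩ := (sq_add_X_mul_sq_eq_iff
    (f := p * evenPart x + r * evenPart y - PowerSeries.C (algebraMap ℂ R (1 / 2)) *
      (PowerSeries.X * (2 * (PowerSeries.X * d⁄dX R (evenPart z)))))
    (g := p * oddPart x + r * oddPart y - PowerSeries.C (algebraMap ℂ R (1 / 2)) *
      (PowerSeries.X * (oddPart z + 2 * (PowerSeries.X * d⁄dX R (oddPart z)))))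
    (f' := PowerSeries.C t * PowerSeries.X * oddPart z -
      PowerSeries.C (algebraMap ℂ R (3 / 4)) * PowerSeries.X * evenPart z)
    (g' := PowerSeries.C t * evenPart z -
      PowerSeries.C (algebraMap ℂ R (3 / 4)) * PowerSeries.X * oddPart z)).1 (by
        simp only [map_add, map_sub, map_mul] at h ⊢
        simp only [← hC, ← hX] at h ⊢
        linear_combination h)
  constructor
  · rw [e2]
    linear_combination h1 + (PowerSeries.X ^ 2 * d⁄dX R (evenPart z)) * e1
  · rw [e3]
    linear_combination h2 + (PowerSeries.X ^ 2 * d⁄dX R (oddPart z)) * e1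

theorem exists_gauge_infSeries (t : Rˣ) (A : Matrix (Fin 2) (Fin 2) R⟦X⟧)
    (h00 : PowerSeries.coeff 0 (A 0 0) = 0) (h01 : PowerSeries.coeff 0 (A 0 1) = t)
    (h10 : PowerSeries.coeff 0 (A 1 0) = 0) (h11 : PowerSeries.coeff 0 (A 1 1) = 0)
    (h10' : PowerSeries.coeff 1 (A 1 0) = t)
    (htr : PowerSeries.coeff 1 (A 0 0) + PowerSeries.coeff 1 (A 1 1) = -1) :
    ∃ g : (Matrix (Fin 2) (Fin 2) R⟦X⟧)ˣ,
      A * g.val - (PowerSeries.X : R⟦X⟧) ^ 2 • g.val.map (d⁄dX R) = g.val * infSeries (t : R) := by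
  have hX : ∀ f : R⟦X⟧, PowerSeries.coeff 0 f = 0 → ∃ b, f = PowerSeries.X * b := fun f hf =>
    PowerSeries.X_dvd_iff.2 (by simpa using hf)
  obtain ⟨b11, e11⟩ := hX _ h00
  obtain ⟨b12, e12⟩ := hX (A 0 1 - PowerSeries.C (t : R)) (by simpa [sub_eq_zero] using h01)
  obtain ⟨c21, e21⟩ := hX _ h10
  obtain ⟨b22, e22⟩ := hX _ h11
  rw [e21, ← zero_add 1, PowerSeries.coeff_succ_X_mul] at h10'
  rw [e11, e22, ← zero_add 1, PowerSeries.coeff_succ_X_mul, PowerSeries.coeff_succ_X_mul] at htr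
  obtain ⟨b21, e21'⟩ := hX (c21 - PowerSeries.C (t : R)) (by
    rw [map_sub, h10', PowerSeries.coeff_zero_C, sub_self])
  obtain ⟨K, hK⟩ := hX (b11 + b22 + 1) (by
    rw [map_add, map_add, htr, PowerSeries.coeff_zero_one]
    simp)
  have hK' : sq b11 + sq b22 + 1 = PowerSeries.X ^ 2 * sq K := by
    have := congrArg (sq (R := R)) hK
    rwa [map_add, map_add, map_one, map_mul, PowerSeries.expand_X] at this
  obtain ⟨x, q, hx, hq, h1, h2⟩ := exists_formal_solution t (sq b11) (sq b12)
    (sq b21) (sq b22) (PowerSeries.X * sq K)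
  have f11 : sq (A 0 0) = PowerSeries.X ^ 2 * sq b11 := by
    rw [e11, map_mul, PowerSeries.expand_X]
  have f12 : sq (A 0 1) = PowerSeries.C (t : R) + PowerSeries.X ^ 2 * sq b12 := by
    rw [sub_eq_iff_eq_add'.1 e12, map_add, map_mul, PowerSeries.expand_X, PowerSeries.expand_C]
  have f21 : sq (A 1 0) = PowerSeries.X ^ 2 * (PowerSeries.C (t : R) +
      PowerSeries.X ^ 2 * sq b21) := by
    rw [e21, sub_eq_iff_eq_add'.1 e21', map_mul, map_add, map_mul, PowerSeries.expand_X,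
      PowerSeries.expand_C]
  have f22 : sq (A 1 1) = PowerSeries.X ^ 2 * sq b22 := by
    rw [e22, map_mul, PowerSeries.expand_X]
  have c1 : PowerSeries.C (algebraMap ℂ R (1 / 4)) = PowerSeries.C (algebraMap ℂ R (3 / 4)) -
      PowerSeries.C (algebraMap ℂ R (1 / 2)) := by
    rw [← map_sub, ← map_sub]
    norm_num
  have c2 : PowerSeries.C (algebraMap ℂ R (1 / 2)) * 2 = (1 : R⟦X⟧) := by
    rw [← map_ofNat (PowerSeries.C (R := R)) 2, ← map_ofNat (algebraMap ℂ R) 2, ← map_mul,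
      ← map_mul]
    norm_num
  have c3 : PowerSeries.C (algebraMap ℂ R (3 / 4)) * 2 =
      1 + PowerSeries.C (algebraMap ℂ R (1 / 2)) := by
    rw [← map_ofNat (PowerSeries.C (R := R)) 2, ← map_ofNat (algebraMap ℂ R) 2, ← map_mul,
      ← map_mul, ← map_one (PowerSeries.C (R := R)), ← map_one (algebraMap ℂ R), ← map_add,
      ← map_add]
    norm_num
  have hy : PowerSeries.X * d⁄dX R (PowerSeries.X * (x + q)) = PowerSeries.X * (x + q) +
      PowerSeries.X * (PowerSeries.X * d⁄dX R x + PowerSeries.X * d⁄dX R q) := by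
    rw [Derivation.leibniz, PowerSeries.derivative_X, map_add, smul_eq_mul, smul_eq_mul]
    ring
  obtain ⟨r1, r2⟩ := even_odd_row (p := A 0 0) (r := A 0 1) (x := x)
    (y := PowerSeries.X * (x + q)) (z := x) (t : R) (by
      rw [f11, f12]
      linear_combination PowerSeries.X * h1)
  obtain ⟨r3, r4⟩ := even_odd_row (p := A 1 0) (r := A 1 1) (x := x)
    (y := PowerSeries.X * (x + q)) (z := PowerSeries.X * (x + q)) (t : R) (by
      rw [f21, f22, hy]
      rw [c1] at h2
      linear_combination -PowerSeries.X ^ 2 * h1 - PowerSeries.X ^ 3 * h2 + PowerSeries.X ^ 3 * x * hK' - (PowerSeries.X ^ 3 * (PowerSeries.X * d⁄dX R x)) * c2 +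
        PowerSeries.X ^ 3 * x * c3)
  let g : Matrix (Fin 2) (Fin 2) R⟦X⟧ := !![evenPart x, oddPart x;
    evenPart (PowerSeries.X * (x + q)), oddPart (PowerSeries.X * (x + q))]
  have hg : IsUnit g := by
    rw [Matrix.isUnit_iff_isUnit_det, PowerSeries.isUnit_iff_constantCoeff, Matrix.det_fin_two]
    have a1 : PowerSeries.constantCoeff (evenPart x) = 1 := by
      rw [← PowerSeries.coeff_zero_eq_constantCoeff_apply, evenPart, PowerSeries.coeff_mk]
      simpa using hx
    have a2 : PowerSeries.constantCoeff (evenPart (PowerSeries.X * (x + q))) = 0 := by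
      rw [← PowerSeries.coeff_zero_eq_constantCoeff_apply, evenPart, PowerSeries.coeff_mk]
      simp
    have a3 : PowerSeries.constantCoeff (oddPart (PowerSeries.X * (x + q))) = 1 := by
      rw [← PowerSeries.coeff_zero_eq_constantCoeff_apply, oddPart, PowerSeries.coeff_mk,
        PowerSeries.coeff_succ_X_mul]
      simpa [hq] using hx
    simp [g, a1, a2, a3]
  refine ⟨hg.unit, ?_⟩
  rw [IsUnit.unit_spec]
  ext1 i j
  fin_cases i <;> fin_cases j <;>
    simp only [Matrix.sub_apply, Matrix.smul_apply, Matrix.mul_apply, Fin.sum_univ_two,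
      Matrix.map_apply, g, infSeries, smul_eq_mul, Matrix.of_apply, Matrix.cons_val', Matrix.cons_val_zero,
      Matrix.cons_val_one, Fin.zero_eta, Fin.mk_one, Matrix.cons_val_fin_one]
  · linear_combination r1
  · linear_combination r2
  · linear_combination r3
  · linear_combination r4

end infinity

end DegPV

namespace DegPV

noncomputable section laurent

variable {R : Type} [CommRing R]

theorem coeff_lderiv (f : LaurentSeries R) (n : ℤ) :
    (lderiv f).coeff n = ((n + 1 : ℤ) : R) * f.coeff (n + 1) := by
  rw [lderiv, LaurentSeries.hasseDeriv_coeff]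
  simp

theorem lderiv_add (f g : LaurentSeries R) : lderiv (f + g) = lderiv f + lderiv g :=
  map_add _ _ _

theorem lderiv_single_mul (n : ℤ) (r : R) (f : LaurentSeries R) :
    lderiv (HahnSeries.single n r * f) =
      HahnSeries.single (n - 1) ((n : R) * r) * f + HahnSeries.single n r * lderiv f := by
  ext m
  rw [coeff_lderiv, HahnSeries.coeff_add, HahnSeries.coeff_single_mul, HahnSeries.coeff_single_mul,
    HahnSeries.coeff_single_mul, coeff_lderiv, show m + 1 - n = m - n + 1 by ring,
    show m - (n - 1) = m - n + 1 by ring]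
  push_cast
  ring

theorem lderiv_ofPowerSeries (f : R⟦X⟧) :
    lderiv (HahnSeries.ofPowerSeries ℤ R f) = HahnSeries.ofPowerSeries ℤ R (d⁄dX R f) := by
  ext m
  rw [coeff_lderiv]
  rcases lt_or_ge m 0 with h | h
  · rw [PowerSeries.coeff_coe (d⁄dX R f), if_pos h]
    rcases eq_or_lt_of_le (Int.add_one_le_iff.2 h) with h' | h'
    · rw [h']
      simp
    · rw [PowerSeries.coeff_coe, if_pos h', mul_zero]
  · lift m to ℕ using h
    rw [PowerSeries.coeff_coe, PowerSeries.coeff_coe, if_neg (by omega), if_neg (by omega)]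
    rw [show ((m : ℤ) + 1).natAbs = m + 1 by omega, Int.natAbs_natCast,
      PowerSeries.coeff_derivative]
    push_cast
    ring

theorem exists_eq_single_mul (f : LaurentSeries R) :
    ∃ (n : ℤ) (F : R⟦X⟧), f = HahnSeries.single n 1 * HahnSeries.ofPowerSeries ℤ R F :=
  ⟨f.order, f.powerSeriesPart, (LaurentSeries.single_order_mul_powerSeriesPart f).symm⟩

theorem lderiv_mul (f g : LaurentSeries R) : lderiv (f * g) = lderiv f * g + f * lderiv g := by
  obtain ⟨n, F, rfl⟩ := exists_eq_single_mul f
  obtain ⟨m, G, rfl⟩ := exists_eq_single_mul g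
  have h : HahnSeries.single n (1 : R) * HahnSeries.ofPowerSeries ℤ R F *
      (HahnSeries.single m 1 * HahnSeries.ofPowerSeries ℤ R G) =
      HahnSeries.single (n + m) 1 * HahnSeries.ofPowerSeries ℤ R (F * G) := by
    rw [map_mul, mul_mul_mul_comm, HahnSeries.single_mul_single, one_mul]
  have e1 : HahnSeries.single (n + m - 1) (((n + m : ℤ) : R) * 1) =
      HahnSeries.single (n - 1) ((n : R) * 1) * HahnSeries.single m (1 : R) +
        HahnSeries.single n (1 : R) * HahnSeries.single (m - 1) ((m : R) * 1) := by
    rw [HahnSeries.single_mul_single, HahnSeries.single_mul_single, add_sub_assoc n,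
      show n - 1 + m = n + (m - 1) by ring, ← HahnSeries.single_add]
    push_cast
    ring_nf
  have e2 : HahnSeries.single (n + m) (1 : R) =
      HahnSeries.single n (1 : R) * HahnSeries.single m (1 : R) := by
    rw [HahnSeries.single_mul_single, one_mul]
  rw [h, lderiv_single_mul, lderiv_single_mul, lderiv_single_mul, lderiv_ofPowerSeries,
    lderiv_ofPowerSeries, lderiv_ofPowerSeries, Derivation.leibniz, e1, e2]
  simp only [smul_eq_mul, map_add, map_mul]
  ring

/-- The power series `X^n p(1/X)`, for polynomials `p` of degree at most `n`. -/
def revSeries (n : ℕ) (p : R[X]) : R⟦X⟧ :=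
  ∑ i ∈ Finset.range (n + 1), PowerSeries.C (p.coeff i) * PowerSeries.X ^ (n - i)

theorem coeff_revSeries {n k : ℕ} (hk : k ≤ n) (p : R[X]) :
    PowerSeries.coeff k (revSeries n p) = p.coeff (n - k) := by
  rw [revSeries, map_sum, Finset.sum_eq_single (n - k)]
  · rw [PowerSeries.coeff_C_mul_X_pow, if_pos (by omega)]
  · intro i hi hne
    rw [Finset.mem_range] at hi
    rw [PowerSeries.coeff_C_mul_X_pow, if_neg (by omega)]
  · intro h
    exact absurd (Finset.mem_range.2 (by omega)) h

theorem single_mul_aeval_zInf {n : ℕ} {p : R[X]} (hp : p.natDegree ≤ n) :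
    HahnSeries.single 1 1 ^ n * aeval (zInf R) p = HahnSeries.ofPowerSeries ℤ R (revSeries n p) := by
  rw [Polynomial.aeval_eq_sum_range' (Nat.lt_succ_of_le hp), revSeries, map_sum, Finset.mul_sum]
  refine Finset.sum_congr rfl fun i hi => ?_
  have hi : i ≤ n := Nat.le_of_lt_succ (Finset.mem_range.1 hi)
  have h1 : HahnSeries.single (1 : ℤ) (1 : R) ^ i * zInf R ^ i = 1 := by
    rw [← mul_pow, zInf, HahnSeries.single_mul_single]
    simp
  rw [map_mul, map_pow, HahnSeries.ofPowerSeries_X, HahnSeries.ofPowerSeries_C,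
    Algebra.smul_def, ← Nat.sub_add_cancel hi, pow_add, Nat.add_sub_cancel]
  have h2 : algebraMap R (LaurentSeries R) (p.coeff i) = HahnSeries.C (p.coeff i) := by
    exact (HahnSeries.algebraMap_apply' ℤ _).trans (by
      rw [PowerSeries.algebraMap_apply, HahnSeries.ofPowerSeries_C, Algebra.algebraMap_self_apply])
  rw [h2]
  linear_combination (HahnSeries.single (1 : ℤ) (1 : R) ^ (n - i) * HahnSeries.C (p.coeff i)) * h1

end laurent

section infinity

variable {R : Type} [CommRing R]

/-- The bounds for the degrees of the entries of the matrix of a connection on `V`. -/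
structure DegreeBounds (A : Matrix (Fin 2) (Fin 2) R[X]) : Prop where
  deg00 : (A 0 0).natDegree ≤ 2
  deg01 : (A 0 1).natDegree ≤ 3
  deg10 : (A 1 0).natDegree ≤ 1
  deg11 : (A 1 1).natDegree ≤ 2

/-- The matrix of a connection on the lattice of `V` at infinity. -/
noncomputable def infMatrix (A : Matrix (Fin 2) (Fin 2) R[X]) : Matrix (Fin 2) (Fin 2) R⟦X⟧ :=
  !![revSeries 2 (A 0 0), revSeries 3 (A 0 1);
    revSeries 1 (A 1 0), revSeries 2 (A 1 1) - PowerSeries.X * (1 - PowerSeries.X)]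

variable [Algebra ℂ R]

/-- The matrices `A` and `g` satisfy the equation for an equivalence at infinity. -/
def InfEquation (A g : Matrix (Fin 2) (Fin 2) R⟦X⟧) (t : R) : Prop :=
  A * g - ((PowerSeries.X : R⟦X⟧) ^ 2 * (1 - PowerSeries.X)) • g.map (d⁄dX R) =
    (1 - PowerSeries.X : R⟦X⟧) • (g * infSeries t)

theorem hasInfModel_equation_iff {A : Matrix (Fin 2) (Fin 2) R[X]} (hA : DegreeBounds A) (t : R)
    (g : Matrix (Fin 2) (Fin 2) R⟦X⟧) (h : Matrix (Fin 2) (Fin 2) (LaurentSeries R))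
    (hh : h = Matrix.diagonal ![1, HahnSeries.single 1 1] *
      g.map (HahnSeries.ofPowerSeries ℤ R)) :
    A.map (aeval (zInf R)) * h + (zInf R - 1) • h.map eulerInf =
      (zInf R - 1) • (h * infModel t) ↔ InfEquation (infMatrix A) g t := by
  let P := HahnSeries.ofPowerSeries ℤ R
  have hP : Function.Injective P := HahnSeries.ofPowerSeries_injective
  have hw : P PowerSeries.X = HahnSeries.single 1 1 := HahnSeries.ofPowerSeries_X
  have hC : ∀ c, P (PowerSeries.C c) = HahnSeries.C c := HahnSeries.ofPowerSeries_C
  set w : LaurentSeries R := HahnSeries.single 1 1 with hw'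
  have hz : w * zInf R = 1 := by
    rw [hw', zInf, HahnSeries.single_mul_single]
    simp
  have h0 : ∀ j, h 0 j = P (g 0 j) := fun j => by simp [hh, P]
  have h1 : ∀ j, h 1 j = w * P (g 1 j) := fun j => by simp [hh, P]
  have d0 : ∀ j, eulerInf (P (g 0 j)) = -(w * P (d⁄dX R (g 0 j))) := fun j => by
    rw [eulerInf, lderiv_ofPowerSeries]
  have d1 : ∀ j, eulerInf (w * P (g 1 j)) = -(w * (P (g 1 j) + w * P (d⁄dX R (g 1 j)))) := fun j => by
    rw [eulerInf, hw', lderiv_single_mul, lderiv_ofPowerSeries]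
    simp [P]
  have a00 := single_mul_aeval_zInf hA.deg00
  have a01 := single_mul_aeval_zInf hA.deg01
  have a10 := single_mul_aeval_zInf hA.deg10
  have a11 := single_mul_aeval_zInf hA.deg11
  rw [← hw'] at a00 a01 a10 a11
  have hu : ∀ x, w ^ 2 * x = 0 → x = 0 := fun x hx => by
    have := congrArg (fun y => zInf R ^ 2 * y) hx
    simpa [← mul_assoc, ← mul_pow, mul_comm (zInf R) w, hz] using this
  have r0 : ∀ j, w ^ 2 * ((A.map (aeval (zInf R)) * h + (zInf R - 1) • h.map eulerInf) 0 j -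
      ((zInf R - 1) • (h * infModel t)) 0 j) =
      P ((infMatrix A * g - ((PowerSeries.X : R⟦X⟧) ^ 2 * (1 - PowerSeries.X)) •
        g.map (d⁄dX R)) 0 j - ((1 - PowerSeries.X : R⟦X⟧) • (g * infSeries t)) 0 j) := by
    intro j
    fin_cases j <;>
      simp only [Matrix.add_apply, Matrix.sub_apply, Matrix.smul_apply, Matrix.mul_apply,
        Fin.sum_univ_two, Matrix.map_apply, smul_eq_mul, d0, h0, h1, infMatrix, map_sub, map_add,
        map_mul, map_pow, map_one, hw, Matrix.of_apply, Matrix.cons_val', Matrix.cons_val_zero,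
        Matrix.cons_val_one, Matrix.cons_val_fin_one, infModel, infSeries, hC, Fin.zero_eta,
        Fin.mk_one]
    · linear_combination P (g 0 0) * a00 + P (g 1 0) * a01 + w * (-w * P (d⁄dX R (g 0 0)) -
        HahnSeries.C (algebraMap ℂ R (-3 / 4)) * P (g 0 0) - HahnSeries.C t * P (g 0 1)) * hz
    · linear_combination P (g 0 1) * a00 + P (g 1 1) * a01 + (w * (-w * P (d⁄dX R (g 0 1)) -
        HahnSeries.C (algebraMap ℂ R (-1 / 4)) * P (g 0 1)) - (w * zInf R + 1 - w) * HahnSeries.C t * P (g 0 0)) * hz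
  have r1 : ∀ j, w ^ 2 * ((A.map (aeval (zInf R)) * h + (zInf R - 1) • h.map eulerInf) 1 j -
      ((zInf R - 1) • (h * infModel t)) 1 j) =
      w * P ((infMatrix A * g - ((PowerSeries.X : R⟦X⟧) ^ 2 * (1 - PowerSeries.X)) •
        g.map (d⁄dX R)) 1 j - ((1 - PowerSeries.X : R⟦X⟧) • (g * infSeries t)) 1 j) := by
    intro j
    fin_cases j <;>
      simp only [Matrix.add_apply, Matrix.sub_apply, Matrix.smul_apply, Matrix.mul_apply,
        Fin.sum_univ_two, Matrix.map_apply, smul_eq_mul, d1, h0, h1, infMatrix, map_sub, map_add,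
        map_mul, map_pow, map_one, hw, Matrix.of_apply, Matrix.cons_val', Matrix.cons_val_zero,
        Matrix.cons_val_one, Matrix.cons_val_fin_one, infModel, infSeries, hC, Fin.zero_eta,
        Fin.mk_one]
    · linear_combination w * P (g 0 0) * a10 + w * P (g 1 0) * a11 +
        w ^ 2 * (-(P (g 1 0) + w * P (d⁄dX R (g 1 0))) - HahnSeries.C (algebraMap ℂ R (-3 / 4)) * P (g 1 0) -
          HahnSeries.C t * P (g 1 1)) * hz
    · linear_combination w * P (g 0 1) * a10 + w * P (g 1 1) * a11 +
        (w ^ 2 * (-(P (g 1 1) + w * P (d⁄dX R (g 1 1))) - HahnSeries.C (algebraMap ℂ R (-1 / 4)) * P (g 1 1)) -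
          w * (w * zInf R + 1 - w) * HahnSeries.C t * P (g 1 0)) * hz
  have hu1 : ∀ x, w * x = 0 → x = 0 := fun x hx => hu x (by rw [pow_two, mul_assoc, hx, mul_zero])
  constructor
  · intro H
    ext1 i j
    rw [← sub_eq_zero]
    refine hP ?_
    rw [map_zero]
    fin_cases i
    · exact (r0 j).symm.trans (by rw [H, sub_self, mul_zero])
    · exact hu1 _ ((r1 j).symm.trans (by rw [H, sub_self, mul_zero]))
  · intro H
    rw [InfEquation] at H
    ext1 i j
    rw [← sub_eq_zero]
    refine hu _ ?_
    fin_cases i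
    · refine (r0 j).trans (by rw [H, sub_self, map_zero])
    · refine (r1 j).trans (by rw [H, sub_self, map_zero, mul_zero])

theorem hasInfModel_iff {A : Matrix (Fin 2) (Fin 2) R[X]} (hA : DegreeBounds A) (t : R) :
    HasInfModel A t ↔
      ∃ g : (Matrix (Fin 2) (Fin 2) R⟦X⟧)ˣ, InfEquation (infMatrix A) g t := by
  refine exists_congr fun g => ⟨?_, fun h => ⟨_, rfl, ?_⟩⟩
  · rintro ⟨h, hh, e⟩
    exact (hasInfModel_equation_iff hA t _ h hh).1 e
  · exact (hasInfModel_equation_iff hA t _ _ rfl).2 h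

end infinity

end DegPV

namespace DegPV

section infinity

variable {R : Type} [CommRing R]

/-- The conditions on the coefficients of a matrix that describe the behaviour at infinity. -/
structure InfConditions (A : Matrix (Fin 2) (Fin 2) R[X]) (t : R) : Prop extends
    DegreeBounds A where
  trace_two : (A 0 0).coeff 2 + (A 1 1).coeff 2 = 0
  trace_one : (A 0 0).coeff 1 + (A 1 1).coeff 1 = 0
  det_four : (A 0 0).coeff 2 ^ 2 + (A 0 1).coeff 3 * (A 1 0).coeff 1 = 0
  det_three : 2 * (A 0 0).coeff 2 * (A 0 0).coeff 1 + (A 0 1).coeff 3 * (A 1 0).coeff 0 +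
    (A 0 1).coeff 2 * (A 1 0).coeff 1 + (A 0 0).coeff 2 = t ^ 2

theorem coeff_infMatrix (A : Matrix (Fin 2) (Fin 2) R[X]) :
    (infMatrix A).map (PowerSeries.coeff 0) =
        !![(A 0 0).coeff 2, (A 0 1).coeff 3; (A 1 0).coeff 1, (A 1 1).coeff 2] ∧
      (infMatrix A).map (PowerSeries.coeff 1) =
        !![(A 0 0).coeff 1, (A 0 1).coeff 2; (A 1 0).coeff 0, (A 1 1).coeff 1 - 1] := by
  have h0 : ∀ n (p : R[X]), PowerSeries.constantCoeff (revSeries n p) = p.coeff n := fun n p => by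
    rw [← PowerSeries.coeff_zero_eq_constantCoeff_apply, coeff_revSeries (Nat.zero_le n),
      Nat.sub_zero]
  have h2 : PowerSeries.coeff 1 (PowerSeries.X * (1 - PowerSeries.X) : R⟦X⟧) = 1 := by
    rw [← zero_add 1, PowerSeries.coeff_succ_X_mul]
    simp
  constructor <;> ext i j <;> fin_cases i <;> fin_cases j <;>
    simp [infMatrix, h0, coeff_revSeries, h2]

variable [Algebra ℂ R]

theorem coeff_infSeries (t : R) : (infSeries t).map (PowerSeries.coeff 0) = !![0, t; 0, 0] ∧
    (infSeries t).map (PowerSeries.coeff 1) =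
      !![algebraMap ℂ R (-3 / 4), 0; t, algebraMap ℂ R (-1 / 4)] := by
  constructor <;> ext i j <;> fin_cases i <;> fin_cases j <;>
    simp [infSeries, PowerSeries.coeff_C]

theorem InfEquation.conditions {A : Matrix (Fin 2) (Fin 2) R[X]} (hA : DegreeBounds A) {t : R}
    (g : (Matrix (Fin 2) (Fin 2) R⟦X⟧)ˣ) (h : InfEquation (infMatrix A) g.val t) :
    InfConditions A t := by
  obtain ⟨N, hN⟩ : ∃ N, infMatrix A = (1 - PowerSeries.X : R⟦X⟧) •
      (g.val * infSeries t * (g⁻¹).val) + (PowerSeries.X : R⟦X⟧) ^ 2 • N := by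
    refine ⟨(1 - PowerSeries.X : R⟦X⟧) • (g.val.map (d⁄dX R) * (g⁻¹).val), ?_⟩
    rw [InfEquation, sub_eq_iff_eq_add] at h
    have := congrArg (fun x => x * (g⁻¹).val) h
    simp only [Matrix.mul_assoc, Units.mul_inv, Matrix.mul_one, add_mul, Matrix.smul_mul] at this
    rw [this, smul_smul]
    simp only [Matrix.mul_assoc]
  obtain ⟨c0, c1⟩ := coeff_infMatrix A
  obtain ⟨s0, s1⟩ := coeff_infSeries t
  set G := g.val * infSeries t * (g⁻¹).val with hG
  have htr : G.trace = (infSeries t).trace := by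
    rw [hG, Matrix.trace_mul_comm, ← Matrix.mul_assoc, Units.inv_mul, Matrix.one_mul]
  have hdet : G.det = (infSeries t).det := by
    rw [hG, Matrix.det_mul, Matrix.det_mul, mul_right_comm, ← Matrix.det_mul, Units.mul_inv,
      Matrix.det_one, one_mul]
  have e1 : (infMatrix A).trace = (1 - PowerSeries.X : R⟦X⟧) * (infSeries t).trace +
      PowerSeries.X ^ 2 * N.trace := by
    rw [hN, Matrix.trace_add, Matrix.trace_smul, Matrix.trace_smul, htr, smul_eq_mul, smul_eq_mul]
  obtain ⟨r, e2⟩ : ∃ r, (infMatrix A).det = (1 - PowerSeries.X : R⟦X⟧) ^ 2 * (infSeries t).det +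
      PowerSeries.X ^ 2 * r := by
    refine ⟨(1 - PowerSeries.X) * (G 0 0 * N 1 1 + N 0 0 * G 1 1 - G 0 1 * N 1 0 - N 0 1 * G 1 0) +
      PowerSeries.X ^ 2 * N.det, ?_⟩
    rw [hN, ← hdet]
    simp only [Matrix.det_fin_two, Matrix.add_apply, Matrix.smul_apply, smul_eq_mul]
    ring
  have E : ∀ (f : R⟦X⟧) (n : ℕ), n < 2 →
      PowerSeries.coeff n (PowerSeries.X ^ 2 * f) = 0 := fun f n hn => by
    rw [PowerSeries.coeff_X_pow_mul', if_neg (by omega)]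
  have t0 := congrArg (PowerSeries.coeff 0) e1
  have t1 := congrArg (PowerSeries.coeff 1) e1
  have d0 := congrArg (PowerSeries.coeff 0) e2
  have d1 := congrArg (PowerSeries.coeff 1) e2
  rw [map_add, E _ _ (by norm_num), add_zero] at t0 t1 d0 d1
  simp only [← Matrix.ext_iff, Fin.forall_fin_two, Matrix.map_apply, Matrix.of_apply,
    Matrix.cons_val', Matrix.cons_val_zero, Matrix.cons_val_one, Matrix.cons_val_fin_one,
    PowerSeries.coeff_zero_eq_constantCoeff] at c0 c1 s0 s1
  obtain ⟨⟨c000, c001⟩, c010, c011⟩ := c0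
  obtain ⟨⟨c100, c101⟩, c110, c111⟩ := c1
  obtain ⟨⟨s000, s001⟩, s010, s011⟩ := s0
  obtain ⟨⟨s100, s101⟩, s110, s111⟩ := s1
  simp only [Matrix.trace_fin_two, Matrix.det_fin_two, PowerSeries.coeff_one_mul, map_sub, map_add,
    map_mul, map_one, PowerSeries.coeff_zero_eq_constantCoeff, pow_two, c000, c001, c010, c011, c100, c101,
    c110, c111, s000, s001, s010, s011, s100, s101, s110, s111] at t0 t1 d0 d1
  simp only [PowerSeries.coeff_one_X, PowerSeries.constantCoeff_X, PowerSeries.coeff_one] at t1 d1 t0 d0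
  have q : algebraMap ℂ R (-3 / 4) + algebraMap ℂ R (-1 / 4) = -1 := by
    rw [← map_add, ← map_one (algebraMap ℂ R), ← map_neg]
    norm_num
  have T0 : (A 0 0).coeff 2 + (A 1 1).coeff 2 = 0 := by linear_combination t0
  have T1 : (A 0 0).coeff 1 + (A 1 1).coeff 1 = 0 := by
    linear_combination t1 + q
  refine { hA with trace_two := T0, trace_one := T1, det_four := ?_, det_three := ?_ }
  · linear_combination -d0 + (A 0 0).coeff 2 * T0
  · linear_combination -d1 + (A 0 0).coeff 2 * T1 + (A 0 0).coeff 1 * T0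

theorem exists_infEquation_of_normalForm {A : Matrix (Fin 2) (Fin 2) R⟦X⟧} (t : Rˣ)
    (g : (Matrix (Fin 2) (Fin 2) R)ˣ)
    (h0 : A.map (PowerSeries.coeff 0) * g.val = g.val * !![0, (t : R); 0, 0])
    (h1 : ((g⁻¹).val * A.map (PowerSeries.coeff 1) * g.val) 1 0 = t)
    (htr : PowerSeries.coeff 1 A.trace = -1) :
    ∃ g : (Matrix (Fin 2) (Fin 2) R⟦X⟧)ˣ, InfEquation A g.val (t : R) := by
  let v : R⟦X⟧ := PowerSeries.mk 1
  have hv : v * (1 - PowerSeries.X) = 1 := PowerSeries.mk_one_mul_one_sub_eq_one R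
  let G : (Matrix (Fin 2) (Fin 2) R⟦X⟧)ˣ :=
    Units.map (PowerSeries.C (R := R)).mapMatrix.toMonoidHom g
  have hG : G.val = g.val.map PowerSeries.C := rfl
  have hG' : (G⁻¹).val = (g⁻¹).val.map PowerSeries.C := rfl
  have v0 : PowerSeries.coeff 0 v = 1 := PowerSeries.coeff_mk _ _
  have v1 : PowerSeries.coeff 1 v = 1 := PowerSeries.coeff_mk _ _
  have hl : ∀ (n : ℕ) (M : Matrix (Fin 2) (Fin 2) R) (B : Matrix (Fin 2) (Fin 2) R⟦X⟧),
      (M.map PowerSeries.C * B).map (PowerSeries.coeff n) =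
        M * B.map (PowerSeries.coeff n) := by
    intro n M B
    ext i j
    simp [Matrix.mul_apply]
  have hr : ∀ (n : ℕ) (M : Matrix (Fin 2) (Fin 2) R) (B : Matrix (Fin 2) (Fin 2) R⟦X⟧),
      (B * M.map PowerSeries.C).map (PowerSeries.coeff n) =
        B.map (PowerSeries.coeff n) * M := by
    intro n M B
    ext i j
    simp [Matrix.mul_apply]
  have hA0 : (v • A).map (PowerSeries.coeff 0) = A.map (PowerSeries.coeff 0) := by
    ext i j
    rw [PowerSeries.coeff_zero_eq_constantCoeff] at v0
    simp [v0]
  have hA1 : (v • A).map (PowerSeries.coeff 1) =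
      A.map (PowerSeries.coeff 1) + A.map (PowerSeries.coeff 0) := by
    ext i j
    rw [PowerSeries.coeff_zero_eq_constantCoeff] at v0
    simp only [Matrix.map_apply, Matrix.smul_apply, smul_eq_mul, PowerSeries.coeff_one_mul, v0, v1,
      Matrix.add_apply, PowerSeries.coeff_zero_eq_constantCoeff]
    ring
  have e0 : ((G⁻¹).val * (v • A) * G.val).map (PowerSeries.coeff 0) = !![0, (t : R); 0, 0] := by
    rw [hG, hG', hr, hl, hA0, Matrix.mul_assoc, h0, ← Matrix.mul_assoc, Units.inv_mul,
      Matrix.one_mul]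
  have e1 : ((G⁻¹).val * (v • A) * G.val).map (PowerSeries.coeff 1) =
      (g⁻¹).val * A.map (PowerSeries.coeff 1) * g.val + !![0, (t : R); 0, 0] := by
    rw [← e0, hG, hG', hr, hl, hr, hl, hA1, hA0, Matrix.mul_add, Matrix.add_mul]
  have e2 : ((g⁻¹).val * A.map (PowerSeries.coeff 1) * g.val).trace = -1 := by
    rw [Matrix.trace_mul_comm, ← Matrix.mul_assoc, Units.mul_inv, Matrix.one_mul, ← htr]
    simp [Matrix.trace_fin_two]
  rw [Matrix.trace_fin_two] at e2
  obtain ⟨f, hf⟩ := exists_gauge_infSeries t ((G⁻¹).val * (v • A) * G.val)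
    (by simpa using congrFun₂ e0 0 0) (by simpa using congrFun₂ e0 0 1)
    (by simpa using congrFun₂ e0 1 0) (by simpa using congrFun₂ e0 1 1)
    (by
      have := congrFun₂ e1 1 0
      rw [Matrix.map_apply, Matrix.add_apply, h1] at this
      simpa using this)
    (by
      have h00 := congrFun₂ e1 0 0
      have h11 := congrFun₂ e1 1 1
      rw [Matrix.map_apply, Matrix.add_apply] at h00 h11
      rw [h00, h11, ← e2]
      simp)
  refine ⟨G * f, ?_⟩
  have hd : (G.val * f.val).map (d⁄dX R) = G.val * f.val.map (d⁄dX R) := by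
    ext1 i j
    simp [hG, Matrix.mul_apply]
  have h2 := congrArg (fun B => (1 - PowerSeries.X : R⟦X⟧) • (G.val * B)) hf
  simp only [Matrix.mul_sub, smul_sub, ← Matrix.mul_assoc, Units.mul_inv, Matrix.one_mul] at h2
  rw [Matrix.smul_mul, Matrix.smul_mul, smul_smul, mul_comm _ v, hv, one_smul, Matrix.mul_smul,
    smul_smul, mul_comm (1 - PowerSeries.X : R⟦X⟧)] at h2
  rw [InfEquation, Units.val_mul, hd, ← Matrix.mul_assoc]
  exact h2

theorem InfConditions.exists_infEquation {A : Matrix (Fin 2) (Fin 2) R[X]} {t : Rˣ}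
    (h : InfConditions A (t : R)) (hu : IsUnit ((A 1 0).coeff 1) ∨ IsUnit ((A 0 1).coeff 3)) :
    ∃ g : (Matrix (Fin 2) (Fin 2) R⟦X⟧)ˣ, InfEquation (infMatrix A) g.val (t : R) := by
  obtain ⟨c0, c1⟩ := coeff_infMatrix A
  have htr : PowerSeries.coeff 1 (infMatrix A).trace = -1 := by
    have h0 := congrFun₂ c1 0 0
    have h1 := congrFun₂ c1 1 1
    simp only [Matrix.map_apply, Matrix.of_apply, Matrix.cons_val', Matrix.cons_val_zero,
      Matrix.cons_val_one, Matrix.cons_val_fin_one] at h0 h1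
    rw [Matrix.trace_fin_two, map_add, h0, h1]
    linear_combination h.trace_one
  have t2 : (A 1 1).coeff 2 = -(A 0 0).coeff 2 := by linear_combination h.trace_two
  have t1 : (A 1 1).coeff 1 = -(A 0 0).coeff 1 := by linear_combination h.trace_one
  have d4 := h.det_four
  have d3 := h.det_three
  rw [t2] at c0
  rw [t1] at c1
  generalize (A 0 0).coeff 2 = α2, (A 0 0).coeff 1 = α1, (A 0 1).coeff 3 = β3,
    (A 0 1).coeff 2 = β2, (A 1 0).coeff 1 = γ1, (A 1 0).coeff 0 = γ0 at *
  have ht := t.mul_inv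
  have htu : (t⁻¹).val * t.val = 1 := t.inv_mul
  generalize (t⁻¹).val = t' at ht htu
  rcases hu with ⟨u, rfl⟩ | ⟨u, rfl⟩
  · have hu := u.mul_inv
    generalize (u⁻¹).val = u' at hu
    refine exists_infEquation_of_normalForm t ⟨!![α2, (t : R); (u : R), 0],
      !![0, u'; t', -α2 * t' * u'], ?_, ?_⟩ ?_ ?_ htr
    · ext i j
      fin_cases i <;> fin_cases j <;> simp [Matrix.mul_apply, Fin.sum_univ_two] <;> grind
    · ext i j
      fin_cases i <;> fin_cases j <;> simp [Matrix.mul_apply, Fin.sum_univ_two] <;> grind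
    · rw [c0]
      ext i j
      fin_cases i <;> fin_cases j <;> simp [Matrix.mul_apply, Fin.sum_univ_two] <;> grind
    · rw [c1]
      simp [Matrix.mul_apply, Fin.sum_univ_two]
      grind
  · have hu := u.mul_inv
    generalize (u⁻¹).val = u' at hu
    refine exists_infEquation_of_normalForm t ⟨!![(u : R), 0; -α2, (t : R)],
      !![u', 0; α2 * t' * u', t'], ?_, ?_⟩ ?_ ?_ htr
    · ext i j
      fin_cases i <;> fin_cases j <;> simp [Matrix.mul_apply, Fin.sum_univ_two] <;> grind
    · ext i j
      fin_cases i <;> fin_cases j <;> simp [Matrix.mul_apply, Fin.sum_univ_two] <;> grind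
    · rw [c0]
      ext i j
      fin_cases i <;> fin_cases j <;> simp [Matrix.mul_apply, Fin.sum_univ_two] <;> grind
    · rw [c1]
      simp [Matrix.mul_apply, Fin.sum_univ_two]
      grind

end infinity

end DegPV

namespace DegPV

section local_

variable {R : Type} [CommRing R]

theorem mem_of_localization_span {s : Set R} (hs : Ideal.span s = ⊤) {I : Ideal R}
    (h : ∀ r ∈ s, ∃ n : ℕ, r ^ n ∈ I) : (1 : R) ∈ I := by
  rw [← Ideal.eq_top_iff_one, ← Ideal.radical_eq_top, eq_top_iff, ← hs, Ideal.span_le]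
  exact fun r hr => h r hr

theorem eq_of_localization_span {s : Set R} (hs : Ideal.span s = ⊤) {a b : R}
    (h : ∀ r ∈ s, algebraMap R (Localization.Away r) a = algebraMap R (Localization.Away r) b) :
    a = b := by
  have := mem_of_localization_span hs (I := LinearMap.ker (LinearMap.mulRight R (a - b))) (by
    intro r hr
    obtain ⟨⟨_, n, rfl⟩, hc⟩ := (IsLocalization.eq_iff_exists (Submonoid.powers r) _).1 (h r hr)
    refine ⟨n, ?_⟩
    simpa [mul_sub, sub_eq_zero] using hc)
  simpa [sub_eq_zero] using this

end local_

namespace BundleConnection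

variable {R : Type} [CommRing R]

theorem op_apply (D : BundleConnection R) (v : Fin 2 → R[X]) (i : Fin 2) :
    D.op v i = D.matrix i 0 * v 0 + D.matrix i 1 * v 1 + X * (X - 1) * derivative (v i) := by
  have h : v = v 0 • Pi.single 0 1 + v 1 • Pi.single 1 1 := by
    ext1 j
    fin_cases j <;> simp
  conv_lhs => rw [h]
  rw [map_add, D.leibniz, D.leibniz]
  simp only [Pi.add_apply, Pi.smul_apply, smul_eq_mul, matrix, Matrix.of_apply]
  fin_cases i <;> simp <;> ring

theorem ext_matrix {D E : BundleConnection R} (h : D.matrix = E.matrix) : D = E := by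
  have : D.op = E.op := by
    ext1 j
    ext : 3
    simp only [LinearMap.comp_apply, op_apply, h]
  cases D
  cases E
  cases this
  rfl

theorem degree_lt_succ_iff {p : R[X]} {n : ℕ} :
    p.degree < (n + 1 : ℕ) ↔ p.natDegree ≤ n := by
  rw [natDegree_le_iff_coeff_eq_zero, degree_lt_iff_coeff_zero]
  rfl

theorem mem_bundleSections {n : ℕ} {v : Fin 2 → R[X]} :
    v ∈ bundleSections R n ↔ (v 0).natDegree ≤ n ∧ (v 1).degree < n := by
  rw [← degree_lt_succ_iff, bundleSections]
  simp [mem_degreeLT]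

theorem degreeBounds (D : BundleConnection R) : DegreeBounds D.matrix := by
  have h0 := mem_bundleSections.1 (D.pole 0 (Pi.single 0 1) (by
    rw [mem_bundleSections]
    simp))
  have h1 := mem_bundleSections.1 (D.pole 1 (Pi.single 1 1) (by
    rw [mem_bundleSections]
    refine ⟨by simp, ?_⟩
    rw [degree_lt_succ_iff (n := 0)]
    simp))
  exact ⟨h0.1, h1.1, degree_lt_succ_iff.1 h0.2, degree_lt_succ_iff.1 h1.2⟩

/-- The connection with a given matrix. -/
noncomputable def ofMatrix (A : Matrix (Fin 2) (Fin 2) R[X]) (hA : DegreeBounds A) :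
    BundleConnection R where
  op :=
    { toFun := fun v i => A i 0 * v 0 + A i 1 * v 1 + X * (X - 1) * derivative (v i)
      map_add' := fun v w => by
        ext1 i
        simp only [Pi.add_apply, derivative_add]
        ring
      map_smul' := fun r v => by
        ext1 i
        simp only [Pi.smul_apply, derivative_smul, RingHom.id_apply, mul_smul_comm, smul_add] }
  leibniz f v := by
    ext1 i
    simp only [LinearMap.coe_mk, AddHom.coe_mk, Pi.add_apply, Pi.smul_apply, smul_eq_mul,
      derivative_mul]
    ring
  pole n v hv := by
    rw [mem_bundleSections] at hv ⊢
    have hX : (X * (X - 1) : R[X]).natDegree ≤ 2 := by compute_degree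
    simp only [LinearMap.coe_mk, AddHom.coe_mk]
    cases n with
    | zero =>
      have h1 : v 1 = 0 := by
        rw [← degree_eq_bot]
        simpa using hv.2
      have h0 : derivative (v 0) = 0 := derivative_of_natDegree_zero (Nat.le_zero.1 hv.1)
      rw [h1, h0]
      simp only [mul_zero, add_zero, derivative_zero]
      exact ⟨(natDegree_mul_le_of_le hA.deg00 hv.1).trans (by omega),
        degree_lt_succ_iff.2 ((natDegree_mul_le_of_le hA.deg10 hv.1).trans (by omega))⟩
    | succ n =>
      have h0 := hv.1
      have h1 := degree_lt_succ_iff.1 hv.2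
      have d0 : (derivative (v 0)).natDegree ≤ n := (natDegree_derivative_le _).trans (by omega)
      have d1 : (derivative (v 1)).natDegree ≤ n := (natDegree_derivative_le _).trans (by omega)
      refine ⟨natDegree_add_le_of_degree_le (natDegree_add_le_of_degree_le ?_ ?_) ?_,
        degree_lt_succ_iff.2
        (natDegree_add_le_of_degree_le (natDegree_add_le_of_degree_le ?_ ?_) ?_)⟩
      · exact (natDegree_mul_le_of_le hA.deg00 h0).trans (by omega)
      · exact (natDegree_mul_le_of_le hA.deg01 h1).trans (by omega)
      · exact (natDegree_mul_le_of_le hX d0).trans (by omega)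
      · exact (natDegree_mul_le_of_le hA.deg10 h0).trans (by omega)
      · exact (natDegree_mul_le_of_le hA.deg11 h1).trans (by omega)
      · exact (natDegree_mul_le_of_le hX d1).trans (by omega)

theorem matrix_ofMatrix (A : Matrix (Fin 2) (Fin 2) R[X]) (hA : DegreeBounds A) :
    (ofMatrix A hA).matrix = A := by
  ext1 i j
  rw [matrix, Matrix.of_apply]
  change A i 0 * (Pi.single j 1 : Fin 2 → R[X]) 0 + A i 1 * (Pi.single j 1 : Fin 2 → R[X]) 1 +
    X * (X - 1) * derivative ((Pi.single j 1 : Fin 2 → R[X]) i) = A i j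
  fin_cases j <;> fin_cases i <;> simp

end BundleConnection

section familyMatrix

section

variable {R : Type} [CommRing R]

theorem charpoly_eq_iff (B : Matrix (Fin 2) (Fin 2) R) (c : R) :
    B.charpoly = X ^ 2 - C c ↔ B 0 0 + B 1 1 = 0 ∧ B 0 0 * B 1 1 - B 0 1 * B 1 0 = -c := by
  nontriviality R
  rw [Matrix.charpoly_fin_two, Matrix.trace_fin_two, Matrix.det_fin_two]
  constructor
  · intro h
    have h0 := congrArg (fun p => coeff p 0) h
    have h1 := congrArg (fun p => coeff p 1) h
    simp [coeff_X, coeff_C] at h0 h1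
    constructor
    · linear_combination -h1
    · linear_combination h0
  · rintro ⟨h0, h1⟩
    rw [h0, h1]
    simp [sub_eq_add_neg]

theorem eq_of_natDegree_le_two {p q : R[X]} (hp : p.natDegree ≤ 2) (hq : q.natDegree ≤ 2)
    (h0 : p.coeff 0 = q.coeff 0) (h1 : p.coeff 1 = q.coeff 1) (h2 : p.coeff 2 = q.coeff 2) :
    p = q := by
  ext n
  match n with
  | 0 => exact h0
  | 1 => exact h1
  | 2 => exact h2
  | n + 3 =>
    rw [coeff_eq_zero_of_natDegree_lt (by omega), coeff_eq_zero_of_natDegree_lt (by omega)]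

end

variable (θ₀ θ₁ : ℂ) {R : Type} [CommRing R] [Algebra ℂ R]

/-- The conditions on the matrix `A` and the unit `t` for a family of connections. -/
structure IsFamilyMatrix (A : Matrix (Fin 2) (Fin 2) R[X]) (t : R) : Prop extends
    InfConditions A t where
  trace : A 1 1 = -A 0 0
  zero : (A 0 0).coeff 0 ^ 2 + (A 0 1).coeff 0 * (A 1 0).coeff 0 = algebraMap ℂ R (θ₀ ^ 2 / 4)
  one : (A 0 0).eval 1 ^ 2 + (A 0 1).eval 1 * (A 1 0).eval 1 = algebraMap ℂ R (θ₁ ^ 2 / 4)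

variable {θ₀ θ₁}

theorem Family.isFamilyMatrix (x : Family θ₀ θ₁ R) :
    IsFamilyMatrix θ₀ θ₁ x.conn.matrix (x.t : R) := by
  have hb := x.conn.degreeBounds
  obtain ⟨s, hs, h⟩ := x.at_infty
  have key : ∀ r ∈ s, InfConditions
      (x.conn.matrix.map (Polynomial.map (algebraMap R (Localization.Away r))))
      (algebraMap R (Localization.Away r) x.t) := by
    intro r hr
    have hb' : DegreeBounds
        (x.conn.matrix.map (Polynomial.map (algebraMap R (Localization.Away r)))) :=
      ⟨natDegree_map_le.trans hb.deg00, natDegree_map_le.trans hb.deg01,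
        natDegree_map_le.trans hb.deg10, natDegree_map_le.trans hb.deg11⟩
    obtain ⟨g, hg⟩ := (hasInfModel_iff hb' _).1 (h r hr)
    exact hg.conditions hb' g
  have hinf : InfConditions x.conn.matrix (x.t : R) := by
    refine { hb with trace_two := ?_, trace_one := ?_, det_four := ?_, det_three := ?_ } <;>
      refine eq_of_localization_span hs fun r hr => ?_
    · simpa using (key r hr).trace_two
    · simpa using (key r hr).trace_one
    · simpa using (key r hr).det_four
    · simpa [map_ofNat] using (key r hr).det_three
  obtain ⟨z1, z2⟩ := (charpoly_eq_iff _ _).1 x.at_zero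
  obtain ⟨o1, o2⟩ := (charpoly_eq_iff _ _).1 x.at_one
  simp only [BundleConnection.residueZero, BundleConnection.residueOne, Matrix.neg_apply,
    Matrix.map_apply, ← coeff_zero_eq_eval_zero] at z1 z2 o1 o2
  have ht : x.conn.matrix 1 1 = -x.conn.matrix 0 0 := by
    refine eq_of_natDegree_le_two hb.deg11 (by rw [natDegree_neg]; exact hb.deg00) ?_ ?_ ?_
    · rw [coeff_neg]
      linear_combination -z1
    · rw [coeff_neg]
      linear_combination hinf.trace_one
    · rw [coeff_neg]
      linear_combination hinf.trace_two
  rw [ht] at z2 o2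
  refine { hinf with trace := ht, zero := ?_, one := ?_ }
  · rw [coeff_neg] at z2
    linear_combination -z2
  · rw [eval_neg] at o2
    linear_combination -o2

theorem Family.ext_matrix {x y : Family θ₀ θ₁ R} (h : x.conn.matrix = y.conn.matrix)
    (ht : x.t = y.t) : x = y := by
  cases x
  cases y
  cases ht
  cases BundleConnection.ext_matrix h
  rfl

theorem IsFamilyMatrix.map {R' : Type} [CommRing R'] [Algebra ℂ R'] (φ : R →+* R')
    (hφ : ∀ c, φ (algebraMap ℂ R c) = algebraMap ℂ R' c) {A : Matrix (Fin 2) (Fin 2) R[X]} {t : R}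
    (h : IsFamilyMatrix θ₀ θ₁ A t) : IsFamilyMatrix θ₀ θ₁ (A.map (Polynomial.map φ)) (φ t) where
  deg00 := natDegree_map_le.trans h.deg00
  deg01 := natDegree_map_le.trans h.deg01
  deg10 := natDegree_map_le.trans h.deg10
  deg11 := natDegree_map_le.trans h.deg11
  trace_two := by simpa using congrArg φ h.trace_two
  trace_one := by simpa using congrArg φ h.trace_one
  det_four := by simpa using congrArg φ h.det_four
  det_three := by simpa [map_ofNat] using congrArg φ h.det_three
  trace := by simp [h.trace]
  zero := by
    have := congrArg φ h.zero
    rw [hφ] at this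
    simpa using this
  one := by
    have := congrArg φ h.one
    rw [hφ] at this
    simpa [Polynomial.eval_one_map] using this

theorem IsFamilyMatrix.span_eq_top {A : Matrix (Fin 2) (Fin 2) R[X]} {t : Rˣ}
    (h : IsFamilyMatrix θ₀ θ₁ A (t : R)) :
    Ideal.span {(A 1 0).coeff 1, (A 0 1).coeff 3} = ⊤ := by
  rw [Ideal.eq_top_iff_one]
  have h4 := h.det_four
  have h3 := h.det_three
  generalize (A 0 0).coeff 2 = α2, (A 0 0).coeff 1 = α1, (A 0 1).coeff 3 = β3,
    (A 0 1).coeff 2 = β2, (A 1 0).coeff 1 = γ1, (A 1 0).coeff 0 = γ0 at *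
  have ht := t.inv_mul
  rw [Ideal.mem_span_pair]
  generalize (t⁻¹).val = t' at *
  generalize t.val = t at *
  refine ⟨t' ^ 4 * (-β3 * (2 * α1 + 1) ^ 2 + β2 * (t ^ 2 + (2 * α1 + 1) * α2)),
    t' ^ 4 * (γ0 * (t ^ 2 + (2 * α1 + 1) * α2)), ?_⟩
  linear_combination (-t' ^ 4 * (2 * α1 + 1) ^ 2) * h4 +
    (t' ^ 4 * (t ^ 2 + (2 * α1 + 1) * α2)) * h3 + (t' * t + 1) * (t' ^ 2 * t ^ 2 + 1) * ht

theorem IsFamilyMatrix.exists_family {A : Matrix (Fin 2) (Fin 2) R[X]} {t : Rˣ}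
    (h : IsFamilyMatrix θ₀ θ₁ A (t : R)) :
    ∃ x : Family θ₀ θ₁ R, x.conn.matrix = A ∧ x.t = t := by
  have hA := BundleConnection.matrix_ofMatrix A h.toDegreeBounds
  refine ⟨⟨BundleConnection.ofMatrix A h.toDegreeBounds, t, ?_, ?_, _, h.span_eq_top, ?_⟩, hA, rfl⟩
  · rw [charpoly_eq_iff]
    simp only [BundleConnection.residueZero, Matrix.neg_apply, hA,
      Matrix.map_apply, ← coeff_zero_eq_eval_zero, h.trace, coeff_neg]
    exact ⟨by ring, by linear_combination -h.zero⟩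
  · rw [charpoly_eq_iff]
    simp only [BundleConnection.residueOne, hA,
      Matrix.map_apply, h.trace, eval_neg]
    exact ⟨by ring, by linear_combination -h.one⟩
  · intro r hr
    have h' := h.map (algebraMap R (Localization.Away r)) fun c =>
      (IsScalarTower.algebraMap_apply ℂ R (Localization.Away r) c).symm
    rw [hA, hasInfModel_iff h'.toDegreeBounds]
    refine InfConditions.exists_infEquation
      (t := Units.map (algebraMap R (Localization.Away r)).toMonoidHom t) h'.toInfConditions ?_
    have hu := IsLocalization.Away.algebraMap_isUnit (S := Localization.Away r) r
    rcases hr with rfl | rfl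
    · left
      simpa using hu
    · right
      simpa using hu

end familyMatrix

end DegPV

namespace DegPV

/-- The coefficients of a trace free matrix `(α, β; γ, -α)` with
`deg α ≤ 2`, `deg β ≤ 3`, `deg γ ≤ 1`. -/
@[ext]
structure Coeffs (R : Type) where
  (a0 a1 a2 b0 b1 b2 b3 g0 g1 : R)

namespace Coeffs

variable {R : Type} [CommRing R]

/-- The matrix with the given coefficients. -/
noncomputable def matrix (c : Coeffs R) : Matrix (Fin 2) (Fin 2) R[X] :=
  !![C c.a0 + C c.a1 * X + C c.a2 * X ^ 2,
      C c.b0 + C c.b1 * X + C c.b2 * X ^ 2 + C c.b3 * X ^ 3;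
    C c.g0 + C c.g1 * X, -(C c.a0 + C c.a1 * X + C c.a2 * X ^ 2)]

/-- The image of the coefficients under a homomorphism. -/
@[simps]
def map {R' : Type} [CommRing R'] (φ : R →+* R') (c : Coeffs R) : Coeffs R' :=
  ⟨φ c.a0, φ c.a1, φ c.a2, φ c.b0, φ c.b1, φ c.b2, φ c.b3, φ c.g0, φ c.g1⟩

/-- The equations for the coefficients of a family. -/
structure Eqs [Algebra ℂ R] (θ₀ θ₁ : ℂ) (c : Coeffs R) (t : R) : Prop where
  four : c.a2 ^ 2 + c.b3 * c.g1 = 0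
  three : 2 * c.a2 * c.a1 + c.b3 * c.g0 + c.b2 * c.g1 + c.a2 = t ^ 2
  zero : c.a0 ^ 2 + c.b0 * c.g0 = algebraMap ℂ R (θ₀ ^ 2 / 4)
  one : (c.a0 + c.a1 + c.a2) ^ 2 + (c.b0 + c.b1 + c.b2 + c.b3) * (c.g0 + c.g1) =
    algebraMap ℂ R (θ₁ ^ 2 / 4)

/-- The equations saying that the automorphism `(u, l₀ + l₁ z; 0, 1)` of `V` carries one connection
to another. -/
structure Rel (u l0 l1 : R) (c c' : Coeffs R) : Prop where
  g0 : u * c'.g0 = c.g0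
  g1 : u * c'.g1 = c.g1
  a0 : c.a0 + l0 * c'.g0 = c'.a0
  a1 : c.a1 + l0 * c'.g1 + l1 * c'.g0 = c'.a1
  a2 : c.a2 + l1 * c'.g1 = c'.a2
  b0 : u * c.b0 - l0 * (c.a0 + c'.a0) = c'.b0
  b1 : u * c.b1 - l0 * (c.a1 + c'.a1) - l1 * (c.a0 + c'.a0) + l1 = c'.b1
  b2 : u * c.b2 - l0 * (c.a2 + c'.a2) - l1 * (c.a1 + c'.a1) - l1 = c'.b2
  b3 : u * c.b3 - l1 * (c.a2 + c'.a2) = c'.b3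

theorem coeff_matrix (c : Coeffs R) :
    (c.matrix 0 0).coeff 0 = c.a0 ∧ (c.matrix 0 0).coeff 1 = c.a1 ∧ (c.matrix 0 0).coeff 2 = c.a2 ∧
    (c.matrix 0 1).coeff 0 = c.b0 ∧ (c.matrix 0 1).coeff 1 = c.b1 ∧ (c.matrix 0 1).coeff 2 = c.b2 ∧
    (c.matrix 0 1).coeff 3 = c.b3 ∧ (c.matrix 1 0).coeff 0 = c.g0 ∧
    (c.matrix 1 0).coeff 1 = c.g1 := by
  refine ⟨?_, ?_, ?_, ?_, ?_, ?_, ?_, ?_, ?_⟩ <;>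
    simp [matrix, coeff_X, coeff_C, coeff_X_pow]

theorem matrix_injective {c c' : Coeffs R} (h : c.matrix = c'.matrix) : c = c' := by
  obtain ⟨h1, h2, h3, h4, h5, h6, h7, h8, h9⟩ := c.coeff_matrix
  obtain ⟨h1', h2', h3', h4', h5', h6', h7', h8', h9'⟩ := c'.coeff_matrix
  rw [← h] at h1' h2' h3' h4' h5' h6' h7' h8' h9'
  ext
  exacts [h1.symm.trans h1', h2.symm.trans h2', h3.symm.trans h3', h4.symm.trans h4',
    h5.symm.trans h5', h6.symm.trans h6', h7.symm.trans h7', h8.symm.trans h8', h9.symm.trans h9']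

theorem degreeBounds (c : Coeffs R) : DegreeBounds c.matrix where
  deg00 := by simp only [matrix, Matrix.of_apply, Matrix.cons_val', Matrix.cons_val_zero,
    Matrix.cons_val_fin_one]; compute_degree
  deg01 := by simp only [matrix, Matrix.of_apply, Matrix.cons_val', Matrix.cons_val_zero,
    Matrix.cons_val_one, Matrix.cons_val_fin_one]; compute_degree
  deg10 := by simp only [matrix, Matrix.of_apply, Matrix.cons_val', Matrix.cons_val_zero,
    Matrix.cons_val_one, Matrix.cons_val_fin_one]; compute_degree
  deg11 := by simp only [matrix, Matrix.of_apply, Matrix.cons_val', Matrix.cons_val_one,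
    Matrix.cons_val_fin_one]; compute_degree

theorem matrix_map {R' : Type} [CommRing R'] (φ : R →+* R') (c : Coeffs R) :
    (c.map φ).matrix = c.matrix.map (Polynomial.map φ) := by
  ext1 i j
  fin_cases i <;> fin_cases j <;> simp [matrix]

/-- The coefficients of a matrix. -/
noncomputable def ofMatrix (A : Matrix (Fin 2) (Fin 2) R[X]) : Coeffs R :=
  ⟨(A 0 0).coeff 0, (A 0 0).coeff 1, (A 0 0).coeff 2, (A 0 1).coeff 0, (A 0 1).coeff 1,
    (A 0 1).coeff 2, (A 0 1).coeff 3, (A 1 0).coeff 0, (A 1 0).coeff 1⟩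

theorem matrix_ofMatrix {A : Matrix (Fin 2) (Fin 2) R[X]} (hA : DegreeBounds A)
    (h : A 1 1 = -A 0 0) : (ofMatrix A).matrix = A := by
  have key : C ((A 0 0).coeff 0) + C ((A 0 0).coeff 1) * X + C ((A 0 0).coeff 2) * X ^ 2 =
      A 0 0 := by
    conv_rhs => rw [(A 0 0).as_sum_range_C_mul_X_pow' (Nat.lt_succ_of_le hA.deg00)]
    simp [Finset.sum_range_succ]
  ext1 i j
  fin_cases i <;> fin_cases j
  · exact key
  · change C ((A 0 1).coeff 0) + C ((A 0 1).coeff 1) * X + C ((A 0 1).coeff 2) * X ^ 2 +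
      C ((A 0 1).coeff 3) * X ^ 3 = A 0 1
    conv_rhs => rw [(A 0 1).as_sum_range_C_mul_X_pow' (Nat.lt_succ_of_le hA.deg01)]
    simp [Finset.sum_range_succ]
  · change C ((A 1 0).coeff 0) + C ((A 1 0).coeff 1) * X = A 1 0
    conv_rhs => rw [(A 1 0).as_sum_range_C_mul_X_pow' (Nat.lt_succ_of_le hA.deg10)]
    simp [Finset.sum_range_succ]
  · exact (congrArg Neg.neg key).trans h.symm

variable [Algebra ℂ R] {θ₀ θ₁ : ℂ}

theorem isFamilyMatrix_iff (c : Coeffs R) (t : R) :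
    IsFamilyMatrix θ₀ θ₁ c.matrix t ↔ c.Eqs θ₀ θ₁ t := by
  obtain ⟨h1, h2, h3, h4, h5, h6, h7, h8, h9⟩ := c.coeff_matrix
  have htr : c.matrix 1 1 = -c.matrix 0 0 := rfl
  have e0 : (c.matrix 0 0).eval 1 = c.a0 + c.a1 + c.a2 := by simp [matrix]
  have e1 : (c.matrix 0 1).eval 1 = c.b0 + c.b1 + c.b2 + c.b3 := by simp [matrix]
  have e2 : (c.matrix 1 0).eval 1 = c.g0 + c.g1 := by simp [matrix]
  constructor
  · intro h
    refine ⟨?_, ?_, ?_, ?_⟩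
    · simpa only [h1, h2, h3, h4, h5, h6, h7, h8, h9] using h.det_four
    · simpa only [h1, h2, h3, h4, h5, h6, h7, h8, h9] using h.det_three
    · simpa only [h1, h2, h3, h4, h5, h6, h7, h8, h9] using h.zero
    · simpa only [e0, e1, e2] using h.one
  · intro h
    refine { c.degreeBounds with
      trace_two := ?_
      trace_one := ?_
      det_four := ?_
      det_three := ?_
      trace := htr
      zero := ?_
      one := ?_ }
    · rw [htr, coeff_neg, add_neg_cancel]
    · rw [htr, coeff_neg, add_neg_cancel]
    · simpa only [h1, h2, h3, h4, h5, h6, h7, h8, h9] using h.four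
    · simpa only [h1, h2, h3, h4, h5, h6, h7, h8, h9] using h.three
    · simpa only [h1, h2, h3, h4, h5, h6, h7, h8, h9] using h.zero
    · simpa only [e0, e1, e2] using h.one

theorem Eqs.map {R' : Type} [CommRing R'] [Algebra ℂ R'] (φ : R →+* R')
    (hφ : ∀ x, φ (algebraMap ℂ R x) = algebraMap ℂ R' x) {c : Coeffs R} {t : R}
    (h : c.Eqs θ₀ θ₁ t) : (c.map φ).Eqs θ₀ θ₁ (φ t) := by
  rw [← isFamilyMatrix_iff] at h ⊢
  rw [matrix_map]
  exact h.map φ hφ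

theorem Eqs.span_eq_top {c : Coeffs R} {t : Rˣ} (h : c.Eqs θ₀ θ₁ (t : R)) :
    Ideal.span {c.g0, c.g1} = ⊤ := by
  rw [Ideal.eq_top_iff_one]
  have h4 := h.four
  have h3 := h.three
  have ht := t.inv_mul
  rw [Ideal.mem_span_pair]
  generalize (t⁻¹).val = t' at *
  generalize t.val = t at *
  refine ⟨t' ^ 4 * (c.b3 * (t ^ 2 + (2 * c.a1 + 1) * c.a2)),
    t' ^ 4 * (-c.b3 * (2 * c.a1 + 1) ^ 2 + c.b2 * (t ^ 2 + (2 * c.a1 + 1) * c.a2)), ?_⟩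
  linear_combination (-t' ^ 4 * (2 * c.a1 + 1) ^ 2) * h4 +
    (t' ^ 4 * (t ^ 2 + (2 * c.a1 + 1) * c.a2)) * h3 + (t' * t + 1) * (t' ^ 2 * t ^ 2 + 1) * ht

omit [Algebra ℂ R] in
theorem Rel.isUnit {u l0 l1 : R} {c c' : Coeffs R} (h : Rel u l0 l1 c c')
    (hc : Ideal.span {c.g0, c.g1} = ⊤) : IsUnit u := by
  rw [Ideal.eq_top_iff_one, Ideal.mem_span_pair] at hc
  obtain ⟨a, b, hab⟩ := hc
  refine IsUnit.of_mul_eq_one (a * c'.g0 + b * c'.g1) ?_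
  rw [← hab, ← h.g0, ← h.g1]
  ring

/-! ### Coordinates -/

section coordinates

variable (c : Coeffs R) (i : R)

/-- The coordinates of the first chart; `i` is the inverse of `g₁`. -/
def coord1 : Fin 3 → R :=
  ![c.a0 - c.g0 * i * (c.a1 - c.a2 * (c.g0 * i)), c.g0 * i,
    c.b1 * c.g1 + (c.a1 - c.a2 * (c.g0 * i)) * c.a1 + c.a2 * c.a0 +
      c.a2 * (c.a0 - c.g0 * i * (c.a1 - c.a2 * (c.g0 * i))) - c.a2]

/-- The coordinates of the second chart; `i` is the inverse of `g₀`. -/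
def coord2 : Fin 3 → R :=
  ![c.a2 - c.g1 * i * (c.a1 - c.g1 * i * c.a0), c.g1 * i,
    c.g0 * c.b1 + c.a0 * c.a1 + (c.a1 - c.g1 * i * c.a0) * c.a0 - (c.a1 - c.g1 * i * c.a0)]

/-- The normal form for given coordinates of the first chart. -/
noncomputable def normal1 (θ₀ θ₁ : ℂ) (t a b c : R) : Coeffs R :=
  ⟨a, 0, 0, -algebraMap ℂ R (θ₀ ^ 2 / 4) + algebraMap ℂ R (θ₁ ^ 2 / 4) - c - t ^ 2 - b * c -
    b * t ^ 2, c, t ^ 2, 0, b, 1⟩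

/-- The normal form for given coordinates of the second chart. -/
noncomputable def normal2 (θ₀ θ₁ : ℂ) (t a b c : R) : Coeffs R :=
  ⟨0, 0, a, algebraMap ℂ R (θ₀ ^ 2 / 4), c, -c - t ^ 2 - b * algebraMap ℂ R (θ₀ ^ 2 / 4) - b * c +
    a - algebraMap ℂ R (θ₀ ^ 2 / 4) + algebraMap ℂ R (θ₁ ^ 2 / 4),
    t ^ 2 - b * (-c - t ^ 2 - b * algebraMap ℂ R (θ₀ ^ 2 / 4) - b * c +
    a - algebraMap ℂ R (θ₀ ^ 2 / 4) + algebraMap ℂ R (θ₁ ^ 2 / 4)) - a, 1, b⟩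

variable {c i}

theorem Eqs.eq1 {t : R} (h : c.Eqs θ₀ θ₁ t) (hi : c.g1 * i = 1) :
    Eq1 θ₀ θ₁ t (c.coord1 i 0) (c.coord1 i 1) (c.coord1 i 2) := by
  obtain ⟨h1, h2, h3, h4⟩ := h
  simp only [Eq1, coord1, Matrix.cons_val]
  grind

theorem Eqs.eq2 {t : R} (h : c.Eqs θ₀ θ₁ t) (hi : c.g0 * i = 1) :
    Eq2 θ₀ θ₁ t (c.coord2 i 0) (c.coord2 i 1) (c.coord2 i 2) := by
  obtain ⟨h1, h2, h3, h4⟩ := h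
  simp only [Eq2, coord2, Matrix.cons_val]
  grind

theorem Eqs.rel1 {t : R} (h : c.Eqs θ₀ θ₁ t) (hi : c.g1 * i = 1) :
    Rel c.g1 (-(c.a1 - c.a2 * (c.g0 * i))) (-c.a2) c
      (normal1 θ₀ θ₁ t (c.coord1 i 0) (c.coord1 i 1) (c.coord1 i 2)) := by
  obtain ⟨h1, h2, h3, h4⟩ := h
  constructor <;> simp only [normal1, coord1, Matrix.cons_val] <;> grind

theorem Eqs.rel2 {t : R} (h : c.Eqs θ₀ θ₁ t) (hi : c.g0 * i = 1) :
    Rel c.g0 (-c.a0) (-(c.a1 - c.g1 * i * c.a0)) c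
      (normal2 θ₀ θ₁ t (c.coord2 i 0) (c.coord2 i 1) (c.coord2 i 2)) := by
  obtain ⟨h1, h2, h3, h4⟩ := h
  constructor <;> simp only [normal2, coord2, Matrix.cons_val] <;> grind

theorem eqs_normal1 {t a b d : R} (h : Eq1 θ₀ θ₁ t a b d) :
    (normal1 θ₀ θ₁ t a b d).Eqs θ₀ θ₁ t := by
  rw [Eq1] at h
  constructor <;> simp only [normal1] <;> grind

theorem eqs_normal2 {t a b d : R} (h : Eq2 θ₀ θ₁ t a b d) :
    (normal2 θ₀ θ₁ t a b d).Eqs θ₀ θ₁ t := by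
  rw [Eq2] at h
  constructor <;> simp only [normal2] <;> grind

omit [Algebra ℂ R] in
theorem Rel.coord1_eq {u l0 l1 : R} {c' : Coeffs R} (h : Rel u l0 l1 c c') {i' : R}
    (hi : c.g1 * i = 1) (hi' : c'.g1 * i' = 1) : c.coord1 i = c'.coord1 i' := by
  obtain ⟨h1, h2, h3, h4, h5, h6, h7, h8, h9⟩ := h
  ext k
  fin_cases k <;> simp only [coord1, Matrix.cons_val, Fin.zero_eta, Fin.mk_one, Fin.reduceFinMk] <;>
    grind

omit [Algebra ℂ R] in
theorem Rel.coord2_eq {u l0 l1 : R} {c' : Coeffs R} (h : Rel u l0 l1 c c') {i' : R}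
    (hi : c.g0 * i = 1) (hi' : c'.g0 * i' = 1) : c.coord2 i = c'.coord2 i' := by
  obtain ⟨h1, h2, h3, h4, h5, h6, h7, h8, h9⟩ := h
  ext k
  fin_cases k <;> simp only [coord2, Matrix.cons_val, Fin.zero_eta, Fin.mk_one, Fin.reduceFinMk] <;>
    grind

omit [Algebra ℂ R] in
/-- The relation between the coordinates of both charts. -/
theorem coord2_eq {j : R} (hi : c.g1 * i = 1) (hj : c.g0 * j = 1) :
    c.coord1 i 1 * c.coord2 j 1 = 1 ∧ c.coord2 j 0 = c.coord1 i 0 * c.coord2 j 1 ^ 2 ∧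
      c.coord2 j 2 = c.coord1 i 1 * c.coord1 i 2 +
        (c.coord1 i 0 - c.coord1 i 0 ^ 2) * c.coord2 j 1 := by
  simp only [coord1, coord2, Matrix.cons_val]
  refine ⟨?_, ?_, ?_⟩ <;> grind

omit [Algebra ℂ R] in
theorem Rel.symm {u u' l0 l1 : R} {c' : Coeffs R} (h : Rel u l0 l1 c c') (hu : u * u' = 1) :
    Rel u' (-l0 * u') (-l1 * u') c' c := by
  obtain ⟨h1, h2, h3, h4, h5, h6, h7, h8, h9⟩ := h
  constructor
  · linear_combination (-u') * h1 + c'.g0 * hu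
  · linear_combination (-u') * h2 + c'.g1 * hu
  · linear_combination (-1 : R) * h3 + (l0 * u') * h1 - l0 * c'.g0 * hu
  · linear_combination (-1 : R) * h4 + (l0 * u') * h2 + (l1 * u') * h1 -
      (l0 * c'.g1 + l1 * c'.g0) * hu
  · linear_combination (-1 : R) * h5 + (l1 * u') * h2 - l1 * c'.g1 * hu
  · linear_combination (-u') * h6 + c.b0 * hu
  · linear_combination (-u') * h7 + c.b1 * hu
  · linear_combination (-u') * h8 + c.b2 * hu
  · linear_combination (-u') * h9 + c.b3 * hu

omit [Algebra ℂ R] in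
theorem Rel.trans {u l0 l1 v m0 m1 : R} {c' c'' : Coeffs R} (h : Rel u l0 l1 c c')
    (h' : Rel v m0 m1 c' c'') : Rel (u * v) (l0 * v + m0) (l1 * v + m1) c c'' := by
  obtain ⟨h1, h2, h3, h4, h5, h6, h7, h8, h9⟩ := h
  obtain ⟨h1', h2', h3', h4', h5', h6', h7', h8', h9'⟩ := h'
  constructor
  · linear_combination u * h1' + h1
  · linear_combination u * h2' + h2
  · linear_combination h3 + h3' + l0 * h1'
  · linear_combination h4 + h4' + l0 * h2' + l1 * h1'
  · linear_combination h5 + h5' + l1 * h2'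
  · linear_combination v * h6 + h6' + v * l0 * h3' - m0 * h3 - l0 * m0 * h1'
  · linear_combination v * h7 + h7' + v * l0 * h4' - m0 * h4 + v * l1 * h3' - m1 * h3 -
      l0 * m0 * h2' - (l0 * m1 + l1 * m0) * h1'
  · linear_combination v * h8 + h8' + v * l0 * h5' - m0 * h5 + v * l1 * h4' - m1 * h4 -
      (l0 * m1 + l1 * m0) * h2' - l1 * m1 * h1'
  · linear_combination v * h9 + h9' + v * l1 * h5' - m1 * h5 - l1 * m1 * h2'

end coordinates

end Coeffs

end DegPV

namespace DegPV

/-! ### Morphisms on a standard open cover of an affine scheme -/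

section cover

variable {R : Type} [CommRing R] {X : Scheme.{0}}

theorem hom_ext_of_span {s : Set R} (hs : Ideal.span s = ⊤) {f g : Spec (CommRingCat.of R) ⟶ X}
    (h : ∀ r ∈ s, Spec.map (CommRingCat.ofHom (algebraMap R (Localization.Away r))) ≫ f =
      Spec.map (CommRingCat.ofHom (algebraMap R (Localization.Away r))) ≫ g) : f = g :=
  Scheme.Cover.hom_ext (Scheme.affineOpenCoverOfSpanRangeEqTop (R := CommRingCat.of R)
    (fun r : s => (r : R)) (by rwa [Subtype.range_coe])).openCover _ _ fun r : s => h r r.2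

theorem exists_glue {ι : Type} (s : ι → R) (hs : Ideal.span (Set.range s) = ⊤)
    (f : ∀ i, Spec (CommRingCat.of (Localization.Away (s i))) ⟶ X)
    (hf : ∀ i j (B : Type) [CommRing B] (φ : Localization.Away (s i) →+* B)
      (ψ : Localization.Away (s j) →+* B), φ.comp (algebraMap R _) = ψ.comp (algebraMap R _) →
      Spec.map (CommRingCat.ofHom φ) ≫ f i = Spec.map (CommRingCat.ofHom ψ) ≫ f j) :
    ∃ F : Spec (CommRingCat.of R) ⟶ X, ∀ i,
      Spec.map (CommRingCat.ofHom (algebraMap R (Localization.Away (s i)))) ≫ F = f i := by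
  let 𝒰 := (Scheme.affineOpenCoverOfSpanRangeEqTop (R := CommRingCat.of R) s hs).openCover
  refine ⟨Scheme.Cover.glueMorphisms 𝒰 f fun (i j : ι) => ?_,
    fun i => Scheme.Cover.ι_glueMorphisms 𝒰 f _ i⟩
  let e := pullbackSpecIso R (Localization.Away (s i)) (Localization.Away (s j))
  have h1 : e.inv ≫ pullback.fst (𝒰.f i) (𝒰.f j) = _ := pullbackSpecIso_inv_fst _ _ _
  have h2 : e.inv ≫ pullback.snd (𝒰.f i) (𝒰.f j) = _ := pullbackSpecIso_inv_snd _ _ _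
  refine (cancel_epi e.inv).1 ?_
  have h3 := hf i j _ (Algebra.TensorProduct.includeLeftRingHom (R := R))
    (Algebra.TensorProduct.includeRight (R := R) (A := Localization.Away (s i))
      (B := Localization.Away (s j))).toRingHom (by
        ext r
        exact (Algebra.TensorProduct.includeRight (R := R) (A := Localization.Away (s i))
          (B := Localization.Away (s j))).commutes r |>.symm)
  refine (Category.assoc _ _ _).symm.trans (Eq.trans ?_ (Category.assoc _ _ _))
  exact (congrArg (· ≫ f i) h1).trans (h3.trans (congrArg (· ≫ f j) h2).symm)

end cover

/-! ### The classifying morphism -/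

noncomputable section classifying

variable {θ₀ θ₁ : ℂ} {R : Type} [CommRing R] [Algebra ℂ R]

namespace Coeffs

/-- The point of the first chart defined by a connection with `γ₁` invertible. -/
def chartHom1 {c : Coeffs R} {t : Rˣ} (h : c.Eqs θ₀ θ₁ (t : R)) {i : R} (hi : c.g1 * i = 1) :
    Chart1 θ₀ θ₁ →+* R :=
  point1 t _ _ _ (h.eq1 hi)

/-- The point of the second chart defined by a connection with `γ₀` invertible. -/
def chartHom2 {c : Coeffs R} {t : Rˣ} (h : c.Eqs θ₀ θ₁ (t : R)) {i : R} (hi : c.g0 * i = 1) :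
    Chart2 θ₀ θ₁ →+* R :=
  point2 t _ _ _ (h.eq2 hi)

variable {c : Coeffs R} {t : Rˣ} (h : c.Eqs θ₀ θ₁ (t : R)) {i j : R}

theorem chartHom1_x1 (hi : c.g1 * i = 1) (k : Fin 3) :
    chartHom1 h hi (x1 θ₀ θ₁ k) = c.coord1 i k := by
  fin_cases k
  exacts [point1_zero _ _ _ _ _, point1_one _ _ _ _ _, point1_two _ _ _ _ _]

theorem chartHom2_x2 (hi : c.g0 * i = 1) (k : Fin 3) :
    chartHom2 h hi (x2 θ₀ θ₁ k) = c.coord2 i k := by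
  fin_cases k
  exacts [point2_zero _ _ _ _ _, point2_one _ _ _ _ _, point2_two _ _ _ _ _]

theorem chartHom1_kk (hi : c.g1 * i = 1) (x : ℂ) :
    chartHom1 h hi (kk _ x) = algebraMap ℂ R x := point1_kk _ _ _ _ _ _

theorem chartHom1_tt (hi : c.g1 * i = 1) : chartHom1 h hi (tt _) = t := point1_tt _ _ _ _ _

theorem chartHom2_kk (hi : c.g0 * i = 1) (x : ℂ) :
    chartHom2 h hi (kk _ x) = algebraMap ℂ R x := point2_kk _ _ _ _ _ _

theorem chartHom2_tt (hi : c.g0 * i = 1) : chartHom2 h hi (tt _) = t := point2_tt _ _ _ _ _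

theorem eq_chartHom1 {φ : Chart1 θ₀ θ₁ →+* R} (hi : c.g1 * i = 1)
    (hk : ∀ x, φ (kk _ x) = algebraMap ℂ R x) (ht : φ (tt _) = t)
    (hx : ∀ k, φ (x1 θ₀ θ₁ k) = c.coord1 i k) : φ = chartHom1 h hi := by
  refine chart1_ringHom_ext (fun x => ?_) ?_ fun k => ?_
  · rw [hk, chartHom1_kk]
  · rw [ht, chartHom1_tt]
  · rw [hx, chartHom1_x1]

theorem eq_chartHom2 {φ : Chart2 θ₀ θ₁ →+* R} (hi : c.g0 * i = 1)
    (hk : ∀ x, φ (kk _ x) = algebraMap ℂ R x) (ht : φ (tt _) = t)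
    (hx : ∀ k, φ (x2 θ₀ θ₁ k) = c.coord2 i k) : φ = chartHom2 h hi := by
  refine chart2_ringHom_ext (fun x => ?_) ?_ fun k => ?_
  · rw [hk, chartHom2_kk]
  · rw [ht, chartHom2_tt]
  · rw [hx, chartHom2_x2]

theorem comp_chartHom1 {B : Type} [CommRing B] [Algebra ℂ B] (ψ : R →+* B)
    (hψ : ∀ x, ψ (algebraMap ℂ R x) = algebraMap ℂ B x) {t' : Bˣ} (ht : ψ t = t')
    (h' : (c.map ψ).Eqs θ₀ θ₁ (t' : B)) {i' : B} (hi : c.g1 * i = 1)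
    (hi' : (c.map ψ).g1 * i' = 1) : ψ.comp (chartHom1 h hi) = chartHom1 h' hi' := by
  have hii : i' = ψ i := by
    have h1 := congrArg ψ hi
    rw [map_mul, map_one] at h1
    change ψ c.g1 * i' = 1 at hi'
    linear_combination ψ i * hi' - i' * h1
  subst hii
  refine eq_chartHom1 h' hi' (fun x => ?_) ?_ fun k => ?_
  · rw [RingHom.comp_apply, chartHom1_kk, hψ]
  · rw [RingHom.comp_apply, chartHom1_tt, ht]
  · rw [RingHom.comp_apply, chartHom1_x1]
    fin_cases k <;> simp [coord1]

theorem comp_chartHom2 {B : Type} [CommRing B] [Algebra ℂ B] (ψ : R →+* B)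
    (hψ : ∀ x, ψ (algebraMap ℂ R x) = algebraMap ℂ B x) {t' : Bˣ} (ht : ψ t = t')
    (h' : (c.map ψ).Eqs θ₀ θ₁ (t' : B)) {i' : B} (hi : c.g0 * i = 1)
    (hi' : (c.map ψ).g0 * i' = 1) : ψ.comp (chartHom2 h hi) = chartHom2 h' hi' := by
  have hii : i' = ψ i := by
    have h1 := congrArg ψ hi
    rw [map_mul, map_one] at h1
    change ψ c.g0 * i' = 1 at hi'
    linear_combination ψ i * hi' - i' * h1
  subst hii
  refine eq_chartHom2 h' hi' (fun x => ?_) ?_ fun k => ?_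
  · rw [RingHom.comp_apply, chartHom2_kk, hψ]
  · rw [RingHom.comp_apply, chartHom2_tt, ht]
  · rw [RingHom.comp_apply, chartHom2_x2]
    fin_cases k <;> simp [coord2]

theorem spec_chartHom1_eq (hi : c.g1 * i = 1) (hj : c.g0 * j = 1) :
    Spec.map (CommRingCat.ofHom (chartHom1 h hi)) ≫ ι₁ θ₀ θ₁ =
      Spec.map (CommRingCat.ofHom (chartHom2 h hj)) ≫ ι₂ θ₀ θ₁ := by
  obtain ⟨e1, e0, e2⟩ := coord2_eq hi hj
  have hu : IsUnit (chartHom1 h hi (x1 θ₀ θ₁ 1)) := by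
    rw [chartHom1_x1]
    exact IsUnit.of_mul_eq_one _ e1
  let κ := IsLocalization.Away.lift (S := Overlap θ₀ θ₁) (x1 θ₀ θ₁ 1) hu
  have hκ : ∀ a, κ (algebraMap _ _ a) = chartHom1 h hi a :=
    fun a => IsLocalization.Away.lift_eq (x1 θ₀ θ₁ 1) hu a
  have hy : ∀ k, κ (y1 θ₀ θ₁ k) = c.coord1 i k := fun k => (hκ _).trans (chartHom1_x1 h hi k)
  have hinv : κ (inv1 θ₀ θ₁) = c.coord2 j 1 := by
    have := congrArg κ (y1_mul_inv1 θ₀ θ₁)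
    rw [map_mul, hy, map_one] at this
    linear_combination c.coord2 j 1 * this - κ (inv1 θ₀ θ₁) * e1
  refine (spec_comp_ι_eq_iff θ₀ θ₁ _ _).2 ⟨κ, IsLocalization.Away.lift_comp _ _, ?_⟩
  refine eq_chartHom2 h hj (fun x => ?_) ?_ fun k => ?_
  · rw [RingHom.comp_apply]
    erw [map_kk (transition θ₀ θ₁) x]
    rw [kk, IsScalarTower.algebraMap_apply _ (Chart1 θ₀ θ₁), hκ]
    exact chartHom1_kk h hi x
  · rw [RingHom.comp_apply]
    erw [map_tt (transition θ₀ θ₁)]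
    rw [tt, IsScalarTower.algebraMap_apply _ (Chart1 θ₀ θ₁), hκ]
    exact chartHom1_tt h hi
  · change κ (transition θ₀ θ₁ (x2 θ₀ θ₁ k)) = _
    fin_cases k
    · simp only [transition, Fin.zero_eta, lift2_0, map_mul, map_pow, hy, hinv, e0]
    · simp only [transition, Fin.mk_one, lift2_1, hinv]
    · simp only [transition, Fin.reduceFinMk, lift2_2, map_mul, map_pow, map_add, map_sub, hy, hinv,
        e2]

/-- The characterization of the classifying morphism of a connection. -/
def IsClassifying (θ₀ θ₁ : ℂ) (c : Coeffs R) (t : Rˣ) (F : Spec (CommRingCat.of R) ⟶ M θ₀ θ₁) :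
    Prop :=
  ∀ (B : Type) [CommRing B] [Algebra ℂ B] (ψ : R →ₐ[ℂ] B) (t' : Bˣ), ψ t = t' →
    ∀ (h : (c.map (ψ : R →+* B)).Eqs θ₀ θ₁ (t' : B)) (i : B),
    (∀ hi : (c.map (ψ : R →+* B)).g1 * i = 1, Spec.map (CommRingCat.ofHom (ψ : R →+* B)) ≫ F =
      Spec.map (CommRingCat.ofHom (chartHom1 h hi)) ≫ ι₁ θ₀ θ₁) ∧
    ∀ hi : (c.map (ψ : R →+* B)).g0 * i = 1, Spec.map (CommRingCat.ofHom (ψ : R →+* B)) ≫ F =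
      Spec.map (CommRingCat.ofHom (chartHom2 h hi)) ≫ ι₂ θ₀ θ₁

theorem IsClassifying.unique {F F' : Spec (CommRingCat.of R) ⟶ M θ₀ θ₁}
    (h : c.Eqs θ₀ θ₁ (t : R)) (hF : IsClassifying θ₀ θ₁ c t F) (hF' : IsClassifying θ₀ θ₁ c t F') :
    F = F' := by
  refine hom_ext_of_span h.span_eq_top ?_
  intro r hr
  let ψ : R →ₐ[ℂ] Localization.Away r := IsScalarTower.toAlgHom ℂ R _
  have h' : (c.map (ψ : R →+* _)).Eqs θ₀ θ₁ 
      ((Units.map (ψ : R →* Localization.Away r) t : (Localization.Away r)ˣ) : Localization.Away r) :=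
    Eqs.map (algebraMap R (Localization.Away r)) ψ.commutes h
  have h1 := hF _ ψ _ rfl h' (IsLocalization.Away.invSelf r)
  have h2 := hF' _ ψ _ rfl h' (IsLocalization.Away.invSelf r)
  have h3 : algebraMap R (Localization.Away r) r * IsLocalization.Away.invSelf r = 1 :=
    IsLocalization.Away.mul_invSelf r
  rcases hr with rfl | rfl
  · exact (h1.2 h3).trans (h2.2 h3).symm
  · exact (h1.1 h3).trans (h2.1 h3).symm

end Coeffs

end classifying

end DegPV

namespace DegPV

noncomputable section classifying

variable {θ₀ θ₁ : ℂ} {R : Type} [CommRing R] [Algebra ℂ R]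

namespace Coeffs

variable {c : Coeffs R} {t : Rˣ}

theorem exists_isClassifying (h : c.Eqs θ₀ θ₁ (t : R)) : ∃ F, IsClassifying θ₀ θ₁ c t F := by
  let s : Fin 2 → R := ![c.g0, c.g1]
  have hs : Ideal.span (Set.range s) = ⊤ := by
    rw [← h.span_eq_top, Matrix.range_cons, Matrix.range_cons, Matrix.range_empty, Set.union_empty]
    rfl
  have hEq : ∀ i, (c.map (algebraMap R (Localization.Away (s i)))).Eqs θ₀ θ₁
      ((Units.map (algebraMap R (Localization.Away (s i)) : R →* _) t :
        (Localization.Away (s i))ˣ) : Localization.Away (s i)) := fun i =>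
    Eqs.map (algebraMap R (Localization.Away (s i)))
      (fun x => (IsScalarTower.algebraMap_apply ℂ R _ x).symm) h
  have hinv : ∀ i, algebraMap R (Localization.Away (s i)) (s i) *
      IsLocalization.Away.invSelf (s i) = 1 := fun i => IsLocalization.Away.mul_invSelf _
  have hloc : ∀ i (x : ℂ), algebraMap ℂ (Localization.Away (s i)) x =
    algebraMap R _ (algebraMap ℂ R x) := fun i x => IsScalarTower.algebraMap_apply ℂ R _ x
  let f : ∀ i, Spec (CommRingCat.of (Localization.Away (s i))) ⟶ M θ₀ θ₁ := fun i =>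
    match i with
    | 0 => Spec.map (CommRingCat.ofHom (chartHom2 (hEq 0) (hinv 0))) ≫ ι₂ θ₀ θ₁
    | 1 => Spec.map (CommRingCat.ofHom (chartHom1 (hEq 1) (hinv 1))) ≫ ι₁ θ₀ θ₁
  have key1 : ∀ (B : Type) [CommRing B] [Algebra ℂ B] (φ : Localization.Away (s 1) →+* B)
      (κ : R →+* B) (_ : φ.comp (algebraMap R _) = κ) (_ : ∀ x, κ (algebraMap ℂ R x) =
        algebraMap ℂ B x) (t' : Bˣ), κ t = t' →
      ∀ (h' : (c.map κ).Eqs θ₀ θ₁ (t' : B)) (i : B) (hi : (c.map κ).g1 * i = 1),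
      Spec.map (CommRingCat.ofHom φ) ≫ f 1 =
      Spec.map (CommRingCat.ofHom (chartHom1 h' hi)) ≫ ι₁ θ₀ θ₁ := by
    rintro B _ _ φ κ rfl hφ t' ht h' i hi
    refine (Category.assoc _ _ _).symm.trans ?_
    rw [← Spec.map_comp, ← CommRingCat.ofHom_comp]
    rw [comp_chartHom1 (hEq 1) φ (fun x => (congrArg φ (hloc 1 x)).trans (hφ x)) ht h' (hinv 1) hi]
    rfl
  have key0 : ∀ (B : Type) [CommRing B] [Algebra ℂ B] (φ : Localization.Away (s 0) →+* B)
      (κ : R →+* B) (_ : φ.comp (algebraMap R _) = κ) (_ : ∀ x, κ (algebraMap ℂ R x) =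
        algebraMap ℂ B x) (t' : Bˣ), κ t = t' →
      ∀ (h' : (c.map κ).Eqs θ₀ θ₁ (t' : B)) (i : B) (hi : (c.map κ).g0 * i = 1),
      Spec.map (CommRingCat.ofHom φ) ≫ f 0 =
      Spec.map (CommRingCat.ofHom (chartHom2 h' hi)) ≫ ι₂ θ₀ θ₁ := by
    rintro B _ _ φ κ rfl hφ t' ht h' i hi
    refine (Category.assoc _ _ _).symm.trans ?_
    rw [← Spec.map_comp, ← CommRingCat.ofHom_comp]
    rw [comp_chartHom2 (hEq 0) φ (fun x => (congrArg φ (hloc 0 x)).trans (hφ x)) ht h' (hinv 0) hi]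
    rfl
  have hu : ∀ {B : Type} [CommRing B] (i : Fin 2) (φ : Localization.Away (s i) →+* B),
      φ (algebraMap R _ (s i)) * φ (IsLocalization.Away.invSelf (s i)) = 1 := fun i φ => by
    rw [← map_mul, hinv, map_one]
  obtain ⟨F, hF⟩ := exists_glue s hs f (by
    intro i j B _ φ ψ hφψ
    let κ := φ.comp (algebraMap R _)
    let _ : Algebra ℂ B := (κ.comp (algebraMap ℂ R)).toAlgebra
    have hB : ∀ x, κ (algebraMap ℂ R x) = algebraMap ℂ B x := fun x => rfl
    have hE : (c.map κ).Eqs θ₀ θ₁ ((Units.map (κ : R →* B) t : Bˣ) : B) :=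
      Eqs.map κ hB h
    have hii : κ (s i) * φ (IsLocalization.Away.invSelf (s i)) = 1 := hu i φ
    have hij := hu j ψ
    rw [← RingHom.comp_apply, ← hφψ] at hij
    fin_cases i <;> fin_cases j
    · exact (key0 B φ κ rfl hB _ rfl hE _ hii).trans (key0 B ψ κ hφψ.symm hB _ rfl hE _ hii).symm
    · exact (key0 B φ κ rfl hB _ rfl hE _ hii).trans
        ((spec_chartHom1_eq hE hij hii).symm.trans (key1 B ψ κ hφψ.symm hB _ rfl hE _ hij).symm)
    · exact (key1 B φ κ rfl hB _ rfl hE _ hii).trans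
        ((spec_chartHom1_eq hE hii hij).trans (key0 B ψ κ hφψ.symm hB _ rfl hE _ hij).symm)
    · exact (key1 B φ κ rfl hB _ rfl hE _ hii).trans (key1 B ψ κ hφψ.symm hB _ rfl hE _ hii).symm)
  refine ⟨F, ?_⟩
  intro B _ _ ψ t' ht h' i
  constructor
  · intro hi
    have hui : IsUnit ((ψ : R →+* B) (s 1)) := IsUnit.of_mul_eq_one _ hi
    have hcomp := IsLocalization.Away.lift_comp (S := Localization.Away (s 1)) (s 1) hui
    conv_lhs => rw [← hcomp]
    rw [CommRingCat.ofHom_comp, Spec.map_comp, Category.assoc, hF]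
    exact key1 B _ ψ hcomp ψ.commutes t' ht h' i hi
  · intro hi
    have hui : IsUnit ((ψ : R →+* B) (s 0)) := IsUnit.of_mul_eq_one _ hi
    have hcomp := IsLocalization.Away.lift_comp (S := Localization.Away (s 0)) (s 0) hui
    conv_lhs => rw [← hcomp]
    rw [CommRingCat.ofHom_comp, Spec.map_comp, Category.assoc, hF]
    exact key0 B _ ψ hcomp ψ.commutes t' ht h' i hi

theorem IsClassifying.comp {F : Spec (CommRingCat.of R) ⟶ M θ₀ θ₁} (hF : IsClassifying θ₀ θ₁ c t F)
    {B : Type} [CommRing B] [Algebra ℂ B] (φ : R →ₐ[ℂ] B) {t' : Bˣ} (ht : φ t = t') :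
    IsClassifying θ₀ θ₁ (c.map (φ : R →+* B)) t' (Spec.map (CommRingCat.ofHom (φ : R →+* B)) ≫ F) := by
  intro B' _ _ ψ t'' ht' h i
  have := hF B' (ψ.comp φ) t'' (by rw [AlgHom.comp_apply, ht, ht']) h i
  rw [← Category.assoc, ← Spec.map_comp, ← CommRingCat.ofHom_comp]
  exact this

theorem IsClassifying.eq1 {F : Spec (CommRingCat.of R) ⟶ M θ₀ θ₁} (h : c.Eqs θ₀ θ₁ (t : R))
    (hF : IsClassifying θ₀ θ₁ c t F) {i : R} (hi : c.g1 * i = 1) :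
    F = Spec.map (CommRingCat.ofHom (chartHom1 h hi)) ≫ ι₁ θ₀ θ₁ := by
  have e : Spec.map (CommRingCat.ofHom (AlgHom.id ℂ R : R →+* R)) = 𝟙 _ := Spec.map_id _
  exact (Category.id_comp F).symm.trans ((congrArg (· ≫ F) e.symm).trans
    ((hF R (AlgHom.id ℂ R) t rfl h i).1 hi))

theorem IsClassifying.eq2 {F : Spec (CommRingCat.of R) ⟶ M θ₀ θ₁} (h : c.Eqs θ₀ θ₁ (t : R))
    (hF : IsClassifying θ₀ θ₁ c t F) {i : R} (hi : c.g0 * i = 1) :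
    F = Spec.map (CommRingCat.ofHom (chartHom2 h hi)) ≫ ι₂ θ₀ θ₁ := by
  have e : Spec.map (CommRingCat.ofHom (AlgHom.id ℂ R : R →+* R)) = 𝟙 _ := Spec.map_id _
  exact (Category.id_comp F).symm.trans ((congrArg (· ≫ F) e.symm).trans
    ((hF R (AlgHom.id ℂ R) t rfl h i).2 hi))

theorem IsClassifying.toT {F : Spec (CommRingCat.of R) ⟶ M θ₀ θ₁} (h : c.Eqs θ₀ θ₁ (t : R))
    (hF : IsClassifying θ₀ θ₁ c t F) :
    F ≫ M.toT θ₀ θ₁ = Spec.map (CommRingCat.ofHom (laurentHom t)) := by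
  refine hom_ext_of_span h.span_eq_top ?_
  intro r hr
  let ψ : R →ₐ[ℂ] Localization.Away r := IsScalarTower.toAlgHom ℂ R _
  have h' : (c.map (ψ : R →+* _)).Eqs θ₀ θ₁
      ((Units.map (ψ : R →* Localization.Away r) t : (Localization.Away r)ˣ) : Localization.Away r) :=
    Eqs.map (algebraMap R (Localization.Away r)) ψ.commutes h
  have h1 := hF _ ψ _ rfl h' (IsLocalization.Away.invSelf r)
  have h3 : algebraMap R (Localization.Away r) r * IsLocalization.Away.invSelf r = 1 :=
    IsLocalization.Away.mul_invSelf r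
  refine (Category.assoc _ _ _).symm.trans ?_
  rw [← Spec.map_comp, ← CommRingCat.ofHom_comp]
  rcases hr with rfl | rfl
  · refine (congrArg (· ≫ M.toT θ₀ θ₁) (h1.2 h3)).trans ?_
    rw [Category.assoc, ι₂_toT, M₂.toT, ← Spec.map_comp, ← CommRingCat.ofHom_comp]
    refine congrArg (fun f => Spec.map (CommRingCat.ofHom f)) (laurent_ringHom_ext (fun x => ?_) ?_)
    · refine (chartHom2_kk h' h3 x).trans ?_
      rw [RingHom.comp_apply, laurentHom_C]
      exact (ψ.commutes x).symm
    · refine (chartHom2_tt h' h3).trans ?_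
      rw [RingHom.comp_apply, laurentHom_T]
      rfl
  · refine (congrArg (· ≫ M.toT θ₀ θ₁) (h1.1 h3)).trans ?_
    rw [Category.assoc, ι₁_toT, M₁.toT, ← Spec.map_comp, ← CommRingCat.ofHom_comp]
    refine congrArg (fun f => Spec.map (CommRingCat.ofHom f)) (laurent_ringHom_ext (fun x => ?_) ?_)
    · refine (chartHom1_kk h' h3 x).trans ?_
      rw [RingHom.comp_apply, laurentHom_C]
      exact (ψ.commutes x).symm
    · refine (chartHom1_tt h' h3).trans ?_
      rw [RingHom.comp_apply, laurentHom_T]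
      rfl

end Coeffs

/-- The coefficients of the connection of a family. -/
def Family.coeffs (x : Family θ₀ θ₁ R) : Coeffs R := Coeffs.ofMatrix x.conn.matrix

theorem Family.matrix_coeffs (x : Family θ₀ θ₁ R) : x.coeffs.matrix = x.conn.matrix :=
  Coeffs.matrix_ofMatrix x.isFamilyMatrix.toDegreeBounds x.isFamilyMatrix.trace

theorem Family.eqs (x : Family θ₀ θ₁ R) : x.coeffs.Eqs θ₀ θ₁ (x.t : R) := by
  rw [← Coeffs.isFamilyMatrix_iff, matrix_coeffs]
  exact x.isFamilyMatrix

theorem Coeffs.Eqs.exists_family {c : Coeffs R} {t : Rˣ} (h : c.Eqs θ₀ θ₁ (t : R)) :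
    ∃ x : Family θ₀ θ₁ R, x.coeffs = c ∧ x.t = t := by
  obtain ⟨x, hx, ht⟩ := ((Coeffs.isFamilyMatrix_iff c _).2 h).exists_family
  exact ⟨x, Coeffs.matrix_injective (x.matrix_coeffs.trans hx), ht⟩

/-- The classifying morphism of a family. -/
def classify : Assignment θ₀ θ₁ := fun _ _ _ x => (Coeffs.exists_isClassifying x.eqs).choose

theorem isClassifying_classify (x : Family θ₀ θ₁ R) :
    Coeffs.IsClassifying θ₀ θ₁ x.coeffs x.t (classify R x) :=
  (Coeffs.exists_isClassifying x.eqs).choose_spec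

theorem laurentHom_comp_toC (t : Rˣ) :
    Spec.map (CommRingCat.ofHom (laurentHom t)) ≫ TLine.toC = specToC R := by
  rw [TLine.toC, specToC, ← Spec.map_comp, ← CommRingCat.ofHom_comp]
  refine congrArg (fun f => Spec.map (CommRingCat.ofHom f)) (RingHom.ext fun x => ?_)
  exact laurentHom_C t x

theorem Family.IsPullback.coeffs {R' : Type} [CommRing R'] [Algebra ℂ R'] {φ : R →ₐ[ℂ] R'}
    {x : Family θ₀ θ₁ R} {y : Family θ₀ θ₁ R'} (h : Family.IsPullback φ x y) :
    y.coeffs = x.coeffs.map (φ : R →+* R') := by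
  apply Coeffs.matrix_injective
  rw [Coeffs.matrix_map, matrix_coeffs, matrix_coeffs]
  ext1 i j
  have := congrFun (h.2 (Pi.single j 1)) i
  rw [Matrix.map_apply, BundleConnection.matrix, Matrix.of_apply, BundleConnection.matrix,
    Matrix.of_apply, ← this]
  have hs : (fun k => (Pi.single j 1 : Fin 2 → R[X]) k |>.map (φ : R →+* R')) = Pi.single j 1 := by
    funext k
    fin_cases k <;> fin_cases j <;> simp
  rw [hs]

theorem classify_isNatural : (classify : Assignment θ₀ θ₁).IsNatural := by
  constructor
  · intro R _ _ x
    rw [M.toC, ← Category.assoc, (isClassifying_classify x).toT x.eqs, laurentHom_comp_toC]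
  · intro R R' _ _ _ _ φ x y h
    refine (isClassifying_classify y).unique y.eqs ?_
    rw [h.coeffs]
    exact (isClassifying_classify x).comp φ h.1.symm

theorem exists_universal_family1 : ∃ x : Family θ₀ θ₁ (Chart1 θ₀ θ₁),
    x.conn.matrix = univMatrix1 θ₀ θ₁ ∧ (x.t : Chart1 θ₀ θ₁) = tt _ ∧ classify _ x = ι₁ θ₀ θ₁ := by
  obtain ⟨t, ht⟩ := isUnit_tt (Chart1 θ₀ θ₁)
  have h1 := eq1_of_ringHom (RingHom.id (Chart1 θ₀ θ₁)) kk_eq_algebraMap₁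
  simp only [RingHom.id_apply] at h1
  rw [← ht] at h1
  obtain ⟨x, hx, rfl⟩ := (Coeffs.eqs_normal1 h1).exists_family
  refine ⟨x, ?_, ht, ?_⟩
  · rw [← x.matrix_coeffs, hx, Coeffs.matrix, univMatrix1]
    ext1 i j
    fin_cases i <;> fin_cases j <;> simp [Coeffs.normal1, formC0, kk_eq_algebraMap₁, ht, add_comm]
  · have hi : x.coeffs.g1 * 1 = 1 := by rw [hx]; exact mul_one _
    refine ((isClassifying_classify x).eq1 x.eqs hi).trans ?_
    rw [← Coeffs.eq_chartHom1 x.eqs (φ := RingHom.id _) hi kk_eq_algebraMap₁ ht.symm]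
    · exact (congrArg (· ≫ ι₁ θ₀ θ₁) (Spec.map_id _)).trans (Category.id_comp _)
    · intro k
      rw [hx]
      fin_cases k <;> simp [Coeffs.normal1, Coeffs.coord1]

theorem exists_universal_family2 : ∃ x : Family θ₀ θ₁ (Chart2 θ₀ θ₁),
    x.conn.matrix = univMatrix2 θ₀ θ₁ ∧ (x.t : Chart2 θ₀ θ₁) = tt _ ∧ classify _ x = ι₂ θ₀ θ₁ := by
  obtain ⟨t, ht⟩ := isUnit_tt (Chart2 θ₀ θ₁)
  have h1 := eq2_of_ringHom (RingHom.id (Chart2 θ₀ θ₁)) kk_eq_algebraMap₂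
  simp only [RingHom.id_apply] at h1
  rw [← ht] at h1
  obtain ⟨x, hx, rfl⟩ := (Coeffs.eqs_normal2 h1).exists_family
  refine ⟨x, ?_, ht, ?_⟩
  · rw [← x.matrix_coeffs, hx, Coeffs.matrix, univMatrix2]
    ext1 i j
    fin_cases i <;> fin_cases j <;> simp [Coeffs.normal2, formC2, kk_eq_algebraMap₂, ht]
  · have hi : x.coeffs.g0 * 1 = 1 := by rw [hx]; exact mul_one _
    refine ((isClassifying_classify x).eq2 x.eqs hi).trans ?_
    rw [← Coeffs.eq_chartHom2 x.eqs (φ := RingHom.id _) hi kk_eq_algebraMap₂ ht.symm]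
    · exact (congrArg (· ≫ ι₂ θ₀ θ₁) (Spec.map_id _)).trans (Category.id_comp _)
    · intro k
      rw [hx]
      fin_cases k <;> simp [Coeffs.normal2, Coeffs.coord2]

end classifying

end DegPV

namespace DegPV

section

variable {R : Type} [CommRing R]

theorem eq_zero_of_cubic_eq_zero {a b c d : R}
    (h : C a + C b * X + C c * X ^ 2 + C d * X ^ 3 = 0) : a = 0 ∧ b = 0 ∧ c = 0 ∧ d = 0 := by
  refine ⟨?_, ?_, ?_, ?_⟩
  · simpa [coeff_X, coeff_C] using congrArg (coeff · 0) h
  · simpa [coeff_X, coeff_C] using congrArg (coeff · 1) h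
  · simpa [coeff_X, coeff_C] using congrArg (coeff · 2) h
  · simpa [coeff_X, coeff_C] using congrArg (coeff · 3) h

namespace Coeffs

variable {c c' : Coeffs R} {u l0 l1 : R}

theorem rel_iff : Rel u l0 l1 c c' ↔ C u * c'.matrix 1 0 = c.matrix 1 0 ∧
    c.matrix 0 0 + (C l0 + C l1 * X) * c'.matrix 1 0 = c'.matrix 0 0 ∧
    C u * c.matrix 0 1 - (C l0 + C l1 * X) * (c.matrix 0 0 + c'.matrix 0 0) -
      X * (X - 1) * C l1 = c'.matrix 0 1 := by
  simp only [matrix, Matrix.of_apply, Matrix.cons_val', Matrix.cons_val_zero, Matrix.cons_val_one,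
    Matrix.cons_val_fin_one]
  constructor
  · rintro ⟨h1, h2, h3, h4, h5, h6, h7, h8, h9⟩
    refine ⟨?_, ?_, ?_⟩
    · rw [← h1, ← h2]
      simp only [map_mul]
      ring
    · rw [← h3, ← h4, ← h5]
      simp only [map_mul, map_add]
      ring
    · rw [← h6, ← h7, ← h8, ← h9]
      simp only [map_mul, map_add, map_sub]
      ring
  · rintro ⟨h1, h2, h3⟩
    obtain ⟨e1, e2, -, -⟩ := eq_zero_of_cubic_eq_zero (a := u * c'.g0 - c.g0)
      (b := u * c'.g1 - c.g1) (c := 0) (d := 0) (by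
        simp only [map_mul, map_sub, map_zero]
        linear_combination h1)
    obtain ⟨e3, e4, e5, -⟩ := eq_zero_of_cubic_eq_zero (a := c.a0 + l0 * c'.g0 - c'.a0)
      (b := c.a1 + l0 * c'.g1 + l1 * c'.g0 - c'.a1) (c := c.a2 + l1 * c'.g1 - c'.a2) (d := 0) (by
        simp only [map_mul, map_sub, map_zero, map_add]
        linear_combination h2)
    obtain ⟨e6, e7, e8, e9⟩ := eq_zero_of_cubic_eq_zero
      (a := u * c.b0 - l0 * (c.a0 + c'.a0) - c'.b0)
      (b := u * c.b1 - l0 * (c.a1 + c'.a1) - l1 * (c.a0 + c'.a0) + l1 - c'.b1)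
      (c := u * c.b2 - l0 * (c.a2 + c'.a2) - l1 * (c.a1 + c'.a1) - l1 - c'.b2)
      (d := u * c.b3 - l1 * (c.a2 + c'.a2) - c'.b3) (by
        simp only [map_mul, map_sub, map_add]
        linear_combination h3)
    exact ⟨sub_eq_zero.1 e1, sub_eq_zero.1 e2, sub_eq_zero.1 e3, sub_eq_zero.1 e4,
      sub_eq_zero.1 e5, sub_eq_zero.1 e6, sub_eq_zero.1 e7, sub_eq_zero.1 e8, sub_eq_zero.1 e9⟩

theorem Rel.map {B : Type} [CommRing B] (φ : R →+* B) (h : Rel u l0 l1 c c') :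
    Rel (φ u) (φ l0) (φ l1) (c.map φ) (c'.map φ) := by
  obtain ⟨h1, h2, h3, h4, h5, h6, h7, h8, h9⟩ := h
  constructor <;> simp only [Coeffs.map, ← map_mul, ← map_add, ← map_sub, *]

/-- The coefficients of the automorphism are determined by both connections. -/
theorem Rel.eq (h : Rel u l0 l1 c c') {p q : R} (hpq : p * c'.g0 + q * c'.g1 = 1) :
    u = p * c.g0 + q * c.g1 ∧
    l0 = p ^ 2 * c'.g0 * (c'.a0 - c.a0) + 2 * p * q * c'.g1 * (c'.a0 - c.a0) +
      q ^ 2 * (c'.g1 * (c'.a1 - c.a1) - c'.g0 * (c'.a2 - c.a2)) ∧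
    l1 = p ^ 2 * (c'.g0 * (c'.a1 - c.a1) - c'.g1 * (c'.a0 - c.a0)) +
      2 * p * q * c'.g0 * (c'.a2 - c.a2) + q ^ 2 * c'.g1 * (c'.a2 - c.a2) := by
  rw [← h.g0, ← h.g1, ← h.a0, ← h.a1, ← h.a2]
  refine ⟨?_, ?_, ?_⟩
  · linear_combination (-u) * hpq
  · linear_combination (-l0) * (p * c'.g0 + q * c'.g1 + 1) * hpq
  · linear_combination (-l1) * (p * c'.g0 + q * c'.g1 + 1) * hpq

theorem exists_rel_of_localization_span {s : Set R} (hs : Ideal.span s = ⊤)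
    (hc : Ideal.span {c'.g0, c'.g1} = ⊤)
    (h : ∀ r ∈ s, ∃ u l0 l1 : Localization.Away r,
      Rel u l0 l1 (c.map (algebraMap R _)) (c'.map (algebraMap R _))) :
    ∃ u l0 l1 : R, Rel u l0 l1 c c' := by
  rw [Ideal.eq_top_iff_one, Ideal.mem_span_pair] at hc
  obtain ⟨p, q, hpq⟩ := hc
  refine ⟨p * c.g0 + q * c.g1,
    p ^ 2 * c'.g0 * (c'.a0 - c.a0) + 2 * p * q * c'.g1 * (c'.a0 - c.a0) +
      q ^ 2 * (c'.g1 * (c'.a1 - c.a1) - c'.g0 * (c'.a2 - c.a2)),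
    p ^ 2 * (c'.g0 * (c'.a1 - c.a1) - c'.g1 * (c'.a0 - c.a0)) +
      2 * p * q * c'.g0 * (c'.a2 - c.a2) + q ^ 2 * c'.g1 * (c'.a2 - c.a2), ?_⟩
  have key : ∀ r ∈ s, Rel (algebraMap R (Localization.Away r) (p * c.g0 + q * c.g1))
      (algebraMap R (Localization.Away r) (p ^ 2 * c'.g0 * (c'.a0 - c.a0) +
        2 * p * q * c'.g1 * (c'.a0 - c.a0) +
        q ^ 2 * (c'.g1 * (c'.a1 - c.a1) - c'.g0 * (c'.a2 - c.a2))))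
      (algebraMap R (Localization.Away r) (p ^ 2 * (c'.g0 * (c'.a1 - c.a1) -
        c'.g1 * (c'.a0 - c.a0)) +
        2 * p * q * c'.g0 * (c'.a2 - c.a2) + q ^ 2 * c'.g1 * (c'.a2 - c.a2)))
      (c.map (algebraMap R _)) (c'.map (algebraMap R _)) := by
    intro r hr
    obtain ⟨u, l0, l1, h⟩ := h r hr
    have h' := h
    obtain ⟨h1, h2, h3⟩ := h.eq (p := algebraMap R _ p) (q := algebraMap R _ q) (by
      simp only [Coeffs.map, ← map_mul, ← map_add, hpq, map_one])
    rw [h1, h2, h3] at h'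
    simpa only [Coeffs.map, map_add, map_sub, map_mul, map_pow, map_ofNat] using h'
  generalize p * c.g0 + q * c.g1 = u at *
  generalize p ^ 2 * c'.g0 * (c'.a0 - c.a0) + 2 * p * q * c'.g1 * (c'.a0 - c.a0) +
      q ^ 2 * (c'.g1 * (c'.a1 - c.a1) - c'.g0 * (c'.a2 - c.a2)) = l0 at *
  generalize p ^ 2 * (c'.g0 * (c'.a1 - c.a1) - c'.g1 * (c'.a0 - c.a0)) +
      2 * p * q * c'.g0 * (c'.a2 - c.a2) + q ^ 2 * c'.g1 * (c'.a2 - c.a2) = l1 at *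
  constructor
  · refine eq_of_localization_span hs fun r hr => ?_
    simpa only [map_add, map_mul, map_sub, Coeffs.map] using (key r hr).g0
  · refine eq_of_localization_span hs fun r hr => ?_
    simpa only [map_add, map_mul, map_sub, Coeffs.map] using (key r hr).g1
  · refine eq_of_localization_span hs fun r hr => ?_
    simpa only [map_add, map_mul, map_sub, Coeffs.map] using (key r hr).a0
  · refine eq_of_localization_span hs fun r hr => ?_
    simpa only [map_add, map_mul, map_sub, Coeffs.map] using (key r hr).a1
  · refine eq_of_localization_span hs fun r hr => ?_
    simpa only [map_add, map_mul, map_sub, Coeffs.map] using (key r hr).a2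
  · refine eq_of_localization_span hs fun r hr => ?_
    simpa only [map_add, map_mul, map_sub, Coeffs.map] using (key r hr).b0
  · refine eq_of_localization_span hs fun r hr => ?_
    simpa only [map_add, map_mul, map_sub, Coeffs.map] using (key r hr).b1
  · refine eq_of_localization_span hs fun r hr => ?_
    simpa only [map_add, map_mul, map_sub, Coeffs.map] using (key r hr).b2
  · refine eq_of_localization_span hs fun r hr => ?_
    simpa only [map_add, map_mul, map_sub, Coeffs.map] using (key r hr).b3

end Coeffs

end

section

variable {θ₀ θ₁ : ℂ} {R : Type} [CommRing R] [Algebra ℂ R]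

/-- The automorphism `(u, l; 0, 1)`. -/
noncomputable def shearEquiv (u : Rˣ) (l : R[X]) : (Fin 2 → R[X]) ≃ₗ[R[X]] (Fin 2 → R[X]) where
  toFun v := ![C (u : R) * v 0 + l * v 1, v 1]
  invFun v := ![C ((u⁻¹ : Rˣ) : R) * (v 0 - l * v 1), v 1]
  map_add' v w := by
    ext1 i
    fin_cases i
    · simp only [Fin.zero_eta, Matrix.cons_val_zero, Pi.add_apply]
      ring
    · simp
  map_smul' r v := by
    ext1 i
    fin_cases i
    · simp only [Fin.zero_eta, Matrix.cons_val_zero, Pi.smul_apply, smul_eq_mul, RingHom.id_apply]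
      ring
    · simp
  left_inv v := by
    have h : C ((u⁻¹ : Rˣ) : R) * C (u : R) = 1 := by rw [← C_mul, Units.inv_mul, C_1]
    ext1 i
    fin_cases i
    · simp only [Fin.zero_eta, Matrix.cons_val_zero, Matrix.cons_val_one]
      linear_combination v 0 * h
    · simp
  right_inv v := by
    have h : C ((u⁻¹ : Rˣ) : R) * C (u : R) = 1 := by rw [← C_mul, Units.inv_mul, C_1]
    ext1 i
    fin_cases i
    · simp only [Fin.zero_eta, Matrix.cons_val_zero, Matrix.cons_val_one]
      linear_combination (v 0 - l * v 1) * h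
    · simp

omit [Algebra ℂ R] in
theorem mem_bundleSections_linear {a : R} {l : R[X]} (hl : l.natDegree ≤ 1) {n : ℕ} {v : Fin 2 → R[X]}
    (hv : v ∈ bundleSections R n) : ![C a * v 0 + l * v 1, v 1] ∈ bundleSections R n := by
  rw [BundleConnection.mem_bundleSections] at hv ⊢
  refine ⟨?_, hv.2⟩
  simp only [Matrix.cons_val_zero]
  refine natDegree_add_le_of_degree_le ((natDegree_C_mul_le _ _).trans hv.1) ?_
  by_cases h : v 1 = 0
  · simp [h]
  · have h2 : (v 1).natDegree < n := (natDegree_lt_iff_degree_lt h).2 hv.2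
    exact natDegree_mul_le.trans (by omega)

theorem Family.iso_of_rel {x y : Family θ₀ θ₁ R} (ht : x.t = y.t) {u l0 l1 : R}
    (h : Coeffs.Rel u l0 l1 x.coeffs y.coeffs) : x.Iso y := by
  obtain ⟨u, rfl⟩ := h.isUnit x.eqs.span_eq_top
  have hl : (C l0 + C l1 * X).natDegree ≤ 1 := by compute_degree
  refine ⟨ht, shearEquiv u (C l0 + C l1 * X), fun n v => ⟨fun hv => ?_, fun hv => ?_⟩, fun v => ?_⟩
  · rw [← (shearEquiv u (C l0 + C l1 * X)).symm_apply_apply v]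
    have : -(C ((u⁻¹ : Rˣ) : R) * (C l0 + C l1 * X)) =
        C (-(((u⁻¹ : Rˣ) : R) * l0)) + C (-(((u⁻¹ : Rˣ) : R) * l1)) * X := by
      simp only [map_mul, map_neg]; ring
    have := mem_bundleSections_linear (a := ((u⁻¹ : Rˣ) : R))
      (l := -(C ((u⁻¹ : Rˣ) : R) * (C l0 + C l1 * X))) (by rw [this]; compute_degree) hv
    convert this using 1
    change ![_, _] = _
    congr 1
    ring
  · exact mem_bundleSections_linear hl hv
  · obtain ⟨h1, h2, h3⟩ := Coeffs.rel_iff.1 h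
    rw [x.matrix_coeffs, y.matrix_coeffs] at h1 h2 h3
    have hx := x.isFamilyMatrix.trace
    have hy := y.isFamilyMatrix.trace
    ext1 i
    fin_cases i
    · change C (u : R) * x.conn.op v 0 + (C l0 + C l1 * X) * x.conn.op v 1 = y.conn.op _ 0
      rw [BundleConnection.op_apply, BundleConnection.op_apply, BundleConnection.op_apply, hx]
      change _ = _ * (C (u : R) * v 0 + (C l0 + C l1 * X) * v 1) + _ * v 1 +
        _ * derivative (C (u : R) * v 0 + (C l0 + C l1 * X) * v 1)
      simp only [derivative_add, derivative_mul, derivative_C, derivative_X]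
      linear_combination v 1 * h3 + C (u : R) * v 0 * h2 -
        (C l0 + C l1 * X) * v 0 * h1
    · change x.conn.op v 1 = y.conn.op _ 1
      rw [BundleConnection.op_apply, BundleConnection.op_apply, hx, hy]
      change _ = _ * (C (u : R) * v 0 + (C l0 + C l1 * X) * v 1) + _ * v 1 +
        _ * derivative (v 1)
      linear_combination (-v 0) * h1 - v 1 * h2

theorem Family.Iso.exists_rel {x y : Family θ₀ θ₁ R} (h : x.Iso y) :
    x.t = y.t ∧ ∃ u l0 l1 : R, Coeffs.Rel u l0 l1 x.coeffs y.coeffs := by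
  obtain ⟨ht, g, hg, hop⟩ := h
  refine ⟨ht, ?_⟩
  have m0 : (Pi.single 0 1 : Fin 2 → R[X]) ∈ bundleSections R 0 := by
    rw [BundleConnection.mem_bundleSections]; simp
  have m1 : (Pi.single 1 1 : Fin 2 → R[X]) ∈ bundleSections R 1 := by
    rw [BundleConnection.mem_bundleSections]
    simp only [Pi.single_eq_same, ne_eq, zero_ne_one, not_false_eq_true, Pi.single_eq_of_ne,
      natDegree_zero, zero_le, true_and, Nat.cast_one]
    exact lt_of_le_of_lt degree_one_le (by norm_num)
  have key : ∀ g : (Fin 2 → R[X]) ≃ₗ[R[X]] (Fin 2 → R[X]),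
      (∀ (n : ℕ) (v : Fin 2 → R[X]), g v ∈ bundleSections R n ↔ v ∈ bundleSections R n) →
      ∃ u w l0 l1 : R, ∀ v, g v = ![C u * v 0 + (C l0 + C l1 * X) * v 1, C w * v 1] := by
    intro g hg
    have h0 := BundleConnection.mem_bundleSections.1 ((hg 0 _).2 m0)
    have h1 := BundleConnection.mem_bundleSections.1 ((hg 1 _).2 m1)
    rw [Nat.cast_zero, Nat.WithBot.lt_zero_iff, degree_eq_bot] at h0
    have h2 := (BundleConnection.degree_lt_succ_iff (n := 0)).1 h1.2
    obtain ⟨u, hu⟩ := natDegree_eq_zero.1 (Nat.le_zero.1 h0.1)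
    obtain ⟨w, hw⟩ := natDegree_eq_zero.1 (Nat.le_zero.1 h2)
    obtain ⟨l1, l0, hl⟩ := exists_eq_X_add_C_of_natDegree_le_one h1.1
    refine ⟨u, w, l0, l1, fun v => ?_⟩
    have hv : v = v 0 • Pi.single 0 1 + v 1 • Pi.single 1 1 := by
      ext1 j
      fin_cases j <;> simp
    conv_lhs => rw [hv, map_add, map_smul, map_smul]
    ext1 i
    fin_cases i
    · simp only [Fin.zero_eta, Pi.add_apply, Pi.smul_apply, smul_eq_mul, ← hu, hl,
        Matrix.cons_val_zero]
      ring
    · simp only [Fin.mk_one, Pi.add_apply, Pi.smul_apply, smul_eq_mul, ← hw, h0.2,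
        Matrix.cons_val_one, Matrix.cons_val_fin_one]
      ring
  obtain ⟨u, w, l0, l1, hgv⟩ := key g hg
  obtain ⟨u', w', l0', l1', hgv'⟩ := key g.symm fun n v => by rw [← hg, g.apply_symm_apply]
  have hw : w * w' = 1 := by
    have := congrFun (g.apply_symm_apply (Pi.single 1 1)) 1
    rw [hgv, hgv'] at this
    simpa [← C_mul, ← C_1, -map_one, -map_mul] using this
  have e0 := hop (Pi.single 0 1)
  have e1 := hop (Pi.single 1 1)
  rw [hgv, hgv] at e0 e1
  have e01 := congrFun e0 1
  have e10 := congrFun e1 0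
  have e11 := congrFun e1 1
  simp only [BundleConnection.op_apply, Matrix.cons_val_one, Matrix.cons_val_zero,
    Matrix.cons_val_fin_one, Pi.single_eq_same, ne_eq, zero_ne_one, one_ne_zero, not_false_eq_true,
    Pi.single_eq_of_ne, x.isFamilyMatrix.trace, y.isFamilyMatrix.trace, derivative_zero,
    derivative_one, mul_zero, add_zero, mul_one, zero_add, derivative_add, derivative_mul,
    derivative_C, derivative_X, zero_mul] at e01 e10 e11
  have hw' : C w * C w' = 1 := by rw [← C_mul, hw, C_1]
  refine ⟨w' * u, w' * l0, w' * l1, Coeffs.rel_iff.2 ?_⟩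
  rw [x.matrix_coeffs, y.matrix_coeffs]
  simp only [map_mul]
  refine ⟨?_, ?_, ?_⟩
  · linear_combination (-C w') * e01 + x.conn.matrix 1 0 * hw'
  · linear_combination (-C w') * e11 + (y.conn.matrix 0 0 - x.conn.matrix 0 0) * hw'
  · linear_combination C w' * e10 + y.conn.matrix 0 1 * hw'

theorem Family.iso_iff {x y : Family θ₀ θ₁ R} :
    x.Iso y ↔ x.t = y.t ∧ ∃ u l0 l1 : R, Coeffs.Rel u l0 l1 x.coeffs y.coeffs :=
  ⟨fun h => h.exists_rel, fun ⟨ht, _, _, _, h⟩ => iso_of_rel ht h⟩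

end

end DegPV

namespace DegPV

noncomputable section

variable {θ₀ θ₁ : ℂ} {R : Type} [CommRing R] [Algebra ℂ R]

namespace Coeffs

variable {c c' : Coeffs R} {t : Rˣ}

theorem IsClassifying.of_rel {u l0 l1 : R} (h : c.Eqs θ₀ θ₁ (t : R)) (hr : Rel u l0 l1 c c')
    {F : Spec (CommRingCat.of R) ⟶ M θ₀ θ₁} (hF : IsClassifying θ₀ θ₁ c t F) :
    IsClassifying θ₀ θ₁ c' t F := by
  intro B _ _ ψ t' ht h' i
  obtain ⟨u, rfl⟩ := hr.isUnit h.span_eq_top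
  have hE : (c.map (ψ : R →+* B)).Eqs θ₀ θ₁ (t' : B) := by
    rw [← ht]
    exact Eqs.map (ψ : R →+* B) ψ.commutes h
  have hrel := hr.map (ψ : R →+* B)
  have huu : ψ u * ψ ((u⁻¹ : Rˣ) : R) = 1 := by rw [← map_mul, Units.mul_inv, map_one]
  have hF' := hF B ψ t' ht hE (i * ψ ((u⁻¹ : Rˣ) : R))
  constructor
  · intro hi
    have hi' : (c.map (ψ : R →+* B)).g1 * (i * ψ ((u⁻¹ : Rˣ) : R)) = 1 := by
      rw [← hrel.g1]
      change ψ u * _ * _ = _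
      linear_combination ψ u * ψ ((u⁻¹ : Rˣ) : R) * hi + huu
    refine (hF'.1 hi').trans ?_
    rw [eq_chartHom1 h' hi (chartHom1_kk hE hi') (chartHom1_tt hE hi') fun k => by
      rw [chartHom1_x1, hrel.coord1_eq hi' hi]]
  · intro hi
    have hi' : (c.map (ψ : R →+* B)).g0 * (i * ψ ((u⁻¹ : Rˣ) : R)) = 1 := by
      rw [← hrel.g0]
      change ψ u * _ * _ = _
      linear_combination ψ u * ψ ((u⁻¹ : Rˣ) : R) * hi + huu
    refine (hF'.2 hi').trans ?_
    rw [eq_chartHom2 h' hi (chartHom2_kk hE hi') (chartHom2_tt hE hi') fun k => by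
      rw [chartHom2_x2, hrel.coord2_eq hi' hi]]

theorem exists_rel_of_g1 (h : c.Eqs θ₀ θ₁ (t : R)) (h' : c'.Eqs θ₀ θ₁ (t : R))
    {F : Spec (CommRingCat.of R) ⟶ M θ₀ θ₁} (hF : IsClassifying θ₀ θ₁ c t F)
    (hF' : IsClassifying θ₀ θ₁ c' t F) {i i' : R} (hi : c.g1 * i = 1) (hi' : c'.g1 * i' = 1) :
    ∃ u l0 l1 : R, Rel u l0 l1 c c' := by
  have e := spec_comp_ι₁_injective _ _ ((hF.eq1 h hi).symm.trans (hF'.eq1 h' hi'))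
  have e' : ∀ k, c.coord1 i k = c'.coord1 i' k := fun k => by
    rw [← chartHom1_x1 h hi, ← chartHom1_x1 h' hi', e]
  have h1 := h.rel1 hi
  have h2 := h'.rel1 hi'
  rw [e', e', e'] at h1
  exact ⟨_, _, _, h1.trans (h2.symm hi')⟩

theorem exists_rel_of_g0 (h : c.Eqs θ₀ θ₁ (t : R)) (h' : c'.Eqs θ₀ θ₁ (t : R))
    {F : Spec (CommRingCat.of R) ⟶ M θ₀ θ₁} (hF : IsClassifying θ₀ θ₁ c t F)
    (hF' : IsClassifying θ₀ θ₁ c' t F) {i i' : R} (hi : c.g0 * i = 1) (hi' : c'.g0 * i' = 1) :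
    ∃ u l0 l1 : R, Rel u l0 l1 c c' := by
  have e := spec_comp_ι₂_injective _ _ ((hF.eq2 h hi).symm.trans (hF'.eq2 h' hi'))
  have e' : ∀ k, c.coord2 i k = c'.coord2 i' k := fun k => by
    rw [← chartHom2_x2 h hi, ← chartHom2_x2 h' hi', e]
  have h1 := h.rel2 hi
  have h2 := h'.rel2 hi'
  rw [e', e', e'] at h1
  exact ⟨_, _, _, h1.trans (h2.symm hi')⟩

theorem isUnit_g0_of_g1 (h : c.Eqs θ₀ θ₁ (t : R)) (h' : c'.Eqs θ₀ θ₁ (t : R))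
    {F : Spec (CommRingCat.of R) ⟶ M θ₀ θ₁} (hF : IsClassifying θ₀ θ₁ c t F)
    (hF' : IsClassifying θ₀ θ₁ c' t F) {i i' : R} (hi : c.g1 * i = 1) (hi' : c'.g0 * i' = 1) :
    IsUnit c.g0 := by
  have e := mul_eq_one_of_spec_comp_eq _ _ ((hF.eq1 h hi).symm.trans (hF'.eq2 h' hi'))
  rw [chartHom1_x1, chartHom2_x2] at e
  have e1 : c.coord1 i 1 = c.g0 * i := rfl
  rw [e1, mul_assoc] at e
  exact IsUnit.of_mul_eq_one _ e

theorem exists_rel_of_isUnit (h : c.Eqs θ₀ θ₁ (t : R)) (h' : c'.Eqs θ₀ θ₁ (t : R))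
    {F : Spec (CommRingCat.of R) ⟶ M θ₀ θ₁} (hF : IsClassifying θ₀ θ₁ c t F)
    (hF' : IsClassifying θ₀ θ₁ c' t F) (hu : IsUnit c.g0 ∨ IsUnit c.g1)
    (hu' : IsUnit c'.g0 ∨ IsUnit c'.g1) : ∃ u l0 l1 : R, Rel u l0 l1 c c' := by
  rcases hu with hu | hu <;> rcases hu' with hu' | hu'
  · exact exists_rel_of_g0 h h' hF hF' hu.mul_val_inv hu'.mul_val_inv
  · exact exists_rel_of_g0 h h' hF hF' hu.mul_val_inv
      (isUnit_g0_of_g1 h' h hF' hF hu'.mul_val_inv hu.mul_val_inv).mul_val_inv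
  · exact exists_rel_of_g0 h h' hF hF'
      (isUnit_g0_of_g1 h h' hF hF' hu.mul_val_inv hu'.mul_val_inv).mul_val_inv hu'.mul_val_inv
  · exact exists_rel_of_g1 h h' hF hF' hu.mul_val_inv hu'.mul_val_inv

open scoped Pointwise in
theorem exists_rel (h : c.Eqs θ₀ θ₁ (t : R)) (h' : c'.Eqs θ₀ θ₁ (t : R))
    {F : Spec (CommRingCat.of R) ⟶ M θ₀ θ₁} (hF : IsClassifying θ₀ θ₁ c t F)
    (hF' : IsClassifying θ₀ θ₁ c' t F) : ∃ u l0 l1 : R, Rel u l0 l1 c c' := by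
  have hs : Ideal.span (({c.g0, c.g1} : Set R) * ({c'.g0, c'.g1} : Set R)) = ⊤ := by
    rw [← Ideal.span_mul_span', h.span_eq_top, h'.span_eq_top, Ideal.top_mul]
  refine exists_rel_of_localization_span hs h'.span_eq_top ?_
  rintro _ ⟨a, ha, b, hb, rfl⟩
  let B := Localization.Away (a * b)
  let ψ : R →ₐ[ℂ] B := IsScalarTower.toAlgHom ℂ R _
  have hab : IsUnit (ψ a * ψ b) := by
    rw [← map_mul]
    exact IsLocalization.Away.algebraMap_isUnit (a * b)
  have hE : (c.map (ψ : R →+* B)).Eqs θ₀ θ₁ ((Units.map (ψ : R →* B) t : Bˣ) : B) :=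
    Eqs.map (ψ : R →+* B) ψ.commutes h
  have hE' : (c'.map (ψ : R →+* B)).Eqs θ₀ θ₁ ((Units.map (ψ : R →* B) t : Bˣ) : B) :=
    Eqs.map (ψ : R →+* B) ψ.commutes h'
  refine exists_rel_of_isUnit hE hE' (hF.comp ψ rfl) (hF'.comp ψ rfl) ?_ ?_
  · rcases ha with rfl | rfl
    · exact .inl (isUnit_of_mul_isUnit_left hab)
    · exact .inr (isUnit_of_mul_isUnit_left hab)
  · rcases hb with rfl | rfl
    · exact .inl (isUnit_of_mul_isUnit_right hab)
    · exact .inr (isUnit_of_mul_isUnit_right hab)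

end Coeffs

theorem classify_eq_iff (x y : Family θ₀ θ₁ R) : classify R x = classify R y ↔ x.Iso y := by
  have hx := isClassifying_classify x
  have hy := isClassifying_classify y
  constructor
  · intro h
    have ht : x.t = y.t := by
      have h1 := (hx.toT x.eqs).symm.trans ((congrArg (· ≫ M.toT θ₀ θ₁) h).trans (hy.toT y.eqs))
      have h2 : laurentHom x.t = laurentHom y.t := congr($(Spec.map_injective h1).hom)
      ext
      rw [← laurentHom_T, h2, laurentHom_T]
    rw [← h, ← ht] at hy
    have hyE := y.eqs
    rw [← ht] at hyE
    exact Family.iso_iff.2 ⟨ht, Coeffs.exists_rel x.eqs hyE hx hy⟩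
  · intro h
    obtain ⟨ht, u, l0, l1, hr⟩ := Family.iso_iff.1 h
    have := hx.of_rel x.eqs hr
    rw [ht] at this
    exact this.unique y.eqs hy

theorem exists_family_of_chart1 (φ : Chart1 θ₀ θ₁ →+* R)
    (h : Spec.map (CommRingCat.ofHom φ) ≫ ι₁ θ₀ θ₁ ≫ M.toC θ₀ θ₁ = specToC R) :
    ∃ x : Family θ₀ θ₁ R, classify R x = Spec.map (CommRingCat.ofHom φ) ≫ ι₁ θ₀ θ₁ ∧
      x.coeffs = Coeffs.normal1 θ₀ θ₁ (x.t : R) (φ (x1 _ _ 0)) (φ (x1 _ _ 1)) (φ (x1 _ _ 2)) := by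
  have hk : ∀ x, φ (kk _ x) = algebraMap ℂ R x := by
    intro x
    rw [M.toC, ← Category.assoc (ι₁ θ₀ θ₁), ι₁_toT, M₁.toT, TLine.toC, ← Spec.map_comp,
      ← Spec.map_comp] at h
    exact RingHom.congr_fun congr($(Spec.map_injective h).hom) x
  obtain ⟨t, ht⟩ := (isUnit_tt (Chart1 θ₀ θ₁)).map φ
  have h1 := eq1_of_ringHom φ hk
  rw [← ht] at h1
  obtain ⟨x, hx, rfl⟩ := (Coeffs.eqs_normal1 h1).exists_family
  refine ⟨x, ?_, hx⟩
  have hi : x.coeffs.g1 * 1 = 1 := by rw [hx]; exact mul_one _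
  refine ((isClassifying_classify x).eq1 x.eqs hi).trans ?_
  rw [← Coeffs.eq_chartHom1 x.eqs (φ := φ) hi hk ht.symm]
  intro k
  rw [hx]
  fin_cases k <;> simp [Coeffs.normal1, Coeffs.coord1]

theorem exists_family_of_chart2 (φ : Chart2 θ₀ θ₁ →+* R)
    (h : Spec.map (CommRingCat.ofHom φ) ≫ ι₂ θ₀ θ₁ ≫ M.toC θ₀ θ₁ = specToC R) :
    ∃ x : Family θ₀ θ₁ R, classify R x = Spec.map (CommRingCat.ofHom φ) ≫ ι₂ θ₀ θ₁ := by
  have hk : ∀ x, φ (kk _ x) = algebraMap ℂ R x := by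
    intro x
    rw [M.toC, ← Category.assoc (ι₂ θ₀ θ₁), ι₂_toT, M₂.toT, TLine.toC, ← Spec.map_comp,
      ← Spec.map_comp] at h
    exact RingHom.congr_fun congr($(Spec.map_injective h).hom) x
  obtain ⟨t, ht⟩ := (isUnit_tt (Chart2 θ₀ θ₁)).map φ
  have h1 := eq2_of_ringHom φ hk
  rw [← ht] at h1
  obtain ⟨x, hx, rfl⟩ := (Coeffs.eqs_normal2 h1).exists_family
  refine ⟨x, ?_⟩
  have hi : x.coeffs.g0 * 1 = 1 := by rw [hx]; exact mul_one _
  refine ((isClassifying_classify x).eq2 x.eqs hi).trans ?_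
  rw [← Coeffs.eq_chartHom2 x.eqs (φ := φ) hi hk ht.symm]
  intro k
  rw [hx]
  fin_cases k <;> simp [Coeffs.normal2, Coeffs.coord2]

theorem specToC_comp_away (r : R) :
    Spec.map (CommRingCat.ofHom (algebraMap R (Localization.Away r))) ≫ specToC R =
      specToC (Localization.Away r) := by
  rw [specToC, specToC, ← Spec.map_comp, ← CommRingCat.ofHom_comp, ← IsScalarTower.algebraMap_eq]

theorem exists_family_locally (f : Spec (CommRingCat.of R) ⟶ M θ₀ θ₁)
    (hf : f ≫ M.toC θ₀ θ₁ = specToC R) :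
    ∃ s : Set R, Ideal.span s = ⊤ ∧ ∀ r ∈ s, ∃ x : Family θ₀ θ₁ (Localization.Away r),
      classify _ x =
        Spec.map (CommRingCat.ofHom (algebraMap R (Localization.Away r))) ≫ f := by
  refine ⟨{r | ∃ x : Family θ₀ θ₁ (Localization.Away r), classify _ x =
        Spec.map (CommRingCat.ofHom (algebraMap R (Localization.Away r))) ≫ f}, ?_, fun r hr => hr⟩
  by_contra hne
  obtain ⟨m, hm, hsm⟩ := Ideal.exists_le_maximal _ hne
  let p : Spec (CommRingCat.of R) := ⟨m, hm.isPrime⟩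
  have key : ∀ U : (M θ₀ θ₁).Opens, f p ∈ U → ∃ r ∉ m,
      Set.range (Spec.map (CommRingCat.ofHom (algebraMap R (Localization.Away r))) ≫ f) ⊆ U := by
    intro U hU
    obtain ⟨_, ⟨r, rfl⟩, hr, hrU⟩ := PrimeSpectrum.isTopologicalBasis_basic_opens.exists_subset_of_mem_open
      (show p ∈ f ⁻¹' U from hU) (U.2.preimage f.continuous)
    refine ⟨r, hr, ?_⟩
    rintro _ ⟨q, rfl⟩
    rw [Scheme.Hom.comp_apply]
    refine hrU ?_
    have : Spec.map (CommRingCat.ofHom (algebraMap R (Localization.Away r))) q ∈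
        Set.range (PrimeSpectrum.comap (algebraMap R (Localization.Away r))) := ⟨q, rfl⟩
    rwa [PrimeSpectrum.localization_away_comap_range (Localization.Away r) r] at this
  have hC : ∀ r : R, (Spec.map (CommRingCat.ofHom (algebraMap R (Localization.Away r))) ≫ f) ≫
      M.toC θ₀ θ₁ = specToC (Localization.Away r) := fun r => by
    rw [Category.assoc, hf, specToC_comp_away]
  rcases mem_range_or θ₀ θ₁ (f p) with h | h
  · obtain ⟨r, hr, hrU⟩ := key (ι₁ θ₀ θ₁).opensRange h
    obtain ⟨φ, hφ⟩ := exists_spec_of_range_ι₁ θ₀ θ₁ _ hrU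
    have hC' := hC r
    rw [hφ, Category.assoc] at hC'
    obtain ⟨x, hx, -⟩ := exists_family_of_chart1 φ hC'
    exact hr (hsm (Ideal.subset_span ⟨x, hx.trans hφ.symm⟩))
  · obtain ⟨r, hr, hrU⟩ := key (ι₂ θ₀ θ₁).opensRange h
    obtain ⟨φ, hφ⟩ := exists_spec_of_range_ι₂ θ₀ θ₁ _ hrU
    have hC' := hC r
    rw [hφ, Category.assoc] at hC'
    obtain ⟨x, hx⟩ := exists_family_of_chart2 φ hC'
    exact hr (hsm (Ideal.subset_span ⟨x, hx.trans hφ.symm⟩))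

theorem classify_represents :
    (classify : Assignment θ₀ θ₁).Represents (fun _ _ _ _ => True) := by
  refine ⟨fun R _ _ x y _ _ => classify_eq_iff x y, fun R _ _ f hf => ?_⟩
  obtain ⟨s, hs, h⟩ := exists_family_locally f hf
  refine ⟨s, hs, fun r hr => ?_⟩
  obtain ⟨x, hx⟩ := h r hr
  exact ⟨x, trivial, hx⟩

end

end DegPV

namespace DegPV

noncomputable section

variable {θ₀ θ₁ : ℂ} {R : Type} [CommRing R] [Algebra ℂ R]

theorem isLocallyTriangular_of_charpoly {B : Matrix (Fin 2) (Fin 2) R} {ω : ℂ} (hω : ω ≠ 0)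
    (h : B.charpoly = X ^ 2 - C (algebraMap ℂ R (ω ^ 2))) : IsLocallyTriangular B ω := by
  obtain ⟨h1, h2⟩ := (charpoly_eq_iff _ _).1 h
  have h3 : B 1 1 = -B 0 0 := by linear_combination h1
  rw [h3, map_pow] at h2
  refine ⟨{B 0 0 + algebraMap ℂ R ω, algebraMap ℂ R ω - B 0 0}, ?_, ?_⟩
  · rw [Ideal.eq_top_iff_one, Ideal.mem_span_pair]
    refine ⟨algebraMap ℂ R (1 / (2 * ω)), algebraMap ℂ R (1 / (2 * ω)), ?_⟩
    have : algebraMap ℂ R (1 / (2 * ω)) * (2 * algebraMap ℂ R ω) = 1 := by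
      rw [← map_ofNat (algebraMap ℂ R) 2, ← map_mul, ← map_mul, one_div_mul_cancel (by simpa),
        map_one]
    linear_combination this
  · rintro r hr
    have hω' : algebraMap R (Localization.Away r) (algebraMap ℂ R ω) =
      algebraMap ℂ (Localization.Away r) ω := (IsScalarTower.algebraMap_apply ℂ R _ ω).symm
    have hi : algebraMap R (Localization.Away r) r * IsLocalization.Away.invSelf r = 1 :=
      IsLocalization.Away.mul_invSelf r
    have h2' := congrArg (algebraMap R (Localization.Away r)) h2
    simp only [map_mul, map_sub, map_neg, map_pow, hω'] at h2'
    rcases hr with hr | hr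
    · have e : algebraMap R (Localization.Away r) r = algebraMap R (Localization.Away r) (B 0 0) +
          algebraMap ℂ (Localization.Away r) ω := by rw [← hω', ← map_add]; exact congrArg _ hr
      rw [e] at hi
      generalize (IsLocalization.Away.invSelf r : Localization.Away r) = i at hi
      have hdet : IsUnit (!![algebraMap R (Localization.Away r) (B 0 0) +
          algebraMap ℂ (Localization.Away r) ω, 0; algebraMap R (Localization.Away r) (B 1 0), 1] :
          Matrix (Fin 2) (Fin 2) (Localization.Away r)) := by
        rw [Matrix.isUnit_iff_isUnit_det, Matrix.det_fin_two_of]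
        exact IsUnit.of_mul_eq_one i (by linear_combination hi)
      obtain ⟨g, hg⟩ := hdet
      refine ⟨g, algebraMap R (Localization.Away r) (B 0 1) * i, ?_⟩
      rw [hg]
      ext k l
      fin_cases k <;> fin_cases l <;> simp [Matrix.mul_apply, Fin.sum_univ_two, h3]
      · linear_combination (-1 : Localization.Away r) * h2'
      · linear_combination (-algebraMap R (Localization.Away r) (B 0 1)) * hi
      · ring
      · linear_combination i * h2' +
          (algebraMap R (Localization.Away r) (B 0 0) - algebraMap ℂ (Localization.Away r) ω) * hi
    · have e : algebraMap R (Localization.Away r) r = algebraMap ℂ (Localization.Away r) ω -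
          algebraMap R (Localization.Away r) (B 0 0) := by
        rw [← hω', ← map_sub]; exact congrArg _ hr
      rw [e] at hi
      generalize (IsLocalization.Away.invSelf r : Localization.Away r) = i at hi
      have hdet : IsUnit (!![algebraMap R (Localization.Away r) (B 0 1), 1;
          algebraMap ℂ (Localization.Away r) ω - algebraMap R (Localization.Away r) (B 0 0), 0] :
          Matrix (Fin 2) (Fin 2) (Localization.Away r)) := by
        rw [Matrix.isUnit_iff_isUnit_det, Matrix.det_fin_two_of]
        exact IsUnit.of_mul_eq_one (-i) (by linear_combination hi)
      obtain ⟨g, hg⟩ := hdet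
      refine ⟨g, algebraMap R (Localization.Away r) (B 1 0) * i, ?_⟩
      rw [hg]
      ext k l
      fin_cases k <;> fin_cases l <;> simp [Matrix.mul_apply, Fin.sum_univ_two, h3]
      · ring
      · linear_combination i * h2' -
          (algebraMap R (Localization.Away r) (B 0 0) + algebraMap ℂ (Localization.Away r) ω) * hi
      · linear_combination (-1 : Localization.Away r) * h2'
      · linear_combination (-algebraMap R (Localization.Away r) (B 1 0)) * hi

theorem IsLocallyTriangular.conj {B B' : Matrix (Fin 2) (Fin 2) R} {ω : ℂ}
    (h : IsLocallyTriangular B ω) (G : (Matrix (Fin 2) (Fin 2) R)ˣ) (hG : G.val * B = B' * G.val) :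
    IsLocallyTriangular B' ω := by
  obtain ⟨s, hs, h⟩ := h
  refine ⟨s, hs, fun r hr => ?_⟩
  obtain ⟨g, c, hg⟩ := h r hr
  let G' := Units.map ((algebraMap R (Localization.Away r)).mapMatrix (m := Fin 2)).toMonoidHom G
  refine ⟨G' * g, c, ?_⟩
  have hG' : G'.val * B.map (algebraMap R (Localization.Away r)) =
      B'.map (algebraMap R (Localization.Away r)) * G'.val := by
    have := congrArg (algebraMap R (Localization.Away r)).mapMatrix hG
    rwa [map_mul, map_mul] at this
  rw [Units.val_mul, ← mul_assoc, ← hG', mul_assoc, hg, mul_assoc]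

theorem IsLocallyTriangular.eq_zero {e : R} (h : IsLocallyTriangular !![e, 0; 0, -e] 0) :
    e = 0 := by
  obtain ⟨s, hs, h⟩ := h
  refine eq_of_localization_span hs fun r hr => ?_
  obtain ⟨g, c, hg⟩ := h r hr
  have h0 := congrFun (congrFun hg 0) 0
  have h1 := congrFun (congrFun hg 1) 0
  simp [Matrix.mul_apply, Fin.sum_univ_two] at h0 h1
  have hdet : IsUnit (g.val.det) := (Matrix.isUnit_iff_isUnit_det _).1 g.isUnit
  rw [map_zero, ← hdet.mul_left_eq_zero, Matrix.det_fin_two]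
  linear_combination g.val 1 1 * h0 - g.val 0 1 * h1

omit [Algebra ℂ R] in
theorem Coeffs.Rel.eval {u l0 l1 : R} {c c' : Coeffs R} (h : Coeffs.Rel u l0 l1 c c') {a : R}
    (ha : a * (a - 1) = 0) :
    !![u, l0 + l1 * a; 0, 1] * c.matrix.map (eval a) =
      c'.matrix.map (eval a) * !![u, l0 + l1 * a; 0, 1] := by
  obtain ⟨h1, h2, h3⟩ := Coeffs.rel_iff.1 h
  have e : ∀ c : Coeffs R, c.matrix 1 1 = -c.matrix 0 0 := fun c => rfl
  replace h1 := congrArg (Polynomial.eval a) h1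
  replace h2 := congrArg (Polynomial.eval a) h2
  replace h3 := congrArg (Polynomial.eval a) h3
  simp only [eval_mul, eval_add, eval_sub, eval_C, eval_X, eval_one, ha, zero_mul, sub_zero]
    at h1 h2 h3
  ext i j
  fin_cases i <;> fin_cases j <;> simp [Matrix.mul_apply, Fin.sum_univ_two, e]
  · linear_combination u * h2 - (l0 + l1 * a) * h1
  · linear_combination h3
  · linear_combination (-1 : R) * h1
  · linear_combination (-1 : R) * h2

theorem Family.Iso.isTriangular {x y : Family θ₀ θ₁ R} (h : x.Iso y) (hx : x.IsTriangular) :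
    y.IsTriangular := by
  obtain ⟨-, u, l0, l1, hr⟩ := Family.iso_iff.1 h
  have hu := hr.isUnit x.eqs.span_eq_top
  have hG : ∀ a, IsUnit (!![u, l0 + l1 * a; 0, 1] : Matrix (Fin 2) (Fin 2) R) := fun a => by
    rw [Matrix.isUnit_iff_isUnit_det, Matrix.det_fin_two_of]
    simpa using hu
  constructor
  · refine hx.1.conj (hG 0).unit ?_
    have := hr.eval (a := 0) (by simp)
    rw [x.matrix_coeffs, y.matrix_coeffs] at this
    rw [IsUnit.unit_spec, BundleConnection.residueZero, BundleConnection.residueZero, mul_neg,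
      neg_mul, this]
  · refine hx.2.conj (hG 1).unit ?_
    have := hr.eval (a := 1) (by simp)
    rwa [x.matrix_coeffs, y.matrix_coeffs] at this

theorem Family.isTriangular (x : Family θ₀ θ₁ R) (h₀ : θ₀ ≠ 0) (h₁ : θ₁ ≠ 0) :
    x.IsTriangular := by
  constructor
  · refine isLocallyTriangular_of_charpoly (by simpa) ?_
    rw [x.at_zero]
    congr 3
    ring
  · refine isLocallyTriangular_of_charpoly (by simpa) ?_
    rw [x.at_one]
    congr 3
    ring

/-- If the triangular families represent `M`, then every family is locally triangular. -/
theorem exists_isTriangular_locally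
    (h : (classify : Assignment θ₀ θ₁).Represents (fun _ _ _ x => x.IsTriangular))
    (y : Family θ₀ θ₁ R) : ∃ s : Set R, Ideal.span s = ⊤ ∧ ∀ r ∈ s,
      ∃ x : Family θ₀ θ₁ (Localization.Away r), x.IsTriangular ∧
        x.coeffs = y.coeffs.map (algebraMap R _) := by
  obtain ⟨s, hs, hs'⟩ := h.2 R (classify R y) (classify_isNatural.1 R y)
  refine ⟨s, hs, fun r hr => ?_⟩
  obtain ⟨x, hx, hxc⟩ := hs' r hr
  let ψ : R →ₐ[ℂ] Localization.Away r := IsScalarTower.toAlgHom ℂ R _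
  have hE : (y.coeffs.map (ψ : R →+* Localization.Away r)).Eqs θ₀ θ₁
      ((Units.map (ψ : R →* Localization.Away r) y.t : (Localization.Away r)ˣ) : Localization.Away r) :=
    Coeffs.Eqs.map (ψ : R →+* Localization.Away r) ψ.commutes y.eqs
  obtain ⟨y', hy', ht⟩ := hE.exists_family
  have hc := (isClassifying_classify y).comp ψ (t' := y'.t) (by rw [ht]; rfl)
  rw [← hy'] at hc
  have e := (isClassifying_classify y').unique y'.eqs hc
  exact ⟨y', ((classify_eq_iff x y').1 (hxc.trans e.symm)).isTriangular hx, hy'⟩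

theorem represents_isTriangular_iff :
    (classify : Assignment θ₀ θ₁).Represents (fun _ _ _ x => x.IsTriangular) ↔
      θ₀ ≠ 0 ∧ θ₁ ≠ 0 := by
  constructor
  · intro h
    have hε : (DualNumber.eps : DualNumber ℂ) ≠ 0 := by
      intro h
      have := congrArg TrivSqZeroExt.snd h
      simp at this
    have hε2 : (DualNumber.eps : DualNumber ℂ) ^ 2 = 0 := by rw [pow_two, DualNumber.eps_mul_eps]
    constructor
    · rintro rfl
      have h1 : Eq1 0 θ₁ ((1 : (DualNumber ℂ)ˣ) : DualNumber ℂ) DualNumber.eps 0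
          (algebraMap ℂ _ (θ₁ ^ 2 / 4) - 1) := by
        rw [Eq1, hε2]; simp
      obtain ⟨y, hy, -⟩ := (Coeffs.eqs_normal1 h1).exists_family
      obtain ⟨s, hs, hs'⟩ := exists_isTriangular_locally h y
      refine hε (eq_of_localization_span hs fun r hr => ?_)
      obtain ⟨x, hx, hxc⟩ := hs' r hr
      have hx0 := hx.1
      have e : x.conn.residueZero = !![-algebraMap (DualNumber ℂ) (Localization.Away r) DualNumber.eps, 0; 0,
          - -algebraMap (DualNumber ℂ) (Localization.Away r) DualNumber.eps] := by
        rw [BundleConnection.residueZero, ← x.matrix_coeffs, hxc, hy]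
        ext i j
        fin_cases i <;> fin_cases j <;> simp [Coeffs.matrix, Coeffs.normal1]
      rw [e, zero_div] at hx0
      rw [map_zero]
      exact neg_eq_zero.1 hx0.eq_zero
    · rintro rfl
      have h1 : Eq1 θ₀ 0 ((1 : (DualNumber ℂ)ˣ) : DualNumber ℂ) DualNumber.eps (-1)
          (algebraMap ℂ _ (θ₀ ^ 2 / 4) - 1) := by
        rw [Eq1, hε2]; simp; ring
      obtain ⟨y, hy, -⟩ := (Coeffs.eqs_normal1 h1).exists_family
      obtain ⟨s, hs, hs'⟩ := exists_isTriangular_locally h y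
      refine hε (eq_of_localization_span hs fun r hr => ?_)
      obtain ⟨x, hx, hxc⟩ := hs' r hr
      have hx0 := hx.2
      have e : x.conn.residueOne = !![algebraMap (DualNumber ℂ) (Localization.Away r) DualNumber.eps, 0; 0,
          -algebraMap (DualNumber ℂ) (Localization.Away r) DualNumber.eps] := by
        rw [BundleConnection.residueOne, ← x.matrix_coeffs, hxc, hy]
        ext i j
        fin_cases i <;> fin_cases j <;> simp [Coeffs.matrix, Coeffs.normal1]
        ring
      rw [e, zero_div] at hx0
      rw [map_zero]
      exact hx0.eq_zero
  · rintro ⟨h₀, h₁⟩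
    refine ⟨fun R _ _ x y _ _ => classify_eq_iff x y, fun R _ _ f hf => ?_⟩
    obtain ⟨s, hs, h⟩ := exists_family_locally f hf
    refine ⟨s, hs, fun r hr => ?_⟩
    obtain ⟨x, hx⟩ := h r hr
    exact ⟨x, x.isTriangular h₀ h₁, hx⟩

end

end DegPV

namespace DegPV

noncomputable section

/-! ### Expansions of rational functions -/

theorem algebraMap_laurentSeries (c : ℂ) :
    algebraMap ℂ (LaurentSeries ℂ) c = HahnSeries.C c :=
  (HahnSeries.algebraMap_apply' ℤ _).trans (by
    rw [PowerSeries.algebraMap_apply, HahnSeries.ofPowerSeries_C, Algebra.algebraMap_self_apply])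

theorem lderiv_C (c : ℂ) : lderiv (HahnSeries.C c : LaurentSeries ℂ) = 0 := by
  rw [← HahnSeries.ofPowerSeries_C, lderiv_ofPowerSeries]
  simp

theorem lderiv_aeval (x : LaurentSeries ℂ) (p : ℂ[X]) :
    lderiv (aeval x p) = aeval x (derivative p) * lderiv x := by
  induction p using Polynomial.induction_on with
  | C c => rw [aeval_C, derivative_C, map_zero, zero_mul, algebraMap_laurentSeries, lderiv_C]
  | add p q hp hq => rw [map_add, lderiv_add, hp, hq, derivative_add, map_add, add_mul]
  | monomial n c h =>
    rw [pow_succ, ← mul_assoc]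
    generalize C c * X ^ n = q at h ⊢
    rw [map_mul, lderiv_mul, h, derivative_mul, derivative_X, mul_one, map_add, map_mul, aeval_X]
    ring

/-- The expansion of rational functions, as a homomorphism. -/
def expandHom (x : LaurentSeries ℂ) (hx : ∀ p : ℂ[X], p ≠ 0 → aeval x p ≠ 0) :
    RatFunc ℂ →ₐ[ℂ] LaurentSeries ℂ :=
  RatFunc.liftAlgHom (aeval x) fun p hp =>
    mem_nonZeroDivisors_of_ne_zero (hx p (nonZeroDivisors.ne_zero hp))

section

variable {x : LaurentSeries ℂ} (hx : ∀ p : ℂ[X], p ≠ 0 → aeval x p ≠ 0)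

theorem expandHom_apply (r : RatFunc ℂ) : expandHom x hx r = expand x r := by
  have h : algebraMap ℂ (LaurentSeries ℂ) = HahnSeries.C := RingHom.ext algebraMap_laurentSeries
  refine (RatFunc.liftAlgHom_apply (aeval x) _ r).trans ?_
  rw [expand, RatFunc.eval, aeval_def, aeval_def, h]

theorem expandHom_algebraMap (p : ℂ[X]) :
    expandHom x hx (algebraMap ℂ[X] (RatFunc ℂ) p) = aeval x p := by
  have := RatFunc.liftAlgHom_apply_div (aeval x) (fun p hp =>
    mem_nonZeroDivisors_of_ne_zero (hx p (nonZeroDivisors.ne_zero hp))) p 1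
  simpa [expandHom] using this

theorem lderiv_expandHom (r : RatFunc ℂ) :
    lderiv (expandHom x hx r) = expandHom x hx (rderiv r) * lderiv x := by
  obtain ⟨p, q, hq, rfl⟩ := exists_div r
  have hq' := hx q hq
  have h := congrArg lderiv (div_mul_cancel₀ (aeval x p) hq')
  rw [lderiv_mul, lderiv_aeval, lderiv_aeval] at h
  rw [rderiv_div _ _ hq]
  simp only [map_div₀, expandHom_algebraMap, map_pow, map_sub, map_mul]
  generalize lderiv (aeval x p / aeval x q) = y at h ⊢
  field_simp at h ⊢
  linear_combination h

end

theorem aeval_zAt (a : ℂ) (p : ℂ[X]) :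
    aeval (zAt a) p = HahnSeries.ofPowerSeries ℤ ℂ ((taylor a p : ℂ[X]) : ℂ⟦X⟧) := by
  have h1 : zAt a = HahnSeries.ofPowerSeries ℤ ℂ (PowerSeries.C a + PowerSeries.X) := by
    rw [map_add, HahnSeries.ofPowerSeries_C, HahnSeries.ofPowerSeries_X, zAt]
  induction p using Polynomial.induction_on' with
  | add p q hp hq => rw [map_add, hp, hq, map_add, Polynomial.coe_add, map_add]
  | monomial n c =>
    rw [aeval_monomial, h1, taylor_monomial, Polynomial.coe_mul, Polynomial.coe_pow,
      Polynomial.coe_add, Polynomial.coe_X, Polynomial.coe_C, Polynomial.coe_C, map_mul, map_pow,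
      HahnSeries.ofPowerSeries_C, algebraMap_laurentSeries, add_comm]

theorem aeval_zAt_ne_zero (a : ℂ) (p : ℂ[X]) (hp : p ≠ 0) : aeval (zAt a) p ≠ 0 := by
  rw [aeval_zAt, map_ne_zero_iff _ HahnSeries.ofPowerSeries_injective]
  simpa [Polynomial.coe_eq_zero_iff] using hp

theorem aeval_zInf_ne_zero (p : ℂ[X]) (hp : p ≠ 0) : aeval (zInf ℂ) p ≠ 0 := by
  intro h
  have h1 := single_mul_aeval_zInf (p := p) le_rfl
  rw [h, mul_zero] at h1
  have h2 := coeff_revSeries (n := p.natDegree) (Nat.zero_le _) p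
  rw [(map_eq_zero_iff _ HahnSeries.ofPowerSeries_injective).1 h1.symm, map_zero] at h2
  exact hp (leadingCoeff_eq_zero.1 h2.symm)

/-- The substitution `w = u⁴`. -/
def ram : LaurentSeries ℂ →+* LaurentSeries ℂ :=
  HahnSeries.embDomainRingHom (AddMonoidHom.mulLeft (4 : ℤ)) (fun a b h => by simpa using h)
    (fun a b => by simp)

theorem coeff_ram_four_mul (f : LaurentSeries ℂ) (n : ℤ) : (ram f).coeff (4 * n) = f.coeff n :=
  HahnSeries.embDomain_coeff (f := (⟨⟨AddMonoidHom.mulLeft (4 : ℤ), fun a b h => by simpa using h⟩,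
    by simp⟩ : ℤ ↪o ℤ))

theorem coeff_ram_of_not_dvd (f : LaurentSeries ℂ) {n : ℤ} (hn : ¬ 4 ∣ n) :
    (ram f).coeff n = 0 := by
  refine HahnSeries.embDomain_of_notMem_range (f := (⟨⟨AddMonoidHom.mulLeft (4 : ℤ),
    fun a b h => by simpa using h⟩, by simp⟩ : ℤ ↪o ℤ)) ?_
  rintro ⟨m, rfl⟩
  exact hn ⟨m, rfl⟩

theorem ram_single (n : ℤ) (c : ℂ) : ram (HahnSeries.single n c) = HahnSeries.single (4 * n) c :=
  HahnSeries.embDomain_single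

theorem ram_C (c : ℂ) : ram (HahnSeries.C c) = HahnSeries.C c := by
  rw [HahnSeries.C_apply, ram_single, mul_zero]

theorem ram_aeval (f : LaurentSeries ℂ) (p : ℂ[X]) : ram (aeval f p) = aeval (ram f) p := by
  rw [aeval_def, aeval_def, hom_eval₂]
  congr 1
  ext c
  rw [RingHom.comp_apply, algebraMap_laurentSeries, ram_C]

theorem ram_zInf : ram (zInf ℂ) = zRam := ram_single _ _

theorem aeval_zRam_ne_zero (p : ℂ[X]) (hp : p ≠ 0) : aeval zRam p ≠ 0 := by
  rw [← ram_zInf, ← ram_aeval]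
  exact (map_ne_zero_iff _ ram.injective).2 (aeval_zInf_ne_zero p hp)

/-- The expansion at the point `a`. -/
def atHom (a : ℂ) : RatFunc ℂ →ₐ[ℂ] LaurentSeries ℂ := expandHom (zAt a) (aeval_zAt_ne_zero a)

/-- The expansion at infinity. -/
def infHom : RatFunc ℂ →ₐ[ℂ] LaurentSeries ℂ := expandHom (zInf ℂ) aeval_zInf_ne_zero

theorem atHom_apply (a : ℂ) (r : RatFunc ℂ) : atHom a r = expand (zAt a) r := expandHom_apply _ _

theorem atHom_algebraMap (a : ℂ) (p : ℂ[X]) :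
    atHom a (algebraMap ℂ[X] (RatFunc ℂ) p) = aeval (zAt a) p := expandHom_algebraMap _ _

theorem infHom_algebraMap (p : ℂ[X]) :
    infHom (algebraMap ℂ[X] (RatFunc ℂ) p) = aeval (zInf ℂ) p := expandHom_algebraMap _ _

theorem atHom_X (a : ℂ) : atHom a RatFunc.X = zAt a := by
  rw [← RatFunc.algebraMap_X, atHom_algebraMap, aeval_X]

theorem infHom_X : infHom RatFunc.X = zInf ℂ := by
  rw [← RatFunc.algebraMap_X, infHom_algebraMap, aeval_X]

theorem ram_infHom (r : RatFunc ℂ) : ram (infHom r) = expand zRam r := by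
  obtain ⟨p, q, -, rfl⟩ := exists_div r
  rw [← expandHom_apply aeval_zRam_ne_zero, map_div₀, map_div₀, map_div₀, infHom_algebraMap,
    infHom_algebraMap, expandHom_algebraMap, expandHom_algebraMap, ram_aeval, ram_aeval, ram_zInf]

theorem lderiv_zAt (a : ℂ) : lderiv (zAt a) = 1 := by
  rw [zAt, lderiv_add, lderiv_C, zero_add, ← HahnSeries.ofPowerSeries_X, lderiv_ofPowerSeries]
  simp

theorem lderiv_atHom (a : ℂ) (r : RatFunc ℂ) : lderiv (atHom a r) = atHom a (rderiv r) := by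
  have h := lderiv_expandHom (aeval_zAt_ne_zero a) r
  rw [lderiv_zAt, mul_one] at h
  exact h

theorem single_mul_lderiv_zInf : HahnSeries.single 1 1 * lderiv (zInf ℂ) = -zInf ℂ := by
  ext n
  rw [HahnSeries.coeff_single_mul, coeff_lderiv, zInf, one_mul, HahnSeries.coeff_neg,
    sub_add_cancel]
  by_cases hn : n = -1
  · subst hn; simp
  · rw [HahnSeries.coeff_single_of_ne hn]; simp

theorem eulerInf_infHom (r : RatFunc ℂ) : eulerInf (infHom r) = infHom (RatFunc.X * rderiv r) := by
  have h : lderiv (infHom r) = infHom (rderiv r) * lderiv (zInf ℂ) :=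
    lderiv_expandHom aeval_zInf_ne_zero r
  rw [eulerInf, map_mul, infHom_X, h]
  linear_combination (-infHom (rderiv r)) * single_mul_lderiv_zInf

/-! ### Integral Laurent series -/

/-- The ring of power series, inside the field of Laurent series. -/
def integers : Subring (LaurentSeries ℂ) := (HahnSeries.ofPowerSeries ℤ ℂ).range

theorem mem_integers_iff {f : LaurentSeries ℂ} : f ∈ integers ↔ ∀ n < 0, f.coeff n = 0 := by
  constructor
  · rintro ⟨F, rfl⟩ n hn
    rw [PowerSeries.coeff_coe, if_pos hn]
  · intro h
    refine ⟨PowerSeries.mk fun n => f.coeff n, ?_⟩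
    ext n
    rw [PowerSeries.coeff_coe]
    split_ifs with hn
    · exact (h n hn).symm
    · rw [PowerSeries.coeff_mk, Int.natAbs_of_nonneg (not_lt.1 hn)]

theorem coeff_zero_ofPowerSeries (F : ℂ⟦X⟧) :
    (HahnSeries.ofPowerSeries ℤ ℂ F).coeff 0 = PowerSeries.constantCoeff F := by
  rw [PowerSeries.coeff_coe]
  simp

/-- The constant coefficient is multiplicative on integral series. -/
theorem coeff_zero_mul {f g : LaurentSeries ℂ} (hf : f ∈ integers) (hg : g ∈ integers) :
    (f * g).coeff 0 = f.coeff 0 * g.coeff 0 := by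
  obtain ⟨F, rfl⟩ := hf
  obtain ⟨G, rfl⟩ := hg
  rw [← map_mul, coeff_zero_ofPowerSeries, coeff_zero_ofPowerSeries, coeff_zero_ofPowerSeries,
    map_mul]

theorem inv_mem_integers {f : LaurentSeries ℂ} (hf : f ∈ integers) (h0 : f.coeff 0 ≠ 0) :
    f⁻¹ ∈ integers := by
  obtain ⟨F, rfl⟩ := hf
  rw [coeff_zero_ofPowerSeries] at h0
  refine ⟨F⁻¹, ?_⟩
  rw [eq_comm, inv_eq_iff_eq_inv, eq_comm]
  refine inv_eq_of_mul_eq_one_right ?_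
  rw [← map_mul, PowerSeries.inv_mul_cancel F h0, map_one]

theorem aeval_zAt_mem_integers (a : ℂ) (p : ℂ[X]) : aeval (zAt a) p ∈ integers := by
  rw [aeval_zAt]
  exact ⟨_, rfl⟩

theorem coeff_zero_aeval_zAt (a : ℂ) (p : ℂ[X]) : (aeval (zAt a) p).coeff 0 = p.eval a := by
  rw [aeval_zAt, coeff_zero_ofPowerSeries, ← PowerSeries.coeff_zero_eq_constantCoeff_apply,
    Polynomial.coeff_coe, taylor_coeff_zero]

theorem atHom_mul_denom (a : ℂ) (r : RatFunc ℂ) :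
    atHom a r * aeval (zAt a) r.denom = aeval (zAt a) r.num := by
  have h : r * algebraMap ℂ[X] (RatFunc ℂ) r.denom = algebraMap ℂ[X] (RatFunc ℂ) r.num := by
    have h0 : algebraMap ℂ[X] (RatFunc ℂ) r.denom ≠ 0 := by simpa using r.denom_ne_zero
    rw [← div_eq_iff h0 |>.1 r.num_div_denom]
  rw [← atHom_algebraMap, ← atHom_algebraMap, ← map_mul, h]

theorem mem_localRing_iff {a : ℂ} {r : RatFunc ℂ} :
    r ∈ localRing a ↔ atHom a r ∈ integers := by
  constructor
  · rintro ⟨p, q, hq, rfl⟩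
    rw [map_div₀, atHom_algebraMap, atHom_algebraMap, div_eq_mul_inv]
    refine integers.mul_mem (aeval_zAt_mem_integers a p)
      (inv_mem_integers (aeval_zAt_mem_integers a q) ?_)
    rwa [coeff_zero_aeval_zAt]
  · intro h
    refine ⟨r.num, r.denom, fun h0 => ?_, r.num_div_denom.symm⟩
    have h1 := atHom_mul_denom a r
    have h2 := congrArg (fun f => HahnSeries.coeff f 0) h1
    simp only [coeff_zero_mul h (aeval_zAt_mem_integers a _), coeff_zero_aeval_zAt, h0,
      mul_zero] at h2
    obtain ⟨u, v, huv⟩ := r.isCoprime_num_denom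
    have := congrArg (eval a) huv
    simp [h0, ← h2] at this

theorem coeff_zero_atHom {a : ℂ} {r : RatFunc ℂ} (hr : r ∈ localRing a) :
    (atHom a r).coeff 0 = RatFunc.eval (RingHom.id ℂ) a r := by
  have h1 := atHom_mul_denom a r
  have h2 := congrArg (fun f => HahnSeries.coeff f 0) h1
  simp only [coeff_zero_mul (mem_localRing_iff.1 hr) (aeval_zAt_mem_integers a _),
    coeff_zero_aeval_zAt] at h2
  have h3 : r.denom.eval a ≠ 0 := by
    intro h0
    rw [h0, mul_zero] at h2
    obtain ⟨u, v, huv⟩ := r.isCoprime_num_denom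
    have := congrArg (eval a) huv
    simp [h0, ← h2] at this
  rw [RatFunc.eval, eval₂_id, eval₂_id, eq_div_iff h3, h2]

theorem exists_polynomial_of_forall_mem {r : RatFunc ℂ} (h : ∀ a, r ∈ localRing a) :
    ∃ p : ℂ[X], algebraMap ℂ[X] (RatFunc ℂ) p = r := by
  have hd : r.denom.degree = 0 := by
    by_contra hd
    obtain ⟨a, ha⟩ := IsAlgClosed.exists_root r.denom hd
    obtain ⟨p, q, hq, e⟩ := h a
    have hdvd : r.denom ∣ q := by
      rw [e]
      exact RatFunc.denom_div_dvd p q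
    exact hq (eval_eq_zero_of_dvd_of_eval_eq_zero hdvd ha)
  refine ⟨r.num, ?_⟩
  have h1 : r.denom = 1 := eq_one_of_monic_natDegree_zero r.monic_denom
    (natDegree_eq_of_degree_eq_some hd)
  conv_rhs => rw [← r.num_div_denom, h1, map_one, div_one]

end

end DegPV

namespace DegPV

noncomputable section

/-! ### Gauge transformations -/

/-- An additive map satisfying the Leibniz rule. -/
structure IsDer {R : Type} [CommRing R] (δ : R → R) : Prop where
  add : ∀ x y, δ (x + y) = δ x + δ y
  mul : ∀ x y, δ (x * y) = δ x * y + x * δ y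

theorem IsDer.zero {R : Type} [CommRing R] {δ : R → R} (h : IsDer δ) : δ 0 = 0 := by
  simpa using h.add 0 0

theorem IsDer.one {R : Type} [CommRing R] {δ : R → R} (h : IsDer δ) : δ 1 = 0 := by
  simpa using h.mul 1 1

theorem IsDer.neg {R : Type} [CommRing R] {δ : R → R} (h : IsDer δ) (x : R) :
    δ (-x) = -δ x := by
  have := h.add (-x) x
  rw [neg_add_cancel, h.zero] at this
  exact eq_neg_of_add_eq_zero_left this.symm

theorem IsDer.sub {R : Type} [CommRing R] {δ : R → R} (h : IsDer δ) (x y : R) :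
    δ (x - y) = δ x - δ y := by
  rw [sub_eq_add_neg, h.add, h.neg, ← sub_eq_add_neg]

theorem IsDer.const_mul {R : Type} [CommRing R] {δ : R → R} (h : IsDer δ) (c : R) :
    IsDer fun x => c * δ x :=
  ⟨fun x y => by rw [h.add, mul_add], fun x y => by rw [h.mul]; ring⟩

theorem isDer_rderiv : IsDer rderiv := ⟨rderiv_add, rderiv_mul⟩

theorem isDer_lderiv : IsDer (lderiv : LaurentSeries ℂ → LaurentSeries ℂ) :=
  ⟨fun x y => lderiv_add x y, fun x y => lderiv_mul x y⟩

theorem isDer_eulerInf : IsDer (eulerInf : LaurentSeries ℂ → LaurentSeries ℂ) := by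
  have h := isDer_lderiv.const_mul (-HahnSeries.single 1 1)
  simp only [neg_mul] at h
  exact h

theorem isDer_eulerRam : IsDer eulerRam := by
  have h := isDer_lderiv.const_mul (HahnSeries.C (-1 / 4) * HahnSeries.single 1 1)
  simp only [mul_assoc] at h
  exact h

section

variable {R : Type} [CommRing R] {δ : R → R}

theorem IsDer.map_mul (h : IsDer δ) (P Q : Matrix (Fin 2) (Fin 2) R) :
    (P * Q).map δ = P.map δ * Q + P * Q.map δ := by
  ext i j
  simp only [Matrix.map_apply, Matrix.mul_apply, Fin.sum_univ_two, Matrix.add_apply, h.add, h.mul]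
  ring

theorem IsDer.map_one (h : IsDer δ) : (1 : Matrix (Fin 2) (Fin 2) R).map δ = 0 := by
  ext i j
  rw [Matrix.map_apply, Matrix.one_apply]
  split_ifs
  · exact h.one
  · exact h.zero

/-- `P` transforms `δ + A` into `δ + B`. -/
def IsGauge (δ : R → R) (A P B : Matrix (Fin 2) (Fin 2) R) : Prop :=
  A * P + P.map δ = P * B

theorem IsGauge.trans (h : IsDer δ) {A B C P Q : Matrix (Fin 2) (Fin 2) R}
    (h1 : IsGauge δ A P B) (h2 : IsGauge δ B Q C) : IsGauge δ A (P * Q) C := by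
  unfold IsGauge at *
  rw [h.map_mul, mul_assoc, ← h2, mul_add, ← mul_assoc P, ← h1]
  noncomm_ring

theorem IsGauge.symm (h : IsDer δ) {A B : Matrix (Fin 2) (Fin 2) R}
    {P : (Matrix (Fin 2) (Fin 2) R)ˣ} (h1 : IsGauge δ A P.val B) :
    IsGauge δ B (P⁻¹).val A := by
  unfold IsGauge at *
  have h2 := h.map_mul P.val (P⁻¹).val
  rw [Units.mul_inv, h.map_one] at h2
  have h3 : (P⁻¹).val.map δ = -((P⁻¹).val * (P.val.map δ * (P⁻¹).val)) := by
    have := congrArg ((P⁻¹).val * ·) h2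
    simp only [mul_zero, mul_add, Units.inv_mul_cancel_left] at this
    rw [eq_neg_iff_add_eq_zero, add_comm, ← this]
  have h4 : B = (P⁻¹).val * (A * P.val + P.val.map δ) := by
    rw [h1, Units.inv_mul_cancel_left]
  rw [h3, h4]
  simp only [mul_add, add_mul, mul_assoc, Units.mul_inv, mul_one]
  abel

theorem IsGauge.map {R' : Type} [CommRing R'] {δ' : R' → R'} (φ : R →+* R')
    (hφ : ∀ x, φ (δ x) = δ' (φ x)) {A B P : Matrix (Fin 2) (Fin 2) R} (h : IsGauge δ A P B) :
    IsGauge δ' (A.map φ) (P.map φ) (B.map φ) := by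
  have h1 := congrArg (fun N => Matrix.map N φ) h
  simp only [Matrix.map_mul, Matrix.map_add φ (map_add φ)] at h1
  rw [IsGauge, ← h1]
  congr 1
  ext i j
  simp [hφ]

theorem IsGauge.smul {A B P : Matrix (Fin 2) (Fin 2) R} (h : IsGauge δ A P B) (c : R) :
    IsGauge (fun x => c * δ x) (c • A) P (c • B) := by
  unfold IsGauge at *
  rw [Matrix.smul_mul, Matrix.mul_smul, ← h, smul_add]
  congr 1

theorem IsGauge.inv_smul {A B P : Matrix (Fin 2) (Fin 2) R} {c d : R} (hcd : d * c = 1)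
    (h : IsGauge (fun x => c * δ x) (c • A) P (c • B)) : IsGauge δ A P B := by
  have h1 := h.smul d
  simpa only [← mul_assoc, hcd, one_mul, smul_smul, one_smul] using h1

end

/-! ### Orders of Laurent series -/

/-- The Laurent series `f` has order at least `n`. -/
def OrdGE (n : ℤ) (f : LaurentSeries ℂ) : Prop := ∀ k < n, f.coeff k = 0

section

variable {f g : LaurentSeries ℂ} {m n : ℤ}

theorem ordGE_zero_iff : OrdGE 0 f ↔ f ∈ integers := mem_integers_iff.symm

theorem OrdGE.mono (h : OrdGE n f) (hmn : m ≤ n) : OrdGE m f := fun k hk => h k (hk.trans_le hmn)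

theorem ordGE_zero (n : ℤ) : OrdGE n 0 := fun _ _ => rfl

theorem OrdGE.add (hf : OrdGE n f) (hg : OrdGE n g) : OrdGE n (f + g) := fun k hk => by
  rw [HahnSeries.coeff_add, hf k hk, hg k hk, add_zero]

theorem OrdGE.neg (hf : OrdGE n f) : OrdGE n (-f) := fun k hk => by
  rw [HahnSeries.coeff_neg, hf k hk, neg_zero]

theorem OrdGE.sub (hf : OrdGE n f) (hg : OrdGE n g) : OrdGE n (f - g) := fun k hk => by
  rw [HahnSeries.coeff_sub, hf k hk, hg k hk, sub_zero]

theorem coeff_single_one_mul (n k : ℤ) (f : LaurentSeries ℂ) :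
    (HahnSeries.single n (1 : ℂ) * f).coeff k = f.coeff (k - n) := by
  rw [HahnSeries.coeff_single_mul, one_mul]

theorem ordGE_iff_exists : OrdGE n f ↔ ∃ g ∈ integers, f = HahnSeries.single n 1 * g := by
  constructor
  · intro h
    refine ⟨HahnSeries.single (-n) 1 * f, mem_integers_iff.2 fun k hk => ?_, ?_⟩
    · rw [coeff_single_one_mul]
      exact h _ (by omega)
    · rw [← mul_assoc, HahnSeries.single_mul_single, add_neg_cancel, one_mul,
        HahnSeries.single_zero_one, one_mul]
  · rintro ⟨g, hg, rfl⟩ k hk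
    rw [coeff_single_one_mul]
    exact mem_integers_iff.1 hg _ (by omega)

theorem OrdGE.mul (hf : OrdGE n f) (hg : OrdGE m g) : OrdGE (n + m) (f * g) := by
  obtain ⟨f', hf', rfl⟩ := ordGE_iff_exists.1 hf
  obtain ⟨g', hg', rfl⟩ := ordGE_iff_exists.1 hg
  refine ordGE_iff_exists.2 ⟨f' * g', integers.mul_mem hf' hg', ?_⟩
  rw [mul_mul_mul_comm, HahnSeries.single_mul_single, one_mul]

theorem OrdGE.coeff_mul (hf : OrdGE n f) (hg : OrdGE m g) :
    (f * g).coeff (n + m) = f.coeff n * g.coeff m := by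
  obtain ⟨f', hf', rfl⟩ := ordGE_iff_exists.1 hf
  obtain ⟨g', hg', rfl⟩ := ordGE_iff_exists.1 hg
  rw [mul_mul_mul_comm, HahnSeries.single_mul_single, one_mul, coeff_single_one_mul,
    coeff_single_one_mul, coeff_single_one_mul, sub_self, sub_self, sub_self, coeff_zero_mul hf' hg']

theorem ordGE_single (n : ℤ) (c : ℂ) : OrdGE n (HahnSeries.single n c) := fun _ hk =>
  HahnSeries.coeff_single_of_ne hk.ne

theorem ordGE_C (c : ℂ) : OrdGE 0 (HahnSeries.C c) := ordGE_single 0 c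

theorem exists_ordGE (f : LaurentSeries ℂ) : ∃ n, OrdGE n f :=
  ⟨f.order, fun _ hk => HahnSeries.coeff_eq_zero_of_lt_order hk⟩

theorem exists_order (hf : f ≠ 0) : ∃ n, OrdGE n f ∧ f.coeff n ≠ 0 :=
  ⟨f.order, fun _ hk => HahnSeries.coeff_eq_zero_of_lt_order hk, mt HahnSeries.coeff_order_eq_zero.1 hf⟩

/-- An order is at most the index of a non-zero coefficient. -/
theorem OrdGE.le (hf : OrdGE n f) (h : f.coeff m ≠ 0) : n ≤ m := not_lt.1 fun hm => h (hf m hm)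

theorem OrdGE.succ (hf : OrdGE n f) (h : f.coeff n = 0) : OrdGE (n + 1) f := fun k hk => by
  rcases (Int.lt_add_one_iff.1 hk).lt_or_eq with h1 | rfl
  · exact hf k h1
  · exact h

theorem coeff_single_mul_lderiv (f : LaurentSeries ℂ) (k : ℤ) :
    (HahnSeries.single 1 1 * lderiv f).coeff k = k * f.coeff k := by
  rw [coeff_single_one_mul, coeff_lderiv, sub_add_cancel]

theorem coeff_eulerInf (f : LaurentSeries ℂ) (k : ℤ) :
    (eulerInf f).coeff k = -(k * f.coeff k) := by
  rw [eulerInf, HahnSeries.coeff_neg, coeff_single_mul_lderiv]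

theorem coeff_eulerRam (f : LaurentSeries ℂ) (k : ℤ) :
    (eulerRam f).coeff k = -(k / 4 * f.coeff k) := by
  rw [eulerRam, HahnSeries.C_mul_eq_smul, HahnSeries.coeff_smul, coeff_single_mul_lderiv,
    smul_eq_mul]
  ring

theorem OrdGE.eulerInf (hf : OrdGE n f) : OrdGE n (eulerInf f) := fun k hk => by
  rw [coeff_eulerInf, hf k hk, mul_zero, neg_zero]

theorem eulerRam_ram (f : LaurentSeries ℂ) : ram (eulerInf f) = eulerRam (ram f) := by
  ext k
  by_cases hk : 4 ∣ k
  · obtain ⟨k, rfl⟩ := hk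
    rw [coeff_eulerRam, coeff_ram_four_mul, coeff_ram_four_mul, coeff_eulerInf]
    push_cast
    ring
  · rw [coeff_eulerRam, coeff_ram_of_not_dvd _ hk, coeff_ram_of_not_dvd _ hk, mul_zero, neg_zero]

end

/-- All entries have order at least `n`. -/
def MOrdGE (n : ℤ) (G : Matrix (Fin 2) (Fin 2) (LaurentSeries ℂ)) : Prop :=
  ∀ i j, OrdGE n (G i j)

/-- The matrix of coefficients. -/
def mcoeff (n : ℤ) (G : Matrix (Fin 2) (Fin 2) (LaurentSeries ℂ)) : Matrix (Fin 2) (Fin 2) ℂ :=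
  G.map fun f => f.coeff n

section

variable {F G : Matrix (Fin 2) (Fin 2) (LaurentSeries ℂ)} {m n : ℤ}

theorem MOrdGE.mul (hF : MOrdGE n F) (hG : MOrdGE m G) : MOrdGE (n + m) (F * G) := fun i j => by
  rw [Matrix.mul_apply, Fin.sum_univ_two]
  exact ((hF i 0).mul (hG 0 j)).add ((hF i 1).mul (hG 1 j))

theorem MOrdGE.mcoeff_mul (hF : MOrdGE n F) (hG : MOrdGE m G) :
    mcoeff (n + m) (F * G) = mcoeff n F * mcoeff m G := by
  ext i j
  simp only [mcoeff, Matrix.map_apply, Matrix.mul_apply, Fin.sum_univ_two, HahnSeries.coeff_add,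
    (hF i 0).coeff_mul (hG 0 j), (hF i 1).coeff_mul (hG 1 j)]

theorem exists_mOrdGE (G : Matrix (Fin 2) (Fin 2) (LaurentSeries ℂ)) : ∃ n, MOrdGE n G := by
  choose o ho using fun i j => exists_ordGE (G i j)
  refine ⟨min (min (o 0 0) (o 0 1)) (min (o 1 0) (o 1 1)), fun i j => (ho i j).mono ?_⟩
  fin_cases i <;> fin_cases j <;> simp

theorem MOrdGE.mono (h : MOrdGE n G) (hmn : m ≤ n) : MOrdGE m G := fun i j => (h i j).mono hmn

end

/-! ### Regular singular points -/

theorem eq_zero_of_intertwines {S S' T : Matrix (Fin 2) (Fin 2) ℂ} {c k : ℂ} (hS : S * S = c • 1)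
    (hS' : S' * S' = c • 1) (hk : k ≠ 0) (hkc : k ^ 2 ≠ 4 * c) (h : k • T = T * S - S' * T) :
    T = 0 := by
  have h1 : k ^ 2 • T = (2 * c) • T - (2 : ℂ) • (S' * T * S) := by
    have : k ^ 2 • T = (k • T) * S - S' * (k • T) := by
      rw [Matrix.smul_mul, Matrix.mul_smul, ← smul_sub, ← h, smul_smul, pow_two]
    rw [this, h, sub_mul, mul_sub, mul_assoc T, hS, ← mul_assoc S' S', hS', Matrix.mul_smul,
      mul_one, Matrix.smul_mul, one_mul, ← mul_assoc]
    module
  have h2 : k • (S' * T * S) = -(c * k) • T := by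
    have : k • (S' * T * S) = S' * (k • T) * S := by simp
    rw [this, h, mul_sub, sub_mul, ← mul_assoc, mul_assoc _ S, hS, ← mul_assoc S' S', hS']
    simp only [Matrix.mul_smul, Matrix.smul_mul, mul_one, one_mul]
    rw [← smul_sub, ← neg_sub, ← h]
    module
  have h3 : (k * (k ^ 2 - 4 * c)) • T = 0 := by
    have : k • (k ^ 2 • T) = k • ((2 * c) • T) - (2 : ℂ) • (k • (S' * T * S)) := by
      rw [h1, smul_sub, smul_comm k (2 : ℂ)]
    rw [h2] at this
    have h4 : (k * (k ^ 2 - 4 * c)) • T = k • (k ^ 2 • T) - (4 * c * k) • T := by module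
    rw [h4, this]
    module
  exact (smul_eq_zero.1 h3).resolve_left (mul_ne_zero hk (sub_ne_zero.2 hkc))

/-- A horizontal map, with finite poles, between lattices with residues `S₀`, `S₀'` is integral if
no difference of eigenvalues is a non-zero integer. -/
theorem mOrdGE_zero_of_intertwines {G S S' : Matrix (Fin 2) (Fin 2) (LaurentSeries ℂ)} {c : ℂ}
    (hS : MOrdGE 0 S) (hS' : MOrdGE 0 S') (hSc : mcoeff 0 S * mcoeff 0 S = c • 1)
    (hSc' : mcoeff 0 S' * mcoeff 0 S' = c • 1) (hc : ∀ k : ℤ, k ≠ 0 → (k : ℂ) ^ 2 ≠ 4 * c)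
    (h : IsGauge (fun f => HahnSeries.single 1 1 * lderiv f) S' G S) : MOrdGE 0 G := by
  obtain ⟨m, hm⟩ := exists_mOrdGE G
  have key : ∀ n : ℕ, m + n ≤ 0 → MOrdGE (m + n) G := by
    intro n
    induction n with
    | zero => exact fun _ => by simpa using hm
    | succ n ih =>
      intro hn
      push_cast at hn
      have h1 := ih (by omega)
      have h2 : mcoeff (m + n) G = 0 := by
        refine eq_zero_of_intertwines (k := ((m + n : ℤ) : ℂ)) hSc hSc' ?_ (hc _ (by omega)) ?_
        · exact_mod_cast (show m + (n : ℤ) ≠ 0 by omega)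
        have h3 := congrArg (mcoeff (m + n)) h
        have h4 := h1.mcoeff_mul hS
        have h5 := hS'.mcoeff_mul h1
        rw [add_zero] at h4
        rw [zero_add] at h5
        rw [h4] at h3
        rw [← h3, ← h5, eq_sub_iff_add_eq']
        ext i j
        simp only [mcoeff, Matrix.map_apply, Matrix.add_apply, Matrix.smul_apply,
          HahnSeries.coeff_add, coeff_single_mul_lderiv, smul_eq_mul]
      intro i j
      push_cast
      rw [← add_assoc]
      exact (h1 i j).succ (congrFun (congrFun h2 i) j)
  obtain ⟨n, hn⟩ | hm0 : (∃ n : ℕ, m + n = 0) ∨ 0 ≤ m := by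
    rcases le_total 0 m with h0 | h0
    · exact Or.inr h0
    · exact Or.inl ⟨m.natAbs, by omega⟩
  · have := key n hn.le
    rwa [hn] at this
  · exact hm.mono hm0

theorem exists_intertwiner {R : Matrix (Fin 2) (Fin 2) ℂ} {c k : ℂ} (hR : R * R = c • 1)
    (hk : k ≠ 0) (hkc : k ^ 2 ≠ 4 * c) (Y : Matrix (Fin 2) (Fin 2) ℂ) :
    ∃ T, k • T + R * T - T * R = Y := by
  let a : ℂ := (k * (k ^ 2 - 4 * c))⁻¹
  have ha : a * (k * (k ^ 2 - 4 * c)) = 1 :=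
    inv_mul_cancel₀ (mul_ne_zero hk (sub_ne_zero.2 hkc))
  refine ⟨a • ((k ^ 2 - 2 * c) • Y - k • (R * Y - Y * R) - (2 : ℂ) • (R * Y * R)), ?_⟩
  have h1 : R * (R * Y) = c • Y := by rw [← mul_assoc, hR, Matrix.smul_mul, one_mul]
  have h2 : ∀ Z : Matrix (Fin 2) (Fin 2) ℂ, Z * R * R = c • Z := fun Z => by
    rw [mul_assoc, hR, Matrix.mul_smul, mul_one]
  have h3 : R * (R * Y * R) = c • (Y * R) := by
    rw [← mul_assoc, h1, Matrix.smul_mul]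
  simp only [Matrix.mul_smul, Matrix.smul_mul, mul_sub, sub_mul, h1, h2, h3, ← mul_assoc]
  have h6 : Y = (a * (k * (k ^ 2 - 4 * c))) • Y := by rw [ha, one_smul]
  conv_rhs => rw [h6]
  module

theorem exists_seq_of_forall_exists {α : Type} (Q : ∀ n : ℕ, (∀ m, m < n → α) → α → Prop)
    (h : ∀ n s, ∃ x, Q n s x) : ∃ g : ℕ → α, ∀ n, Q n (fun m _ => g m) (g n) := by
  choose F hF using h
  refine ⟨fun n => Nat.strongRecOn n F, fun n => ?_⟩
  have h1 : (Nat.strongRecOn n F : α) = F n fun m _ => Nat.strongRecOn m F :=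
    Nat.strongRecOn_eq _ _
  simp only
  rw [h1]
  exact hF _ _

/-- A connection with a regular singularity and a non-resonant residue `R` is equivalent to
`s d/ds + R`. -/
theorem exists_isGauge_residue (S : Matrix (Fin 2) (Fin 2) ℂ⟦X⟧) {R : Matrix (Fin 2) (Fin 2) ℂ}
    {c : ℂ} (hSR : S.map PowerSeries.constantCoeff = R) (hR : R * R = c • 1)
    (hc : ∀ k : ℤ, k ≠ 0 → (k : ℂ) ^ 2 ≠ 4 * c) :
    ∃ g : (Matrix (Fin 2) (Fin 2) ℂ⟦X⟧)ˣ,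
      IsGauge (fun f => PowerSeries.X * PowerSeries.derivative ℂ f) S g.val
        (R.map PowerSeries.C) := by
  let Sc : ℕ → Matrix (Fin 2) (Fin 2) ℂ := fun n => S.map (PowerSeries.coeff (R := ℂ) n)
  obtain ⟨g, hg⟩ := exists_seq_of_forall_exists (α := Matrix (Fin 2) (Fin 2) ℂ)
    (fun n s x => (n = 0 → x = 1) ∧ (n ≠ 0 →
      (n : ℂ) • x + R * x - x * R = -∑ j : Fin n, Sc (n - j) * s j j.2)) (fun n s => by
    by_cases hn : n = 0
    · exact ⟨1, fun _ => rfl, fun h => absurd hn h⟩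
    · obtain ⟨x, hx⟩ := exists_intertwiner hR (k := n) (by exact_mod_cast hn)
        (by simpa using hc n (by exact_mod_cast hn)) (-∑ j : Fin n, Sc (n - j) * s j j.2)
      exact ⟨x, fun h => absurd h hn, fun _ => hx⟩)
  let G : Matrix (Fin 2) (Fin 2) ℂ⟦X⟧ := Matrix.of fun i j => PowerSeries.mk fun n => g n i j
  have hg0 : g 0 = 1 := (hg 0).1 rfl
  have hG0 : G.map PowerSeries.constantCoeff = 1 := by
    ext i j
    rw [← hg0, Matrix.map_apply, ← PowerSeries.coeff_zero_eq_constantCoeff_apply]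
    exact PowerSeries.coeff_mk (R := ℂ) 0 fun n => g n i j
  have hdet : IsUnit G.det := by
    rw [PowerSeries.isUnit_iff_constantCoeff]
    have := RingHom.map_det PowerSeries.constantCoeff G
    rw [this, RingHom.mapMatrix_apply, hG0, Matrix.det_one]
    exact isUnit_one
  obtain ⟨u, hu⟩ := (Matrix.isUnit_iff_isUnit_det _).2 hdet
  refine ⟨u, ?_⟩
  rw [hu, IsGauge]
  have hSg : ∀ (n : ℕ) (i j : Fin 2), PowerSeries.coeff n ((S * G) i j) =
      (∑ k ∈ Finset.range (n + 1), Sc (n - k) * g k) i j := by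
    intro n i j
    rw [Matrix.mul_apply, map_sum, Matrix.sum_apply]
    simp only [PowerSeries.coeff_mul, Matrix.mul_apply]
    rw [Finset.sum_comm, Finset.Nat.sum_antidiagonal_eq_sum_range_succ_mk, ← Finset.sum_range_reflect]
    refine Finset.sum_congr rfl fun k hk => Finset.sum_congr rfl fun l _ => ?_
    have hk' : k ≤ n := by simpa [Nat.lt_succ_iff] using hk
    have e1 : n + 1 - 1 - k = n - k := by omega
    have e2 : n - (n - k) = k := by omega
    simp only [e1, e2, Sc, Matrix.map_apply, G, Matrix.of_apply, PowerSeries.coeff_mk]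
  refine Matrix.ext fun i j => PowerSeries.ext fun n => ?_
  rw [Matrix.add_apply, map_add, hSg]
  have hr : PowerSeries.coeff n ((G * R.map PowerSeries.C) i j) = (g n * R) i j := by
    simp [Matrix.mul_apply, G, Fin.sum_univ_two]
  have hd : PowerSeries.coeff n (G.map (fun f => PowerSeries.X * PowerSeries.derivative ℂ f) i j) =
      n * g n i j := by
    rw [Matrix.map_apply]
    cases n with
    | zero => simp
    | succ n =>
      rw [PowerSeries.coeff_succ_X_mul, PowerSeries.coeff_derivative]
      simp [G, mul_comm]
  rw [hr, hd]
  have h0 : Sc 0 = R := by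
    rw [← hSR]
    ext i j
    simp [Sc]
  by_cases hn : n = 0
  · subst hn
    simp [h0, hg0]
  · have h1 := (hg n).2 hn
    rw [Fin.sum_univ_eq_sum_range (fun j => Sc (n - j) * g j) n] at h1
    rw [Finset.sum_range_succ, Nat.sub_self, h0]
    have h2 : ∑ k ∈ Finset.range n, Sc (n - k) * g k + R * g n + (n : ℂ) • g n = g n * R := by
      rw [eq_neg_iff_add_eq_zero] at h1
      rw [← sub_eq_zero, ← h1]
      abel
    have h3 := congrFun (congrFun h2 i) j
    simpa using h3

end

end DegPV

namespace DegPV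

noncomputable section

/-! ### Approximation of local bases by global ones -/

/-- The subgroup `GL₂(ℂ⟦s⟧)` of `GL₂(ℂ((s)))`. -/
def unimodular : Subgroup (Matrix (Fin 2) (Fin 2) (LaurentSeries ℂ))ˣ where
  carrier := {g | MOrdGE 0 g.val ∧ MOrdGE 0 (g⁻¹).val}
  one_mem' := by
    have h : MOrdGE 0 (1 : Matrix (Fin 2) (Fin 2) (LaurentSeries ℂ)) := fun i j => by
      rw [Matrix.one_apply, ordGE_zero_iff]
      split_ifs
      exacts [integers.one_mem, integers.zero_mem]
    exact ⟨h, by simpa using h⟩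
  mul_mem' := by
    rintro g g' ⟨h1, h2⟩ ⟨h1', h2'⟩
    refine ⟨by simpa using h1.mul h1', ?_⟩
    rw [mul_inv_rev]
    simpa using h2'.mul h2
  inv_mem' := by
    rintro g ⟨h1, h2⟩
    exact ⟨h2, by simpa using h1⟩

theorem mem_unimodular_iff {g : (Matrix (Fin 2) (Fin 2) (LaurentSeries ℂ))ˣ} :
    g ∈ unimodular ↔ MOrdGE 0 g.val ∧ MOrdGE 0 (g⁻¹).val := Iff.rfl

theorem MOrdGE.adjugate {G : Matrix (Fin 2) (Fin 2) (LaurentSeries ℂ)} {n : ℤ} (h : MOrdGE n G) :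
    MOrdGE n G.adjugate := by
  rw [Matrix.adjugate_fin_two]
  intro i j
  fin_cases i <;> fin_cases j
  exacts [h 1 1, (h 0 1).neg, (h 1 0).neg, h 0 0]

theorem mem_unimodular_of_det {g : (Matrix (Fin 2) (Fin 2) (LaurentSeries ℂ))ˣ}
    (h : MOrdGE 0 g.val) (hd : g.val.det.coeff 0 ≠ 0) : g ∈ unimodular := by
  refine ⟨h, ?_⟩
  have hdet : g.val.det ∈ integers := by
    rw [Matrix.det_fin_two, ← ordGE_zero_iff]
    simpa using ((h 0 0).mul (h 1 1)).sub ((h 0 1).mul (h 1 0))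
  have h1 : (g⁻¹).val = g.val.det⁻¹ • g.val.adjugate := by
    rw [Matrix.coe_units_inv, Matrix.inv_def, Ring.inverse_eq_inv']
  rw [h1]
  intro i j
  simpa using (ordGE_zero_iff.2 (inv_mem_integers hdet hd)).mul (h.adjugate i j)

theorem atHom_X_sub_C (a : ℂ) : atHom a (RatFunc.X - RatFunc.C a) = HahnSeries.single 1 1 := by
  rw [map_sub, atHom_X, ← RatFunc.algebraMap_C, atHom_algebraMap, aeval_C,
    algebraMap_laurentSeries, zAt, add_sub_cancel_left]

theorem X_sub_C_ne_zero (a : ℂ) : (RatFunc.X - RatFunc.C a : RatFunc ℂ) ≠ 0 := fun h => by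
  have := atHom_X_sub_C a
  rw [h, map_zero] at this
  exact HahnSeries.single_ne_zero one_ne_zero this.symm

theorem single_zpow (n : ℤ) : (HahnSeries.single 1 1 : LaurentSeries ℂ) ^ n =
    HahnSeries.single n 1 := by
  have h (k : ℕ) : (HahnSeries.single 1 1 : LaurentSeries ℂ) ^ k = HahnSeries.single (k : ℤ) 1 := by
    rw [HahnSeries.single_pow, one_pow]
    simp
  obtain ⟨k, rfl | rfl⟩ := n.eq_nat_or_neg
  · rw [zpow_natCast, h]
  · rw [zpow_neg, zpow_natCast, h, HahnSeries.inv_single, inv_one]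

theorem atHom_X_sub_C_zpow (a : ℂ) (n : ℤ) :
    atHom a ((RatFunc.X - RatFunc.C a) ^ n) = HahnSeries.single n 1 := by
  rw [map_zpow₀, atHom_X_sub_C, single_zpow]

theorem algebraMap_mem_localRing (a : ℂ) (p : ℂ[X]) :
    algebraMap ℂ[X] (RatFunc ℂ) p ∈ localRing a := ⟨p, 1, by simp, by simp⟩

theorem X_sub_C_zpow_mem {a b : ℂ} (h : b ≠ a) (n : ℤ) :
    (RatFunc.X - RatFunc.C a : RatFunc ℂ) ^ n ∈ localRing b := by
  have e : (RatFunc.X - RatFunc.C a : RatFunc ℂ) = algebraMap ℂ[X] _ (X - C a) := by simp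
  obtain ⟨k, rfl | rfl⟩ := n.eq_nat_or_neg
  · rw [zpow_natCast, e]
    exact (localRing b).pow_mem (algebraMap_mem_localRing _ _) _
  · refine ⟨1, (X - C a) ^ k, ?_, ?_⟩
    · simpa using pow_ne_zero _ (sub_ne_zero.2 h)
    · rw [zpow_neg, zpow_natCast, map_one, one_div, map_pow, e]

/-- The principal part of a Laurent series at `a`, to any order, comes from a rational function
whose only finite pole is `a`. -/
theorem exists_approx (a : ℂ) (f : LaurentSeries ℂ) (m : ℤ) :
    ∃ r : RatFunc ℂ, (∀ b, b ≠ a → r ∈ localRing b) ∧ OrdGE m (f - atHom a r) := by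
  obtain ⟨n, hn⟩ := exists_ordGE f
  obtain ⟨_, ⟨F, rfl⟩, rfl⟩ := ordGE_iff_exists.1 hn
  let k : ℕ := (m - n).toNat
  let p : ℂ[X] := taylor (-a) (PowerSeries.trunc k F)
  refine ⟨(RatFunc.X - RatFunc.C a) ^ n * algebraMap ℂ[X] _ p, fun b hb =>
    (localRing b).mul_mem (X_sub_C_zpow_mem hb n) (algebraMap_mem_localRing _ _), ?_⟩
  rw [map_mul, atHom_X_sub_C_zpow, atHom_algebraMap, aeval_zAt, ← mul_sub, ← map_sub]
  have hp : taylor a p = PowerSeries.trunc k F := by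
    simp only [p, taylor_taylor, add_neg_cancel, taylor_zero]
  rw [hp]
  intro l hl
  rw [coeff_single_one_mul, PowerSeries.coeff_coe]
  split_ifs with h0
  · rfl
  · rw [map_sub, Polynomial.coeff_coe, PowerSeries.coeff_trunc, if_pos, sub_self]
    simp only [k]
    omega

/-- The expansion at `a` of an invertible matrix. -/
def atGL (a : ℂ) : (Matrix (Fin 2) (Fin 2) (RatFunc ℂ))ˣ →*
    (Matrix (Fin 2) (Fin 2) (LaurentSeries ℂ))ˣ :=
  Units.map (RingHom.mapMatrix (atHom a : RatFunc ℂ →+* LaurentSeries ℂ)).toMonoidHom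

theorem atGL_val (a : ℂ) (P : (Matrix (Fin 2) (Fin 2) (RatFunc ℂ))ˣ) :
    (atGL a P).val = P.val.map (atHom a) := rfl

theorem atGL_mem_unimodular_iff {a : ℂ} {P : (Matrix (Fin 2) (Fin 2) (RatFunc ℂ))ˣ} :
    atGL a P ∈ unimodular ↔
      (∀ i j, P.val i j ∈ localRing a) ∧ ∀ i j, (P⁻¹).val i j ∈ localRing a := by
  rw [mem_unimodular_iff, ← map_inv]
  simp only [MOrdGE, ordGE_zero_iff, mem_localRing_iff]
  rfl

/-- The columns swapped. -/
def swapGL : (Matrix (Fin 2) (Fin 2) (LaurentSeries ℂ))ˣ where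
  val := !![0, 1; 1, 0]
  inv := !![0, 1; 1, 0]
  val_inv := by rw [Matrix.mul_fin_two, Matrix.one_fin_two]; simp
  inv_val := by rw [Matrix.mul_fin_two, Matrix.one_fin_two]; simp

theorem swapGL_mem : swapGL ∈ unimodular := by
  have h : MOrdGE 0 (!![0, 1; 1, 0] : Matrix (Fin 2) (Fin 2) (LaurentSeries ℂ)) := by
    intro i j
    rw [ordGE_zero_iff]
    fin_cases i <;> fin_cases j
    exacts [integers.zero_mem, integers.one_mem, integers.one_mem, integers.zero_mem]
  exact ⟨h, h⟩

/-- An upper triangular invertible matrix. -/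
def upperGL (a : ℂ) (m n : ℤ) (r : RatFunc ℂ) : (Matrix (Fin 2) (Fin 2) (RatFunc ℂ))ˣ where
  val := !![(RatFunc.X - RatFunc.C a) ^ m, r; 0, (RatFunc.X - RatFunc.C a) ^ n]
  inv := !![(RatFunc.X - RatFunc.C a) ^ (-m),
    -(r * (RatFunc.X - RatFunc.C a) ^ (-m) * (RatFunc.X - RatFunc.C a) ^ (-n));
    0, (RatFunc.X - RatFunc.C a) ^ (-n)]
  val_inv := by
    have h (n : ℤ) : (RatFunc.X - RatFunc.C a : RatFunc ℂ) ^ n ≠ 0 :=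
      zpow_ne_zero _ (X_sub_C_ne_zero a)
    have h1 := h n
    have h2 := h m
    rw [Matrix.mul_fin_two, Matrix.one_fin_two, zpow_neg, zpow_neg]
    congr 1
    field_simp
    simp [h1, h2]
  inv_val := by
    have h (n : ℤ) : (RatFunc.X - RatFunc.C a : RatFunc ℂ) ^ n ≠ 0 :=
      zpow_ne_zero _ (X_sub_C_ne_zero a)
    have h1 := h n
    have h2 := h m
    rw [Matrix.mul_fin_two, Matrix.one_fin_two, zpow_neg, zpow_neg]
    congr 1
    field_simp
    simp [h1, h2]

theorem atGL_upperGL_mem {a b : ℂ} (h : b ≠ a) (m n : ℤ) {r : RatFunc ℂ} (hr : r ∈ localRing b) :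
    atGL b (upperGL a m n r) ∈ unimodular := by
  rw [atGL_mem_unimodular_iff]
  have h0 (n : ℤ) := X_sub_C_zpow_mem h n
  constructor <;> intro i j <;> fin_cases i <;> fin_cases j
  exacts [h0 m, hr, (localRing b).zero_mem, h0 n, h0 (-m),
    (localRing b).neg_mem ((localRing b).mul_mem ((localRing b).mul_mem hr (h0 _)) (h0 _)),
    (localRing b).zero_mem, h0 (-n)]

theorem exists_upperGL (a : ℂ) (g : (Matrix (Fin 2) (Fin 2) (LaurentSeries ℂ))ˣ) {n : ℤ}
    (h0 : OrdGE n (g.val 1 0)) (h1 : OrdGE n (g.val 1 1)) (h2 : (g.val 1 1).coeff n ≠ 0) :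
    ∃ P, (∀ b, b ≠ a → atGL b P ∈ unimodular) ∧ (atGL a P)⁻¹ * g ∈ unimodular := by
  have hdet : g.val.det ≠ 0 := ((Matrix.isUnit_iff_isUnit_det _).1 g.isUnit).ne_zero
  obtain ⟨d, hd, hd0⟩ := exists_order hdet
  have hy : g.val 1 1 ≠ 0 := fun h => h2 (by rw [h]; rfl)
  obtain ⟨m, rfl⟩ : ∃ m, d = m + n := ⟨d - n, by omega⟩
  obtain ⟨r, hr, hra⟩ := exists_approx a (g.val 0 1 * HahnSeries.single n 1 * (g.val 1 1)⁻¹) m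
  obtain ⟨y, hy1, hye⟩ := ordGE_iff_exists.1 h1
  obtain ⟨x, hx1, hxe⟩ := ordGE_iff_exists.1 h0
  obtain ⟨e, he1, hee⟩ := ordGE_iff_exists.1 hra
  obtain ⟨D, hD1, hDe⟩ := ordGE_iff_exists.1 hd
  have hy0 : y.coeff 0 ≠ 0 := by
    rw [hye, coeff_single_one_mul, sub_self] at h2
    exact h2
  have hyne : y ≠ 0 := fun h => hy0 (by rw [h]; rfl)
  have hyinv := inv_mem_integers hy1 hy0
  refine ⟨upperGL a m n r, fun b hb => atGL_upperGL_mem hb m n (hr b hb), ?_⟩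
  have hs (k : ℤ) : (HahnSeries.single k (1 : ℂ) : LaurentSeries ℂ) ≠ 0 :=
    HahnSeries.single_ne_zero one_ne_zero
  have hinv (k : ℤ) : (HahnSeries.single (-k) (1 : ℂ) : LaurentSeries ℂ) =
    (HahnSeries.single k 1)⁻¹ := by rw [HahnSeries.inv_single, inv_one]
  have hsn := hs n
  have hsm := hs m
  have hval : ((atGL a (upperGL a m n r))⁻¹ * g).val = !![D * y⁻¹ + e * x, e * y; x, y] := by
    have e1 : ((atGL a (upperGL a m n r))⁻¹).val =
        !![HahnSeries.single (-m) 1,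
          -(atHom a r * HahnSeries.single (-m) 1 * HahnSeries.single (-n) 1);
          0, HahnSeries.single (-n) 1] := by
      rw [← map_inv, atGL_val]
      ext1 i j
      fin_cases i <;> fin_cases j
      · exact atHom_X_sub_C_zpow a (-m)
      · refine (map_neg (atHom a) _).trans (congrArg Neg.neg ?_)
        rw [map_mul, map_mul, atHom_X_sub_C_zpow, atHom_X_sub_C_zpow]
      · exact map_zero (atHom a)
      · exact atHom_X_sub_C_zpow a (-n)
    have e3 : g.val.det = g.val 0 0 * g.val 1 1 - g.val 0 1 * g.val 1 0 := Matrix.det_fin_two _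
    have hmn : (HahnSeries.single (m + n) (1 : ℂ) : LaurentSeries ℂ) =
      HahnSeries.single m 1 * HahnSeries.single n 1 := by
      rw [HahnSeries.single_mul_single, one_mul]
    rw [hDe, hmn, hye, hxe] at e3
    rw [Units.val_mul, e1, Matrix.eta_fin_two g.val, Matrix.mul_fin_two, hinv, hinv, hye, hxe]
    rw [hye] at hee
    generalize atHom a r = ρ at hee ⊢
    generalize HahnSeries.single n (1 : ℂ) = sn at *
    generalize HahnSeries.single m (1 : ℂ) = sm at *
    generalize g.val 0 0 = p at *
    generalize g.val 0 1 = q at *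
    have hq : q = (sm * e + ρ) * y := by
      field_simp at hee
      linear_combination hee
    rw [hq] at e3
    have hp : sn * (p * y - (sm * D + (sm * e + ρ) * y * x)) = 0 := by linear_combination -e3
    have hp' := sub_eq_zero.1 ((mul_eq_zero.1 hp).resolve_left hsn)
    have hp2 : p = (sm * D + (sm * e + ρ) * y * x) / y := by
      rw [eq_div_iff hyne, hp']
    rw [hq, hp2]
    ext1 i j
    fin_cases i <;> fin_cases j <;> simp only [Fin.mk_zero, Fin.mk_one,
      Matrix.of_apply, Matrix.cons_val_zero, Matrix.cons_val_one, Matrix.cons_val', Fin.isValue]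
    · field_simp
      ring
    · field_simp
      ring
    · field_simp
      ring
    · field_simp
      ring
  have hD0 : D.coeff 0 ≠ 0 := by
    rw [hDe, coeff_single_one_mul, sub_self] at hd0
    exact hd0
  apply mem_unimodular_of_det
  · rw [hval]
    intro i j
    rw [ordGE_zero_iff]
    fin_cases i <;> fin_cases j
    exacts [integers.add_mem (integers.mul_mem hD1 hyinv) (integers.mul_mem he1 hx1),
      integers.mul_mem he1 hy1, hx1, hy1]
  · rw [hval, Matrix.det_fin_two_of]
    convert hD0 using 2
    field_simp
    ring

/-- A basis over `ℂ((z-a))` can be approximated by a rational basis that is regular and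
non-degenerate at all other points. -/
theorem exists_atGL_inv_mul_mem (a : ℂ) (g : (Matrix (Fin 2) (Fin 2) (LaurentSeries ℂ))ˣ) :
    ∃ P, (∀ b, b ≠ a → atGL b P ∈ unimodular) ∧ (atGL a P)⁻¹ * g ∈ unimodular := by
  have hdet : g.val.det ≠ 0 := ((Matrix.isUnit_iff_isUnit_det _).1 g.isUnit).ne_zero
  obtain ⟨n, h0, h1, h2⟩ : ∃ n, OrdGE n (g.val 1 0) ∧ OrdGE n (g.val 1 1) ∧
      ((g.val 1 0).coeff n ≠ 0 ∨ (g.val 1 1).coeff n ≠ 0) := by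
    by_cases hx : g.val 1 0 = 0
    · have hy : g.val 1 1 ≠ 0 := fun hy => hdet (by rw [Matrix.det_fin_two, hx, hy]; simp)
      obtain ⟨n, hn, hn'⟩ := exists_order hy
      exact ⟨n, hx ▸ ordGE_zero n, hn, Or.inr hn'⟩
    by_cases hy : g.val 1 1 = 0
    · obtain ⟨n, hn, hn'⟩ := exists_order hx
      exact ⟨n, hn, hy ▸ ordGE_zero n, Or.inl hn'⟩
    · obtain ⟨n, hn, hn'⟩ := exists_order hx
      obtain ⟨m, hm, hm'⟩ := exists_order hy
      rcases le_total n m with h | h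
      · exact ⟨n, hn, hm.mono h, Or.inl hn'⟩
      · exact ⟨m, hn.mono h, hm, Or.inr hm'⟩
  rcases h2 with h2 | h2
  · have e : ∀ i, (g * swapGL).val i 0 = g.val i 1 ∧ (g * swapGL).val i 1 = g.val i 0 := by
      intro i
      rw [Units.val_mul]
      simp [Matrix.mul_apply, Fin.sum_univ_two, swapGL]
    obtain ⟨P, hP, hP'⟩ := exists_upperGL a (g * swapGL) (n := n) (by rwa [(e 1).1])
      (by rwa [(e 1).2]) (by rwa [(e 1).2])
    refine ⟨P, hP, ?_⟩
    rwa [← mul_assoc, unimodular.mul_mem_cancel_right swapGL_mem] at hP'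
  · exact exists_upperGL a g h0 h1 h2

theorem exists_atGL_inv_mul_mem_of_finset (T : Finset ℂ)
    (g : ℂ → (Matrix (Fin 2) (Fin 2) (LaurentSeries ℂ))ˣ) :
    ∃ P, (∀ a ∉ T, atGL a P ∈ unimodular) ∧ ∀ a ∈ T, (atGL a P)⁻¹ * g a ∈ unimodular := by
  induction T using Finset.induction_on with
  | empty => exact ⟨1, fun a _ => by rw [map_one]; exact one_mem _, by simp⟩
  | insert b T hb ih =>
    obtain ⟨P, hP, hP'⟩ := ih
    obtain ⟨Q, hQ, hQ'⟩ := exists_atGL_inv_mul_mem b ((atGL b P)⁻¹ * g b)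
    refine ⟨P * Q, fun a ha => ?_, fun a ha => ?_⟩
    · rw [Finset.mem_insert, not_or] at ha
      rw [map_mul]
      exact mul_mem (hP a ha.2) (hQ a ha.1)
    · rw [map_mul, mul_inv_rev, mul_assoc]
      rcases Finset.mem_insert.1 ha with rfl | ha
      · exact hQ'
      · exact mul_mem (inv_mem (hQ a (fun h => hb (h ▸ ha)))) (hP' a ha)

end

end DegPV

namespace DegPV

noncomputable section

/-! ### The connection at infinity -/

theorem coeff_C_mul_laurent (c : ℂ) (f : LaurentSeries ℂ) (n : ℤ) :
    (HahnSeries.C c * f).coeff n = c * f.coeff n := by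
  rw [HahnSeries.C_mul_eq_smul, HahnSeries.coeff_smul, smul_eq_mul]

theorem C_mul_single (c : ℂ) (n : ℤ) :
    (HahnSeries.C c * HahnSeries.single n 1 : LaurentSeries ℂ) = HahnSeries.single n c := by
  rw [HahnSeries.C_apply, HahnSeries.single_mul_single, zero_add, mul_one]

theorem C_mul_single' (c d : ℂ) (n : ℤ) :
    (HahnSeries.C c * HahnSeries.single n d : LaurentSeries ℂ) = HahnSeries.single n (c * d) := by
  rw [HahnSeries.C_apply, HahnSeries.single_mul_single, zero_add]

theorem coeff_zInf_mul (f : LaurentSeries ℂ) (n : ℤ) :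
    (zInf ℂ * f).coeff n = f.coeff (n + 1) := by
  rw [zInf, coeff_single_one_mul, sub_neg_eq_add]

theorem OrdGE.C_mul {f : LaurentSeries ℂ} {n : ℤ} (h : OrdGE n f) (c : ℂ) :
    OrdGE n (HahnSeries.C c * f) := fun k hk => by rw [coeff_C_mul_laurent, h k hk, mul_zero]

theorem eulerInf_zInf : eulerInf (zInf ℂ) = zInf ℂ := by
  rw [eulerInf, single_mul_lderiv_zInf, neg_neg]

/-- Eigenfunctions of `z d/dz` are monomials. -/
theorem coeff_eq_zero_of_eulerInf_eq {f : LaurentSeries ℂ} {c : ℂ}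
    (h : eulerInf f = HahnSeries.C c * f) {n : ℤ} (hn : -(n : ℂ) ≠ c) : f.coeff n = 0 := by
  have h1 := congrArg (fun g => HahnSeries.coeff g n) h
  simp only [coeff_eulerInf, coeff_C_mul_laurent] at h1
  have h2 : (-(n : ℂ) - c) * f.coeff n = 0 := by linear_combination h1
  exact (mul_eq_zero.1 h2).resolve_left (sub_ne_zero.2 hn)

theorem riccati {t : ℂ} (ht : t ≠ 0) (c : ℂ) (f : LaurentSeries ℂ) :
    eulerInf f + HahnSeries.C t * f ^ 2 + HahnSeries.C c * f ≠ HahnSeries.C t * zInf ℂ := by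
  intro h
  have hz : ∀ n : ℤ, (HahnSeries.C t * zInf ℂ).coeff n = if n = -1 then t else 0 := by
    intro n
    rw [coeff_C_mul_laurent, zInf, HahnSeries.coeff_single]
    split_ifs <;> simp
  by_cases h0 : OrdGE 0 f
  · have h1 : OrdGE 0 (HahnSeries.C t * zInf ℂ) := by
      rw [← h, pow_two]
      exact (h0.eulerInf.add ((h0.mul h0).C_mul t)).add (h0.C_mul c)
    have h2 := h1 (-1) (by omega)
    rw [hz, if_pos rfl] at h2
    exact ht h2
  · have hf : f ≠ 0 := fun hf => h0 (hf ▸ ordGE_zero 0)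
    obtain ⟨n, hn, hn'⟩ := exists_order hf
    have hn0 : n < 0 := not_le.1 fun h => h0 (hn.mono h)
    have h1 := congrArg (fun g => HahnSeries.coeff g (n + n)) h
    simp only [HahnSeries.coeff_add, hz, pow_two, coeff_C_mul_laurent, hn.coeff_mul hn,
      coeff_eulerInf, hn (n + n) (by omega)] at h1
    rw [if_neg (by omega)] at h1
    simp [ht, hn'] at h1

/-- The matrix of `z d/dz` on a basis `H₁, H₂` with `∂ H₁ = a H₁ + t H₂` and
`∂ H₂ = t z H₁ + b H₂`. -/
def ricMatrix (a b t : ℂ) : Matrix (Fin 2) (Fin 2) (LaurentSeries ℂ) :=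
  !![HahnSeries.C a, HahnSeries.C t * zInf ℂ; HahnSeries.C t, HahnSeries.C b]

theorem infModel_eq (t : ℂ) : infModel t = ricMatrix (-3 / 4) (-1 / 4) t := rfl

theorem eq_zero_of_ricMatrix {t : ℂ} (ht : t ≠ 0) {a b : ℂ} {α x y : LaurentSeries ℂ}
    (h1 : eulerInf x + α * x = HahnSeries.C a * x + HahnSeries.C t * y)
    (h2 : eulerInf y + α * y = HahnSeries.C t * zInf ℂ * x + HahnSeries.C b * y) :
    x = 0 := by
  by_contra hx
  obtain ⟨f, rfl⟩ : ∃ f, y = f * x := ⟨y / x, by field_simp⟩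
  refine riccati ht (a - b) f (mul_right_cancel₀ hx ?_)
  rw [isDer_eulerInf.mul] at h2
  rw [map_sub]
  linear_combination h2 - f * h1

theorem ricMatrix_rows {a b t : ℂ} {Z H : Matrix (Fin 2) (Fin 2) (LaurentSeries ℂ)}
    (h : IsGauge eulerInf Z H (ricMatrix a b t)) (i : Fin 2) :
    (Z i 0 * H 0 0 + Z i 1 * H 1 0 + eulerInf (H i 0) =
      HahnSeries.C a * H i 0 + HahnSeries.C t * H i 1) ∧
    Z i 0 * H 0 1 + Z i 1 * H 1 1 + eulerInf (H i 1) =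
      HahnSeries.C t * zInf ℂ * H i 0 + HahnSeries.C b * H i 1 := by
  have h0 := congrFun (congrFun h i) 0
  have h1 := congrFun (congrFun h i) 1
  simp only [Matrix.add_apply, Matrix.mul_apply, Fin.sum_univ_two, Matrix.map_apply, ricMatrix,
    Matrix.of_apply, Matrix.cons_val_zero, Matrix.cons_val_one, Matrix.cons_val'] at h0 h1
  exact ⟨by linear_combination h0, by linear_combination h1⟩

theorem eq_zero_of_isGauge_ricMatrix {t : ℂ} (ht : t ≠ 0) {a b : ℂ}
    {Z H : Matrix (Fin 2) (Fin 2) (LaurentSeries ℂ)}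
    (h : IsGauge eulerInf Z H (ricMatrix a b t)) (hdet : H.det = 0) : H = 0 := by
  have hC : (HahnSeries.C t : LaurentSeries ℂ) ≠ 0 := by simpa using ht
  rw [Matrix.det_fin_two, sub_eq_zero] at hdet
  have hrow := ricMatrix_rows h
  by_cases h0 : H 0 0 = 0 ∧ H 1 0 = 0
  · ext1 i j
    have h1 := (hrow i).1
    have hi : H i 0 = 0 := by
      fin_cases i
      exacts [h0.1, h0.2]
    rw [h0.1, h0.2, hi, isDer_eulerInf.zero] at h1
    simp only [mul_zero, add_zero, zero_add] at h1
    fin_cases j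
    exacts [hi, (mul_eq_zero.1 h1.symm).resolve_left hC]
  · exfalso
    obtain ⟨f, hf0, hf1⟩ : ∃ f, H 0 1 = f * H 0 0 ∧ H 1 1 = f * H 1 0 := by
      by_cases h00 : H 0 0 = 0
      · have h10 : H 1 0 ≠ 0 := fun h10 => h0 ⟨h00, h10⟩
        refine ⟨H 1 1 / H 1 0, ?_, by field_simp⟩
        rw [h00, zero_mul, eq_comm, mul_eq_zero] at hdet
        rw [hdet.resolve_right h10, h00, mul_zero]
      · refine ⟨H 0 1 / H 0 0, by field_simp, ?_⟩
        field_simp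
        linear_combination hdet
    have key : ∀ i, H i 0 = 0 := by
      intro i
      by_contra hx
      obtain ⟨h1, h2⟩ := hrow i
      have hfi : H i 1 = f * H i 0 := by
        fin_cases i
        exacts [hf0, hf1]
      rw [hfi] at h1 h2
      rw [hf0, hf1, isDer_eulerInf.mul] at h2
      refine riccati ht (a - b) f (mul_right_cancel₀ hx ?_)
      rw [map_sub]
      linear_combination h2 - f * h1
    exact h0 ⟨key 0, key 1⟩

theorem IsGauge.det {R : Type} [CommRing R] {δ : R → R} (hδ : IsDer δ)
    {A P B : Matrix (Fin 2) (Fin 2) R} (h : IsGauge δ A P B) :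
    A.trace * P.det + δ P.det = B.trace * P.det := by
  have e := fun i j => congrFun (congrFun h i) j
  simp only [Matrix.add_apply, Matrix.mul_apply, Fin.sum_univ_two, Matrix.map_apply] at e
  rw [Matrix.trace_fin_two, Matrix.trace_fin_two, Matrix.det_fin_two, hδ.sub, hδ.mul, hδ.mul]
  linear_combination P 1 1 * e 0 0 + P 0 0 * e 1 1 - P 1 0 * e 0 1 - P 0 1 * e 1 0

/-! ### Descent along the ramified cover -/

/-- The series `f_j` in the decomposition `f = ∑ u⁻ʲ f_j(u⁴)`. -/
def unram (j : ℤ) (f : LaurentSeries ℂ) : LaurentSeries ℂ :=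
  HahnSeries.ofSuppBddBelow (fun n => f.coeff (4 * n - j)) (by
    obtain ⟨m, hm⟩ := exists_ordGE f
    refine ⟨(m + j) / 4, fun n hn => ?_⟩
    have := hm.le hn
    omega)

theorem coeff_unram (j : ℤ) (f : LaurentSeries ℂ) (n : ℤ) :
    (unram j f).coeff n = f.coeff (4 * n - j) := rfl

theorem unram_add (j : ℤ) (f g : LaurentSeries ℂ) : unram j (f + g) = unram j f + unram j g := by
  ext n
  simp only [coeff_unram, HahnSeries.coeff_add]

theorem unram_single_mul (i j : ℤ) (f : LaurentSeries ℂ) :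
    unram j (HahnSeries.single i 1 * f) = unram (j + i) f := by
  ext n
  rw [coeff_unram, coeff_single_one_mul, coeff_unram, sub_sub]

theorem unram_ram (f : LaurentSeries ℂ) : unram 0 (ram f) = f := by
  ext n
  rw [coeff_unram, sub_zero, coeff_ram_four_mul]

theorem unram_ram_of_not_dvd {j : ℤ} (hj : ¬ 4 ∣ j) (f : LaurentSeries ℂ) :
    unram j (ram f) = 0 := by
  ext n
  rw [coeff_unram, coeff_ram_of_not_dvd _ (by omega), HahnSeries.coeff_zero]

theorem unram_add_four (j : ℤ) (f : LaurentSeries ℂ) : unram (j - 4) f = zInf ℂ * unram j f := by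
  ext n
  rw [coeff_zInf_mul, coeff_unram, coeff_unram]
  congr 1
  ring

theorem eq_zero_of_unram {f : LaurentSeries ℂ} (h0 : unram 0 f = 0) (h1 : unram 1 f = 0)
    (h2 : unram 2 f = 0) (h3 : unram 3 f = 0) : f = 0 := by
  ext n
  have key : ∀ j : ℤ, unram j f = 0 → ∀ m, f.coeff (4 * m - j) = 0 := fun j hj m => by
    rw [← coeff_unram, hj, HahnSeries.coeff_zero]
  obtain h | h | h | h : n = 4 * ((n + 3) / 4) - 0 ∨ n = 4 * ((n + 3) / 4) - 1 ∨
      n = 4 * ((n + 3) / 4) - 2 ∨ n = 4 * ((n + 3) / 4) - 3 := by omega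
  all_goals rw [h]
  exacts [key 0 h0 _, key 1 h1 _, key 2 h2 _, key 3 h3 _]

theorem eq_sum_unram (f : LaurentSeries ℂ) :
    f = ram (unram 0 f) + HahnSeries.single (-1) 1 * ram (unram 1 f) +
      HahnSeries.single (-2) 1 * ram (unram 2 f) +
      HahnSeries.single (-3) 1 * ram (unram 3 f) := by
  have hs : ∀ f g : LaurentSeries ℂ, ∀ j, unram j (f - g) = unram j f - unram j g := by
    intro f g j
    ext n
    simp only [coeff_unram, HahnSeries.coeff_sub]
  rw [← sub_eq_zero]
  refine eq_zero_of_unram ?_ ?_ ?_ ?_ <;>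
    rw [hs, unram_add, unram_add, unram_add, unram_single_mul, unram_single_mul, unram_single_mul]
      <;> norm_num [unram_ram, unram_ram_of_not_dvd]

theorem unram_ram_mul_of_mem {j : ℤ} (hj : j = 0 ∨ j = 1 ∨ j = 2 ∨ j = 3) (F f : LaurentSeries ℂ) :
    unram j (ram F * f) = F * unram j f := by
  have h : ram F * f = ram (F * unram 0 f) +
      HahnSeries.single (-1) 1 * ram (F * unram 1 f) +
      HahnSeries.single (-2) 1 * ram (F * unram 2 f) +
      HahnSeries.single (-3) 1 * ram (F * unram 3 f) := by
    conv_lhs => rw [eq_sum_unram f]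
    simp only [map_mul]
    ring
  rw [h, unram_add, unram_add, unram_add, unram_single_mul, unram_single_mul, unram_single_mul]
  rcases hj with rfl | rfl | rfl | rfl <;>
    norm_num [unram_ram, unram_ram_of_not_dvd, -map_mul]

theorem unram_eulerRam (j : ℤ) (f : LaurentSeries ℂ) :
    unram j (eulerRam f) = eulerInf (unram j f) + HahnSeries.C (j / 4 : ℂ) * unram j f := by
  ext n
  rw [coeff_unram, coeff_eulerRam, HahnSeries.coeff_add, coeff_eulerInf, coeff_C_mul_laurent,
    coeff_unram]
  push_cast
  ring

theorem unram_C_mul (j : ℤ) (c : ℂ) (f : LaurentSeries ℂ) :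
    unram j (HahnSeries.C c * f) = HahnSeries.C c * unram j f := by
  ext n
  rw [coeff_unram, coeff_C_mul_laurent, coeff_C_mul_laurent, coeff_unram]

/-- Over `ℂ((z⁻¹))`, a connection with trace `0` and the prescribed ramified form is equivalent
to the model. -/
theorem exists_isGauge_infModel {t : ℂ} (ht : t ≠ 0)
    {Z : Matrix (Fin 2) (Fin 2) (LaurentSeries ℂ)} (hZ : Z.trace = 0)
    (h : GaugeEquiv eulerRam (Z.map ram)
      !![HahnSeries.single (-2) t, 0; 0, -HahnSeries.single (-2) t]) :
    ∃ H, H.det ≠ 0 ∧ IsGauge eulerInf Z H (infModel t) := by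
  obtain ⟨g, hg⟩ := h
  let v : Fin 2 → LaurentSeries ℂ := fun i => g.val i 0
  have hv : ∀ i, ram (Z i 0) * v 0 + ram (Z i 1) * v 1 + eulerRam (v i) =
      HahnSeries.C t * (HahnSeries.single (-2) 1 * v i) := by
    intro i
    have h0 := congrFun (congrFun hg i) 0
    have h1 : (HahnSeries.C t * HahnSeries.single (-2) 1 : LaurentSeries ℂ) =
        HahnSeries.single (-2) t := C_mul_single t _
    simp only [Matrix.add_apply, Matrix.mul_apply, Fin.sum_univ_two, Matrix.map_apply,
      Matrix.of_apply, Matrix.cons_val_zero, Matrix.cons_val_one, Matrix.cons_val', mul_zero,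
      add_zero] at h0
    rw [← mul_assoc, h1, h0, mul_comm]
  have key : ∀ j : ℤ, (j = 0 ∨ j = 1 ∨ j = 2 ∨ j = 3) → ∀ i,
      Z i 0 * unram j (v 0) + Z i 1 * unram j (v 1) + (eulerInf (unram j (v i)) +
        HahnSeries.C (j / 4 : ℂ) * unram j (v i)) =
      HahnSeries.C t * unram (j - 2) (v i) := by
    intro j hj i
    have h0 := congrArg (unram j) (hv i)
    rwa [unram_add, unram_add, unram_ram_mul_of_mem hj, unram_ram_mul_of_mem hj, unram_eulerRam,
      unram_C_mul, unram_single_mul, ← sub_eq_add_neg] at h0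
  have mk : ∀ j : ℤ, (j = 2 ∨ j = 3) → IsGauge eulerInf Z
      (Matrix.of fun i k => unram (![j, j - 2] k) (v i))
      (ricMatrix (-(j / 4)) (-((j - 2) / 4)) t) := by
    intro j hj
    ext1 i k
    have h1 := key j (by omega) i
    have h2 := key (j - 2) (by omega) i
    rw [show j - 2 - 2 = j - 4 by ring, unram_add_four] at h2
    fin_cases k
    · simp only [Matrix.add_apply, Matrix.mul_apply, Fin.sum_univ_two, Matrix.map_apply,
        ricMatrix, Matrix.of_apply, Matrix.cons_val_zero, Matrix.cons_val_one, Matrix.cons_val',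
        Fin.zero_eta, map_neg]
      linear_combination h1
    · simp only [Matrix.add_apply, Matrix.mul_apply, Fin.sum_univ_two, Matrix.map_apply,
        ricMatrix, Matrix.of_apply, Matrix.cons_val_zero, Matrix.cons_val_one, Matrix.cons_val',
        Fin.mk_one, map_neg]
      push_cast at h2
      linear_combination h2
  have hK := mk 2 (Or.inl rfl)
  have hH := mk 3 (Or.inr rfl)
  have hK0 := eq_zero_of_isGauge_ricMatrix ht hK (by
    have h1 := hK.det isDer_eulerInf
    rw [hZ, zero_mul, zero_add] at h1
    have h2 : (ricMatrix (-((2 : ℤ) / 4)) (-(((2 : ℤ) - 2) / 4)) t).trace =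
        HahnSeries.C (-1 / 2) := by
      rw [Matrix.trace_fin_two]
      refine (map_add HahnSeries.C _ _).symm.trans ?_
      norm_num
    rw [h2] at h1
    ext n
    refine coeff_eq_zero_of_eulerInf_eq h1 fun h => ?_
    have h3 : ((2 * n : ℤ) : ℂ) = (1 : ℤ) := by push_cast; linear_combination -2 * h
    have := Int.cast_injective h3
    omega)
  have hH' : IsGauge eulerInf Z (Matrix.of fun i k => unram (![3, 3 - 2] k) (v i))
      (infModel t) := by
    have e1 : (-((3 : ℤ) / 4) : ℂ) = -3 / 4 := by norm_num
    have e2 : (-(((3 : ℤ) - 2) / 4) : ℂ) = -1 / 4 := by norm_num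
    rwa [e1, e2] at hH
  refine ⟨_, fun h0 => ?_, hH'⟩
  · have hH0 := eq_zero_of_isGauge_ricMatrix ht hH h0
    have hv0 : ∀ i, v i = 0 := fun i => eq_zero_of_unram
      (congrFun (congrFun hK0 i) 1) (congrFun (congrFun hH0 i) 1)
      (congrFun (congrFun hK0 i) 0) (congrFun (congrFun hH0 i) 0)
    have hdet : g.val.det ≠ 0 := ((Matrix.isUnit_iff_isUnit_det _).1 g.isUnit).ne_zero
    apply hdet
    rw [Matrix.det_fin_two, show g.val 0 0 = 0 from hv0 0, show g.val 1 0 = 0 from hv0 1]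
    simp

/-- The basis of eigenvectors of the model on the ramified cover. -/
theorem gaugeEquiv_infModel_ram (t : ℂ) : GaugeEquiv eulerRam ((infModel t).map ram)
    !![HahnSeries.single (-2) t, 0; 0, -HahnSeries.single (-2) t] := by
  have hE : ∀ (n : ℤ) (c : ℂ), -(n / 4) = c → eulerRam (HahnSeries.single n 1) =
      HahnSeries.C c * HahnSeries.single n 1 := by
    intro n c hc
    ext k
    rw [coeff_eulerRam, coeff_C_mul_laurent, HahnSeries.coeff_single]
    split_ifs with h
    · rw [h, ← hc, neg_mul]
    · rw [mul_zero, mul_zero, neg_zero]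
  have h3 := hE (-3) (3 / 4) (by norm_num)
  have h1 := hE (-1) (1 / 4) (by norm_num)
  have e4 : ram (zInf ℂ) = HahnSeries.single (-1) 1 * HahnSeries.single (-3) 1 := by
    rw [ram_zInf, zRam, HahnSeries.single_mul_single, one_mul]
    norm_num
  have e2 : (HahnSeries.single (-2) t : LaurentSeries ℂ) * HahnSeries.single (-1) 1 =
      HahnSeries.C t * HahnSeries.single (-3) 1 := by
    rw [HahnSeries.single_mul_single, C_mul_single, mul_one]
    norm_num
  have e5 : (HahnSeries.single (-2) t : LaurentSeries ℂ) * HahnSeries.single (-3) 1 =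
      HahnSeries.C t * (HahnSeries.single (-1) 1 * HahnSeries.single (-3) 1) *
        HahnSeries.single (-1) 1 := by
    rw [HahnSeries.single_mul_single, HahnSeries.single_mul_single, mul_assoc,
      HahnSeries.single_mul_single, C_mul_single', mul_one]
    norm_num
  have c3 : ram (HahnSeries.C (-3 / 4 : ℂ)) = -HahnSeries.C (3 / 4) := by
    rw [ram_C, ← map_neg]; norm_num
  have c1 : ram (HahnSeries.C (-1 / 4 : ℂ)) = -HahnSeries.C (1 / 4) := by
    rw [ram_C, ← map_neg]; norm_num
  have hp : (HahnSeries.single (-3) (1 : ℂ) : LaurentSeries ℂ) ≠ 0 :=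
    HahnSeries.single_ne_zero one_ne_zero
  have hq : (HahnSeries.single (-1) (1 : ℂ) : LaurentSeries ℂ) ≠ 0 :=
    HahnSeries.single_ne_zero one_ne_zero
  generalize (HahnSeries.single (-3) (1 : ℂ) : LaurentSeries ℂ) = p at *
  generalize (HahnSeries.single (-1) (1 : ℂ) : LaurentSeries ℂ) = q at *
  have hQ : IsUnit !![p, p; q, -q] := by
    rw [Matrix.isUnit_iff_isUnit_det, isUnit_iff_ne_zero, Matrix.det_fin_two_of]
    have h2 : (2 : LaurentSeries ℂ) ≠ 0 := by
      rw [← map_ofNat (HahnSeries.C : ℂ →+* LaurentSeries ℂ) 2]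
      simp
    have h4 : p * -q - p * q = -(2 * p * q) := by ring
    rw [h4]
    exact neg_ne_zero.2 (mul_ne_zero (mul_ne_zero h2 hp) hq)
  obtain ⟨u, hu⟩ := hQ
  refine ⟨u, ?_⟩
  rw [hu, infModel_eq]
  have h1' := isDer_eulerRam.neg q
  ext1 i j
  fin_cases i <;> fin_cases j <;>
    simp only [Fin.zero_eta, Fin.mk_one, Matrix.add_apply, Matrix.mul_apply, Fin.sum_univ_two,
      Matrix.map_apply, ricMatrix, Matrix.of_apply, Matrix.cons_val_zero, Matrix.cons_val_one,
      Matrix.cons_val', map_mul, c3, c1, ram_C, e4, h3, h1, h1']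
  · linear_combination -e5
  · linear_combination e5
  · linear_combination -e2
  · linear_combination -e2

end

end DegPV

namespace DegPV

noncomputable section

/-- The model at infinity has only scalar automorphisms. -/
theorem isGauge_infModel_self {t : ℂ} (ht : t ≠ 0)
    {Q : Matrix (Fin 2) (Fin 2) (LaurentSeries ℂ)}
    (h : IsGauge eulerInf (infModel t) Q (infModel t)) :
    ∃ c : ℂ, Q = (HahnSeries.C c : LaurentSeries ℂ) • (1 : Matrix (Fin 2) (Fin 2) (LaurentSeries ℂ)) := by
  rw [infModel_eq] at h
  obtain ⟨e00, e01⟩ := ricMatrix_rows h 0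
  obtain ⟨e10, e11⟩ := ricMatrix_rows h 1
  rw [Matrix.eta_fin_two Q]
  simp only [ricMatrix, Matrix.of_apply, Matrix.cons_val_zero, Matrix.cons_val_one,
    Matrix.cons_val'] at e00 e01 e10 e11
  generalize Q 0 0 = p, Q 0 1 = q, Q 1 0 = r, Q 1 1 = s at *
  have c1 : (HahnSeries.C (-1 / 4 : ℂ) : LaurentSeries ℂ) =
      HahnSeries.C (-3 / 4) + HahnSeries.C (1 / 2) := by
    rw [← map_add]
    norm_num
  have c2 : (HahnSeries.C (1 / 2) + HahnSeries.C (1 / 2) : LaurentSeries ℂ) = 1 := by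
    rw [← map_add, ← map_one (HahnSeries.C : ℂ →+* LaurentSeries ℂ)]
    norm_num
  rw [c1] at e01 e10
  have h1 : q + zInf ℂ * r = 0 := by
    have hd : eulerInf (q + zInf ℂ * r) = HahnSeries.C (1 / 2) * (q + zInf ℂ * r) := by
      rw [isDer_eulerInf.add, isDer_eulerInf.mul, eulerInf_zInf]
      linear_combination e01 + zInf ℂ * e10 - zInf ℂ * r * c2
    ext n
    refine coeff_eq_zero_of_eulerInf_eq hd fun h => ?_
    have h3 : ((-(2 * n) : ℤ) : ℂ) = (1 : ℤ) := by push_cast; linear_combination 2 * h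
    have := Int.cast_injective h3
    omega
  have h2 : eulerInf (p - s) = HahnSeries.C (4 * t) * q := by
    rw [isDer_eulerInf.sub, map_mul, map_ofNat]
    linear_combination e00 - e11 - 2 * HahnSeries.C t * h1
  have h3 : HahnSeries.C t * (zInf ℂ * (p - s)) = eulerInf q - HahnSeries.C (1 / 2) * q := by
    linear_combination -e01
  have hps : p - s = 0 := by
    by_contra hm
    obtain ⟨k, hk, hk'⟩ := exists_order hm
    have hq : OrdGE k q := fun n hn => by
      have h4 := congrArg (fun f => HahnSeries.coeff f n) h2
      simp only [hk.eulerInf n hn, coeff_C_mul_laurent] at h4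
      have h5 : 4 * t ≠ 0 := by simpa using ht
      exact (mul_eq_zero.1 h4.symm).resolve_left h5
    have h4 := congrArg (fun f => HahnSeries.coeff f (k - 1)) h3
    simp only [(hq.eulerInf.sub (hq.C_mul _)) (k - 1) (by omega), coeff_C_mul_laurent,
      coeff_zInf_mul, sub_add_cancel] at h4
    exact (mul_ne_zero ht hk') h4
  have hC (c : ℂ) (hc : c ≠ 0) : (HahnSeries.C c : LaurentSeries ℂ) ≠ 0 := by simpa using hc
  have hq : q = 0 := by
    rw [hps, isDer_eulerInf.zero, eq_comm, mul_eq_zero] at h2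
    exact h2.resolve_left (hC _ (by simpa using ht))
  have hr : r = 0 := by
    rw [hq, zero_add, mul_eq_zero] at h1
    exact h1.resolve_left (HahnSeries.single_ne_zero one_ne_zero)
  have hp : eulerInf p = HahnSeries.C 0 * p := by
    rw [map_zero]
    rw [hq, hr] at e00
    linear_combination e00
  have hp' : p = HahnSeries.C (p.coeff 0) := by
    ext n
    by_cases hn : n = 0
    · rw [hn, HahnSeries.C_apply, HahnSeries.coeff_single_same]
    · rw [HahnSeries.C_apply, HahnSeries.coeff_single_of_ne hn]
      exact coeff_eq_zero_of_eulerInf_eq hp (by simpa using hn)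
  refine ⟨p.coeff 0, ?_⟩
  rw [← hp', ← sub_eq_zero.1 hps, hq, hr]
  ext1 i j
  fin_cases i <;> fin_cases j <;> simp

/-! ### Polynomial changes of basis and the splitting type at infinity -/

theorem aeval_zInf_X_pow_mul (k : ℕ) (f : LaurentSeries ℂ) (n : ℤ) :
    (aeval (zInf ℂ) (X ^ k : ℂ[X]) * f).coeff n = f.coeff (n + k) := by
  rw [map_pow, aeval_X]
  induction k generalizing n with
  | zero => simp
  | succ k ih =>
    rw [pow_succ', mul_assoc, coeff_zInf_mul, ih]
    congr 1
    push_cast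
    ring

theorem coeff_aeval_zInf (p : ℂ[X]) (n : ℤ) :
    (aeval (zInf ℂ) p).coeff (-n) = if 0 ≤ n then p.coeff n.toNat else 0 := by
  induction p using Polynomial.induction_on' with
  | add p q hp hq =>
    rw [map_add, HahnSeries.coeff_add, hp, hq]
    split_ifs <;> simp
  | monomial k c =>
    rw [← C_mul_X_pow_eq_monomial, map_mul, aeval_C, algebraMap_laurentSeries,
      coeff_C_mul_laurent, ← mul_one (aeval (zInf ℂ) (X ^ k)), aeval_zInf_X_pow_mul,
      ← HahnSeries.single_zero_one, HahnSeries.coeff_single, coeff_C_mul_X_pow]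
    by_cases hn : n = k
    · subst hn
      simp
    · rw [if_neg (by omega), mul_zero]
      split_ifs with h0 h1
      · omega
      · rfl
      · rfl

theorem natDegree_le_of_ordGE {p : ℂ[X]} {d : ℕ} (h : OrdGE (-d) (aeval (zInf ℂ) p)) :
    p.natDegree ≤ d := by
  rw [natDegree_le_iff_coeff_eq_zero]
  intro k hk
  have h1 := coeff_aeval_zInf p k
  rw [if_pos (by omega), Int.toNat_natCast] at h1
  rw [← h1]
  exact h _ (by omega)

theorem eq_zero_of_ordGE_one {p : ℂ[X]} (h : OrdGE 1 (aeval (zInf ℂ) p)) : p = 0 := by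
  ext k
  have h1 := coeff_aeval_zInf p k
  rw [if_pos (by omega), Int.toNat_natCast] at h1
  rw [← h1]
  exact h _ (by omega)

/-- An invertible polynomial matrix over `ℂ((z⁻¹))`. -/
def infGL : (Matrix (Fin 2) (Fin 2) ℂ[X])ˣ →* (Matrix (Fin 2) (Fin 2) (LaurentSeries ℂ))ˣ :=
  Units.map (RingHom.mapMatrix (aeval (zInf ℂ) : ℂ[X] →ₐ[ℂ] LaurentSeries ℂ).toRingHom).toMonoidHom

theorem infGL_val (P : (Matrix (Fin 2) (Fin 2) ℂ[X])ˣ) :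
    (infGL P).val = P.val.map (aeval (zInf ℂ)) := rfl

theorem det_infGL (P : (Matrix (Fin 2) (Fin 2) ℂ[X])ˣ) :
    ∃ c : ℂ, c ≠ 0 ∧ (infGL P).val.det = HahnSeries.C c := by
  obtain ⟨c, hc, h⟩ := Polynomial.isUnit_iff.1 ((Matrix.isUnit_iff_isUnit_det _).1 P.isUnit)
  refine ⟨c, hc.ne_zero, ?_⟩
  have h1 := (RingHom.map_det (aeval (zInf ℂ) : ℂ[X] →ₐ[ℂ] LaurentSeries ℂ).toRingHom P.val).symm
  refine h1.trans ?_
  rw [← h]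
  exact (aeval_C _ _).trans (algebraMap_laurentSeries c)

/-- The two rows have orders at least `m` and `n`. -/
def RowsGE (m n : ℤ) (G : Matrix (Fin 2) (Fin 2) (LaurentSeries ℂ)) : Prop :=
  (∀ j, OrdGE m (G 0 j)) ∧ ∀ j, OrdGE n (G 1 j)

/-- The rows swapped. -/
def swapPoly : (Matrix (Fin 2) (Fin 2) ℂ[X])ˣ where
  val := !![0, 1; 1, 0]
  inv := !![0, 1; 1, 0]
  val_inv := by rw [Matrix.mul_fin_two, Matrix.one_fin_two]; simp
  inv_val := by rw [Matrix.mul_fin_two, Matrix.one_fin_two]; simp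

/-- An elementary matrix. -/
def elemPoly (p : ℂ[X]) : (Matrix (Fin 2) (Fin 2) ℂ[X])ˣ where
  val := !![1, p; 0, 1]
  inv := !![1, -p; 0, 1]
  val_inv := by rw [Matrix.mul_fin_two, Matrix.one_fin_two]; simp
  inv_val := by rw [Matrix.mul_fin_two, Matrix.one_fin_two]; simp

theorem infGL_swapPoly_mul (G : Matrix (Fin 2) (Fin 2) (LaurentSeries ℂ)) (j : Fin 2) :
    ((infGL swapPoly).val * G) 0 j = G 1 j ∧ ((infGL swapPoly).val * G) 1 j = G 0 j := by
  simp [infGL_val, swapPoly, Matrix.mul_apply, Fin.sum_univ_two]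

theorem infGL_elemPoly_mul (p : ℂ[X]) (G : Matrix (Fin 2) (Fin 2) (LaurentSeries ℂ)) (j : Fin 2) :
    ((infGL (elemPoly p)).val * G) 0 j = G 0 j + aeval (zInf ℂ) p * G 1 j ∧
      ((infGL (elemPoly p)).val * G) 1 j = G 1 j := by
  simp [infGL_val, elemPoly, Matrix.mul_apply, Fin.sum_univ_two]

theorem RowsGE.swap {m n : ℤ} {G : Matrix (Fin 2) (Fin 2) (LaurentSeries ℂ)} (h : RowsGE m n G) :
    RowsGE n m ((infGL swapPoly).val * G) :=
  ⟨fun j => (infGL_swapPoly_mul G j).1 ▸ h.2 j, fun j => (infGL_swapPoly_mul G j).2 ▸ h.1 j⟩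

theorem RowsGE.coeff_det {m n : ℤ} {G : Matrix (Fin 2) (Fin 2) (LaurentSeries ℂ)}
    (h : RowsGE m n G) : G.det.coeff (m + n) = (G 0 0).coeff m * (G 1 1).coeff n -
      (G 0 1).coeff m * (G 1 0).coeff n := by
  rw [Matrix.det_fin_two, HahnSeries.coeff_sub, (h.1 0).coeff_mul (h.2 1),
    (h.1 1).coeff_mul (h.2 0)]

theorem RowsGE.exists_step {m n : ℤ} {G : Matrix (Fin 2) (Fin 2) (LaurentSeries ℂ)}
    (h : RowsGE m n G) (hmn : m ≤ n) (hdet : G.det.coeff (m + n) = 0) :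
    ∃ P m' n', m' + n' = m + n + 1 ∧ RowsGE m' n' ((infGL P).val * G) := by
  rw [h.coeff_det] at hdet
  by_cases h0 : (G 1 0).coeff n = 0 ∧ (G 1 1).coeff n = 0
  · refine ⟨1, m, n + 1, by ring, ?_⟩
    rw [map_one, Units.val_one, one_mul]
    refine ⟨h.1, fun j => (h.2 j).succ ?_⟩
    fin_cases j
    exacts [h0.1, h0.2]
  · obtain ⟨c, hc⟩ : ∃ c, ∀ j, (G 0 j).coeff m = c * (G 1 j).coeff n := by
      by_cases h1 : (G 1 0).coeff n = 0
      · have h2 : (G 1 1).coeff n ≠ 0 := fun h2 => h0 ⟨h1, h2⟩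
        rw [h1, mul_zero, sub_zero, mul_eq_zero] at hdet
        refine ⟨(G 0 1).coeff m / (G 1 1).coeff n, Fin.forall_fin_two.2 ⟨?_, by field_simp⟩⟩
        rw [hdet.resolve_right h2, h1, mul_zero]
      · refine ⟨(G 0 0).coeff m / (G 1 0).coeff n, Fin.forall_fin_two.2 ⟨by field_simp, ?_⟩⟩
        field_simp
        linear_combination -hdet
    obtain ⟨k, rfl⟩ := Int.le.dest hmn
    refine ⟨elemPoly (C (-c) * X ^ k), m + 1, m + k, by ring, fun j => ?_, fun j => ?_⟩
    · rw [(infGL_elemPoly_mul _ G j).1, map_mul, aeval_C, algebraMap_laurentSeries, mul_assoc]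
      have h1 : OrdGE m (aeval (zInf ℂ) (X ^ k : ℂ[X]) * G 1 j) := fun l hl => by
        rw [aeval_zInf_X_pow_mul]
        exact h.2 j _ (by omega)
      refine ((h.1 j).add (h1.C_mul _)).succ ?_
      rw [HahnSeries.coeff_add, coeff_C_mul_laurent, aeval_zInf_X_pow_mul, hc]
      ring
    · rw [(infGL_elemPoly_mul _ G j).2]
      exact h.2 j

/-- A lattice at infinity of degree `-1` splits: after a polynomial change of basis it is
`diag(w^m, w^n) GL₂(ℂ⟦w⟧)` with `m + n = 1`. -/
theorem exists_rowsGE {H : Matrix (Fin 2) (Fin 2) (LaurentSeries ℂ)} (hH : OrdGE 1 H.det) :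
    ∃ P m n, m ≤ n ∧ m + n = 1 ∧ RowsGE m n ((infGL P).val * H) := by
  suffices key : ∀ k : ℕ, ∀ P, ∀ m n : ℤ, m + n + k = 1 → RowsGE m n ((infGL P).val * H) →
      ∃ P m n, m ≤ n ∧ m + n = 1 ∧ RowsGE m n ((infGL P).val * H) by
    obtain ⟨n, hn⟩ := exists_mOrdGE H
    refine key (1 - (min n 0 + min n 0)).toNat 1 (min n 0) (min n 0) (by omega) ?_
    rw [map_one, Units.val_one, one_mul]
    exact ⟨fun j => (hn 0 j).mono (min_le_left _ _), fun j => (hn 1 j).mono (min_le_left _ _)⟩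
  intro k
  induction k with
  | zero =>
    intro P m n hmn h
    rcases le_total m n with hle | hle
    · exact ⟨P, m, n, hle, by simpa using hmn, h⟩
    · refine ⟨swapPoly * P, n, m, hle, by simpa [add_comm] using hmn, ?_⟩
      rw [map_mul, Units.val_mul, mul_assoc]
      exact h.swap
  | succ k ih =>
    intro P m n hmn h
    have hdet : ∀ Q, OrdGE 1 ((infGL Q).val * H).det := by
      intro Q
      obtain ⟨c, -, hc⟩ := det_infGL Q
      rw [Matrix.det_mul, hc]
      exact hH.C_mul c
    push_cast at hmn
    obtain ⟨Q, m', n', e, hQ⟩ : ∃ Q m' n', m' + n' = m + n + 1 ∧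
        RowsGE m' n' ((infGL Q).val * H) := by
      rcases le_total m n with hle | hle
      · obtain ⟨Q, m', n', e, hQ⟩ := h.exists_step hle (hdet P _ (by omega))
        exact ⟨Q * P, m', n', e, by rwa [map_mul, Units.val_mul, mul_assoc]⟩
      · have hs := h.swap
        rw [← mul_assoc, ← Units.val_mul, ← map_mul] at hs
        obtain ⟨Q, m', n', e, hQ⟩ := hs.exists_step hle (hdet _ _ (by omega))
        exact ⟨Q * (swapPoly * P), m', n', by omega, by rwa [map_mul, Units.val_mul, mul_assoc]⟩
    exact ih Q m' n' (by omega) hQ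

theorem ordGE_of_mul {f d : LaurentSeries ℂ} {k e : ℤ} (h : OrdGE k (f * d)) (hd : OrdGE e d)
    (hd0 : d.coeff e ≠ 0) : OrdGE (k - e) f := by
  by_cases hf : f = 0
  · exact hf ▸ ordGE_zero _
  obtain ⟨l, hl, hl'⟩ := exists_order hf
  have h1 : (f * d).coeff (l + e) ≠ 0 := by
    rw [hl.coeff_mul hd]
    exact mul_ne_zero hl' hd0
  have := h.le h1
  exact hl.mono (by omega)

theorem mOrdGE_infModel (t : ℂ) : MOrdGE (-1) (infModel t) := by
  have h0 (c : ℂ) : OrdGE (-1) (HahnSeries.C c) := (ordGE_C c).mono (by omega)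
  intro i j
  fin_cases i <;> fin_cases j
  exacts [h0 _, (ordGE_single (-1) (1 : ℂ)).C_mul t, h0 _, h0 _]

theorem ordGE_zInf_sub_one : OrdGE (-1) (zInf ℂ - 1) :=
  (ordGE_single (-1) (1 : ℂ)).sub ((ordGE_single 0 1).mono (by omega))

section

variable {A : Matrix (Fin 2) (Fin 2) ℂ[X]} {Z G : Matrix (Fin 2) (Fin 2) (LaurentSeries ℂ)}
  {m n : ℤ} {t : ℂ}

theorem RowsGE.ordGE_entries (hZ : (zInf ℂ - 1) • Z = A.map (aeval (zInf ℂ)))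
    (hG : IsGauge eulerInf Z G (infModel t)) (h : RowsGE m n G) (hdet : OrdGE 1 G.det)
    (hdet0 : G.det.coeff 1 ≠ 0) {i : Fin 2} {r : ℤ} (hr : ∀ j, OrdGE r (G i j)) :
    OrdGE (r + n - 3) (aeval (zInf ℂ) (A i 0)) ∧ OrdGE (r + m - 3) (aeval (zInf ℂ) (A i 1)) := by
  have hρ : ∀ j, OrdGE (r - 2) ((zInf ℂ - 1) *
      ((G i 0 * infModel t 0 j + G i 1 * infModel t 1 j) - eulerInf (G i j))) := by
    intro j
    refine (ordGE_zInf_sub_one.mul ((((hr 0).mul (mOrdGE_infModel t 0 j)).add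
      ((hr 1).mul (mOrdGE_infModel t 1 j))).sub (((hr j).eulerInf).mono (by omega)))).mono ?_
    omega
  have he : ∀ j, aeval (zInf ℂ) (A i 0) * G 0 j + aeval (zInf ℂ) (A i 1) * G 1 j =
      (zInf ℂ - 1) * ((G i 0 * infModel t 0 j + G i 1 * infModel t 1 j) - eulerInf (G i j)) := by
    intro j
    have h1 := congrFun (congrFun hG i) j
    have h2 := fun k => congrFun (congrFun hZ i) k
    simp only [Matrix.add_apply, Matrix.mul_apply, Fin.sum_univ_two, Matrix.map_apply,
      Matrix.smul_apply, smul_eq_mul] at h1 h2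
    rw [← h2, ← h2]
    linear_combination (zInf ℂ - 1) * h1
  have hdet' := Matrix.det_fin_two G
  constructor
  · have h1 : OrdGE (r - 2 + n) (aeval (zInf ℂ) (A i 0) * G.det) := by
      have h2 := ((hρ 0).mul (h.2 1)).sub ((hρ 1).mul (h.2 0))
      rw [← he, ← he] at h2
      convert h2 using 1
      rw [hdet']
      ring
    exact (ordGE_of_mul h1 hdet hdet0).mono (by omega)
  · have h1 : OrdGE (r - 2 + m) (aeval (zInf ℂ) (A i 1) * G.det) := by
      have h2 := ((hρ 1).mul (h.1 0)).sub ((hρ 0).mul (h.1 1))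
      rw [← he, ← he] at h2
      convert h2 using 1
      rw [hdet']
      ring
    exact (ordGE_of_mul h1 hdet hdet0).mono (by omega)

theorem RowsGE.eq_one (ht : t ≠ 0) (hZ : (zInf ℂ - 1) • Z = A.map (aeval (zInf ℂ)))
    (hG : IsGauge eulerInf Z G (infModel t)) (h : RowsGE m n G) (hdet : OrdGE 1 G.det)
    (hdet0 : G.det.coeff 1 ≠ 0) (hmn : m ≤ n) (hmn1 : m + n = 1) : m = 0 ∧ n = 1 := by
  by_contra hc
  have h1 := (h.ordGE_entries hZ hG hdet hdet0 (i := 1) h.2).1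
  have h2 : A 1 0 = 0 := eq_zero_of_ordGE_one (h1.mono (by omega))
  have hz : zInf ℂ - 1 ≠ 0 := by
    have := aeval_zInf_ne_zero (X - C 1) (Polynomial.X_sub_C_ne_zero 1)
    simpa using this
  have h3 : Z 1 0 = 0 := by
    have h4 := congrFun (congrFun hZ 1) 0
    rw [Matrix.smul_apply, Matrix.map_apply, h2, map_zero, smul_eq_mul, mul_eq_zero] at h4
    exact h4.resolve_left hz
  rw [infModel_eq] at hG
  obtain ⟨e0, e1⟩ := ricMatrix_rows hG 1
  rw [h3, zero_mul, zero_add, add_comm] at e0 e1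
  have h5 := eq_zero_of_ricMatrix ht e0 e1
  have h6 : G 1 1 = 0 := by
    rw [h5, isDer_eulerInf.zero, mul_zero, mul_zero, zero_add, zero_add, eq_comm, mul_eq_zero] at e0
    exact e0.resolve_left (by simpa using ht)
  rw [Matrix.det_fin_two, h5, h6] at hdet0
  simp at hdet0

theorem exists_units_map_of_mem {g : (Matrix (Fin 2) (Fin 2) (LaurentSeries ℂ))ˣ}
    (hg : g ∈ unimodular) : ∃ u : (Matrix (Fin 2) (Fin 2) ℂ⟦X⟧)ˣ,
      u.val.map (HahnSeries.ofPowerSeries ℤ ℂ) = g.val := by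
  obtain ⟨h1, h2⟩ := hg
  choose F hF using fun i j => ordGE_zero_iff.1 (h1 i j)
  choose F' hF' using fun i j => ordGE_zero_iff.1 (h2 i j)
  have e1 : (Matrix.of F).map (HahnSeries.ofPowerSeries ℤ ℂ) = g.val := by
    ext1 i j
    exact hF i j
  have e2 : (Matrix.of F').map (HahnSeries.ofPowerSeries ℤ ℂ) = (g⁻¹).val := by
    ext1 i j
    exact hF' i j
  have hinj : Function.Injective fun N : Matrix (Fin 2) (Fin 2) ℂ⟦X⟧ =>
      N.map (HahnSeries.ofPowerSeries ℤ ℂ) :=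
    Matrix.map_injective HahnSeries.ofPowerSeries_injective
  have hone : (1 : Matrix (Fin 2) (Fin 2) ℂ⟦X⟧).map (HahnSeries.ofPowerSeries ℤ ℂ) = 1 :=
    Matrix.map_one _ (map_zero _) (map_one _)
  refine ⟨⟨Matrix.of F, Matrix.of F', hinj ?_, hinj ?_⟩, e1⟩
  · simp only [Matrix.map_mul, e1, e2, hone, Units.mul_inv]
  · simp only [Matrix.map_mul, e1, e2, hone, Units.inv_mul]

theorem RowsGE.hasInfModel (hZ : (zInf ℂ - 1) • Z = A.map (aeval (zInf ℂ)))
    (hG : IsGauge eulerInf Z G (infModel t)) (h : RowsGE 0 1 G) (hdet : OrdGE 1 G.det)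
    (hdet0 : G.det.coeff 1 ≠ 0) : HasInfModel A t ∧ DegreeBounds A := by
  constructor
  · let g : Matrix (Fin 2) (Fin 2) (LaurentSeries ℂ) :=
      Matrix.diagonal ![1, HahnSeries.single (-1) 1] * G
    have hss : (HahnSeries.single 1 1 * HahnSeries.single (-1) 1 : LaurentSeries ℂ) = 1 := by
      rw [HahnSeries.single_mul_single, one_mul]
      rfl
    have hg : Matrix.diagonal ![1, HahnSeries.single 1 1] * g = G := by
      rw [← mul_assoc, Matrix.diagonal_mul_diagonal]
      have : (Matrix.diagonal fun i => (![1, HahnSeries.single 1 1] : Fin 2 → LaurentSeries ℂ) i *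
          (![1, HahnSeries.single (-1) 1] : Fin 2 → LaurentSeries ℂ) i) = 1 := by
        rw [← Matrix.diagonal_one]
        congr 1
        ext1 i
        fin_cases i
        · exact mul_one 1
        · exact hss
      rw [this, one_mul]
    have hgdet : g.det.coeff 0 ≠ 0 := by
      rw [Matrix.det_mul, Matrix.det_diagonal, Fin.prod_univ_two]
      simp only [Matrix.cons_val_zero, Matrix.cons_val_one, one_mul]
      rwa [coeff_single_one_mul]
    have hgne : IsUnit g := by
      rw [Matrix.isUnit_iff_isUnit_det, isUnit_iff_ne_zero]
      intro h0
      rw [h0] at hgdet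
      exact hgdet rfl
    obtain ⟨u, hu⟩ := hgne
    have hmem : u ∈ unimodular := by
      refine mem_unimodular_of_det (fun i j => ?_) (by rwa [hu])
      rw [hu]
      fin_cases i
      · simpa [g, Matrix.diagonal_mul] using h.1 j
      · have h1 := (ordGE_single (-1) (1 : ℂ)).mul (h.2 j)
        simpa [g, Matrix.diagonal_mul] using h1
    obtain ⟨v, hv⟩ := exists_units_map_of_mem hmem
    refine ⟨v, G, ?_, ?_⟩
    · rw [hv, hu, hg]
    · rw [← hZ]
      refine (congrArg (· + _) (Matrix.smul_mul _ Z G)).trans ?_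
      ext1 i j
      exact (mul_add (zInf ℂ - 1) ((Z * G) i j) _).symm.trans
        (congrArg _ (congrFun (congrFun hG i) j))
  · have h0 := h.ordGE_entries hZ hG hdet hdet0 (i := 0) h.1
    have h1 := h.ordGE_entries hZ hG hdet hdet0 (i := 1) h.2
    exact ⟨natDegree_le_of_ordGE (h0.1.mono (by norm_num)),
      natDegree_le_of_ordGE (h0.2.mono (by norm_num)),
      natDegree_le_of_ordGE (h1.1.mono (by norm_num)),
      natDegree_le_of_ordGE (h1.2.mono (by norm_num))⟩

end

end

end DegPV

namespace DegPV

noncomputable section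

/-! ### Bases of differential modules -/

theorem mem_span_range_iff {a : ℂ} {V : Type} [AddCommGroup V] [Module (RatFunc ℂ) V]
    (b : Module.Basis (Fin 2) (RatFunc ℂ) V) (m : V) :
    m ∈ Submodule.span (localRing a) (Set.range b) ↔ ∀ i, b.repr m i ∈ localRing a := by
  constructor
  · intro h
    induction h using Submodule.span_induction with
    | mem x hx =>
      obtain ⟨j, rfl⟩ := hx
      intro i
      rw [b.repr_self, Finsupp.single_apply]
      split_ifs
      exacts [(localRing a).one_mem, (localRing a).zero_mem]
    | zero => simp [(localRing a).zero_mem]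
    | add x y _ _ hx hy =>
      intro i
      rw [map_add]
      exact (localRing a).add_mem (hx i) (hy i)
    | smul r x _ hx =>
      intro i
      have h : r • x = (r : RatFunc ℂ) • x := rfl
      rw [h, map_smul]
      exact (localRing a).mul_mem r.2 (hx i)
  · intro h
    rw [← b.sum_repr m]
    refine Submodule.sum_mem _ fun i _ => ?_
    exact Submodule.smul_mem _ (⟨_, h i⟩ : localRing a) (Submodule.subset_span ⟨i, rfl⟩)

section

variable {V : Type} [AddCommGroup V] [Module (RatFunc ℂ) V]
  (b b' : Module.Basis (Fin 2) (RatFunc ℂ) V)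

/-- The matrix expressing the basis `b'` in terms of the basis `b`. -/
def basisGL : (Matrix (Fin 2) (Fin 2) (RatFunc ℂ))ˣ where
  val := b.toMatrix b'
  inv := b'.toMatrix b
  val_inv := b.toMatrix_mul_toMatrix_flip b'
  inv_val := b'.toMatrix_mul_toMatrix_flip b

theorem basisGL_val : (basisGL b b').val = b.toMatrix b' := rfl

theorem basisGL_inv : (basisGL b b')⁻¹ = basisGL b' b := rfl

theorem basisGL_mul (b'' : Module.Basis (Fin 2) (RatFunc ℂ) V) :
    basisGL b b' * basisGL b' b'' = basisGL b b'' :=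
  Units.ext (Module.Basis.toMatrix_mul_toMatrix b b' b'')

theorem repr_eq_basisGL (m : V) (i : Fin 2) :
    b.repr m i = (basisGL b b').val i 0 * b'.repr m 0 + (basisGL b b').val i 1 * b'.repr m 1 := by
  have h := congrFun (b'.toMatrix_mulVec_repr b m) i
  rw [← h, Matrix.mulVec, dotProduct, Fin.sum_univ_two]
  rfl

theorem exists_basisGL_eq (P : (Matrix (Fin 2) (Fin 2) (RatFunc ℂ))ˣ) :
    ∃ b', basisGL b b' = P := by
  refine ⟨b.map (Matrix.toLinearEquiv b P.val ((Matrix.isUnit_iff_isUnit_det _).1 P.isUnit)),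
    Units.ext ?_⟩
  ext1 i j
  rw [basisGL_val, Module.Basis.toMatrix_apply, Module.Basis.map_apply]
  refine (congrArg (fun m => b.repr m i) (Matrix.toLin_self b b P.val j)).trans ?_
  simp [Fin.sum_univ_two, Finsupp.single_apply]
  fin_cases i <;> simp

variable {b b'}

theorem span_eq_of_mem {a : ℂ} (h : atGL a (basisGL b b') ∈ unimodular) :
    Submodule.span (localRing a) (Set.range b) = Submodule.span (localRing a) (Set.range b') := by
  rw [atGL_mem_unimodular_iff, basisGL_inv] at h
  ext m
  rw [mem_span_range_iff, mem_span_range_iff]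
  constructor
  · intro hm i
    rw [repr_eq_basisGL b' b]
    exact (localRing a).add_mem ((localRing a).mul_mem (h.2 i 0) (hm 0))
      ((localRing a).mul_mem (h.2 i 1) (hm 1))
  · intro hm i
    rw [repr_eq_basisGL b b']
    exact (localRing a).add_mem ((localRing a).mul_mem (h.1 i 0) (hm 0))
      ((localRing a).mul_mem (h.1 i 1) (hm 1))

theorem mem_of_span_eq {a : ℂ} (h : Submodule.span (localRing a) (Set.range b) =
    Submodule.span (localRing a) (Set.range b')) : atGL a (basisGL b b') ∈ unimodular := by
  rw [atGL_mem_unimodular_iff, basisGL_inv]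
  constructor
  · intro i j
    exact (mem_span_range_iff b (b' j)).1 (h ▸ Submodule.subset_span ⟨j, rfl⟩) i
  · intro i j
    exact (mem_span_range_iff b' (b j)).1 (h ▸ Submodule.subset_span ⟨j, rfl⟩) i

end

namespace DiffModule

variable (N : DiffModule) (b b' : Module.Basis (Fin 2) (RatFunc ℂ) N.carrier)

theorem repr_op (m : N.carrier) (i : Fin 2) : b.repr (N.op m) i = rderiv (b.repr m i) +
    (N.matrix b i 0 * b.repr m 0 + N.matrix b i 1 * b.repr m 1) := by
  have h : N.op m = rderiv (b.repr m 0) • b 0 + b.repr m 0 • N.op (b 0) +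
      (rderiv (b.repr m 1) • b 1 + b.repr m 1 • N.op (b 1)) := by
    conv_lhs => rw [← b.sum_repr m, Fin.sum_univ_two, map_add, N.leibniz, N.leibniz]
  rw [h]
  simp only [map_add, map_smul, Finsupp.add_apply, Finsupp.smul_apply, smul_eq_mul, b.repr_self,
    matrix, Matrix.of_apply]
  fin_cases i <;> simp <;> ring

theorem isGauge_basisGL : IsGauge rderiv (N.matrix b) (basisGL b b').val (N.matrix b') := by
  ext1 i j
  have h1 := N.repr_op b (b' j) i
  have h2 := repr_eq_basisGL b b' (N.op (b' j)) i
  rw [h2] at h1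
  simp only [Matrix.add_apply, Matrix.mul_apply, Fin.sum_univ_two, Matrix.map_apply]
  exact (add_comm _ _).trans h1.symm

theorem isGauge_at (a : ℂ) : IsGauge lderiv ((N.matrix b).map (atHom a))
    (atGL a (basisGL b b')).val ((N.matrix b').map (atHom a)) :=
  (N.isGauge_basisGL b b').map (atHom a : RatFunc ℂ →+* LaurentSeries ℂ)
    fun x => (lderiv_atHom a x).symm

/-- The matrix of `z d/dz` over `ℂ((z⁻¹))`. -/
def infMatrix : Matrix (Fin 2) (Fin 2) (LaurentSeries ℂ) :=
  ((RatFunc.X : RatFunc ℂ) • N.matrix b).map infHom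

theorem isGauge_inf : IsGauge eulerInf (N.infMatrix b) ((basisGL b b').val.map infHom)
    (N.infMatrix b') :=
  ((N.isGauge_basisGL b b').smul RatFunc.X).map (infHom : RatFunc ℂ →+* LaurentSeries ℂ)
    fun x => (eulerInf_infHom x).symm

theorem infMatrix_map_ram :
    (N.infMatrix b).map ram = zRam • (N.matrix b).map (expand zRam) := by
  ext1 i j
  simp only [infMatrix, Matrix.map_apply, Matrix.smul_apply, smul_eq_mul, map_mul, ← ram_infHom,
    infHom_X, ram_zInf]

theorem matrix_map_expand (a : ℂ) :
    (N.matrix b).map (expand (zAt a)) = (N.matrix b).map (atHom a) := by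
  ext1 i j
  rw [Matrix.map_apply, Matrix.map_apply, atHom_apply]

variable {N b b'}

theorem gaugeEquiv_ram_of_basis {B : Matrix (Fin 2) (Fin 2) (LaurentSeries ℂ)}
    (h : GaugeEquiv eulerRam (zRam • (N.matrix b).map (expand zRam)) B) :
    GaugeEquiv eulerRam ((N.infMatrix b').map ram) B := by
  obtain ⟨g, hg⟩ := h
  rw [← infMatrix_map_ram] at hg
  have h1 := (N.isGauge_inf b' b).map ram eulerRam_ram
  let u : (Matrix (Fin 2) (Fin 2) (LaurentSeries ℂ))ˣ :=
    Units.map (RingHom.mapMatrix (ram.comp (infHom : RatFunc ℂ →+* LaurentSeries ℂ))).toMonoidHom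
      (basisGL b' b)
  have hu : u.val = ((basisGL b' b).val.map infHom).map ram := rfl
  rw [← hu] at h1
  exact ⟨u * g, h1.trans isDer_eulerRam hg⟩

theorem gaugeEquiv_at_of_basis {a : ℂ} {B : Matrix (Fin 2) (Fin 2) (LaurentSeries ℂ)}
    (h : GaugeEquiv lderiv ((N.matrix b).map (expand (zAt a))) B) :
    GaugeEquiv lderiv ((N.matrix b').map (expand (zAt a))) B := by
  obtain ⟨g, hg⟩ := h
  rw [matrix_map_expand] at hg ⊢
  exact ⟨_ * g, (N.isGauge_at b' b a).trans isDer_lderiv hg⟩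

theorem IsTriangularAt.of_basis {a ω : ℂ} (h : N.IsTriangularAt b a ω) :
    N.IsTriangularAt b' a ω := by
  obtain ⟨c, hc⟩ := h
  exact ⟨c, gaugeEquiv_at_of_basis hc⟩

end DiffModule

theorem OrdGE.lderiv {f : LaurentSeries ℂ} (h : OrdGE 0 f) : OrdGE 0 (lderiv f) := fun k hk => by
  rw [coeff_lderiv]
  by_cases h1 : k + 1 < 0
  · rw [h _ h1, mul_zero]
  · obtain rfl : k = -1 := by omega
    simp

/-- Integrality of a connection is invariant under unimodular gauge transformations. -/
theorem mOrdGE_of_isGauge {A B : Matrix (Fin 2) (Fin 2) (LaurentSeries ℂ)}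
    {g : (Matrix (Fin 2) (Fin 2) (LaurentSeries ℂ))ˣ} (hg : g ∈ unimodular)
    (h : IsGauge lderiv A g.val B) (hB : MOrdGE 0 B) : MOrdGE 0 A := by
  have h1 : A = (g.val * B - g.val.map lderiv) * (g⁻¹).val := by
    rw [← h, add_sub_cancel_right, mul_assoc, Units.mul_inv, mul_one]
  rw [h1]
  have h2 : MOrdGE 0 (g.val * B - g.val.map lderiv) := fun i j =>
    ((hg.1.mul hB) i j).sub (hg.1 i j).lderiv
  exact h2.mul hg.2

theorem mOrdGE_of_isGauge_smul {A B : Matrix (Fin 2) (Fin 2) (LaurentSeries ℂ)}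
    {g : (Matrix (Fin 2) (Fin 2) (LaurentSeries ℂ))ˣ} (hg : g ∈ unimodular)
    (h : IsGauge (fun f => HahnSeries.single 1 1 * lderiv f) A g.val B) (hB : MOrdGE 0 B) :
    MOrdGE 0 A ∧ mcoeff 0 A * mcoeff 0 g.val = mcoeff 0 g.val * mcoeff 0 B := by
  have h1 : A = (g.val * B - g.val.map (fun f => HahnSeries.single 1 1 * lderiv f)) *
      (g⁻¹).val := by
    rw [← h, add_sub_cancel_right, mul_assoc, Units.mul_inv, mul_one]
  have h3 : ∀ i j, OrdGE 1 (HahnSeries.single 1 1 * lderiv (g.val i j)) := fun i j =>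
    (ordGE_single 1 (1 : ℂ)).mul (hg.1 i j).lderiv
  have hA : MOrdGE 0 A := by
    rw [h1]
    have h2 : MOrdGE 0 (g.val * B - g.val.map (fun f => HahnSeries.single 1 1 * lderiv f)) :=
      fun i j => ((hg.1.mul hB) i j).sub ((h3 i j).mono (by omega))
    exact h2.mul hg.2
  refine ⟨hA, ?_⟩
  have h4 := congrArg (mcoeff 0) h
  have h5 := hA.mcoeff_mul hg.1
  have h6 := hg.1.mcoeff_mul hB
  rw [add_zero] at h5 h6
  rw [← h5, ← h6, ← h4]
  ext1 i j
  simp only [mcoeff, Matrix.map_apply, Matrix.add_apply, HahnSeries.coeff_add,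
    h3 i j 0 (by omega), add_zero]

theorem mcoeff_mul_inv {g : (Matrix (Fin 2) (Fin 2) (LaurentSeries ℂ))ˣ} (hg : g ∈ unimodular) :
    mcoeff 0 g.val * mcoeff 0 (g⁻¹).val = 1 := by
  have h := hg.1.mcoeff_mul hg.2
  rw [add_zero] at h
  rw [← h, Units.mul_inv]
  ext1 i j
  simp only [mcoeff, Matrix.map_apply, Matrix.one_apply]
  split_ifs
  · exact HahnSeries.coeff_single_same 0 1
  · rfl

theorem charpoly_eq_of_isGauge {A B : Matrix (Fin 2) (Fin 2) (LaurentSeries ℂ)}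
    {g : (Matrix (Fin 2) (Fin 2) (LaurentSeries ℂ))ˣ} (hg : g ∈ unimodular)
    (h : mcoeff 0 A * mcoeff 0 g.val = mcoeff 0 g.val * mcoeff 0 B) :
    (mcoeff 0 A).charpoly = (mcoeff 0 B).charpoly := by
  have h1 := mcoeff_mul_inv hg
  have h2 := mcoeff_mul_inv (inv_mem hg)
  rw [inv_inv] at h2
  let u : (Matrix (Fin 2) (Fin 2) ℂ)ˣ := ⟨_, _, h1, h2⟩
  have h3 : mcoeff 0 A = u.val * mcoeff 0 B * (u⁻¹).val := by
    change _ = mcoeff 0 g.val * mcoeff 0 B * mcoeff 0 (g⁻¹).val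
    rw [← h, mul_assoc, h1, mul_one]
  rw [h3, Matrix.charpoly_mul_comm, ← mul_assoc, Units.inv_mul, one_mul]

end

end DegPV

namespace DegPV

noncomputable section

/-! ### The bundle attached to a differential module with lattices -/

theorem mem_localRing_of_eval_denom_ne_zero {a : ℂ} {r : RatFunc ℂ} (h : r.denom.eval a ≠ 0) :
    r ∈ localRing a := ⟨r.num, r.denom, h, r.num_div_denom.symm⟩

theorem exists_finset_bad (A : Matrix (Fin 2) (Fin 2) (RatFunc ℂ)) :
    ∃ T : Finset ℂ, 0 ∈ T ∧ 1 ∈ T ∧ ∀ a ∉ T, ∀ i j, A i j ∈ localRing a := by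
  classical
  refine ⟨{0, 1} ∪ Finset.univ.biUnion fun i => Finset.univ.biUnion fun j =>
    (A i j).denom.roots.toFinset, by simp, by simp, fun a ha i j => ?_⟩
  refine mem_localRing_of_eval_denom_ne_zero fun h => ha ?_
  refine Finset.mem_union_right _ (Finset.mem_biUnion.2 ⟨i, Finset.mem_univ _,
    Finset.mem_biUnion.2 ⟨j, Finset.mem_univ _, ?_⟩⟩)
  rw [Multiset.mem_toFinset, mem_roots (A i j).denom_ne_zero]
  exact h

theorem DiffModule.IsLatticeAt.residue {N : DiffModule} {a θ : ℂ}
    {Λ : Submodule (localRing a) N.carrier} (h : N.IsLatticeAt a θ Λ)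
    {b : Module.Basis (Fin 2) (RatFunc ℂ) N.carrier}
    (hb : Λ = Submodule.span (localRing a) (Set.range b)) :
    MOrdGE 0 ((HahnSeries.single 1 1 : LaurentSeries ℂ) • (N.matrix b).map (atHom a)) ∧
      (mcoeff 0 ((HahnSeries.single 1 1 : LaurentSeries ℂ) •
        (N.matrix b).map (atHom a))).charpoly = X ^ 2 - C (θ ^ 2 / 4) := by
  obtain ⟨b', hb', B, hB, hBm, hBc⟩ := h
  have h1 : B.map (atHom a) = (HahnSeries.single 1 1 : LaurentSeries ℂ) •
      (N.matrix b').map (atHom a) := by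
    ext1 i j
    rw [hB, Matrix.map_apply, Matrix.smul_apply, smul_eq_mul, map_mul, atHom_X_sub_C]
    rfl
  have hu := mem_of_span_eq (hb.symm.trans hb')
  have h2 : MOrdGE 0 (B.map (atHom a)) := fun i j =>
    ordGE_zero_iff.2 (mem_localRing_iff.1 (hBm i j))
  have h3 : mcoeff 0 (B.map (atHom a)) = B.map (RatFunc.eval (RingHom.id ℂ) a) := by
    ext1 i j
    exact coeff_zero_atHom (hBm i j)
  have hg := (N.isGauge_at b b' a).smul (HahnSeries.single 1 1 : LaurentSeries ℂ)
  rw [← h1] at hg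
  obtain ⟨h4, h5⟩ := mOrdGE_of_isGauge_smul hu hg h2
  exact ⟨h4, by rw [charpoly_eq_of_isGauge hu h5, h3, hBc]⟩

namespace LatticeTuple

variable {θ₀ θ₁ : ℂ} (y : LatticeTuple θ₀ θ₁)

/-- The basis generates the given lattices at `0` and `1`, and the connection is regular on it at
the other finite points. -/
structure IsGood (b : Module.Basis (Fin 2) (RatFunc ℂ) y.N.carrier) : Prop where
  reg : ∀ a, a ≠ 0 → a ≠ 1 → ∀ i j, y.N.matrix b i j ∈ localRing a
  span₀ : y.Λ₀ = Submodule.span (localRing 0) (Set.range b)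
  span₁ : y.Λ₁ = Submodule.span (localRing 1) (Set.range b)

theorem mOrdGE_map_atHom {a : ℂ} {A : Matrix (Fin 2) (Fin 2) (RatFunc ℂ)} :
    MOrdGE 0 (A.map (atHom a)) ↔ ∀ i j, A i j ∈ localRing a := by
  simp only [MOrdGE, ordGE_zero_iff, mem_localRing_iff, Matrix.map_apply]

theorem exists_isGood : ∃ b, y.IsGood b := by
  obtain ⟨b, hb, -⟩ := y.loc
  obtain ⟨b₀, h₀, -⟩ := y.lattice₀
  obtain ⟨b₁, h₁, -⟩ := y.lattice₁
  obtain ⟨T, hT0, hT1, hT⟩ := exists_finset_bad (y.N.matrix b)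
  have hg : ∀ a, ∃ g : (Matrix (Fin 2) (Fin 2) (LaurentSeries ℂ))ˣ,
      (a = 0 → g = atGL a (basisGL b b₀)) ∧ (a = 1 → g = atGL a (basisGL b b₁)) ∧
        (a ≠ 0 → a ≠ 1 → IsGauge lderiv ((y.N.matrix b).map (atHom a)) g.val 0) := by
    intro a
    by_cases h0 : a = 0
    · exact ⟨_, fun _ => rfl, fun h1 => absurd (h0.symm.trans h1) zero_ne_one,
        fun h => absurd h0 h⟩
    by_cases h1 : a = 1
    · exact ⟨_, fun h => absurd h h0, fun _ => rfl, fun _ h => absurd h1 h⟩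
    · obtain ⟨g, hg⟩ := hb a h0 h1
      rw [DiffModule.matrix_map_expand] at hg
      exact ⟨g, fun h => absurd h h0, fun h => absurd h h1, fun _ _ => hg⟩
  choose g hg0 hg1 hg using hg
  obtain ⟨P, hP, hPT⟩ := exists_atGL_inv_mul_mem_of_finset T g
  obtain ⟨b', rfl⟩ := exists_basisGL_eq b P
  refine ⟨b', fun a h0 h1 => ?_, ?_, ?_⟩
  · have h2 := y.N.isGauge_at b b' a
    rw [← mOrdGE_map_atHom]
    by_cases ha : a ∈ T
    · have h3 := hPT a ha
      have h4 := IsGauge.trans isDer_lderiv (h2.symm isDer_lderiv) (hg a h0 h1)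
      exact mOrdGE_of_isGauge h3 h4 fun i j => ordGE_zero 0
    · exact mOrdGE_of_isGauge (inv_mem (hP a ha)) (h2.symm isDer_lderiv)
        (mOrdGE_map_atHom.2 (hT a ha))
  · have h3 := hPT 0 hT0
    rw [hg0 0 rfl, ← map_inv, basisGL_inv, ← map_mul, basisGL_mul] at h3
    exact h₀.trans (span_eq_of_mem h3).symm
  · have h3 := hPT 1 hT1
    rw [hg1 1 rfl, ← map_inv, basisGL_inv, ← map_mul, basisGL_mul] at h3
    exact h₁.trans (span_eq_of_mem h3).symm

variable {y} {b : Module.Basis (Fin 2) (RatFunc ℂ) y.N.carrier}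

theorem IsGood.change (h : y.IsGood b) {b' : Module.Basis (Fin 2) (RatFunc ℂ) y.N.carrier}
    (hb' : ∀ a, atGL a (basisGL b b') ∈ unimodular) : y.IsGood b' where
  reg a h0 h1 := mOrdGE_map_atHom.1 (mOrdGE_of_isGauge (inv_mem (hb' a))
    ((y.N.isGauge_at b b' a).symm isDer_lderiv) (mOrdGE_map_atHom.2 (h.reg a h0 h1)))
  span₀ := h.span₀.trans (span_eq_of_mem (hb' 0))
  span₁ := h.span₁.trans (span_eq_of_mem (hb' 1))

theorem mem_localRing_of_coeff_eq_zero {a : ℂ} {r : RatFunc ℂ}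
    (h : OrdGE 0 (HahnSeries.single 1 1 * atHom a r))
    (h0 : (HahnSeries.single 1 1 * atHom a r : LaurentSeries ℂ).coeff 0 = 0) :
    r ∈ localRing a := by
  rw [mem_localRing_iff, ← ordGE_zero_iff]
  intro k hk
  have h1 := (h.succ h0) (k + 1) (by omega)
  rwa [coeff_single_one_mul, add_sub_cancel_right] at h1

theorem trace_mem {N : DiffModule} {a θ : ℂ} {Λ : Submodule (localRing a) N.carrier}
    (h : N.IsLatticeAt a θ Λ) {b : Module.Basis (Fin 2) (RatFunc ℂ) N.carrier}
    (hb : Λ = Submodule.span (localRing a) (Set.range b)) :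
    (N.matrix b).trace ∈ localRing a := by
  obtain ⟨h1, h2⟩ := h.residue hb
  have e : (HahnSeries.single 1 1 * atHom a (N.matrix b).trace : LaurentSeries ℂ) =
      (HahnSeries.single 1 1 * atHom a (N.matrix b 0 0)) +
        HahnSeries.single 1 1 * atHom a (N.matrix b 1 1) := by
    rw [Matrix.trace_fin_two, map_add, mul_add]
  refine mem_localRing_of_coeff_eq_zero ?_ ?_
  · rw [e]
    exact (h1 0 0).add (h1 1 1)
  · rw [e, HahnSeries.coeff_add]
    exact ((charpoly_eq_iff _ _).1 h2).1

theorem eq_zero_of_rderiv_eq {f : RatFunc ℂ} (hf : f ≠ 0) {q : ℂ[X]}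
    (h : rderiv f = algebraMap ℂ[X] (RatFunc ℂ) q * f) : q = 0 := by
  by_contra hq
  have hf' : infHom f ≠ 0 := (map_ne_zero_iff _ infHom.injective).2 hf
  obtain ⟨n, hn, hn'⟩ := exists_order hf'
  have h1 := eulerInf_infHom f
  rw [h, map_mul, map_mul, infHom_X, infHom_algebraMap] at h1
  have hd : OrdGE (-q.natDegree) (aeval (zInf ℂ) q) := by
    intro k hk
    have h2 := coeff_aeval_zInf q (-k)
    rw [neg_neg, if_pos (by omega)] at h2
    rw [h2]
    exact coeff_eq_zero_of_natDegree_lt (by omega)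
  have hd' : (aeval (zInf ℂ) q).coeff (-q.natDegree) = q.leadingCoeff := by
    rw [coeff_aeval_zInf, if_pos (by omega), Int.toNat_natCast]
    rfl
  have h3 := congrArg (fun f => HahnSeries.coeff f (-q.natDegree + n - 1)) h1
  rw [hn.eulerInf _ (by omega), coeff_zInf_mul, sub_add_cancel, hd.coeff_mul hn, hd'] at h3
  exact mul_ne_zero (leadingCoeff_ne_zero.2 hq) hn' h3.symm

theorem IsGood.trace_eq_zero (h : y.IsGood b) : (y.N.matrix b).trace = 0 := by
  obtain ⟨q, hq⟩ := exists_polynomial_of_forall_mem (r := (y.N.matrix b).trace) (by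
    intro a
    by_cases h0 : a = 0
    · subst h0
      exact trace_mem y.lattice₀ h.span₀
    by_cases h1 : a = 1
    · subst h1
      exact trace_mem y.lattice₁ h.span₁
    · rw [Matrix.trace_fin_two]
      exact (localRing a).add_mem (h.reg a h0 h1 0 0) (h.reg a h0 h1 1 1))
  obtain ⟨ω, hω, halt, hhor⟩ := y.det
  have hop : ∀ j, y.N.op (b j) = y.N.matrix b 0 j • b 0 + y.N.matrix b 1 j • b 1 := by
    intro j
    conv_lhs => rw [← b.sum_repr (y.N.op (b j)), Fin.sum_univ_two]
    rfl
  have hf : rderiv (ω (b 0) (b 1)) = (y.N.matrix b).trace * ω (b 0) (b 1) := by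
    rw [hhor, hop, hop, Matrix.trace_fin_two]
    simp only [map_add, map_smul, LinearMap.add_apply, LinearMap.smul_apply, smul_eq_mul, halt,
      mul_zero, zero_add, add_zero]
    ring
  have hf0 : ω (b 0) (b 1) ≠ 0 := by
    intro h0
    apply hω
    have h1 : ω (b 1) (b 0) = 0 := by
      have h2 := halt (b 0 + b 1)
      simp only [map_add, LinearMap.add_apply, halt, h0, zero_add, add_zero] at h2
      exact h2
    refine b.ext fun i => b.ext fun j => ?_
    fin_cases i <;> fin_cases j
    exacts [halt _, h0, h1, halt _]
  rw [← hq] at hf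
  rw [← hq, eq_zero_of_rderiv_eq hf0 hf, map_zero]

/-- A polynomial change of basis. -/
def polyGL : (Matrix (Fin 2) (Fin 2) ℂ[X])ˣ →* (Matrix (Fin 2) (Fin 2) (RatFunc ℂ))ˣ :=
  Units.map (RingHom.mapMatrix (algebraMap ℂ[X] (RatFunc ℂ))).toMonoidHom

theorem atGL_polyGL_mem (a : ℂ) (P : (Matrix (Fin 2) (Fin 2) ℂ[X])ˣ) :
    atGL a (polyGL P) ∈ unimodular :=
  atGL_mem_unimodular_iff.2 ⟨fun _ _ => algebraMap_mem_localRing _ _,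
    fun _ _ => algebraMap_mem_localRing _ _⟩

theorem polyGL_map_infHom (P : (Matrix (Fin 2) (Fin 2) ℂ[X])ˣ) :
    (polyGL P).val.map infHom = (infGL P).val := by
  ext1 i j
  exact infHom_algebraMap _

theorem exists_isGood_rowsGE (y : LatticeTuple θ₀ θ₁) : ∃ b G m n, y.IsGood b ∧
    IsGauge eulerInf (y.N.infMatrix b) G (infModel (y.t : ℂ)) ∧ RowsGE m n G ∧ OrdGE 1 G.det ∧
      G.det.coeff 1 ≠ 0 ∧ m ≤ n ∧ m + n = 1 := by
  obtain ⟨b, hb⟩ := y.exists_isGood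
  obtain ⟨b₂, -, hb₂⟩ := y.loc
  have htr : ∀ b, y.IsGood b → (y.N.infMatrix b).trace = 0 := by
    intro b hb
    have h1 := hb.trace_eq_zero
    rw [Matrix.trace_fin_two] at h1 ⊢
    simp only [DiffModule.infMatrix, Matrix.map_apply, Matrix.smul_apply, smul_eq_mul]
    rw [← map_add, ← mul_add, h1, mul_zero, map_zero]
  obtain ⟨H, hH0, hH⟩ := exists_isGauge_infModel y.t.ne_zero (htr b hb)
    (DiffModule.gaugeEquiv_ram_of_basis hb₂)
  have hdet : ∀ b G, y.IsGood b → IsGauge eulerInf (y.N.infMatrix b) G (infModel (y.t : ℂ)) →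
      ∀ n, n ≠ 1 → G.det.coeff n = 0 := by
    intro b G hb hG n hn
    have h1 := hG.det isDer_eulerInf
    have h2 : (infModel (y.t : ℂ)).trace = HahnSeries.C (-1) := by
      rw [Matrix.trace_fin_two]
      refine (map_add HahnSeries.C _ _).symm.trans ?_
      norm_num
    rw [htr b hb, zero_mul, zero_add, h2] at h1
    refine coeff_eq_zero_of_eulerInf_eq h1 fun h => hn ?_
    have h3 : (n : ℂ) = (1 : ℤ) := by push_cast; linear_combination -h
    exact Int.cast_injective h3
  obtain ⟨P, m, n, hmn, hmn1, hrows⟩ := exists_rowsGE (H := H) fun k hk =>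
    hdet b H hb hH k (by omega)
  obtain ⟨b', hb'⟩ := exists_basisGL_eq b (polyGL P)⁻¹
  have hgood : y.IsGood b' := hb.change fun a => by
    rw [hb', ← map_inv]
    exact atGL_polyGL_mem a _
  have hG : IsGauge eulerInf (y.N.infMatrix b') ((infGL P).val * H) (infModel (y.t : ℂ)) := by
    have h1 := y.N.isGauge_inf b' b
    rw [← basisGL_inv b b', hb', inv_inv, polyGL_map_infHom] at h1
    exact h1.trans isDer_eulerInf hH
  have hd0 : ((infGL P).val * H).det ≠ 0 := by
    obtain ⟨c, hc, hc'⟩ := det_infGL P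
    rw [Matrix.det_mul, hc']
    exact mul_ne_zero (by simpa using hc) hH0
  refine ⟨b', _, m, n, hgood, hG, hrows, fun k hk => hdet b' _ hgood hG k (by omega),
    fun h0 => hd0 ?_, hmn, hmn1⟩
  ext k
  by_cases hk : k = 1
  · rw [hk, h0, HahnSeries.coeff_zero]
  · rw [hdet b' _ hgood hG k hk, HahnSeries.coeff_zero]

theorem IsGood.exists_matrix (h : y.IsGood b) : ∃ A : Matrix (Fin 2) (Fin 2) ℂ[X],
    y.N.matrix b = (RatFunc.X * (RatFunc.X - 1) : RatFunc ℂ)⁻¹ •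
      A.map (algebraMap ℂ[X] (RatFunc ℂ)) := by
  have hX : (RatFunc.X : RatFunc ℂ) - RatFunc.C 0 = RatFunc.X := by rw [map_zero, sub_zero]
  have hX1 : (RatFunc.X : RatFunc ℂ) - RatFunc.C 1 = RatFunc.X - 1 := by rw [map_one]
  have hm0 : ∀ a, (RatFunc.X : RatFunc ℂ) ∈ localRing a := fun a => by
    rw [← RatFunc.algebraMap_X]
    exact algebraMap_mem_localRing _ _
  have hm1 : ∀ a, (RatFunc.X - 1 : RatFunc ℂ) ∈ localRing a := fun a =>
    (localRing a).sub_mem (hm0 a) (localRing a).one_mem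
  have key : ∀ i j, ∃ p : ℂ[X], algebraMap ℂ[X] (RatFunc ℂ) p =
      RatFunc.X * (RatFunc.X - 1) * y.N.matrix b i j := by
    intro i j
    refine exists_polynomial_of_forall_mem fun a => ?_
    have hlat : ∀ {a θ : ℂ} {Λ : Submodule (localRing a) y.N.carrier},
        y.N.IsLatticeAt a θ Λ → Λ = Submodule.span (localRing a) (Set.range b) →
        (RatFunc.X - RatFunc.C a) * y.N.matrix b i j ∈ localRing a := by
      intro a θ Λ h1 h2
      rw [mem_localRing_iff, ← ordGE_zero_iff, map_mul, atHom_X_sub_C]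
      exact (h1.residue h2).1 i j
    by_cases h0 : a = 0
    · subst h0
      have h1 := hlat y.lattice₀ h.span₀
      rw [hX] at h1
      rw [mul_right_comm]
      exact (localRing 0).mul_mem h1 (hm1 0)
    by_cases h1 : a = 1
    · subst h1
      have h1 := hlat y.lattice₁ h.span₁
      rw [hX1] at h1
      rw [mul_assoc]
      exact (localRing 1).mul_mem (hm0 1) h1
    · exact (localRing a).mul_mem ((localRing a).mul_mem (hm0 a) (hm1 a)) (h.reg a h0 h1 i j)
  choose A hA using key
  refine ⟨Matrix.of A, ?_⟩
  have h0 : (RatFunc.X : RatFunc ℂ) ≠ 0 := RatFunc.X_ne_zero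
  have h1 : (RatFunc.X - 1 : RatFunc ℂ) ≠ 0 := hX1 ▸ X_sub_C_ne_zero 1
  ext1 i j
  rw [Matrix.smul_apply, Matrix.map_apply, Matrix.of_apply, hA, smul_eq_mul,
    inv_mul_cancel_left₀ (mul_ne_zero h0 h1)]

/-- Every differential module with lattices comes from a connection on the bundle `V`. -/
theorem exists_family (y : LatticeTuple θ₀ θ₁) :
    ∃ (x : Family θ₀ θ₁ ℂ) (b : Module.Basis (Fin 2) (RatFunc ℂ) y.N.carrier),
      x.t = y.t ∧ y.Λ₀ = Submodule.span (localRing 0) (Set.range b) ∧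
        y.Λ₁ = Submodule.span (localRing 1) (Set.range b) ∧
        y.N.matrix b = (RatFunc.X * (RatFunc.X - 1) : RatFunc ℂ)⁻¹ •
          x.conn.matrix.map (algebraMap ℂ[X] (RatFunc ℂ)) := by
  obtain ⟨b, G, m, n, hb, hG, hrows, hd, hd0, hmn, hmn1⟩ := exists_isGood_rowsGE y
  obtain ⟨A, hA⟩ := hb.exists_matrix
  have h0 : (RatFunc.X : RatFunc ℂ) ≠ 0 := RatFunc.X_ne_zero
  have h1 : (RatFunc.X - 1 : RatFunc ℂ) ≠ 0 := by
    have := X_sub_C_ne_zero 1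
    rwa [map_one] at this
  have hA' : ∀ i j, algebraMap ℂ[X] (RatFunc ℂ) (A i j) =
      RatFunc.X * (RatFunc.X - 1) * y.N.matrix b i j := by
    intro i j
    rw [hA, Matrix.smul_apply, smul_eq_mul, mul_inv_cancel_left₀ (mul_ne_zero h0 h1),
      Matrix.map_apply]
  have hZ : (zInf ℂ - 1) • y.N.infMatrix b = A.map (aeval (zInf ℂ)) := by
    ext1 i j
    rw [Matrix.map_apply, ← infHom_algebraMap, hA', Matrix.smul_apply, DiffModule.infMatrix,
      Matrix.map_apply, Matrix.smul_apply, smul_eq_mul, smul_eq_mul, map_mul, map_mul, map_mul,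
      map_sub, map_one, infHom_X]
    ring
  obtain ⟨rfl, rfl⟩ := hrows.eq_one y.t.ne_zero hZ hG hd hd0 hmn hmn1
  obtain ⟨hinf, hdeg⟩ := hrows.hasInfModel hZ hG hd hd0
  obtain ⟨g, hg⟩ := (hasInfModel_iff hdeg _).1 hinf
  have hcond := hg.conditions hdeg g
  have htr : A 1 1 = -A 0 0 := by
    have h2 := hb.trace_eq_zero
    rw [Matrix.trace_fin_two] at h2
    apply RatFunc.algebraMap_injective ℂ
    rw [map_neg, hA', hA']
    linear_combination RatFunc.X * (RatFunc.X - 1) * h2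
  have hres : ∀ {a θ c : ℂ} {Λ : Submodule (localRing a) y.N.carrier},
      y.N.IsLatticeAt a θ Λ → Λ = Submodule.span (localRing a) (Set.range b) →
      (∀ i j, (A i j).eval a = c * (mcoeff 0 ((HahnSeries.single 1 1 : LaurentSeries ℂ) •
        (y.N.matrix b).map (atHom a))) i j) → c ^ 2 = 1 →
      (A 0 0).eval a ^ 2 + (A 0 1).eval a * (A 1 0).eval a = θ ^ 2 / 4 := by
    intro a θ c Λ h2 h3 h4 hc
    obtain ⟨h5, h6⟩ := (charpoly_eq_iff _ _).1 (h2.residue h3).2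
    rw [h4, h4, h4]
    linear_combination (-c ^ 2) * h6 + (θ ^ 2 / 4) * hc + c ^ 2 * (mcoeff 0
      ((HahnSeries.single 1 1 : LaurentSeries ℂ) • (y.N.matrix b).map (atHom a))) 0 0 * h5
  have hev : ∀ {a : ℂ} (c : ℂ) (p : ℂ[X]) (i j : Fin 2), p.eval a = c →
      algebraMap ℂ[X] (RatFunc ℂ) (A i j) =
        algebraMap ℂ[X] (RatFunc ℂ) p * ((RatFunc.X - RatFunc.C a) * y.N.matrix b i j) →
      MOrdGE 0 ((HahnSeries.single 1 1 : LaurentSeries ℂ) • (y.N.matrix b).map (atHom a)) →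
      (A i j).eval a = c * (mcoeff 0 ((HahnSeries.single 1 1 : LaurentSeries ℂ) •
        (y.N.matrix b).map (atHom a))) i j := by
    intro a c p i j hp h2 h3
    have h4 := congrArg (fun r => (atHom a r).coeff 0) h2
    simp only [map_mul, atHom_algebraMap, atHom_X_sub_C] at h4
    have h5 := coeff_zero_mul (aeval_zAt_mem_integers a p) (ordGE_zero_iff.1 (h3 i j))
    rw [coeff_zero_aeval_zAt, hp] at h5
    rw [coeff_zero_aeval_zAt] at h4
    exact h4.trans h5
  have hfam : IsFamilyMatrix θ₀ θ₁ A (y.t : ℂ) :=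
    { hcond with
      trace := htr
      zero := by
        simp only [coeff_zero_eq_eval_zero]
        refine hres (c := -1) y.lattice₀ hb.span₀ (fun i j => hev (-1) (X - 1) i j (by simp) ?_
          (y.lattice₀.residue hb.span₀).1) (by norm_num)
        rw [hA', map_sub, map_one, RatFunc.algebraMap_X, map_zero, sub_zero]
        ring
      one := by
        refine hres (c := 1) y.lattice₁ hb.span₁ (fun i j => hev 1 X i j (by simp) ?_
          (y.lattice₁.residue hb.span₁).1) (by norm_num)
        rw [hA', RatFunc.algebraMap_X, map_one]
        ring }
  obtain ⟨x, hx, hxt⟩ := hfam.exists_family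
  exact ⟨x, b, hxt, hb.span₀, hb.span₁, by rw [hA, hx]⟩

end LatticeTuple

end

end DegPV

namespace DegPV

noncomputable section

/-! ### The generic fibre of a family -/

theorem rderiv_one : rderiv 1 = 0 := isDer_rderiv.one

theorem rderiv_zero : rderiv 0 = 0 := isDer_rderiv.zero

/-- The standard basis of the generic fibre. -/
def stdBasis (D : BundleConnection ℂ) :
    Module.Basis (Fin 2) (RatFunc ℂ) (genericFibre D).carrier :=
  Pi.basisFun (RatFunc ℂ) (Fin 2)

theorem genericFibre_matrix (D : BundleConnection ℂ) :
    (genericFibre D).matrix (stdBasis D) = (RatFunc.X * (RatFunc.X - 1) : RatFunc ℂ)⁻¹ •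
      D.matrix.map (algebraMap ℂ[X] (RatFunc ℂ)) := by
  ext1 i j
  have h0 : rderiv ((Pi.single j 1 : Fin 2 → RatFunc ℂ) i) = 0 := by
    rw [Pi.single_apply]
    split_ifs
    exacts [rderiv_one, rderiv_zero]
  have h1 : (genericFibre D).matrix (stdBasis D) i j =
      rderiv ((Pi.basisFun (RatFunc ℂ) (Fin 2) j) i) +
        (RatFunc.X * (RatFunc.X - 1) : RatFunc ℂ)⁻¹ *
          (D.matrix.map (algebraMap ℂ[X] (RatFunc ℂ))).mulVec (Pi.basisFun (RatFunc ℂ) (Fin 2) j) i :=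
    rfl
  rw [h1, Pi.basisFun_apply, h0, zero_add, Matrix.mulVec_single_one]
  rfl

theorem DiffModule.hasTrivialDet_of_trace {N : DiffModule}
    {b : Module.Basis (Fin 2) (RatFunc ℂ) N.carrier} (h : (N.matrix b).trace = 0) :
    N.HasTrivialDet := by
  refine ⟨LinearMap.mk₂ (RatFunc ℂ)
    (fun m n => b.repr m 0 * b.repr n 1 - b.repr m 1 * b.repr n 0) ?_ ?_ ?_ ?_, ?_, ?_, ?_⟩
  · intro m m' n
    simp only [map_add, Finsupp.add_apply]
    ring
  · intro c m n
    simp only [map_smul, Finsupp.smul_apply, smul_eq_mul]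
    ring
  · intro m n n'
    simp only [map_add, Finsupp.add_apply]
    ring
  · intro c m n
    simp only [map_smul, Finsupp.smul_apply, smul_eq_mul]
    ring
  · intro h0
    have := LinearMap.congr_fun₂ h0 (b 0) (b 1)
    simp [LinearMap.mk₂_apply] at this
  · intro m
    rw [LinearMap.mk₂_apply]
    ring
  · intro m n
    rw [Matrix.trace_fin_two] at h
    simp only [LinearMap.mk₂_apply, isDer_rderiv.sub, rderiv_mul, N.repr_op b]
    linear_combination (-(b.repr m 0 * b.repr n 1) + b.repr m 1 * b.repr n 0) * h

/-- Over `ℂ((s))`, a connection with a regular singularity and a non-resonant residue `R` is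
equivalent to `d/ds + R/s`. -/
theorem exists_isGauge_of_residue {B : Matrix (Fin 2) (Fin 2) (LaurentSeries ℂ)}
    {R : Matrix (Fin 2) (Fin 2) ℂ} {c : ℂ}
    (h : MOrdGE 0 ((HahnSeries.single 1 1 : LaurentSeries ℂ) • B))
    (hBR : mcoeff 0 ((HahnSeries.single 1 1 : LaurentSeries ℂ) • B) = R) (hR : R * R = c • 1)
    (hc : ∀ k : ℤ, k ≠ 0 → (k : ℂ) ^ 2 ≠ 4 * c) :
    GaugeEquiv lderiv B (R.map (HahnSeries.single (-1))) := by
  choose F hF using fun i j => ordGE_zero_iff.1 (h i j)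
  obtain ⟨g, hg⟩ := exists_isGauge_residue (Matrix.of F) (R := R) (by
    ext1 i j
    rw [← hBR, mcoeff, Matrix.map_apply, Matrix.map_apply, ← hF, coeff_zero_ofPowerSeries]
    rfl) hR hc
  have hd : ∀ f : ℂ⟦X⟧, HahnSeries.ofPowerSeries ℤ ℂ
      (PowerSeries.X * PowerSeries.derivative ℂ f) =
      HahnSeries.single 1 1 * lderiv (HahnSeries.ofPowerSeries ℤ ℂ f) := by
    intro f
    rw [map_mul, HahnSeries.ofPowerSeries_X, lderiv_ofPowerSeries]
  have h1 := hg.map (HahnSeries.ofPowerSeries ℤ ℂ)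
    (δ' := fun f => HahnSeries.single 1 1 * lderiv f) hd
  have h2 : (Matrix.of F).map (HahnSeries.ofPowerSeries ℤ ℂ) =
      (HahnSeries.single 1 1 : LaurentSeries ℂ) • B := by
    ext1 i j
    exact hF i j
  have h3 : (R.map PowerSeries.C).map (HahnSeries.ofPowerSeries ℤ ℂ) =
      (HahnSeries.single 1 1 : LaurentSeries ℂ) • R.map (HahnSeries.single (-1)) := by
    ext1 i j
    rw [Matrix.map_apply, Matrix.map_apply, HahnSeries.ofPowerSeries_C, Matrix.smul_apply,
      Matrix.map_apply, smul_eq_mul, HahnSeries.single_mul_single, one_mul]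
    rfl
  rw [h2, h3] at h1
  exact ⟨Units.map (RingHom.mapMatrix (HahnSeries.ofPowerSeries ℤ ℂ)).toMonoidHom g,
    h1.inv_smul (d := HahnSeries.single (-1) 1) (by
      rw [HahnSeries.single_mul_single, one_mul]
      rfl)⟩

theorem mOrdGE_single_smul {B : Matrix (Fin 2) (Fin 2) (LaurentSeries ℂ)} (h : MOrdGE 0 B) :
    MOrdGE 0 ((HahnSeries.single 1 1 : LaurentSeries ℂ) • B) ∧
      mcoeff 0 ((HahnSeries.single 1 1 : LaurentSeries ℂ) • B) = 0 := by
  have h1 : ∀ i j, OrdGE 1 (((HahnSeries.single 1 1 : LaurentSeries ℂ) • B) i j) := fun i j =>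
    (ordGE_single 1 (1 : ℂ)).mul (h i j)
  refine ⟨fun i j => (h1 i j).mono (by omega), ?_⟩
  ext1 i j
  exact h1 i j 0 (by omega)

theorem four_mul_ne {θ : ℂ} (h : ∀ n : ℤ, n ≠ 0 → θ ≠ n) (k : ℤ) (hk : k ≠ 0) :
    (k : ℂ) ^ 2 ≠ 4 * (θ ^ 2 / 4) := by
  intro h1
  have h2 : (θ - k) * (θ - (-k : ℤ)) = 0 := by push_cast; linear_combination -h1
  rcases mul_eq_zero.1 h2 with h3 | h3
  · exact h k hk (sub_eq_zero.1 h3)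
  · exact h (-k) (neg_ne_zero.2 hk) (sub_eq_zero.1 h3)

theorem mul_self_of_charpoly {R : Matrix (Fin 2) (Fin 2) ℂ} {c : ℂ}
    (h : R.charpoly = X ^ 2 - C c) : R * R = c • 1 := by
  obtain ⟨h1, h2⟩ := (charpoly_eq_iff _ _).1 h
  ext1 i j
  rw [Matrix.mul_apply, Fin.sum_univ_two]
  fin_cases i <;> fin_cases j
  · simp
    linear_combination R 0 0 * h1 - h2
  · simp
    linear_combination R 0 1 * h1
  · simp
    linear_combination R 1 0 * h1
  · simp
    linear_combination R 1 1 * h1 - h2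

/-- A horizontal change of basis is integral at `a` if both residues are non-resonant. -/
theorem DiffModule.atGL_basisGL_mem {N : DiffModule} {a c : ℂ}
    {b b' : Module.Basis (Fin 2) (RatFunc ℂ) N.carrier}
    (hb : MOrdGE 0 ((HahnSeries.single 1 1 : LaurentSeries ℂ) • (N.matrix b).map (atHom a)))
    (hb' : MOrdGE 0 ((HahnSeries.single 1 1 : LaurentSeries ℂ) • (N.matrix b').map (atHom a)))
    (hbc : mcoeff 0 ((HahnSeries.single 1 1 : LaurentSeries ℂ) • (N.matrix b).map (atHom a)) *
      mcoeff 0 ((HahnSeries.single 1 1 : LaurentSeries ℂ) • (N.matrix b).map (atHom a)) = c • 1)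
    (hbc' : mcoeff 0 ((HahnSeries.single 1 1 : LaurentSeries ℂ) • (N.matrix b').map (atHom a)) *
      mcoeff 0 ((HahnSeries.single 1 1 : LaurentSeries ℂ) • (N.matrix b').map (atHom a)) = c • 1)
    (hc : ∀ k : ℤ, k ≠ 0 → (k : ℂ) ^ 2 ≠ 4 * c) : atGL a (basisGL b b') ∈ unimodular := by
  refine ⟨mOrdGE_zero_of_intertwines hb' hb hbc' hbc hc ((N.isGauge_at b b' a).smul _), ?_⟩
  rw [← map_inv, basisGL_inv]
  exact mOrdGE_zero_of_intertwines hb hb' hbc hbc' hc ((N.isGauge_at b' b a).smul _)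

/-- Differential modules with the same matrix are isomorphic. -/
theorem DiffModule.exists_equiv_of_matrix_eq {N N' : DiffModule}
    (b : Module.Basis (Fin 2) (RatFunc ℂ) N.carrier)
    (b' : Module.Basis (Fin 2) (RatFunc ℂ) N'.carrier) (h : N.matrix b = N'.matrix b') :
    ∃ e : N.Equiv N', ∀ m, b'.repr (e.toEquiv m) = b.repr m := by
  have hr : ∀ m, b'.repr (b.equiv b' (_root_.Equiv.refl _) m) = b.repr m := by
    intro m
    simp [Module.Basis.equiv]
  refine ⟨⟨b.equiv b' (_root_.Equiv.refl _), fun m => ?_⟩, hr⟩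
  apply b'.repr.injective
  ext i
  rw [hr, N.repr_op b, N'.repr_op b', hr, h]

theorem DiffModule.matrix_map_equiv {N N' : DiffModule} (e : N.Equiv N')
    (b : Module.Basis (Fin 2) (RatFunc ℂ) N.carrier) :
    N'.matrix (b.map e.toEquiv) = N.matrix b := by
  ext1 i j
  simp only [DiffModule.matrix, Matrix.of_apply, Module.Basis.map_apply, ← e.comm]
  simp [Module.Basis.map]

theorem LatticeTuple.equiv_of_bases {θ₀ θ₁ : ℂ} {x y : LatticeTuple θ₀ θ₁} (ht : x.t = y.t)
    (b : Module.Basis (Fin 2) (RatFunc ℂ) x.N.carrier)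
    (b' : Module.Basis (Fin 2) (RatFunc ℂ) y.N.carrier) (h : x.N.matrix b = y.N.matrix b')
    (h0 : x.Λ₀ = Submodule.span (localRing 0) (Set.range b))
    (h1 : x.Λ₁ = Submodule.span (localRing 1) (Set.range b))
    (h0' : y.Λ₀ = Submodule.span (localRing 0) (Set.range b'))
    (h1' : y.Λ₁ = Submodule.span (localRing 1) (Set.range b')) : x ≈ y := by
  obtain ⟨e, he⟩ := DiffModule.exists_equiv_of_matrix_eq b b' h
  refine ⟨ht, e, fun m => ?_, fun m => ?_⟩
  · rw [h0, h0', mem_span_range_iff, mem_span_range_iff, he]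
  · rw [h1, h1', mem_span_range_iff, mem_span_range_iff, he]

theorem X_ne_zero' : (RatFunc.X : RatFunc ℂ) ≠ 0 := RatFunc.X_ne_zero

theorem X_sub_one_ne_zero : (RatFunc.X - 1 : RatFunc ℂ) ≠ 0 := by
  have := X_sub_C_ne_zero 1
  rwa [map_one] at this

theorem eval_mul_eval {a : ℂ} {r : RatFunc ℂ} {p q : ℂ[X]} (hr : r ∈ localRing a)
    (h : r * algebraMap ℂ[X] (RatFunc ℂ) q = algebraMap ℂ[X] (RatFunc ℂ) p) :
    RatFunc.eval (RingHom.id ℂ) a r * q.eval a = p.eval a := by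
  have h1 := congrArg (fun r => (atHom a r).coeff 0) h
  simp only [map_mul, atHom_algebraMap] at h1
  rwa [coeff_zero_mul (mem_localRing_iff.1 hr) (aeval_zAt_mem_integers a q), coeff_zero_atHom hr,
    coeff_zero_aeval_zAt, coeff_zero_aeval_zAt] at h1

theorem mem_localRing_of_mul {a : ℂ} {r : RatFunc ℂ} {p q : ℂ[X]} (hq : q.eval a ≠ 0)
    (h : r * algebraMap ℂ[X] (RatFunc ℂ) q = algebraMap ℂ[X] (RatFunc ℂ) p) : r ∈ localRing a := by
  have hq0 : algebraMap ℂ[X] (RatFunc ℂ) q ≠ 0 :=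
    (map_ne_zero_iff _ (RatFunc.algebraMap_injective ℂ)).2 fun h0 => hq (by rw [h0, eval_zero])
  exact ⟨p, q, hq, by rw [eq_div_iff hq0, h]⟩

namespace Family

variable {θ₀ θ₁ : ℂ} (x : Family θ₀ θ₁ ℂ)

theorem algebraMap_matrix (i j : Fin 2) : algebraMap ℂ[X] (RatFunc ℂ) (x.conn.matrix i j) =
    RatFunc.X * (RatFunc.X - 1) * (genericFibre x.conn).matrix (stdBasis x.conn) i j := by
  rw [genericFibre_matrix, Matrix.smul_apply, smul_eq_mul,
    mul_inv_cancel_left₀ (mul_ne_zero X_ne_zero' X_sub_one_ne_zero), Matrix.map_apply]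

theorem trace_genericFibre : ((genericFibre x.conn).matrix (stdBasis x.conn)).trace = 0 := by
  rw [genericFibre_matrix, Matrix.trace_smul, Matrix.trace_fin_two, Matrix.map_apply,
    Matrix.map_apply, x.isFamilyMatrix.trace, map_neg, add_neg_cancel, smul_zero]

theorem hasTrivialDet : (genericFibre x.conn).HasTrivialDet :=
  DiffModule.hasTrivialDet_of_trace x.trace_genericFibre

theorem matrix_mem {a : ℂ} (h0 : a ≠ 0) (h1 : a ≠ 1) (i j : Fin 2) :
    (genericFibre x.conn).matrix (stdBasis x.conn) i j ∈ localRing a := by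
  refine mem_localRing_of_mul (p := x.conn.matrix i j) (q := X * (X - 1)) ?_ ?_
  · simpa using ⟨h0, sub_ne_zero.2 h1⟩
  · rw [algebraMap_matrix, map_mul, map_sub, map_one, RatFunc.algebraMap_X, mul_comm]

theorem isLatticeAt_zero :
    (genericFibre x.conn).IsLatticeAt 0 θ₀ (bundleLattice x.conn 0) := by
  have h1 : ∀ i j, ((RatFunc.X - RatFunc.C 0 : RatFunc ℂ) •
      (genericFibre x.conn).matrix (stdBasis x.conn)) i j *
        algebraMap ℂ[X] (RatFunc ℂ) (X - 1) =
      algebraMap ℂ[X] (RatFunc ℂ) (x.conn.matrix i j) := by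
    intro i j
    rw [algebraMap_matrix, Matrix.smul_apply, smul_eq_mul, map_sub, map_one, RatFunc.algebraMap_X,
      map_zero, sub_zero]
    ring
  have h2 := fun i j => mem_localRing_of_mul (a := 0) (by simp) (h1 i j)
  refine ⟨stdBasis x.conn, rfl, _, rfl, h2, ?_⟩
  have h3 : ((RatFunc.X - RatFunc.C 0 : RatFunc ℂ) •
      (genericFibre x.conn).matrix (stdBasis x.conn)).map (RatFunc.eval (RingHom.id ℂ) 0) =
      x.conn.residueZero := by
    ext1 i j
    have h4 := eval_mul_eval (h2 i j) (h1 i j)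
    rw [BundleConnection.residueZero, Matrix.neg_apply, Matrix.map_apply, Matrix.map_apply, ← h4]
    simp
  rw [h3, x.at_zero]
  rfl

theorem isLatticeAt_one :
    (genericFibre x.conn).IsLatticeAt 1 θ₁ (bundleLattice x.conn 1) := by
  have h1 : ∀ i j, ((RatFunc.X - RatFunc.C 1 : RatFunc ℂ) •
      (genericFibre x.conn).matrix (stdBasis x.conn)) i j * algebraMap ℂ[X] (RatFunc ℂ) X =
      algebraMap ℂ[X] (RatFunc ℂ) (x.conn.matrix i j) := by
    intro i j
    rw [algebraMap_matrix, Matrix.smul_apply, smul_eq_mul, RatFunc.algebraMap_X, map_one]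
    ring
  have h2 := fun i j => mem_localRing_of_mul (a := 1) (by simp) (h1 i j)
  refine ⟨stdBasis x.conn, rfl, _, rfl, h2, ?_⟩
  have h3 : ((RatFunc.X - RatFunc.C 1 : RatFunc ℂ) •
      (genericFibre x.conn).matrix (stdBasis x.conn)).map (RatFunc.eval (RingHom.id ℂ) 1) =
      x.conn.residueOne := by
    ext1 i j
    have h4 := eval_mul_eval (h2 i j) (h1 i j)
    rw [BundleConnection.residueOne, Matrix.map_apply, Matrix.map_apply, ← h4]
    simp
  rw [h3, x.at_one]
  rfl

theorem hasInfModel : HasInfModel x.conn.matrix (x.t : ℂ) := by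
  have h := x.isFamilyMatrix
  rw [hasInfModel_iff h.toDegreeBounds]
  refine h.toInfConditions.exists_infEquation ?_
  by_contra hc
  simp only [isUnit_iff_ne_zero, ne_eq, not_or, not_not] at hc
  have h1 := h.span_eq_top
  rw [hc.1, hc.2] at h1
  simp at h1

theorem infMatrix_eq : (zInf ℂ - 1) • (genericFibre x.conn).infMatrix (stdBasis x.conn) =
    x.conn.matrix.map (aeval (zInf ℂ)) := by
  ext1 i j
  rw [Matrix.map_apply, ← infHom_algebraMap, algebraMap_matrix, Matrix.smul_apply,
    DiffModule.infMatrix, Matrix.map_apply, Matrix.smul_apply, smul_eq_mul, smul_eq_mul, map_mul,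
    map_mul, map_mul, map_sub, map_one, infHom_X]
  ring

theorem exists_isGauge_inf : ∃ h : (Matrix (Fin 2) (Fin 2) (LaurentSeries ℂ))ˣ,
    ∃ g : (Matrix (Fin 2) (Fin 2) ℂ⟦X⟧)ˣ,
      h.val = Matrix.diagonal ![1, HahnSeries.single 1 1] *
        g.val.map (HahnSeries.ofPowerSeries ℤ ℂ) ∧
      IsGauge eulerInf ((genericFibre x.conn).infMatrix (stdBasis x.conn)) h.val
        (infModel (x.t : ℂ)) := by
  obtain ⟨g, h, hh, he⟩ := x.hasInfModel
  have hz : zInf ℂ - 1 ≠ 0 := by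
    have := aeval_zInf_ne_zero (X - C 1) (Polynomial.X_sub_C_ne_zero 1)
    simpa using this
  have hu : IsUnit h := by
    rw [hh]
    have hg : IsUnit ((RingHom.mapMatrix (HahnSeries.ofPowerSeries ℤ ℂ)) g.val) :=
      g.isUnit.map _
    refine IsUnit.mul ?_ hg
    rw [Matrix.isUnit_iff_isUnit_det, Matrix.det_diagonal, Fin.prod_univ_two, isUnit_iff_ne_zero]
    simp
  obtain ⟨u, rfl⟩ := hu
  refine ⟨u, g, hh, ?_⟩
  rw [← x.infMatrix_eq] at he
  ext1 i j
  refine mul_left_cancel₀ hz ?_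
  refine Eq.trans ?_ (congrFun (congrFun he i) j)
  refine (mul_add _ _ _).trans ?_
  congr 1
  exact (congrFun (congrFun (Matrix.smul_mul (zInf ℂ - 1) _ u.val) i) j).symm

theorem isPrescribed :
    (genericFibre x.conn).IsPrescribedAwayFrom01 (stdBasis x.conn) (x.t : ℂ) := by
  constructor
  · intro a h0 h1
    rw [DiffModule.matrix_map_expand]
    obtain ⟨h2, h3⟩ := mOrdGE_single_smul
      (LatticeTuple.mOrdGE_map_atHom.2 (x.matrix_mem h0 h1))
    have h4 := exists_isGauge_of_residue (c := 0) h2 h3 (by simp) (fun k hk => by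
      rw [mul_zero]
      exact pow_ne_zero _ (by exact_mod_cast hk))
    have h5 : (0 : Matrix (Fin 2) (Fin 2) ℂ).map
        (HahnSeries.single (-1) : ℂ → LaurentSeries ℂ) = 0 := by
      ext1 i j
      exact HahnSeries.single_eq_zero
    rwa [h5] at h4
  · obtain ⟨h, g, -, hh⟩ := x.exists_isGauge_inf
    obtain ⟨u, hu⟩ := gaugeEquiv_infModel_ram (x.t : ℂ)
    rw [← DiffModule.infMatrix_map_ram]
    have h1 := hh.map ram eulerRam_ram
    exact ⟨Units.map (RingHom.mapMatrix ram).toMonoidHom h * u, h1.trans isDer_eulerRam hu⟩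

/-- The generic fibre of a family over `ℂ`, with the lattices at `0` and `1`. -/
def toLatticeTuple : LatticeTuple θ₀ θ₁ :=
  ⟨genericFibre x.conn, x.t, bundleLattice x.conn 0, bundleLattice x.conn 1, x.hasTrivialDet,
    ⟨_, x.isPrescribed⟩, x.isLatticeAt_zero, x.isLatticeAt_one⟩

end Family

theorem LatticeTuple.exists_family_equiv {θ₀ θ₁ : ℂ} (y : LatticeTuple θ₀ θ₁) :
    ∃ x : Family θ₀ θ₁ ℂ, x.toLatticeTuple ≈ y := by
  obtain ⟨x, b, ht, h0, h1, hA⟩ := y.exists_family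
  refine ⟨x, LatticeTuple.equiv_of_bases ht (stdBasis x.conn) b ?_ rfl rfl h0 h1⟩
  exact (genericFibre_matrix x.conn).trans hA.symm

end

end DegPV

namespace DegPV

noncomputable section

/-! ### Isomorphisms of generic fibres -/

theorem rderiv_algebraMap (p : ℂ[X]) : rderiv (algebraMap ℂ[X] (RatFunc ℂ) p) =
    algebraMap ℂ[X] (RatFunc ℂ) (derivative p) := by
  rw [rderiv_of_eq _ p 1 one_ne_zero (by simp)]
  simp

theorem isGauge_map_iff {A B P : Matrix (Fin 2) (Fin 2) ℂ[X]} :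
    IsGauge rderiv
      ((RatFunc.X * (RatFunc.X - 1) : RatFunc ℂ)⁻¹ • A.map (algebraMap ℂ[X] (RatFunc ℂ)))
      (P.map (algebraMap ℂ[X] (RatFunc ℂ)))
      ((RatFunc.X * (RatFunc.X - 1) : RatFunc ℂ)⁻¹ • B.map (algebraMap ℂ[X] (RatFunc ℂ))) ↔
    IsGauge (fun p => X * (X - 1) * derivative p) A P B := by
  have hX : (RatFunc.X * (RatFunc.X - 1) : RatFunc ℂ) ≠ 0 := mul_ne_zero X_ne_zero' X_sub_one_ne_zero
  have hd : ∀ p, algebraMap ℂ[X] (RatFunc ℂ) (X * (X - 1) * derivative p) =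
      RatFunc.X * (RatFunc.X - 1) * rderiv (algebraMap ℂ[X] (RatFunc ℂ) p) := by
    intro p
    rw [rderiv_algebraMap, map_mul, map_mul, map_sub, RatFunc.algebraMap_X, map_one]
  constructor
  · intro h
    have h1 := h.smul (RatFunc.X * (RatFunc.X - 1))
    rw [smul_smul, smul_smul, mul_inv_cancel₀ hX, one_smul, one_smul] at h1
    ext1 i j
    apply RatFunc.algebraMap_injective ℂ
    have h2 := congrFun (congrFun h1 i) j
    simp only [Matrix.add_apply, Matrix.mul_apply, Fin.sum_univ_two, Matrix.map_apply, map_add,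
      map_mul] at h2 ⊢
    rw [← h2, ← hd, map_mul, map_mul]
  · intro h
    refine IsGauge.inv_smul (inv_mul_cancel₀ hX) ?_
    rw [smul_smul, smul_smul, mul_inv_cancel₀ hX, one_smul, one_smul]
    exact h.map (δ' := fun r => RatFunc.X * (RatFunc.X - 1) * rderiv r)
      (algebraMap ℂ[X] (RatFunc ℂ)) hd

namespace Family

variable {θ₀ θ₁ : ℂ} {x y : Family θ₀ θ₁ ℂ}

theorem ordGE_of_isGauge_inf (ht : x.t = y.t) {G : Matrix (Fin 2) (Fin 2) (LaurentSeries ℂ)}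
    (h : IsGauge eulerInf ((genericFibre y.conn).infMatrix (stdBasis y.conn)) G
      ((genericFibre x.conn).infMatrix (stdBasis x.conn))) :
    OrdGE 0 (G 0 0) ∧ OrdGE (-1) (G 0 1) ∧ OrdGE 1 (G 1 0) ∧ OrdGE 0 (G 1 1) := by
  obtain ⟨hx, gx, ex, hx'⟩ := x.exists_isGauge_inf
  obtain ⟨hy, gy, ey, hy'⟩ := y.exists_isGauge_inf
  rw [ht] at hx'
  obtain ⟨c, hc⟩ := isGauge_infModel_self y.t.ne_zero
    (((hy'.symm isDer_eulerInf).trans isDer_eulerInf h).trans isDer_eulerInf hx')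
  have h1 : G * hx.val = hy.val *
      ((HahnSeries.C c : LaurentSeries ℂ) • (1 : Matrix (Fin 2) (Fin 2) (LaurentSeries ℂ))) := by
    rw [← hc, ← mul_assoc, ← mul_assoc, Units.mul_inv, one_mul]
  let φ := RingHom.mapMatrix (m := Fin 2) (HahnSeries.ofPowerSeries ℤ ℂ)
  have hφ : ∀ g, MOrdGE 0 (φ g) := fun g i j => ordGE_zero_iff.2 ⟨_, rfl⟩
  have h1c : MOrdGE 0 ((HahnSeries.C c : LaurentSeries ℂ) •
      (1 : Matrix (Fin 2) (Fin 2) (LaurentSeries ℂ))) := by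
    intro i j
    rw [Matrix.smul_apply, Matrix.one_apply]
    refine OrdGE.C_mul ?_ c
    split_ifs
    exacts [ordGE_single 0 1, ordGE_zero 0]
  generalize (HahnSeries.C c : LaurentSeries ℂ) •
    (1 : Matrix (Fin 2) (Fin 2) (LaurentSeries ℂ)) = S at h1 h1c
  have h3 : G * Matrix.diagonal ![1, HahnSeries.single 1 1] =
      Matrix.diagonal ![1, HahnSeries.single 1 1] * (φ gy.val * S * φ (gx⁻¹).val) := by
    have h4 : φ gx.val * φ (gx⁻¹).val = 1 := by rw [← map_mul, Units.mul_inv, map_one]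
    have h5 := congrArg (· * φ (gx⁻¹).val) h1
    rw [ex, ey] at h5
    change G * (_ * φ gx.val) * φ (gx⁻¹).val = (_ * φ gy.val) * S * φ (gx⁻¹).val at h5
    rw [← mul_assoc, mul_assoc _ (φ gx.val), h4, mul_one] at h5
    rw [h5]
    simp only [mul_assoc]
  have hk : MOrdGE 0 (φ gy.val * S * φ (gx⁻¹).val) := ((hφ _).mul h1c).mul (hφ _)
  have hs : (HahnSeries.single (-1) 1 : LaurentSeries ℂ) * HahnSeries.single 1 1 = 1 := by
    rw [HahnSeries.single_mul_single, one_mul]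
    rfl
  generalize φ gy.val * S * φ (gx⁻¹).val = K at h3 hk
  have e : ∀ i j, G i j * (![1, HahnSeries.single 1 1] : Fin 2 → LaurentSeries ℂ) j =
      (![1, HahnSeries.single 1 1] : Fin 2 → LaurentSeries ℂ) i * K i j := by
    intro i j
    have h6 := congrFun (congrFun h3 i) j
    rwa [Matrix.mul_diagonal, Matrix.diagonal_mul] at h6
  have e00 := e 0 0
  have e01 := e 0 1
  have e10 := e 1 0
  have e11 := e 1 1
  simp only [Matrix.cons_val_zero, Matrix.cons_val_one, mul_one, one_mul] at e00 e01 e10 e11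
  have e01' : G 0 1 = HahnSeries.single (-1) 1 * K 0 1 := by
    linear_combination HahnSeries.single (-1) 1 * e01 - G 0 1 * hs
  have e11' : G 1 1 = K 1 1 := by
    linear_combination HahnSeries.single (-1) 1 * e11 + (K 1 1 - G 1 1) * hs
  rw [e00, e01', e10, e11']
  exact ⟨hk 0 0, ((ordGE_single (-1) 1).mul (hk 0 1)).mono (by omega),
    ((ordGE_single 1 1).mul (hk 1 0)).mono (by omega), hk 1 1⟩

theorem iso_of_isGauge (ht : x.t = y.t) {G : (Matrix (Fin 2) (Fin 2) (RatFunc ℂ))ˣ}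
    (h : IsGauge rderiv ((genericFibre y.conn).matrix (stdBasis y.conn)) G.val
      ((genericFibre x.conn).matrix (stdBasis x.conn)))
    (hG : ∀ a, atGL a G ∈ unimodular) : x.Iso y := by
  choose P hP using fun i j => exists_polynomial_of_forall_mem
    (fun a => (atGL_mem_unimodular_iff.1 (hG a)).1 i j)
  have hPG : (Matrix.of P).map (algebraMap ℂ[X] (RatFunc ℂ)) = G.val := by
    ext1 i j
    exact hP i j
  obtain ⟨h00, h01, h10, h11⟩ := ordGE_of_isGauge_inf ht
    ((h.smul RatFunc.X).map (infHom : RatFunc ℂ →+* LaurentSeries ℂ)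
      fun x => (eulerInf_infHom x).symm)
  simp only [Matrix.map_apply, RingHom.coe_coe, ← hP, infHom_algebraMap] at h00 h01 h10 h11
  have h10' := eq_zero_of_ordGE_one h10
  obtain ⟨u, hu⟩ := natDegree_eq_zero.1 (Nat.le_zero.1 (natDegree_le_of_ordGE (d := 0) h00))
  obtain ⟨v, hv⟩ := natDegree_eq_zero.1 (Nat.le_zero.1 (natDegree_le_of_ordGE (d := 0) h11))
  obtain ⟨l1, l0, hl⟩ := exists_eq_X_add_C_of_natDegree_le_one (natDegree_le_of_ordGE (d := 1) h01)
  have hv0 : v ≠ 0 := by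
    rintro rfl
    have hd := (Matrix.isUnit_iff_isUnit_det _).1 G.isUnit
    rw [Matrix.det_fin_two, ← hP 1 0, ← hP 1 1, h10', ← hv] at hd
    simp at hd
  rw [genericFibre_matrix, genericFibre_matrix, ← hPG, isGauge_map_iff] at h
  have e : ∀ i j, _ := fun i j => congrFun (congrFun h i) j
  simp only [Matrix.add_apply, Matrix.mul_apply, Fin.sum_univ_two, Matrix.map_apply,
    Matrix.of_apply] at e
  have e10 := e 1 0
  have e11 := e 1 1
  have e01 := e 0 1
  have hvv : C v⁻¹ * C v = 1 := by rw [← C_mul, inv_mul_cancel₀ hv0, C_1]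
  rw [h10', ← hu, ← hv, derivative_zero] at e10
  rw [h10', ← hv, derivative_C, hl, x.isFamilyMatrix.trace, y.isFamilyMatrix.trace] at e11
  rw [← hu, ← hv, hl, x.isFamilyMatrix.trace, derivative_add, derivative_C_mul, derivative_X,
    derivative_C] at e01
  refine iso_iff.2 ⟨ht, v⁻¹ * u, v⁻¹ * l0, v⁻¹ * l1, Coeffs.rel_iff.2 ?_⟩
  rw [x.matrix_coeffs, y.matrix_coeffs]
  simp only [map_mul]
  refine ⟨?_, ?_, ?_⟩
  · linear_combination C v⁻¹ * e10 + x.conn.matrix 1 0 * hvv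
  · linear_combination C v⁻¹ * e11 - (x.conn.matrix 0 0 - y.conn.matrix 0 0) * hvv
  · linear_combination (-C v⁻¹) * e01 + y.conn.matrix 0 1 * hvv

/-- An isomorphism of generic fibres that is integral at `0` and `1` is an isomorphism of
families. -/
theorem iso_of_equiv (ht : x.t = y.t) (e : (genericFibre x.conn).Equiv (genericFibre y.conn))
    (h0 : atGL 0 (basisGL (stdBasis y.conn) ((stdBasis x.conn).map e.toEquiv)) ∈ unimodular)
    (h1 : atGL 1 (basisGL (stdBasis y.conn) ((stdBasis x.conn).map e.toEquiv)) ∈ unimodular) :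
    x.Iso y := by
  have hm := DiffModule.matrix_map_equiv e (stdBasis x.conn)
  refine iso_of_isGauge ht (G := basisGL (stdBasis y.conn) ((stdBasis x.conn).map e.toEquiv)) ?_ ?_
  · rw [← hm]
    exact (genericFibre y.conn).isGauge_basisGL _ _
  · intro a
    by_cases ha0 : a = 0
    · rwa [ha0]
    by_cases ha1 : a = 1
    · rwa [ha1]
    have hx : MOrdGE 0 (((genericFibre x.conn).matrix (stdBasis x.conn)).map (atHom a)) :=
      LatticeTuple.mOrdGE_map_atHom.2 (x.matrix_mem ha0 ha1)
    have hy : MOrdGE 0 (((genericFibre y.conn).matrix (stdBasis y.conn)).map (atHom a)) :=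
      LatticeTuple.mOrdGE_map_atHom.2 (y.matrix_mem ha0 ha1)
    rw [← hm] at hx
    obtain ⟨hx1, hx2⟩ := mOrdGE_single_smul hx
    obtain ⟨hy1, hy2⟩ := mOrdGE_single_smul hy
    refine DiffModule.atGL_basisGL_mem (c := 0) hy1 hx1 ?_ ?_ ?_
    · rw [hy2, mul_zero, zero_smul]
    · rw [hx2, mul_zero, zero_smul]
    · intro k hk
      simpa using hk

theorem toLatticeTuple_equiv_of_iso (h : x.Iso y) : x.toLatticeTuple ≈ y.toLatticeTuple := by
  obtain ⟨ht, u, l0, l1, hr⟩ := iso_iff.1 h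
  have hu := hr.isUnit x.eqs.span_eq_top
  obtain ⟨h1, h2, h3⟩ := Coeffs.rel_iff.1 hr
  rw [x.matrix_coeffs, y.matrix_coeffs] at h1 h2 h3
  have hP : IsUnit (!![C u, C l0 + C l1 * X; 0, 1] : Matrix (Fin 2) (Fin 2) ℂ[X]) := by
    rw [Matrix.isUnit_iff_isUnit_det, Matrix.det_fin_two]
    simpa using hu
  obtain ⟨P, hP⟩ := hP
  obtain ⟨b, hb⟩ := exists_basisGL_eq (stdBasis y.conn) (LatticeTuple.polyGL P)
  have hg : IsGauge (fun p => X * (X - 1) * derivative p) y.conn.matrix P.val x.conn.matrix := by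
    rw [hP]
    ext1 i j
    fin_cases i <;> fin_cases j <;>
      simp only [Fin.zero_eta, Fin.mk_one, Matrix.add_apply, Matrix.mul_apply, Fin.sum_univ_two,
        Matrix.map_apply, Matrix.of_apply, Matrix.cons_val_zero, Matrix.cons_val_one,
        Matrix.cons_val', Matrix.cons_val_fin_one, x.isFamilyMatrix.trace, y.isFamilyMatrix.trace,
        derivative_zero, derivative_one, derivative_add, derivative_mul, derivative_C,
        derivative_X]
    · linear_combination (C l0 + C l1 * X) * h1 - C u * h2
    · linear_combination -h3
    · linear_combination h1
    · linear_combination h2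
  have hm : (genericFibre y.conn).matrix b = (genericFibre x.conn).matrix (stdBasis x.conn) := by
    have h4 := (genericFibre y.conn).isGauge_basisGL (stdBasis y.conn) b
    rw [hb] at h4
    have h5 := isGauge_map_iff.2 hg
    rw [← genericFibre_matrix, ← genericFibre_matrix] at h5
    have h6 := Eq.trans (Eq.symm h4) h5
    exact (LatticeTuple.polyGL P).isUnit.mul_left_cancel h6
  refine LatticeTuple.equiv_of_bases ht (stdBasis x.conn) b hm.symm rfl rfl ?_ ?_
  · exact span_eq_of_mem (b := stdBasis y.conn) (hb ▸ LatticeTuple.atGL_polyGL_mem _ _)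
  · exact span_eq_of_mem (b := stdBasis y.conn) (hb ▸ LatticeTuple.atGL_polyGL_mem _ _)

theorem iso_of_toLatticeTuple_equiv (h : x.toLatticeTuple ≈ y.toLatticeTuple) : x.Iso y := by
  obtain ⟨ht, e, h0, h1⟩ := h
  have key : ∀ (e : (genericFibre x.conn).Equiv (genericFibre y.conn)) {a : ℂ}, (∀ m, e.toEquiv m ∈ bundleLattice y.conn a ↔ m ∈ bundleLattice x.conn a) →
      atGL a (basisGL (stdBasis y.conn) ((stdBasis x.conn).map e.toEquiv)) ∈ unimodular := by
    intro e a ha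
    refine mem_of_span_eq ?_
    ext m
    obtain ⟨m, rfl⟩ := e.toEquiv.surjective m
    refine (ha m).trans ?_
    refine (mem_span_range_iff (stdBasis x.conn) m).trans ?_
    rw [mem_span_range_iff]
    refine forall_congr' fun i => ?_
    have hr : ((stdBasis x.conn).map e.toEquiv).repr (e.toEquiv m) i = (stdBasis x.conn).repr m i := by
      simp [Module.Basis.map]
    rw [hr]
  exact iso_of_equiv ht e (key e h0) (key e h1)

end Family

end

end DegPV

namespace DegPV

noncomputable section

/-! ### Local forms at `0` and `1` -/

theorem exists_conj_triangular {R : Matrix (Fin 2) (Fin 2) ℂ} {θ : ℂ}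
    (h : R.charpoly = X ^ 2 - C (θ ^ 2 / 4)) :
    ∃ (g : (Matrix (Fin 2) (Fin 2) ℂ)ˣ) (c : ℂ),
      R * g.val = g.val * !![θ / 2, c; 0, -(θ / 2)] := by
  obtain ⟨h1, h2⟩ := (charpoly_eq_iff _ _).1 h
  have key : ∀ (g : Matrix (Fin 2) (Fin 2) ℂ) (c : ℂ), g.det ≠ 0 →
      R * g = g * !![θ / 2, c; 0, -(θ / 2)] → ∃ (g : (Matrix (Fin 2) (Fin 2) ℂ)ˣ) (c : ℂ),
      R * g.val = g.val * !![θ / 2, c; 0, -(θ / 2)] := by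
    intro g c hg hc
    obtain ⟨u, rfl⟩ := (Matrix.isUnit_iff_isUnit_det g).2 (isUnit_iff_ne_zero.2 hg)
    exact ⟨u, c, hc⟩
  rw [Matrix.eta_fin_two R] at key ⊢
  generalize R 0 0 = a, R 0 1 = b, R 1 0 = c, R 1 1 = d at h1 h2 key ⊢
  obtain rfl : d = -a := by linear_combination h1
  by_cases hc : c = 0
  · subst hc
    have h3 : (a - θ / 2) * (a + θ / 2) = 0 := by linear_combination -h2
    rcases mul_eq_zero.1 h3 with h4 | h4
    · obtain rfl : a = θ / 2 := sub_eq_zero.1 h4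
      exact key 1 b (by simp) (by rw [mul_one, one_mul])
    · obtain rfl : a = -(θ / 2) := eq_neg_of_add_eq_zero_left h4
      by_cases hθ : θ = 0
      · subst hθ
        exact key 1 b (by simp) (by rw [mul_one, one_mul]; simp)
      · refine key !![b, 1; θ, 0] 0 (by simpa [Matrix.det_fin_two] using hθ) ?_
        ext1 i j
        fin_cases i <;> fin_cases j <;> simp [Matrix.mul_apply, Fin.sum_univ_two] <;> ring
  · refine key !![a + θ / 2, 1; c, 0] 1 (by simpa [Matrix.det_fin_two] using hc) ?_
    ext1 i j
    fin_cases i <;> fin_cases j <;> simp [Matrix.mul_apply, Fin.sum_univ_two]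
    · linear_combination -h2
    · ring

theorem gaugeEquiv_of_conj {R T : Matrix (Fin 2) (Fin 2) ℂ} {g : (Matrix (Fin 2) (Fin 2) ℂ)ˣ}
    (h : R * g.val = g.val * T) :
    IsGauge lderiv (R.map (HahnSeries.single (-1)))
      (g.val.map (HahnSeries.C : ℂ →+* LaurentSeries ℂ)) (T.map (HahnSeries.single (-1))) := by
  ext1 i j
  have h1 := congrArg (HahnSeries.single (-1 : ℤ)) (congrFun (congrFun h i) j)
  rw [Matrix.add_apply, Matrix.map_apply (f := lderiv), Matrix.map_apply, lderiv_C, add_zero]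
  simp only [Matrix.mul_apply, Fin.sum_univ_two, Matrix.map_apply, HahnSeries.C_apply,
    HahnSeries.single_mul_single, zero_add, add_zero, HahnSeries.single_add] at h1 ⊢
  exact h1

theorem DiffModule.IsLatticeAt.isTriangularAt {N : DiffModule} {a θ : ℂ}
    {Λ : Submodule (localRing a) N.carrier} (h : N.IsLatticeAt a θ Λ)
    (b : Module.Basis (Fin 2) (RatFunc ℂ) N.carrier)
    (hθ : ∀ n : ℤ, n ≠ 0 → θ ≠ n) : N.IsTriangularAt b a (θ / 2) := by
  obtain ⟨b', hb', -⟩ := id h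
  suffices hs : N.IsTriangularAt b' a (θ / 2) from hs.of_basis
  obtain ⟨h1, h2⟩ := h.residue hb'
  obtain ⟨g, hg⟩ := exists_isGauge_of_residue h1 rfl (mul_self_of_charpoly h2) (four_mul_ne hθ)
  obtain ⟨k, c, hk⟩ := exists_conj_triangular h2
  let u := Units.map (RingHom.mapMatrix (HahnSeries.C : ℂ →+* LaurentSeries ℂ)).toMonoidHom k
  have h3 : IsGauge lderiv ((N.matrix b').map (atHom a)) (g * u).val _ :=
    IsGauge.trans isDer_lderiv hg (gaugeEquiv_of_conj hk)
  refine ⟨c, g * u, ?_⟩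
  rw [DiffModule.matrix_map_expand]
  refine Eq.trans h3 (congrArg _ ?_)
  ext1 i j
  fin_cases i <;> fin_cases j <;> simp

theorem DiffModule.IsTriangularAt.exists_isLatticeAt {N : DiffModule} {a θ : ℂ}
    {b : Module.Basis (Fin 2) (RatFunc ℂ) N.carrier} (h : N.IsTriangularAt b a (θ / 2)) :
    ∃ Λ, N.IsLatticeAt a θ Λ := by
  obtain ⟨c, g, hg⟩ := h
  rw [DiffModule.matrix_map_expand] at hg
  obtain ⟨P, -, hP⟩ := exists_atGL_inv_mul_mem a g
  obtain ⟨b', rfl⟩ := exists_basisGL_eq b P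
  rw [← map_inv, basisGL_inv] at hP
  have h1 := (N.isGauge_at b' b a).trans isDer_lderiv hg
  have h2 := h1.smul (HahnSeries.single 1 1 : LaurentSeries ℂ)
  have hT : (HahnSeries.single 1 1 : LaurentSeries ℂ) • (!![HahnSeries.single (-1) (θ / 2),
      HahnSeries.single (-1) c; 0, -HahnSeries.single (-1) (θ / 2)] :
        Matrix (Fin 2) (Fin 2) (LaurentSeries ℂ)) =
      (!![θ / 2, c; 0, -(θ / 2)] : Matrix (Fin 2) (Fin 2) ℂ).map (HahnSeries.single 0) := by
    ext1 i j
    have h0 : ∀ c : ℂ, (HahnSeries.single 1 1 : LaurentSeries ℂ) * HahnSeries.single (-1) c =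
        HahnSeries.single 0 c := fun c => by
      rw [HahnSeries.single_mul_single, one_mul]
      rfl
    fin_cases i <;> fin_cases j
    · exact h0 _
    · exact h0 _
    · simp
    · change HahnSeries.single 1 1 * -(HahnSeries.single (-1) (θ / 2) : LaurentSeries ℂ) =
        HahnSeries.single 0 (-(θ / 2))
      rw [← HahnSeries.single_neg]
      exact h0 _
  rw [hT] at h2
  obtain ⟨h3, h4⟩ := mOrdGE_of_isGauge_smul hP h2 fun i j => ordGE_single 0 _
  have h5 := charpoly_eq_of_isGauge hP h4
  have hm : (HahnSeries.single 1 1 : LaurentSeries ℂ) • (N.matrix b').map (atHom a) =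
      ((RatFunc.X - RatFunc.C a : RatFunc ℂ) • N.matrix b').map (atHom a) := by
    ext1 i j
    rw [Matrix.map_apply, Matrix.smul_apply, Matrix.smul_apply, smul_eq_mul, smul_eq_mul, map_mul,
      atHom_X_sub_C]
    rfl
  rw [hm] at h3 h5
  have h6 := LatticeTuple.mOrdGE_map_atHom.1 h3
  refine ⟨_, b', rfl, _, rfl, h6, ?_⟩
  have h7 : ((RatFunc.X - RatFunc.C a : RatFunc ℂ) • N.matrix b').map
      (RatFunc.eval (RingHom.id ℂ) a) =
      mcoeff 0 (((RatFunc.X - RatFunc.C a : RatFunc ℂ) • N.matrix b').map (atHom a)) := by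
    ext1 i j
    exact (coeff_zero_atHom (h6 i j)).symm
  rw [h7, h5, charpoly_eq_iff]
  simp only [mcoeff, Matrix.map_apply, HahnSeries.coeff_single_same]
  constructor
  · simp
  · simp
    ring

theorem Family.isTriangularAt {θ₀ θ₁ : ℂ} (hθ : ∀ n : ℤ, n ≠ 0 → θ₀ ≠ n ∧ θ₁ ≠ n)
    (x : Family θ₀ θ₁ ℂ) :
    (genericFibre x.conn).IsTriangularAt (stdBasis x.conn) 0 (θ₀ / 2) ∧
      (genericFibre x.conn).IsTriangularAt (stdBasis x.conn) 1 (θ₁ / 2) :=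
  ⟨x.isLatticeAt_zero.isTriangularAt _ fun n hn => (hθ n hn).1,
    x.isLatticeAt_one.isTriangularAt _ fun n hn => (hθ n hn).2⟩

/-- The generic fibre of a family over `ℂ`, for non-resonant parameters. -/
def Family.toSTuple {θ₀ θ₁ : ℂ} (hθ : ∀ n : ℤ, n ≠ 0 → θ₀ ≠ n ∧ θ₁ ≠ n) (x : Family θ₀ θ₁ ℂ) :
    STuple θ₀ θ₁ :=
  ⟨genericFibre x.conn, x.t, x.hasTrivialDet, ⟨_, x.isPrescribed, x.isTriangularAt hθ⟩⟩

theorem STuple.exists_family_equiv {θ₀ θ₁ : ℂ} (hθ : ∀ n : ℤ, n ≠ 0 → θ₀ ≠ n ∧ θ₁ ≠ n)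
    (y : STuple θ₀ θ₁) : ∃ x : Family θ₀ θ₁ ℂ, x.toSTuple hθ ≈ y := by
  obtain ⟨N, t, hd, b, hb, hb0, hb1⟩ := y
  obtain ⟨Λ₀, h0⟩ := hb0.exists_isLatticeAt
  obtain ⟨Λ₁, h1⟩ := hb1.exists_isLatticeAt
  obtain ⟨x, ht, e, -⟩ := LatticeTuple.exists_family_equiv ⟨N, t, Λ₀, Λ₁, hd, ⟨b, hb⟩, h0, h1⟩
  exact ⟨x, ht, ⟨e⟩⟩

theorem Family.toSTuple_equiv_iff {θ₀ θ₁ : ℂ} (hθ : ∀ n : ℤ, n ≠ 0 → θ₀ ≠ n ∧ θ₁ ≠ n)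
    (x y : Family θ₀ θ₁ ℂ) : x.toSTuple hθ ≈ y.toSTuple hθ ↔ x.Iso y := by
  constructor
  · rintro ⟨ht, ⟨e⟩⟩
    have key : ∀ (e : (genericFibre x.conn).Equiv (genericFibre y.conn)) {a θ : ℂ},
        (genericFibre x.conn).IsLatticeAt a θ (bundleLattice x.conn a) →
        (genericFibre y.conn).IsLatticeAt a θ (bundleLattice y.conn a) →
        (∀ n : ℤ, n ≠ 0 → θ ≠ n) →
        atGL a (basisGL (stdBasis y.conn) ((stdBasis x.conn).map e.toEquiv)) ∈ unimodular := by
      intro e a θ hx hy hθ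
      obtain ⟨hx1, hx2⟩ := hx.residue (b := stdBasis x.conn) rfl
      obtain ⟨hy1, hy2⟩ := hy.residue (b := stdBasis y.conn) rfl
      rw [← DiffModule.matrix_map_equiv e] at hx1 hx2
      exact DiffModule.atGL_basisGL_mem hy1 hx1 (mul_self_of_charpoly hy2)
        (mul_self_of_charpoly hx2) (four_mul_ne hθ)
    exact iso_of_equiv ht e
      (key e x.isLatticeAt_zero y.isLatticeAt_zero fun n hn => (hθ n hn).1)
      (key e x.isLatticeAt_one y.isLatticeAt_one fun n hn => (hθ n hn).2)
  · intro h
    obtain ⟨ht, e, -⟩ := toLatticeTuple_equiv_of_iso h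
    exact ⟨ht, ⟨e⟩⟩

/-! ### Complex points -/

theorem exists_equiv_of_forall_iff {F A B : Type*} {f : F → A} {g : F → B}
    (hf : Function.Surjective f) (hg : Function.Surjective g)
    (h : ∀ x y, f x = f y ↔ g x = g y) : ∃ Φ : A ≃ B, ∀ x, Φ (f x) = g x := by
  have hk : ∀ x, g (Function.surjInv hf (f x)) = g x := fun x =>
    (h _ _).1 (Function.surjInv_eq hf _)
  refine ⟨.ofBijective (fun a => g (Function.surjInv hf a)) ⟨fun a a' haa => ?_, fun b => ?_⟩, hk⟩
  · have h1 := (h _ _).2 haa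
    rwa [Function.surjInv_eq hf, Function.surjInv_eq hf] at h1
  · obtain ⟨x, rfl⟩ := hg b
    exact ⟨f x, hk x⟩

/-- The point of `M(θ₀, θ₁)` classifying a family over `ℂ`. -/
def Family.point {θ₀ θ₁ : ℂ} (x : Family θ₀ θ₁ ℂ) : ComplexPoints θ₀ θ₁ :=
  ⟨classify ℂ x, classify_isNatural.1 ℂ x⟩

theorem Family.point_surjective {θ₀ θ₁ : ℂ} :
    Function.Surjective (Family.point (θ₀ := θ₀) (θ₁ := θ₁)) := by
  rintro ⟨f, hf⟩
  rcases exists_spec_of_isLocalRing θ₀ θ₁ f with ⟨φ, rfl⟩ | ⟨φ, rfl⟩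
  · obtain ⟨x, hx, -⟩ := exists_family_of_chart1 φ ((Category.assoc _ _ _).symm.trans hf)
    exact ⟨x, Subtype.ext hx⟩
  · obtain ⟨x, hx⟩ := exists_family_of_chart2 φ ((Category.assoc _ _ _).symm.trans hf)
    exact ⟨x, Subtype.ext hx⟩

theorem Family.point_eq_iff {θ₀ θ₁ : ℂ} (x y : Family θ₀ θ₁ ℂ) : x.point = y.point ↔ x.Iso y :=
  Subtype.ext_iff.trans (classify_eq_iff x y)

theorem exists_equiv_SLattice (θ₀ θ₁ : ℂ) : ∃ Φ : ComplexPoints θ₀ θ₁ ≃ SLattice θ₀ θ₁,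
    ∀ (x : Family θ₀ θ₁ ℂ) (p : ComplexPoints θ₀ θ₁), p.1 = classify ℂ x →
      ∃ y : LatticeTuple θ₀ θ₁,
        (∃ hd hl h0 h1, y = ⟨genericFibre x.conn, x.t, bundleLattice x.conn 0,
          bundleLattice x.conn 1, hd, hl, h0, h1⟩) ∧ Φ p = _root_.Quotient.mk _ y := by
  obtain ⟨Φ, hΦ⟩ := exists_equiv_of_forall_iff (B := SLattice θ₀ θ₁)
    (g := fun x => _root_.Quotient.mk _ x.toLatticeTuple)
    (Family.point_surjective (θ₀ := θ₀) (θ₁ := θ₁)) (by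
      intro y
      induction y using _root_.Quotient.inductionOn with | _ y
      obtain ⟨x, hx⟩ := y.exists_family_equiv
      exact ⟨x, _root_.Quotient.sound hx⟩) (fun x y => by
      rw [Family.point_eq_iff]
      exact ⟨fun h => _root_.Quotient.sound (Family.toLatticeTuple_equiv_of_iso h), fun h =>
        Family.iso_of_toLatticeTuple_equiv (_root_.Quotient.exact h)⟩)
  refine ⟨Φ, fun x p hp => ⟨x.toLatticeTuple, ⟨_, _, _, _, rfl⟩, ?_⟩⟩
  rw [← hΦ x]
  exact congrArg Φ (Subtype.ext hp)

theorem exists_equiv_S {θ₀ θ₁ : ℂ} (hθ : ∀ n : ℤ, n ≠ 0 → θ₀ ≠ n ∧ θ₁ ≠ n) :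
    ∃ Φ : ComplexPoints θ₀ θ₁ ≃ S θ₀ θ₁,
      ∀ (x : Family θ₀ θ₁ ℂ) (p : ComplexPoints θ₀ θ₁), p.1 = classify ℂ x →
        ∃ y : STuple θ₀ θ₁, (∃ hd hl, y = ⟨genericFibre x.conn, x.t, hd, hl⟩) ∧
          Φ p = _root_.Quotient.mk _ y := by
  obtain ⟨Φ, hΦ⟩ := exists_equiv_of_forall_iff (B := S θ₀ θ₁)
    (g := fun x => _root_.Quotient.mk _ (x.toSTuple hθ))
    (Family.point_surjective (θ₀ := θ₀) (θ₁ := θ₁)) (by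
      intro y
      induction y using _root_.Quotient.inductionOn with | _ y
      obtain ⟨x, hx⟩ := y.exists_family_equiv hθ
      exact ⟨x, _root_.Quotient.sound hx⟩) (fun x y => by
      rw [Family.point_eq_iff, ← Family.toSTuple_equiv_iff hθ]
      exact ⟨fun h => _root_.Quotient.sound h, fun h => _root_.Quotient.exact h⟩)
  refine ⟨Φ, fun x p hp => ⟨x.toSTuple hθ, ⟨_, _, rfl⟩, ?_⟩⟩
  rw [← hΦ x]
  exact congrArg Φ (Subtype.ext hp)

end

end DegPV

theorem mainTheorem3 (θ₀ θ₁ : ℂ) :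
    -- `M(θ₀, θ₁)` is an integral separated scheme of finite type over `ℂ`, the union of the two
    -- open affine parts, which meet in the explicit overlap
    (AlgebraicGeometry.IsIntegral (DegPV.M θ₀ θ₁) ∧ IsSeparated (DegPV.M.toC θ₀ θ₁) ∧
      LocallyOfFiniteType (DegPV.M.toC θ₀ θ₁) ∧ QuasiCompact (DegPV.M.toC θ₀ θ₁) ∧
      IsOpenImmersion (DegPV.ι₁ θ₀ θ₁) ∧ IsOpenImmersion (DegPV.ι₂ θ₀ θ₁) ∧
      Set.range (DegPV.ι₁ θ₀ θ₁) ∪ Set.range (DegPV.ι₂ θ₀ θ₁) = Set.univ ∧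
      IsPullback (DegPV.incl₁ θ₀ θ₁) (DegPV.incl₂ θ₀ θ₁) (DegPV.ι₁ θ₀ θ₁) (DegPV.ι₂ θ₀ θ₁)) ∧
    -- smoothness, over `ℂ` and over the `t`-line
    (θ₀ ≠ 0 → θ₁ ≠ 0 →
      SmoothOfRelativeDimension 3 (DegPV.M.toC θ₀ θ₁) ∧
      SmoothOfRelativeDimension 2 (DegPV.M.toT θ₀ θ₁)) ∧
    -- the singular locus of the first affine part
    (θ₀ ≠ 0 → θ₁ ≠ 0 → DegPV.HasSingularLocus (DegPV.M₁.toT θ₀ θ₁) ∅) ∧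
    (θ₀ = 0 → θ₁ ≠ 0 → DegPV.HasSingularLocus (DegPV.M₁.toT θ₀ θ₁)
      (PrimeSpectrum.zeroLocus {DegPV.x1 θ₀ θ₁ 0, DegPV.x1 θ₀ θ₁ 1,
        DegPV.x1 θ₀ θ₁ 2 - (-DegPV.tt _ ^ 2 + DegPV.kk _ (θ₁ ^ 2 / 4))})) ∧
    (θ₀ ≠ 0 → θ₁ = 0 → DegPV.HasSingularLocus (DegPV.M₁.toT θ₀ θ₁)
      (PrimeSpectrum.zeroLocus {DegPV.x1 θ₀ θ₁ 0, DegPV.x1 θ₀ θ₁ 1 - (-1),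
        DegPV.x1 θ₀ θ₁ 2 - (-DegPV.tt _ ^ 2 + DegPV.kk _ (θ₀ ^ 2 / 4))})) ∧
    (θ₀ = 0 → θ₁ = 0 → DegPV.HasSingularLocus (DegPV.M₁.toT θ₀ θ₁)
      (PrimeSpectrum.zeroLocus {DegPV.x1 θ₀ θ₁ 0,
        DegPV.x1 θ₀ θ₁ 1 * (DegPV.x1 θ₀ θ₁ 1 + 1),
        DegPV.x1 θ₀ θ₁ 2 - (-DegPV.tt _ ^ 2)})) ∧
    -- the singular locus of the second affine part
    (θ₁ ≠ 0 → DegPV.HasSingularLocus (DegPV.M₂.toT θ₀ θ₁) ∅) ∧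
    (θ₁ = 0 → DegPV.HasSingularLocus (DegPV.M₂.toT θ₀ θ₁)
      (PrimeSpectrum.zeroLocus {DegPV.x2 θ₀ θ₁ 0, DegPV.x2 θ₀ θ₁ 1 - (-1),
        DegPV.x2 θ₀ θ₁ 2 - (DegPV.tt _ ^ 2 - DegPV.kk _ (θ₀ ^ 2 / 4))})) ∧
    -- the singular locus of `M(θ₀, θ₁)`
    DegPV.HasSingularLocus (DegPV.M.toT θ₀ θ₁)
      ((DegPV.ι₁ θ₀ θ₁) '' DegPV.singularLocus (DegPV.M₁.toT θ₀ θ₁) 2 ∪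
        (DegPV.ι₂ θ₀ θ₁) '' DegPV.singularLocus (DegPV.M₂.toT θ₀ θ₁) 2) ∧
    -- the moduli property
    ∃ η : DegPV.Assignment θ₀ θ₁, η.IsNatural ∧
      -- the explicit connections over the two affine parts, classified by their inclusions
      (∃ x : DegPV.Family θ₀ θ₁ (DegPV.Chart1 θ₀ θ₁),
        x.conn.matrix = DegPV.univMatrix1 θ₀ θ₁ ∧ (x.t : DegPV.Chart1 θ₀ θ₁) = DegPV.tt _ ∧
          η _ x = DegPV.ι₁ θ₀ θ₁) ∧
      (∃ x : DegPV.Family θ₀ θ₁ (DegPV.Chart2 θ₀ θ₁),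
        x.conn.matrix = DegPV.univMatrix2 θ₀ θ₁ ∧ (x.t : DegPV.Chart2 θ₀ θ₁) = DegPV.tt _ ∧
          η _ x = DegPV.ι₂ θ₀ θ₁) ∧
      -- the quotient of the connections with prescribed characteristic polynomials
      η.Represents (fun _ _ _ _ => True) ∧
      -- a fine moduli space for the connections with prescribed local forms
      (η.Represents (fun _ _ _ x => x.IsTriangular) ↔ θ₀ ≠ 0 ∧ θ₁ ≠ 0) ∧
      -- the points: differential modules with invariant lattices
      (∃ Φ : DegPV.ComplexPoints θ₀ θ₁ ≃ DegPV.SLattice θ₀ θ₁,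
        ∀ (x : DegPV.Family θ₀ θ₁ ℂ) (p : DegPV.ComplexPoints θ₀ θ₁), p.1 = η ℂ x →
          ∃ y : DegPV.LatticeTuple θ₀ θ₁,
            (∃ hd hl h0 h1, y = ⟨DegPV.genericFibre x.conn, x.t, DegPV.bundleLattice x.conn 0,
              DegPV.bundleLattice x.conn 1, hd, hl, h0, h1⟩) ∧
            Φ p = _root_.Quotient.mk _ y) ∧
      -- the points: the set `S(θ₀, θ₁)`
      ((∀ n : ℤ, n ≠ 0 → θ₀ ≠ n ∧ θ₁ ≠ n) →
        ∃ Φ : DegPV.ComplexPoints θ₀ θ₁ ≃ DegPV.S θ₀ θ₁,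
          ∀ (x : DegPV.Family θ₀ θ₁ ℂ) (p : DegPV.ComplexPoints θ₀ θ₁), p.1 = η ℂ x →
            ∃ y : DegPV.STuple θ₀ θ₁,
              (∃ hd hl, y = ⟨DegPV.genericFibre x.conn, x.t, hd, hl⟩) ∧
              Φ p = _root_.Quotient.mk _ y) := by
  refine ⟨⟨inferInstance, inferInstance, inferInstance, inferInstance, inferInstance, inferInstance,
      DegPV.range_union θ₀ θ₁, DegPV.isPullback_overlap θ₀ θ₁⟩, DegPV.smooth_M,
    DegPV.singular1_nonzero_nonzero, DegPV.singular1_zero_nonzero,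
    DegPV.singular1_nonzero_zero, DegPV.singular1_zero_zero,
    DegPV.singular2_nonzero, DegPV.singular2_zero, DegPV.hasSingularLocus_M θ₀ θ₁,
    DegPV.classify, DegPV.classify_isNatural, DegPV.exists_universal_family1,
    DegPV.exists_universal_family2, DegPV.classify_represents, DegPV.represents_isTriangular_iff,
    DegPV.exists_equiv_SLattice θ₀ θ₁, fun hθ => DegPV.exists_equiv_S hθ⟩
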